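/- Let $d=\sqrt2$ or $d=-\sqrt2$. A *loop configuration* $C$ on the torus is a finite set of disjoint simple closed curves, and $|C|$ is the number of all its loops, contractible or not. Give all noncontractible loops of $C$ parallel arrows. Then $n_x$ is the number of strands passing through a fixed horizontal circle from below minus the number passing from above, and $n_y$ is the analogous signed number for a fixed vertical circle. Configurations are presented combinatorially, as annular diagrams in general position (finite sequences of local minima, local maxima and crossings of the vertical cut) whose top is glued to their bottom. A *state* is a complex wavefunction $\Psi(C)$ on loop configurations. The Hamiltonian is a sum of projectors $|v\rangle\langle v|/\langle v|v\rangle$, where $v$ runs over the following local states, each inserted into an arbitrary configuration outside the disc or annulus in which it acts: * $|C\rangle-|C'\rangle$, where $C'$ arises from $C$ by an elementary isotopy; * $\bar d\,|C\rangle-|C\cup\circ\rangle$, where $\circ$ is an added small contractible loop; * the Jones–Wenzl state on three neighbouring strands. With the six end points on the boundary of a disc numbered cyclically, it is $$|(14)(23)(56)\rangle+|(25)(16)(34)\rangle+|(36)(12)(45)\rangle-\bar d\,\big(|(12)(34)(56)\rangle+|(16)(23)(45)\rangle\big).$$ A *zero-energy state* is a wavefunction annihilated by all these projectors. Then: 1.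 For every $C$ the pair $(n_x,n_y)$ is well defined up to a common sign, and every pair of integers occurs. 2. $\Psi$ is a zero-energy state if and only if $\Psi(C)=\psi(n_x,n_y)\,d^{|C|}$ for all $C$, where $\psi:\mathbb Z^2\to\mathbb C$ satisfies $\psi(-n_x,-n_y)=\psi(n_x,n_y)$ and the three constraints $$\psi(2,2)+\psi(2,0)+\psi(0,2)-2\psi(0,0)=0,$$ $$\psi(1,2)+\psi(1,-2)-d\,\psi(1,0)=0,$$ $$\psi(0,3+n)=\psi(0,1+n)\quad(n\ge0),$$ together with all their images under the group generated by $(S\psi)(n_x,n_y)=\psi(n_y,-n_x)$, $(T\psi)(n_x,n_y)=\psi(n_x,n_x+n_y)$ and the reflection $(R\psi)(n_x,n_y)=\psi(-n_x,n_y)$. (By part 1, $\psi$ is determined by $\Psi$.) 3. The space of all such $\psi$ has dimension $9$. Its subspace supported on $(n_x,n_y)$ of a given parity class has dimension $3$ for (even, even), and dimension $2$ for each of (odd, odd), (even, odd) and (odd, even). The same dimensions hold for the space of zero-energy states and its subspaces supported on the corresponding configurations. 4. In the domain-wall interpretation there are exactly $3$ ground states: the space of zero-energy states supported on those $C$ that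 are the domain walls of a two-valued spin function on the regions of the torus (constant on each region, changing across every strand) has dimension $3$. Here states are functions of the domain-wall configuration, so that a spin function and its global flip are identified. -/

import Mathlib

/-!
Loop configurations on the torus, the frustration-free loop Hamiltonian without two-loop
reconnection, supplemented by the Jones-Wenzl projector on three strands, and its zero-energy states.

The torus is cut open along one horizontal and one vertical circle.  A loop configuration in general
position with respect to the height function is read from bottom to top: at each regular height it
meets the horizontal circle in finitely many points, numbered `0, …, n - 1` starting from the
vertical cut, and between regular heights elementary events happen one at a time.  The top and
the bottom of the resulting word are glued together.
-/

noncomputable section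

namespace TorusLoops

/-- Elementary events, from `m` points just below to `n` points just above. -/
inductive Event : ℕ → ℕ → Type
  /-- A local minimum: two new neighbouring points `i`, `i + 1` appear. -/
  | birth (n i : ℕ) (h : i ≤ n) : Event n (n + 2)
  /-- A local maximum: the neighbouring points `i`, `i + 1` are joined and disappear. -/
  | death (n i : ℕ) (h : i ≤ n) : Event (n + 2) n
  /-- The last strand crosses the vertical cut towards the right and becomes the first one. -/
  | right (n : ℕ) : Event (n + 1) (n + 1)
  /-- The first strand crosses the vertical cut towards the left and becomes the last one. -/
  | left (n : ℕ) : Event (n + 1) (n + 1)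

/-- A loop diagram on the annulus with `m` end points at the bottom and `n` at the top: a finite
sequence of events, the lowest one first. -/
inductive Word : ℕ → ℕ → Type
  | nil (n : ℕ) : Word n n
  | cons {m k n : ℕ} (e : Event m k) (w : Word k n) : Word m n

/-- Put the second diagram on top of the first one. -/
def Word.comp : {m n k : ℕ} → Word m n → Word n k → Word m k
  | _, _, _, .nil _, v => v
  | _, _, _, .cons e w, v => .cons e (w.comp v)

/-- The diagram with a single event. -/
def one {m n : ℕ} (e : Event m n) : Word m n := .cons e (.nil n)

/-- The diagram with two events, the lower one first. -/
def two {m k n : ℕ} (e : Event m k) (f : Event k n) : Word m n := .cons e (one f)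

/-- The diagram with three events, the lowest one first. -/
def three {m k l n : ℕ} (e : Event m k) (f : Event k l) (g : Event l n) : Word m n :=
  .cons e (two f g)

/-- A loop configuration on the torus: an annular diagram whose top is glued to its bottom. -/
structure Config where
  base : ℕ
  word : Word base base

/-- The configuration that contains the diagram `P` and is given by `X` elsewhere. -/
def close {m n : ℕ} (P : Word m n) (X : Word n m) : Config := ⟨m, P.comp X⟩

/-! ### Loops and winding numbers -/

/-- The number of events. -/
def Word.length : {m n : ℕ} → Word m n → ℕ
  | _, _, .nil _ => 0
  | _, _, .cons _ w => w.length + 1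

/-- The number of points at regular height `l`, for `l = 0, …, length`. -/
def Word.width : {m n : ℕ} → Word m n → ℕ → ℕ
  | m, _, _, 0 => m
  | m, _, .nil _, _ + 1 => m
  | _, _, .cons _ w, l + 1 => w.width l

/-- `w.Has l e`: the event between the heights `l` and `l + 1` is `e`. -/
inductive Word.Has : {m n : ℕ} → Word m n → ℕ → {a b : ℕ} → Event a b → Prop
  | head {m k n : ℕ} (e : Event m k) (w : Word k n) : Word.Has (.cons e w) 0 e
  | tail {m k n l a b : ℕ} {f : Event a b} (e : Event m k) (w : Word k n) :
      Word.Has w l f → Word.Has (.cons e w) (l + 1) f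

/-- `e.Through a b`: the point `a` below the event is continued by the point `b` above it. -/
def Event.Through : {m n : ℕ} → Event m n → ℕ → ℕ → Prop
  | _, _, .birth _ i _, a, b => (a < i ∧ b = a) ∨ (i ≤ a ∧ b = a + 2)
  | _, _, .death _ i _, a, b => (b < i ∧ a = b) ∨ (i ≤ b ∧ a = b + 2)
  | _, _, .right n, a, b => b = a + 1 ∨ (a = n ∧ b = 0)
  | _, _, .left n, a, b => a = b + 1 ∨ (a = 0 ∧ b = n)

/-- The points of a configuration: pairs (height, position). -/
def Config.Point (C : Config) : Type :=
  {p : ℕ × ℕ // p.1 ≤ C.word.length ∧ p.2 < C.word.width p.1}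

/-- Consecutive points on a strand that passes through an event or through the horizontal cut. -/
inductive Config.Strand (C : Config) : ℕ × ℕ → ℕ × ℕ → Prop
  | event {l m n a b : ℕ} {e : Event m n} :
      C.word.Has l e → a < m → b < n → e.Through a b → Config.Strand C (l, a) (l + 1, b)
  | cut {a : ℕ} : a < C.base → Config.Strand C (C.word.length, a) (0, a)

/-- Points joined at a local minimum or at a local maximum. -/
inductive Config.Turn (C : Config) : ℕ × ℕ → ℕ × ℕ → Prop
  | birth {l n i : ℕ} {h : i ≤ n} :
      C.word.Has l (Event.birth n i h) → Config.Turn C (l + 1, i) (l + 1, i + 1)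
  | death {l n i : ℕ} {h : i ≤ n} :
      C.word.Has l (Event.death n i h) → Config.Turn C (l, i) (l, i + 1)

/-- The set of loops of a configuration. -/
def Config.Loop (C : Config) : Type :=
  Quot fun p q : C.Point => C.Strand p.1 q.1 ∨ C.Turn p.1 q.1

/-- The number `|C|` of all loops, contractible or not. -/
def Config.loops (C : Config) : ℕ := Nat.card C.Loop

/-- An arrow on every loop: `1` where it points upwards and `-1` where it points downwards. -/
def Config.IsOrientation (C : Config) (o : C.Point → ℤ) : Prop :=
  (∀ p, o p = 1 ∨ o p = -1) ∧
  (∀ p q : C.Point, C.Strand p.1 q.1 → o q = o p) ∧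
  (∀ p q : C.Point, C.Turn p.1 q.1 → o q = -o p)

/-- The flow of `f` through the vertical cut towards the right at an event, where `f a` is the
flow upwards at the point `a` just below the event. -/
def Event.flux : {m n : ℕ} → Event m n → (ℕ → ℤ) → ℤ
  | _, _, .birth _ _ _, _ => 0
  | _, _, .death _ _ _, _ => 0
  | _, _, .right n, f => f n
  | _, _, .left _, f => -f 0

/-- The total flow through the vertical cut towards the right. -/
def Word.flux : {m n : ℕ} → Word m n → (ℕ → ℕ → ℤ) → ℤ
  | _, _, .nil _, _ => 0
  | _, _, .cons e w, f => e.flux (f 0) + w.flux fun l => f (l + 1)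

open Classical in
/-- Winding numbers of the loops in `A` with arrows `o`: the signed numbers of strands that pass
through the horizontal cut (from below minus from above) and through the vertical cut (from the left
minus from the right). -/
def Config.winding (C : Config) (o : C.Point → ℤ) (A : Set C.Loop) : ℤ × ℤ :=
  let f : ℕ → ℕ → ℤ := fun l a =>
    if h : l ≤ C.word.length ∧ a < C.word.width l then
      (if Quot.mk _ ⟨(l, a), h⟩ ∈ A then o ⟨(l, a), h⟩ else 0)
    else 0
  (∑ a ∈ Finset.range C.base, f 0 a, C.word.flux f)

/-- `v` is the pair of total winding numbers of `C` for some choice of arrows for which all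
noncontractible loops have the same winding numbers. -/
def Config.HasWinding (C : Config) (v : ℤ × ℤ) : Prop :=
  ∃ o : C.Point → ℤ, C.IsOrientation o ∧
    (∃ u : ℤ × ℤ, ∀ c : C.Loop, C.winding o {c} = 0 ∨ C.winding o {c} = u) ∧
    C.winding o Set.univ = v

/-! ### The Hamiltonian -/

/-- The elementary isotopies of loops on the annulus, in general position with respect to the height
function and to the vertical cut. -/
inductive Move : {m n : ℕ} → Word m n → Word m n → Prop
  /- Distant events are interchanged. -/
  | birth_birth (n i k : ℕ) (h : i ≤ k) (h' : k ≤ n) :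
      Move (two (.birth n i (by omega)) (.birth (n + 2) (k + 2) (by omega)))
        (two (.birth n k (by omega)) (.birth (n + 2) i (by omega)))
  | death_death (n i k : ℕ) (h : i ≤ k) (h' : k ≤ n) :
      Move (two (.death (n + 2) (k + 2) (by omega)) (.death n i (by omega)))
        (two (.death (n + 2) i (by omega)) (.death n k (by omega)))
  | birth_death (n i k : ℕ) (h : i ≤ k) (h' : k ≤ n) :
      Move (two (.birth (n + 2) i (by omega)) (.death (n + 2) (k + 2) (by omega)))
        (two (.death n k (by omega)) (.birth n i (by omega)))
  | birth_death' (n i k : ℕ) (h : i ≤ k) (h' : k ≤ n) :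
      Move (two (.birth (n + 2) (k + 2) (by omega)) (.death (n + 2) i (by omega)))
        (two (.death n i (by omega)) (.birth n k (by omega)))
  /- A zigzag is straightened. -/
  | zigzag (n i : ℕ) (h : i ≤ n) :
      Move (two (.birth (n + 1) i (by omega)) (.death (n + 1) (i + 1) (by omega))) (.nil (n + 1))
  | zigzag' (n i : ℕ) (h : i ≤ n) :
      Move (two (.birth (n + 1) (i + 1) (by omega)) (.death (n + 1) i (by omega))) (.nil (n + 1))
  /- A strand is pulled back from the vertical cut. -/
  | right_left (n : ℕ) : Move (two (.right n) (.left n)) (.nil (n + 1))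
  | left_right (n : ℕ) : Move (two (.left n) (.right n)) (.nil (n + 1))
  /- A strand crosses the vertical cut before or after a distant minimum or maximum. -/
  | birth_right (n i : ℕ) (h : i ≤ n) :
      Move (two (.birth (n + 1) i (by omega)) (.right (n + 2)))
        (two (.right n) (.birth (n + 1) (i + 1) (by omega)))
  | death_right (n i : ℕ) (h : i ≤ n) :
      Move (two (.death (n + 1) i (by omega)) (.right n))
        (two (.right (n + 2)) (.death (n + 1) (i + 1) (by omega)))
  /- A minimum or a maximum is moved across the vertical cut. -/
  | birth_cut (n : ℕ) :
      Move (three (.birth n n le_rfl) (.right (n + 1)) (.right (n + 1)))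
        (one (.birth n 0 n.zero_le))
  | death_cut (n : ℕ) :
      Move (three (.right (n + 1)) (.right (n + 1)) (.death n 0 n.zero_le))
        (one (.death n n le_rfl))

/-- The basis state `|C⟩`. -/
def ket (C : Config) : Config →₀ ℂ := Finsupp.single C 1

/-- The Jones-Wenzl state on the three neighbouring strands `i`, `i + 1`, `i + 2`, inserted into the
configuration given by `X` outside the disc.  For `d = ±√2` it is the combination of the five
planar connections of the six end points (in cyclic order `1, …, 6`) in which
`(14)(23)(56)`, `(25)(16)(34)`, `(36)(12)(45)` have coefficient `1`, and
`(12)(34)(56)`, `(16)(23)(45)` have coefficient `-d`. -/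
def jonesWenzl (d : ℂ) (n i : ℕ) (h : i ≤ n) (X : Word (n + 3) (n + 3)) : Config →₀ ℂ :=
  ket (close (.nil (n + 3)) X)
  + ket (close (two (.death (n + 1) i (by omega)) (.birth (n + 1) (i + 1) (by omega))) X)
  + ket (close (two (.death (n + 1) (i + 1) (by omega)) (.birth (n + 1) i (by omega))) X)
  - star d • (ket (close (two (.death (n + 1) i (by omega)) (.birth (n + 1) i (by omega))) X)
    + ket (close (two (.death (n + 1) (i + 1) (by omega))
        (.birth (n + 1) (i + 1) (by omega))) X))

/-- The local states that are penalized by the Hamiltonian. -/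
inductive Penalized (d : ℂ) : (Config →₀ ℂ) → Prop
  /-- Loops may be moved inside the annulus. -/
  | isotopy {m n : ℕ} {P Q : Word m n} (X : Word n m) :
      Move P Q → Penalized d (ket (close P X) - ket (close Q X))
  /-- Loops may be moved across the horizontal cut. -/
  | rotate {m n : ℕ} (X : Word m n) (Y : Word n m) :
      Penalized d (ket (close X Y) - ket (close Y X))
  /-- A small loop may be created or annihilated. -/
  | smallLoop (n i : ℕ) (h : i ≤ n) (X : Word n n) :
      Penalized d (star d • ket (close (.nil n) X)
        - ket (close (two (.birth n i h) (.death n i h)) X))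
  /-- The Jones-Wenzl term. -/
  | jonesWenzl (n i : ℕ) (h : i ≤ n) (X : Word (n + 3) (n + 3)) :
      Penalized d (jonesWenzl d n i h X)

/-- The amplitude `⟨v|Ψ⟩`, as a linear function of the wavefunction `Ψ`. -/
def amplitude (v : Config →₀ ℂ) : (Config → ℂ) →ₗ[ℂ] ℂ :=
  ∑ C ∈ v.support, star (v C) • LinearMap.proj C

/-- The projector `|v⟩⟨v| / ⟨v|v⟩`. -/
def projector (v : Config →₀ ℂ) : (Config → ℂ) →ₗ[ℂ] (Config → ℂ) :=
  ((amplitude v v)⁻¹ • amplitude v).smulRight (v : Config → ℂ)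

/-- The zero-energy states of the frustration-free Hamiltonian: the wavefunctions that are
annihilated by all its projectors. -/
def zeroEnergy (d : ℂ) : Submodule ℂ (Config → ℂ) :=
  ⨅ v : {v : Config →₀ ℂ // Penalized d v}, LinearMap.ker (projector v.1)

/-! ### Domain walls -/

/-- `e.Gap a b`: the interval between points below the event that is numbered `a` and the
interval above it that is numbered `b` belong to the same region.  The interval `k` lies
immediately to the left of the point `k`. -/
def Event.Gap : {m n : ℕ} → Event m n → ℕ → ℕ → Prop
  | _, _, .birth _ i _, a, b => (a ≤ i ∧ b = a) ∨ (i ≤ a ∧ b = a + 2)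
  | _, _, .death _ i _, a, b => (b ≤ i ∧ a = b) ∨ (i ≤ b ∧ a = b + 2)
  | _, _, .right _, a, b => b = a + 1
  | _, _, .left _, a, b => a = b + 1

/-- The loops are the domain walls of Ising spins: there are spins `s l k`, at height `l` and in
the interval `k`, that are constant on every region and change across every strand. -/
def Config.IsDomainWall (C : Config) : Prop :=
  ∃ s : ℕ → ℕ → Bool,
    (∀ l ≤ C.word.length, s l (C.word.width l) = s l 0 ∧
      ∀ k < C.word.width l, s l (k + 1) = !s l k) ∧
    (∀ (l m n a b : ℕ) (e : Event m n), C.word.Has l e → a ≤ m → b ≤ n → e.Gap a b →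
      s l a = s (l + 1) b) ∧
    (∀ k ≤ C.base, s C.word.length k = s 0 k)

/-- The wavefunctions supported on domain-wall configurations. -/
def domainWallStates : Submodule ℂ (Config → ℂ) where
  carrier := {Ψ | ∀ C : Config, ¬ C.IsDomainWall → Ψ C = 0}
  add_mem' {Ψ Φ} h h' C hC := by simp [h C hC, h' C hC]
  zero_mem' C hC := rfl
  smul_mem' c Ψ h C hC := by simp [h C hC]

/-! ### Sectors and amplitudes -/

/-- The parity sector of a pair of winding numbers. -/
def parity (v : ℤ × ℤ) : ZMod 2 × ZMod 2 := (v.1, v.2)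

/-- The wavefunctions supported on the configurations in the parity sector `ε`. -/
def sectorStates (ε : ZMod 2 × ZMod 2) : Submodule ℂ (Config → ℂ) where
  carrier := {Ψ | ∀ C v, Config.HasWinding C v → parity v ≠ ε → Ψ C = 0}
  add_mem' {Ψ Φ} h h' C v hv hC := by simp [h C v hv hC, h' C v hv hC]
  zero_mem' C v _ hC := rfl
  smul_mem' c Ψ h C v hv hC := by simp [h C v hv hC]

/-- The functions `ψ(n_x, n_y)` supported on the parity sector `ε`. -/
def sectorAmplitudes (ε : ZMod 2 × ZMod 2) : Submodule ℂ (ℤ × ℤ → ℂ) where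
  carrier := {ψ | ∀ v, parity v ≠ ε → ψ v = 0}
  add_mem' {ψ φ} h h' v hv := by simp [h v hv, h' v hv]
  zero_mem' v _ := rfl
  smul_mem' c ψ h v hv := by simp [h v hv]

/-- `(S ψ)(n_x, n_y) = ψ(n_y, -n_x)`. -/
def modS : Module.End ℂ (ℤ × ℤ → ℂ) := LinearMap.funLeft ℂ ℂ fun v => (v.2, -v.1)

/-- `(T ψ)(n_x, n_y) = ψ(n_x, n_x + n_y)`. -/
def modT : Module.End ℂ (ℤ × ℤ → ℂ) := LinearMap.funLeft ℂ ℂ fun v => (v.1, v.1 + v.2)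

/-- `(R ψ)(n_x, n_y) = ψ(-n_x, n_y)`. -/
def reflX : Module.End ℂ (ℤ × ℤ → ℂ) := LinearMap.funLeft ℂ ℂ fun v => (-v.1, v.2)

/-- The three basic constraints. -/
def BasicConstraints (d : ℂ) (ψ : ℤ × ℤ → ℂ) : Prop :=
  ψ (2, 2) + ψ (2, 0) + ψ (0, 2) - 2 * ψ (0, 0) = 0 ∧
  ψ (1, 2) + ψ (1, -2) - d * ψ (1, 0) = 0 ∧
  ∀ n : ℕ, ψ (0, 3 + n) = ψ (0, 1 + n)

/-- The functions of the winding numbers, taken up to a common sign, that satisfy the basic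
constraints and all their images under modular transformations and the reflection. -/
def amplitudes (d : ℂ) : Submodule ℂ (ℤ × ℤ → ℂ) where
  carrier := {ψ | (∀ v, ψ (-v) = ψ v) ∧
    ∀ g ∈ Submonoid.closure {modS, modT, reflX}, BasicConstraints d (g ψ)}
  add_mem' {ψ φ} h h' := by
    refine ⟨fun v => by simp [h.1 v, h'.1 v], fun g hg => ?_⟩
    obtain ⟨a, b, c⟩ := h.2 g hg
    obtain ⟨a', b', c'⟩ := h'.2 g hg
    refine ⟨?_, ?_, fun n => ?_⟩
    · simp only [map_add, Pi.add_apply]; linear_combination a + a'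
    · simp only [map_add, Pi.add_apply]; linear_combination b + b'
    · simp only [map_add, Pi.add_apply, c n, c' n]
  zero_mem' := ⟨fun _ => rfl, fun g _ => by simp [BasicConstraints]⟩
  smul_mem' t ψ h := by
    refine ⟨fun v => by simp [h.1 v], fun g hg => ?_⟩
    obtain ⟨a, b, c⟩ := h.2 g hg
    refine ⟨?_, ?_, fun n => ?_⟩
    · simp only [map_smul, Pi.smul_apply, smul_eq_mul]; linear_combination t * a
    · simp only [map_smul, Pi.smul_apply, smul_eq_mul]; linear_combination t * b
    · simp only [map_smul, Pi.smul_apply, c n]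

end TorusLoops

end

/-!
# Zero-energy states of the loop model on the torus

Every configuration has a *state sum*: the multiset of the total winding numbers of all its
orientations, computed downwards by transferring arrow labels from height to height (`Word.run`,
`Config.windings`). It is invariant under isotopies and rotations of the annulus, and a small loop
doubles it. It is also the multiset of all sums `∑ ± w` over the windings `w` of the single loops
(`Config.windings_eq`). Since isotopies, rotations and removals of small loops turn every
configuration into straight strands (`config_induction`), the state sum is that of `g` copies of
one primitive vector `u` and `k` zeros. From it the winding numbers `± g • u` with parallel arrows
(`hasWinding_iff`) and the number `g + k` of loops (`loops_eq`) can be read off, and a wavefunction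
that respects isotopies and small loops is `ψ(n_x, n_y) d ^ |C|` (`IsSkein.eq_stateOf`). The same
works with turning numbers in addition: contractible loops turn once, and the others do not turn in
total (`Config.isStraight`).

It remains to study the Jones-Wenzl relation. Outside the disc in which it acts, a configuration
consists of closed loops and of three strands that join the six ends in pairs (`exists_isTangle`).
The strands are disjoint, so the crossing number of the chords that join the same ends in the disc is,
up to sign, the determinant of the windings of two strands (`Word.cross_run`). Up to symmetry there
are five cases. If there are no crossings, all loops are parallel, and the relation amounts to
nothing or to `ψ((n + 3) u) = ψ((n + 1) u)`; here turning numbers exclude one combination that the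
windings would allow (`jwZero_pairs`, `jwZero_side`). With one crossing it holds because of
`d ^ 2 = 2` (`jwZero_one`). With two or three crossings the windings of the strands contain a basis
`a`, `b` of the lattice, and the relation is the second or the first constraint for this basis
(`jwZero_two`, `jwZero_three`). By the Euclidean algorithm, the images of the basic constraints under
the group are the constraints for all bases (`mem_amplitudes`). Hence the constraints suffice for a
zero-energy state (`stateOf_mem_zeroEnergy`).

The converse is obtained by counting. A few Jones-Wenzl relations on explicit configurations show that
the amplitudes of any zero-energy state vanish if nine of their values do (`IsGround.eq_zero`). On the
other hand, solutions of the constraints with arbitrary values at the same nine points can be written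
down (`exists_isAmplitude`): for even winding numbers they depend on the direction modulo `2` of the
winding, and in the three other parity sectors they combine powers of eighth roots of unity. Therefore
every zero-energy state comes from a solution (`IsGround.isAmplitude`), and the dimensions are the
numbers of points in the sectors. Finally, spins with a given set of domain walls exist if and only
if both winding numbers are even (`Config.HasWinding.isDomainWall_iff`).
-/

noncomputable section

namespace TorusLoops

open scoped Classical

/-! ### Sums with independent signs -/

/-- The multiset of all sums `∑ ± g`, where `g` runs over `L` and all choices of signs occur. -/
def signSums {G : Type*} [AddCommGroup G] (L : Multiset G) : Multiset G :=
  L.powerset.map fun S => 2 • S.sum - L.sum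

section SignSums

variable {G H : Type*} [AddCommGroup G] [AddCommGroup H]

@[simp] theorem signSums_zero : signSums (0 : Multiset G) = {0} := by
  simp [signSums]

theorem signSums_cons (a : G) (L : Multiset G) :
    signSums (a ::ₘ L) = (signSums L).map (a + ·) + (signSums L).map (-a + ·) := by
  simp only [signSums, Multiset.powerset_cons, Multiset.map_add, Multiset.map_map]
  rw [add_comm]
  congr 1
  · refine Multiset.map_congr rfl fun S _ => ?_
    simp only [Function.comp, Multiset.sum_cons]; abel
  · refine Multiset.map_congr rfl fun S _ => ?_
    simp only [Function.comp, Multiset.sum_cons]; abel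

theorem signSums_neg_cons (a : G) (L : Multiset G) :
    signSums (-a ::ₘ L) = signSums (a ::ₘ L) := by
  rw [signSums_cons, signSums_cons, neg_neg, add_comm]

theorem signSums_map (f : G →+ H) (L : Multiset G) :
    signSums (L.map f) = (signSums L).map f := by
  induction L using Multiset.induction_on with
  | empty => simp
  | cons a L ih =>
    simp only [Multiset.map_cons, signSums_cons, ih, Multiset.map_add, Multiset.map_map]
    congr 1 <;> exact Multiset.map_congr rfl fun x _ => by simp

theorem card_signSums (L : Multiset G) : (signSums L).card = 2 ^ L.card := by
  simp [signSums, Multiset.card_powerset]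

theorem exists_mem_signSums (L : Multiset G) : ∃ x, x ∈ signSums L := by
  apply Multiset.exists_mem_of_ne_zero
  intro h
  have := card_signSums L
  rw [h, Multiset.card_zero] at this
  exact absurd this.symm (by positivity)

theorem signSums_cons_congr {L L' : Multiset G} (a : G) (h : signSums L = signSums L') :
    signSums (a ::ₘ L) = signSums (a ::ₘ L') := by
  rw [signSums_cons, signSums_cons, h]

theorem sum_mem_signSums (L : Multiset G) : L.sum ∈ signSums L := by
  refine Multiset.mem_map.2 ⟨L, by simp, ?_⟩
  rw [two_smul]; abel

end SignSums

/-! ### Labels of the points at a regular height -/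

/-- The arrows at the `n` points of a regular height, `1` upwards and `-1` downwards, extended
by `0`. -/
def IsLabel (n : ℕ) (u : ℕ → ℤ) : Prop :=
  (∀ a < n, u a = 1 ∨ u a = -1) ∧ ∀ a, n ≤ a → u a = 0

/-- All labels of `n` points. -/
def labels (n : ℕ) : Multiset (ℕ → ℤ) :=
  signSums ((Multiset.range n).map fun a => (Pi.single a 1 : ℕ → ℤ))

theorem labels_succ (n : ℕ) : labels (n + 1) =
    (labels n).map ((Pi.single n 1 : ℕ → ℤ) + ·) +
      (labels n).map (-(Pi.single n 1 : ℕ → ℤ) + ·) := by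
  rw [labels, Multiset.range_succ, Multiset.map_cons, signSums_cons, labels]

theorem mem_labels {n : ℕ} {u : ℕ → ℤ} : u ∈ labels n ↔ IsLabel n u := by
  induction n generalizing u with
  | zero =>
    simp only [labels, Multiset.range_zero, Multiset.map_zero, signSums_zero,
      Multiset.mem_singleton, IsLabel]
    constructor
    · rintro rfl; simp
    · rintro ⟨_, h⟩; ext a; exact h a (Nat.zero_le _)
  | succ n ih =>
    simp only [labels_succ, Multiset.mem_add, Multiset.mem_map, ih]
    constructor
    · rintro (⟨v, hv, rfl⟩ | ⟨v, hv, rfl⟩)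
      all_goals
        refine ⟨fun a ha => ?_, fun a ha => ?_⟩
        · rcases eq_or_ne a n with rfl | hne
          · simp [hv.2 a le_rfl]
          · simpa [hne] using hv.1 a (by omega)
        · have : a ≠ n := by omega
          simpa [this] using hv.2 a (by omega)
    · intro h
      have hv : IsLabel n (Function.update u n 0) := by
        refine ⟨fun a ha => ?_, fun a ha => ?_⟩
        · rw [Function.update_of_ne (by omega)]; exact h.1 a (by omega)
        · rcases eq_or_ne a n with rfl | hne
          · simp
          · rw [Function.update_of_ne hne]; exact h.2 a (by omega)
      rcases h.1 n (by omega) with h1 | h1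
      · refine Or.inl ⟨_, hv, ?_⟩
        ext a
        rcases eq_or_ne a n with rfl | hne
        · simp [h1]
        · simp [hne]
      · refine Or.inr ⟨_, hv, ?_⟩
        ext a
        rcases eq_or_ne a n with rfl | hne
        · simp [h1]
        · simp [hne]

theorem nodup_labels (n : ℕ) : (labels n).Nodup := by
  induction n with
  | zero => simp [labels]
  | succ n ih =>
    rw [labels_succ, Multiset.nodup_add]
    refine ⟨ih.map (add_right_injective _), ih.map (add_right_injective _), ?_⟩
    rw [Multiset.disjoint_left]
    intro u h1 h2
    obtain ⟨v, hv, rfl⟩ := Multiset.mem_map.1 h1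
    obtain ⟨v', hv', h⟩ := Multiset.mem_map.1 h2
    have := congrFun h n
    simp [(mem_labels.1 hv).2 n le_rfl, (mem_labels.1 hv').2 n le_rfl] at this

/-- The total upward flow. -/
def total (n : ℕ) (u : ℕ → ℤ) : ℤ := ∑ a ∈ Finset.range n, u a

/-- Insert the points `i`, `i + 1` with labels `x`, `-x`. -/
def ins (i : ℕ) (x : ℤ) (u : ℕ → ℤ) : ℕ → ℤ := fun k =>
  if k < i then u k else if k = i then x else if k = i + 1 then -x else u (k - 2)

/-- Remove the points `i`, `i + 1`. -/
def del (i : ℕ) (u : ℕ → ℤ) : ℕ → ℤ := fun k => if k < i then u k else u (k + 2)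

/-- The first of `n + 1` points becomes the last one. -/
def rotL (n : ℕ) (u : ℕ → ℤ) : ℕ → ℤ := fun k =>
  if k < n then u (k + 1) else if k = n then u 0 else u k

/-- The last of `n + 1` points becomes the first one. -/
def rotR (n : ℕ) (u : ℕ → ℤ) : ℕ → ℤ := fun k =>
  if k = 0 then u n else if k ≤ n then u (k - 1) else u k

/-- The labels below an event, with the flow through the vertical cut, for given labels above. -/
def Event.back : {m n : ℕ} → Event m n → (ℕ → ℤ) → Multiset ((ℕ → ℤ) × ℤ)
  | _, _, .birth _ i _, u => if u i + u (i + 1) = 0 then {(del i u, 0)} else 0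
  | _, _, .death _ i _, u => {(ins i 1 u, 0), (ins i (-1) u, 0)}
  | _, _, .right n, u => {(rotL n u, u 0)}
  | _, _, .left n, u => {(rotR n u, -u n)}

/-- The labels at the bottom of a diagram, with the flow through the vertical cut, of all
orientations of the diagram with given labels at the top. -/
def Word.run : {m n : ℕ} → Word m n → (ℕ → ℤ) → Multiset ((ℕ → ℤ) × ℤ)
  | _, _, .nil _, t => {(t, 0)}
  | _, _, .cons e w, t => (w.run t).bind fun p => (e.back p.1).map fun q => (q.1, q.2 + p.2)

theorem bind_pure_eq {α : Type*} (s : Multiset α) : (s.bind fun p => {p}) = s :=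
  (Multiset.bind_singleton s id).trans (Multiset.map_id s)

theorem Word.run_comp {m n k : ℕ} (X : Word m n) (Y : Word n k) (t : ℕ → ℤ) :
    (X.comp Y).run t = (Y.run t).bind fun p => (X.run p.1).map fun q => (q.1, q.2 + p.2) := by
  induction X with
  | nil n => simp [Word.comp, Word.run, bind_pure_eq]
  | cons e w ih =>
    simp only [Word.comp, Word.run, ih, Multiset.bind_assoc, Multiset.map_bind, Multiset.bind_map,
      Multiset.map_map, Function.comp_def, add_assoc]

theorem isLabel_ins {n i : ℕ} (hi : i ≤ n) {u : ℕ → ℤ} (hu : IsLabel n u) {x : ℤ}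
    (hx : x = 1 ∨ x = -1) : IsLabel (n + 2) (ins i x u) := by
  refine ⟨fun a ha => ?_, fun a ha => ?_⟩
  · unfold ins
    split_ifs
    · exact hu.1 a (by omega)
    · exact hx
    · omega
    · exact hu.1 _ (by omega)
  · unfold ins
    rw [if_neg (by omega), if_neg (by omega), if_neg (by omega)]
    exact hu.2 _ (by omega)

theorem isLabel_del {n i : ℕ} (hi : i ≤ n) {u : ℕ → ℤ} (hu : IsLabel (n + 2) u) :
    IsLabel n (del i u) := by
  refine ⟨fun a ha => ?_, fun a ha => ?_⟩
  · unfold del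
    split_ifs <;> exact hu.1 _ (by omega)
  · unfold del
    rw [if_neg (by omega)]
    exact hu.2 _ (by omega)

theorem isLabel_rotL {n : ℕ} {u : ℕ → ℤ} (hu : IsLabel (n + 1) u) : IsLabel (n + 1) (rotL n u) := by
  refine ⟨fun a ha => ?_, fun a ha => ?_⟩
  · unfold rotL
    split_ifs
    · exact hu.1 _ (by omega)
    · exact hu.1 _ (by omega)
    · omega
  · unfold rotL
    rw [if_neg (by omega), if_neg (by omega)]
    exact hu.2 _ (by omega)

theorem isLabel_rotR {n : ℕ} {u : ℕ → ℤ} (hu : IsLabel (n + 1) u) : IsLabel (n + 1) (rotR n u) := by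
  refine ⟨fun a ha => ?_, fun a ha => ?_⟩
  · unfold rotR
    split_ifs
    · exact hu.1 _ (by omega)
    · exact hu.1 _ (by omega)
    · omega
  · unfold rotR
    rw [if_neg (by omega), if_neg (by omega)]
    exact hu.2 _ (by omega)

theorem Event.isLabel_back {m n : ℕ} (e : Event m n) {u : ℕ → ℤ} (hu : IsLabel n u)
    {p : (ℕ → ℤ) × ℤ} (hp : p ∈ e.back u) : IsLabel m p.1 := by
  cases e with
  | birth n i h =>
    simp only [Event.back] at hp
    split_ifs at hp with h1
    · rw [Multiset.mem_singleton] at hp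
      subst hp
      exact isLabel_del h hu
    · simp at hp
  | death n i h =>
    simp only [Event.back, Multiset.insert_eq_cons, Multiset.mem_cons,
      Multiset.mem_singleton] at hp
    rcases hp with rfl | rfl
    · exact isLabel_ins h hu (Or.inl rfl)
    · exact isLabel_ins h hu (Or.inr rfl)
  | right n =>
    simp only [Event.back, Multiset.mem_singleton] at hp
    subst hp
    exact isLabel_rotL hu
  | left n =>
    simp only [Event.back, Multiset.mem_singleton] at hp
    subst hp
    exact isLabel_rotR hu

theorem Word.isLabel_run {m n : ℕ} (w : Word m n) {t : ℕ → ℤ} (ht : IsLabel n t)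
    {p : (ℕ → ℤ) × ℤ} (hp : p ∈ w.run t) : IsLabel m p.1 := by
  induction w generalizing p with
  | nil n => simp only [Word.run, Multiset.mem_singleton] at hp; subst hp; exact ht
  | cons e w ih =>
    simp only [Word.run, Multiset.mem_bind, Multiset.mem_map] at hp
    obtain ⟨q, hq, r, hr, rfl⟩ := hp
    exact e.isLabel_back (p := r) (ih ht hq) hr

/-! ### The intersection form -/

/-- Twice the antisymmetric form that counts the crossings of strands with end points on a line. -/
def cross (n : ℕ) (s s' : ℕ → ℤ) : ℤ :=
  ∑ j ∈ Finset.range n, (total j s * s' j - s j * total j s')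

theorem total_succ (n : ℕ) (s : ℕ → ℤ) : total (n + 1) s = total n s + s n :=
  Finset.sum_range_succ _ _

theorem cross_succ (n : ℕ) (s s' : ℕ → ℤ) :
    cross (n + 1) s s' = cross n s s' + (total n s * s' n - s n * total n s') :=
  Finset.sum_range_succ _ _

theorem total_congr {n : ℕ} {s s' : ℕ → ℤ} (h : ∀ a < n, s a = s' a) : total n s = total n s' :=
  Finset.sum_congr rfl fun a ha => h a (Finset.mem_range.1 ha)

theorem cross_congr {n : ℕ} {s s' t t' : ℕ → ℤ} (h : ∀ a < n, s a = t a)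
    (h' : ∀ a < n, s' a = t' a) : cross n s s' = cross n t t' := by
  refine Finset.sum_congr rfl fun a ha => ?_
  have ha := Finset.mem_range.1 ha
  rw [h a ha, h' a ha, total_congr fun b hb => h b (hb.trans ha),
    total_congr fun b hb => h' b (hb.trans ha)]

theorem ins_lt {i k : ℕ} (h : k < i) (x : ℤ) (u : ℕ → ℤ) : ins i x u k = u k := by simp [ins, h]
theorem ins_self (i : ℕ) (x : ℤ) (u : ℕ → ℤ) : ins i x u i = x := by simp [ins]
theorem ins_succ (i : ℕ) (x : ℤ) (u : ℕ → ℤ) : ins i x u (i + 1) = -x := by simp [ins]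
theorem ins_ge {i k : ℕ} (h : i ≤ k) (x : ℤ) (u : ℕ → ℤ) : ins i x u (k + 2) = u k := by
  simp only [ins]
  rw [if_neg (by omega), if_neg (by omega), if_neg (by omega)]
  rfl

theorem total_ins {i n : ℕ} (h : i ≤ n) (x : ℤ) (u : ℕ → ℤ) :
    total (n + 2) (ins i x u) = total n u := by
  induction n, h using Nat.le_induction with
  | base =>
    rw [total_succ, total_succ, ins_self, ins_succ, total_congr fun a ha => ins_lt ha x u]
    ring
  | succ n h ih => rw [total_succ, ih, ins_ge h, ← total_succ]

theorem cross_ins {i n : ℕ} (h : i ≤ n) (x x' : ℤ) (u u' : ℕ → ℤ) :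
    cross (n + 2) (ins i x u) (ins i x' u') = cross n u u' := by
  induction n, h using Nat.le_induction with
  | base =>
    rw [cross_succ, cross_succ, total_succ, total_succ, ins_self, ins_succ, ins_self, ins_succ,
      cross_congr (fun a ha => ins_lt ha x u) (fun a ha => ins_lt ha x' u'),
      total_congr fun a ha => ins_lt ha x u, total_congr fun a ha => ins_lt ha x' u']
    ring
  | succ n h ih =>
    rw [cross_succ, ih, ins_ge h, ins_ge h, total_ins h, total_ins h, ← cross_succ]

theorem ins_del {i : ℕ} {u : ℕ → ℤ} (h : u i + u (i + 1) = 0) : ins i (u i) (del i u) = u := by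
  ext k
  unfold ins del
  split_ifs with h1 h2 h3 h4
  · rfl
  · rw [h2]
  · rw [h3]; omega
  · omega
  · congr 1; omega

theorem rotR_zero (n : ℕ) (u : ℕ → ℤ) : rotR n u 0 = u n := by simp [rotR]
theorem rotR_succ {n k : ℕ} (h : k < n) (u : ℕ → ℤ) : rotR n u (k + 1) = u k := by
  simp [rotR, Nat.succ_le_of_lt h]

theorem total_rotR_aux {n k : ℕ} (h : k ≤ n) (u : ℕ → ℤ) :
    total (k + 1) (rotR n u) = u n + total k u := by
  induction k with
  | zero => simp [total, rotR_zero]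
  | succ k ih => rw [total_succ, ih (by omega), rotR_succ (by omega), total_succ]; ring

theorem total_rotR (n : ℕ) (u : ℕ → ℤ) : total (n + 1) (rotR n u) = total (n + 1) u := by
  rw [total_rotR_aux le_rfl, total_succ]; ring

theorem cross_rotR (n : ℕ) (u u' : ℕ → ℤ) :
    cross (n + 1) (rotR n u) (rotR n u') = cross (n + 1) u u' +
      2 * (u n * total (n + 1) u' - u' n * total (n + 1) u) := by
  have key : ∀ k ≤ n, cross (k + 1) (rotR n u) (rotR n u') = cross k u u' +
      (u n * total k u' - u' n * total k u) := by
    intro k hk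
    induction k with
    | zero => simp [cross, total]
    | succ k ih =>
      rw [cross_succ, ih (by omega), total_rotR_aux (by omega), total_rotR_aux (by omega),
        rotR_succ (by omega), rotR_succ (by omega), cross_succ, total_succ, total_succ]
      ring
  rw [key n le_rfl, cross_succ, total_succ, total_succ]
  ring

theorem rotR_rotL (n : ℕ) (u : ℕ → ℤ) : rotR n (rotL n u) = u := by
  ext k
  simp only [rotL, rotR]
  split_ifs <;> first | rfl | (exfalso; omega) | (congr 1; omega)

theorem rotL_rotR (n : ℕ) (u : ℕ → ℤ) : rotL n (rotR n u) = u := by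
  ext k
  simp only [rotL, rotR]
  split_ifs <;> first | rfl | (exfalso; omega) | (congr 1; omega)

theorem rotL_last (n : ℕ) (u : ℕ → ℤ) : rotL n u n = u 0 := by simp [rotL]

theorem total_rotL (n : ℕ) (u : ℕ → ℤ) : total (n + 1) (rotL n u) = total (n + 1) u := by
  rw [← total_rotR n (rotL n u), rotR_rotL]

theorem cross_rotL (n : ℕ) (u u' : ℕ → ℤ) :
    cross (n + 1) (rotL n u) (rotL n u') = cross (n + 1) u u' -
      2 * (u 0 * total (n + 1) u' - u' 0 * total (n + 1) u) := by
  have := cross_rotR n (rotL n u) (rotL n u')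
  rw [rotR_rotL, rotR_rotL, rotL_last, rotL_last, total_rotL, total_rotL] at this
  linarith

theorem Event.total_back {m n : ℕ} (e : Event m n) {u : ℕ → ℤ} {p : (ℕ → ℤ) × ℤ}
    (hp : p ∈ e.back u) : total m p.1 = total n u := by
  cases e with
  | birth n i h =>
    simp only [Event.back] at hp
    split_ifs at hp with h1
    · rw [Multiset.mem_singleton] at hp
      subst hp
      rw [← total_ins h (u i), ins_del h1]
    · simp at hp
  | death n i h =>
    simp only [Event.back, Multiset.insert_eq_cons, Multiset.mem_cons,
      Multiset.mem_singleton] at hp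
    rcases hp with rfl | rfl <;> exact total_ins h _ _
  | right n =>
    simp only [Event.back, Multiset.mem_singleton] at hp
    subst hp
    exact total_rotL _ _
  | left n =>
    simp only [Event.back, Multiset.mem_singleton] at hp
    subst hp
    exact total_rotR _ _

theorem Event.cross_back {m n : ℕ} (e : Event m n) {u u' : ℕ → ℤ} {p p' : (ℕ → ℤ) × ℤ}
    (hp : p ∈ e.back u) (hp' : p' ∈ e.back u') :
    cross n u u' - cross m p.1 p'.1 = 2 * (p.2 * total n u' - p'.2 * total n u) := by
  cases e with
  | birth n i h =>
    simp only [Event.back] at hp hp'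
    split_ifs at hp hp' with h1 h2
    · rw [Multiset.mem_singleton] at hp hp'
      subst hp hp'
      rw [← cross_ins h (u i) (u' i), ins_del h1, ins_del h2]
      ring
    all_goals simp at hp hp'
  | death n i h =>
    simp only [Event.back, Multiset.insert_eq_cons, Multiset.mem_cons,
      Multiset.mem_singleton] at hp hp'
    rcases hp with rfl | rfl <;> rcases hp' with rfl | rfl <;> simp only [cross_ins h] <;> ring
  | right n =>
    simp only [Event.back, Multiset.mem_singleton] at hp hp'
    subst hp hp'
    simp only [cross_rotL]
    ring
  | left n =>
    simp only [Event.back, Multiset.mem_singleton] at hp hp'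
    subst hp hp'
    simp only [cross_rotR]
    ring

/-- The flow through the horizontal circle is conserved. -/
theorem Word.total_run {m n : ℕ} (w : Word m n) {t : ℕ → ℤ} {p : (ℕ → ℤ) × ℤ}
    (hp : p ∈ w.run t) : total m p.1 = total n t := by
  induction w generalizing p with
  | nil n => simp only [Word.run, Multiset.mem_singleton] at hp; subst hp; rfl
  | cons e w ih =>
    simp only [Word.run, Multiset.mem_bind, Multiset.mem_map] at hp
    obtain ⟨q, hq, r, hr, rfl⟩ := hp
    rw [← ih hq, ← e.total_back hr]

/-- The intersection number of two flows on the same disjoint strands is determined by the end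
points; on a closed configuration it vanishes. -/
theorem Word.cross_run {m n : ℕ} (w : Word m n) {t t' : ℕ → ℤ} {p p' : (ℕ → ℤ) × ℤ}
    (hp : p ∈ w.run t) (hp' : p' ∈ w.run t') :
    cross n t t' - cross m p.1 p'.1 = 2 * (p.2 * total n t' - p'.2 * total n t) := by
  induction w generalizing p p' with
  | nil n =>
    simp only [Word.run, Multiset.mem_singleton] at hp hp'
    subst hp hp'
    simp
  | cons e w ih =>
    simp only [Word.run, Multiset.mem_bind, Multiset.mem_map] at hp hp'
    obtain ⟨q, hq, r, hr, rfl⟩ := hp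
    obtain ⟨q', hq', r', hr', rfl⟩ := hp'
    have h1 := ih hq hq'
    have h2 := e.cross_back hr hr'
    rw [w.total_run hq, w.total_run hq'] at h2
    simp only
    linear_combination h1 + h2

/-! ### Turning numbers and invariance under isotopy -/

theorem run_two {m k n : ℕ} (e : Event m k) (f : Event k n) (t : ℕ → ℤ) :
    (two e f).run t = (f.back t).bind fun p => (e.back p.1).map fun q => (q.1, q.2 + p.2) := by
  simp [two, one, Word.run]

theorem run_three {m k l n : ℕ} (e : Event m k) (f : Event k l) (g : Event l n) (t : ℕ → ℤ) :
    (three e f g).run t = ((two f g).run t).bind fun p =>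
      (e.back p.1).map fun q => (q.1, q.2 + p.2) := rfl

theorem run_one {m n : ℕ} (e : Event m n) (t : ℕ → ℤ) : (one e).run t = e.back t := by
  simp [one, Word.run]

/-- The labels below an event for given labels above, with the flow through the vertical cut and the
turning of the oriented strands at a minimum or maximum, in half turns to the left. -/
def Event.turnBack : {m n : ℕ} → Event m n → (ℕ → ℤ) → Multiset ((ℕ → ℤ) × ℤ × ℤ)
  | _, _, .birth _ i _, u => if u i + u (i + 1) = 0 then {(del i u, 0, -u i)} else 0
  | _, _, .death _ i _, u => {(ins i 1 u, 0, -1), (ins i (-1) u, 0, 1)}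
  | _, _, .right n, u => {(rotL n u, u 0, 0)}
  | _, _, .left n, u => {(rotR n u, -u n, 0)}

/-- The labels at the bottom of a diagram, with the flow through the vertical cut and the turning, of
all orientations of the diagram with given labels at the top. -/
def Word.turnRun : {m n : ℕ} → Word m n → (ℕ → ℤ) → Multiset ((ℕ → ℤ) × ℤ × ℤ)
  | _, _, .nil _, t => {(t, 0)}
  | _, _, .cons e w, t =>
    (w.turnRun t).bind fun p => (e.turnBack p.1).map fun q => (q.1, q.2 + p.2)

theorem Event.map_turnBack {m n : ℕ} (e : Event m n) (u : ℕ → ℤ) :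
    (e.turnBack u).map (fun p => (p.1, p.2.1)) = e.back u := by
  cases e with
  | birth _ i h => simp only [turnBack, back]; split_ifs <;> simp
  | death n i h => simp [turnBack, back]
  | right _ => simp [turnBack, back]
  | left _ => simp [turnBack, back]

theorem Word.map_turnRun {m n : ℕ} (w : Word m n) (t : ℕ → ℤ) :
    (w.turnRun t).map (fun p => (p.1, p.2.1)) = w.run t := by
  induction w with
  | nil n => simp [turnRun, run]
  | cons e w ih =>
    simp only [turnRun, run, ← ih, Multiset.map_bind, Multiset.bind_map, Multiset.map_map,
      ← e.map_turnBack]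
    rfl

theorem Word.mem_run_of_mem_turnRun {m n : ℕ} {w : Word m n} {t : ℕ → ℤ}
    {p : (ℕ → ℤ) × ℤ × ℤ} (hp : p ∈ w.turnRun t) : (p.1, p.2.1) ∈ w.run t := by
  rw [← w.map_turnRun]
  exact Multiset.mem_map_of_mem _ hp

theorem Word.turnRun_comp {m n k : ℕ} (X : Word m n) (Y : Word n k) (t : ℕ → ℤ) :
    (X.comp Y).turnRun t =
      (Y.turnRun t).bind fun p => (X.turnRun p.1).map fun q => (q.1, q.2 + p.2) := by
  induction X with
  | nil n => simp [Word.comp, Word.turnRun, bind_pure_eq]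
  | cons e w ih =>
    simp only [Word.comp, Word.turnRun, ih, Multiset.bind_assoc, Multiset.map_bind,
      Multiset.bind_map, Multiset.map_map, Function.comp_def, add_assoc]

theorem turnRun_two {m k n : ℕ} (e : Event m k) (f : Event k n) (t : ℕ → ℤ) :
    (two e f).turnRun t =
      (f.turnBack t).bind fun p => (e.turnBack p.1).map fun q => (q.1, q.2 + p.2) := by
  simp [two, one, Word.turnRun]

theorem turnRun_three {m k l n : ℕ} (e : Event m k) (f : Event k l) (g : Event l n)
    (t : ℕ → ℤ) : (three e f g).turnRun t = ((two f g).turnRun t).bind fun p =>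
      (e.turnBack p.1).map fun q => (q.1, q.2 + p.2) := rfl

theorem turnRun_one {m n : ℕ} (e : Event m n) (t : ℕ → ℤ) : (one e).turnRun t = e.turnBack t := by
  simp [one, Word.turnRun]

set_option maxHeartbeats 1000000 in
/-- Isotopies preserve windings and turning numbers of all orientations with given end labels. -/
theorem Move.turnRun_eq {m n : ℕ} {P Q : Word m n} (h : Move P Q) {t : ℕ → ℤ} (ht : IsLabel n t) :
    P.turnRun t = Q.turnRun t := by
  cases h with
  | birth_birth n i k h h' =>
    have e1 : ∀ j, i ≤ j → del i t j = t (j + 2) := fun j hj => by simp [del]; omega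
    have e2 : ∀ j, j < k + 2 → del (k + 2) t j = t j := fun j hj => by simp [del]; omega
    have e3 : del i (del (k + 2) t) = del k (del i t) := by
      ext j
      simp only [del]
      split_ifs <;> first | rfl | (exfalso; omega)
    simp only [turnRun_two, Event.turnBack]
    rw [apply_ite (fun M : Multiset ((ℕ → ℤ) × ℤ × ℤ) => M.bind _),
      apply_ite (fun M : Multiset ((ℕ → ℤ) × ℤ × ℤ) => M.bind _)]
    simp only [Multiset.singleton_bind, Multiset.zero_bind]
    rw [e1 _ h, e1 (k + 1) (by omega), e2 _ (by omega), e2 (i + 1) (by omega), e3]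
    simp only [add_right_comm k 2 1]
    by_cases h1 : t i + t (i + 1) = 0 <;> by_cases h2 : t (k + 2) + t (k + 1 + 2) = 0 <;>
      simp [h1, h2, add_comm]
  | death_death n i k h h' =>
    have e (x y : ℤ) : ins (k + 2) x (ins i y t) = ins i y (ins k x t) := by
      ext j
      simp only [ins]
      split_ifs <;> first | rfl | (exfalso; omega)
    simp [turnRun_two, Event.turnBack, e]
    have swap (a b c d : (ℕ → ℤ) × ℤ × ℤ) : a ::ₘ b ::ₘ c ::ₘ {d} = c ::ₘ b ::ₘ a ::ₘ {d} := by
      rw [Multiset.cons_swap a b, Multiset.cons_swap a c, Multiset.cons_swap b c]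
    exact swap _ _ _ _
  | birth_death n i k h h' =>
    have e (x : ℤ) : del i (ins (k + 2) x t) = ins k x (del i t) := by
      ext j
      simp only [ins, del]
      split_ifs <;> first | rfl | (exfalso; omega) | (congr 1; omega)
    have e1 (x : ℤ) : ins (k + 2) x t i = t i := ins_lt (by omega) _ _
    have e2 (x : ℤ) : ins (k + 2) x t (i + 1) = t (i + 1) := ins_lt (by omega) _ _
    by_cases h1 : t i + t (i + 1) = 0 <;>
      simp [turnRun_two, Event.turnBack, e, e1, e2, h1] <;> simp [add_comm]
  | birth_death' n i k h h' =>
    have e (x : ℤ) : del (k + 2) (ins i x t) = ins i x (del k t) := by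
      ext j
      simp only [ins, del]
      split_ifs <;> first | rfl | (exfalso; omega) | (congr 1; omega)
    have e1 (x : ℤ) : ins i x t (k + 2) = t k := ins_ge (by omega) _ _
    have e2 (x : ℤ) : ins i x t (k + 2 + 1) = t (k + 1) := ins_ge (k := k + 1) (by omega) _ _
    by_cases h1 : t k + t (k + 1) = 0 <;>
      simp [turnRun_two, Event.turnBack, e, e1, e2, h1] <;> simp [add_comm]
  | zigzag n i h =>
    have e1 (x : ℤ) : ins (i + 1) x t i = t i := ins_lt (by omega) _ _
    have e2 (x : ℤ) : ins (i + 1) x t (i + 1) = x := ins_self _ _ _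
    have e (x : ℤ) (hx : t i + x = 0) : del i (ins (i + 1) x t) = t := by
      ext j
      simp only [ins, del]
      split_ifs <;> first | rfl | (exfalso; omega) | skip
      all_goals have : j = i := by omega
      all_goals subst this; omega
    rcases ht.1 i (by omega) with h1 | h1
    · have := e (-1) (by omega)
      simp [turnRun_two, Event.turnBack, e1, e2, h1, this, Word.turnRun]
    · have := e 1 (by omega)
      simp [turnRun_two, Event.turnBack, e1, e2, h1, this, Word.turnRun]
  | zigzag' n i h =>
    have e1 (x : ℤ) : ins i x t (i + 1) = -x := ins_succ _ _ _
    have e2 (x : ℤ) : ins i x t (i + 1 + 1) = t i := ins_ge le_rfl _ _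
    have e (x : ℤ) (hx : x = t i) : del (i + 1) (ins i x t) = t := by
      ext j
      simp only [ins, del]
      split_ifs <;> first | rfl | (exfalso; omega) | skip
      all_goals have : j = i := by omega
      all_goals subst this; omega
    rcases ht.1 i (by omega) with h1 | h1
    · have := e 1 (by omega)
      simp [turnRun_two, Event.turnBack, e1, e2, h1, this, Word.turnRun]
    · have := e (-1) (by omega)
      simp [turnRun_two, Event.turnBack, e1, e2, h1, this, Word.turnRun]
  | right_left n => simp [turnRun_two, Event.turnBack, Word.turnRun, rotL_rotR, rotR_zero]
  | left_right n => simp [turnRun_two, Event.turnBack, Word.turnRun, rotR_rotL, rotL_last]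
  | birth_right n i h =>
    have e : del i (rotL (n + 2) t) = rotL n (del (i + 1) t) := by
      ext j
      simp only [rotL, del]
      split_ifs <;> first | rfl | (exfalso; omega)
    have e1 (j : ℕ) (hj : j < n + 2) : rotL (n + 2) t j = t (j + 1) := by simp [rotL, hj]
    have e2 : del (i + 1) t 0 = t 0 := by simp [del]
    simp only [turnRun_two, Event.turnBack, Multiset.singleton_bind, e1 i (by omega),
      e1 (i + 1) (by omega), e]
    by_cases h1 : t (i + 1) + t (i + 1 + 1) = 0 <;> simp [h1, e2]
  | death_right n i h =>
    have e (x : ℤ) : ins i x (rotL n t) = rotL (n + 2) (ins (i + 1) x t) := by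
      ext j
      simp only [rotL, ins]
      split_ifs <;> first | rfl | (exfalso; omega) | (congr 1; omega)
    have e2 (x : ℤ) : ins (i + 1) x t 0 = t 0 := by simp [ins]
    simp [turnRun_two, Event.turnBack, e, e2]
  | birth_cut _ =>
    have e : del m (rotL (m + 1) (rotL (m + 1) t)) = del 0 t := by
      ext j
      simp only [rotL, del]
      split_ifs <;> first | rfl | (exfalso; omega)
    have e1 : rotL (m + 1) (rotL (m + 1) t) m = t 0 := by simp [rotL]
    have e2 : rotL (m + 1) (rotL (m + 1) t) (m + 1) = t 1 := by simp [rotL]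
    have e3 : rotL (m + 1) t 0 = t 1 := by simp [rotL]
    by_cases h1 : t 0 + t 1 = 0
    · have h2 : t 1 + t 0 = 0 := by omega
      simp [turnRun_three, turnRun_two, turnRun_one, Event.turnBack, e, e1, e2, e3, h1, h2]
    · simp [turnRun_three, turnRun_two, turnRun_one, Event.turnBack, e1, e2, e3, h1]
  | death_cut n =>
    have e (x : ℤ) : rotL (n + 1) (rotL (n + 1) (ins 0 x t)) = ins n x t := by
      ext j
      simp only [rotL, ins]
      split_ifs <;> first | rfl | (exfalso; omega)
    have e1 (x : ℤ) : ins 0 x t 0 = x := ins_self _ _ _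
    have e2 (x : ℤ) : rotL (n + 1) (ins 0 x t) 0 = -x := by simp [rotL, ins]
    simp [turnRun_three, turnRun_two, turnRun_one, Event.turnBack, e, e1, e2]

theorem Move.run_eq {m n : ℕ} {P Q : Word m n} (h : Move P Q) {t : ℕ → ℤ} (ht : IsLabel n t) :
    P.run t = Q.run t := by
  rw [← P.map_turnRun, h.turnRun_eq ht, Q.map_turnRun]

/-! ### The state sum of a configuration -/

/-- The total winding numbers of all orientations of a configuration, with multiplicity. -/
def Config.windings (C : Config) : Multiset (ℤ × ℤ) :=
  (labels C.base).bind fun t =>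
    ((C.word.run t).filter fun p => p.1 = t).map fun p => (total C.base t, p.2)

theorem windings_congr {m n : ℕ} {P Q : Word m n} (X : Word n m)
    (h : ∀ t, IsLabel n t → P.run t = Q.run t) :
    (close P X).windings = (close Q X).windings := by
  refine Multiset.bind_congr fun t ht => ?_
  have ht := mem_labels.1 ht
  have : (P.comp X).run t = (Q.comp X).run t := by
    rw [Word.run_comp, Word.run_comp]
    exact Multiset.bind_congr fun p hp => by rw [h _ (X.isLabel_run ht hp)]
  show Multiset.map _ (((P.comp X).run t).filter _) = _
  rw [this]
  rfl

theorem windings_move {m n : ℕ} {P Q : Word m n} (h : Move P Q) (X : Word n m) :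
    (close P X).windings = (close Q X).windings :=
  windings_congr X fun _ ht => h.run_eq ht

theorem bind_eq_bind_labels {α β : Type*} {n : ℕ} (M : Multiset ((ℕ → ℤ) × β))
    (hM : ∀ p ∈ M, IsLabel n p.1) (f : (ℕ → ℤ) × β → Multiset α) :
    M.bind f = (labels n).bind fun u => (M.filter fun p => p.1 = u).bind f := by
  induction M using Multiset.induction_on with
  | empty => simp
  | cons p M ih =>
    rw [Multiset.cons_bind, ih fun q hq => hM q (Multiset.mem_cons_of_mem hq)]
    have h1 : ∀ u, ((p ::ₘ M).filter fun p => p.1 = u).bind f =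
        (if p.1 = u then f p else 0) + (M.filter fun p => p.1 = u).bind f := by
      intro u
      rw [Multiset.filter_cons]
      split_ifs <;> simp
    simp only [h1, Multiset.bind_add]
    congr 1
    have hp := mem_labels.2 (hM p (Multiset.mem_cons_self _ _))
    obtain ⟨R, hR⟩ := Multiset.exists_cons_of_mem hp
    have hnd := nodup_labels n
    rw [hR] at hnd ⊢
    rw [Multiset.cons_bind, if_pos rfl]
    have : (R.bind fun u => if p.1 = u then f p else 0) = R.bind fun _ => 0 := by
      refine Multiset.bind_congr fun u hu => ?_
      rw [if_neg]
      rintro rfl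
      exact (Multiset.nodup_cons.1 hnd).1 hu
    rw [this, Multiset.bind_zero, add_zero]

theorem windings_close {m n : ℕ} (X : Word m n) (Y : Word n m) : (close X Y).windings =
    (labels m).bind fun t => (labels n).bind fun u =>
      ((Y.run t).filter fun p => p.1 = u).bind fun p =>
        ((X.run u).filter fun q => q.1 = t).map fun q => (total m t, p.2 + q.2) := by
  refine Multiset.bind_congr fun t ht => ?_
  have ht := mem_labels.1 ht
  show Multiset.map _ (((X.comp Y).run t).filter _) = _
  rw [Word.run_comp, Multiset.filter_bind, Multiset.map_bind,
    bind_eq_bind_labels _ (fun p hp => Y.isLabel_run ht hp)]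
  refine Multiset.bind_congr fun u _ => Multiset.bind_congr fun p hp => ?_
  rw [Multiset.mem_filter] at hp
  rw [hp.2, Multiset.filter_map, Multiset.map_map]
  refine Multiset.map_congr rfl fun q _ => ?_
  simp [close, add_comm]

/-- Moving the horizontal cut is cyclicity of a trace: both sides count pairs of labels at the two
places where the diagrams are joined. -/
theorem windings_rotate {m n : ℕ} (X : Word m n) (Y : Word n m) :
    (close X Y).windings = (close Y X).windings := by
  rw [windings_close, windings_close, Multiset.bind_bind]
  refine Multiset.bind_congr fun u hu => Multiset.bind_congr fun t ht => ?_
  simp only [← Multiset.bind_singleton]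
  rw [Multiset.bind_bind]
  refine Multiset.bind_congr fun q hq => Multiset.bind_congr fun p hp => ?_
  rw [Multiset.mem_filter] at hp
  rw [← hp.2, Y.total_run hp.1, add_comm]

/-- A small loop can be oriented in two ways and does not wind. -/
theorem windings_smallLoop {n i : ℕ} (h : i ≤ n) (X : Word n n) :
    (close (two (.birth n i h) (.death n i h)) X).windings =
      (close (.nil n) X).windings + (close (.nil n) X).windings := by
  have e : ∀ t : ℕ → ℤ, (two (.birth n i h) (.death n i h)).run t = {(t, 0)} + {(t, 0)} := by
    intro t
    have e (x : ℤ) : del i (ins i x t) = t := by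
      ext j
      simp only [ins, del]
      split_ifs <;> first | rfl | (exfalso; omega)
    have e1 (x : ℤ) : ins i x t i = x := ins_self _ _ _
    have e2 (x : ℤ) : ins i x t (i + 1) = -x := ins_succ _ _ _
    simp [run_two, Event.back, e, e1, e2]
  simp only [Config.windings, close, Word.run_comp, e]
  simp only [Multiset.map_add, Multiset.bind_add, Multiset.filter_add, Word.run]

theorem windings_mem {C : Config} {v : ℤ × ℤ} : v ∈ C.windings ↔
    ∃ t, IsLabel C.base t ∧ ∃ φ, (t, φ) ∈ C.word.run t ∧ v = (total C.base t, φ) := by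
  simp only [Config.windings, Multiset.mem_bind, mem_labels, Multiset.mem_map, Multiset.mem_filter]
  constructor
  · rintro ⟨t, ht, p, ⟨hp, h1⟩, rfl⟩
    subst h1
    exact ⟨p.1, ht, p.2, hp, rfl⟩
  · rintro ⟨t, ht, φ, h, rfl⟩
    exact ⟨t, ht, (t, φ), ⟨h, rfl⟩, rfl⟩

/-! ### Rotations of the annulus -/

/-- `k` times, the last strand crosses the vertical cut towards the right. -/
def rightPow (n : ℕ) : ℕ → Word (n + 1) (n + 1)
  | 0 => .nil _
  | k + 1 => .cons (.right n) (rightPow n k)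

/-- `k` times, the first strand crosses the vertical cut towards the left. -/
def leftPow (n : ℕ) : ℕ → Word (n + 1) (n + 1)
  | 0 => .nil _
  | k + 1 => .cons (.left n) (leftPow n k)

/-- The flow through the vertical cut in `rightPow n k`. -/
def rotFlux (n k : ℕ) (t : ℕ → ℤ) : ℤ := ∑ j ∈ Finset.range k, t (j % (n + 1))

theorem rotL_apply {n a : ℕ} (h : a ≤ n) (t : ℕ → ℤ) : rotL n t a = t ((a + 1) % (n + 1)) := by
  unfold rotL
  rcases Nat.lt_or_eq_of_le h with h1 | rfl
  · rw [if_pos h1, Nat.mod_eq_of_lt (by omega)]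
  · simp

theorem rotL_iterate {n a : ℕ} (k : ℕ) (h : a ≤ n) (t : ℕ → ℤ) :
    (rotL n)^[k] t a = t ((a + k) % (n + 1)) := by
  induction k generalizing a with
  | zero => simp [Nat.mod_eq_of_lt (Nat.lt_succ_of_le h)]
  | succ k ih =>
    rw [Function.iterate_succ_apply', rotL_apply h, ih (Nat.le_of_lt_succ (Nat.mod_lt _ n.succ_pos))]
    congr 1
    rw [Nat.mod_add_mod]
    congr 1
    ring

theorem rotL_iterate_of_lt {n a : ℕ} (k : ℕ) (h : n < a) (t : ℕ → ℤ) :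
    (rotL n)^[k] t a = t a := by
  induction k with
  | zero => rfl
  | succ k ih =>
    rw [Function.iterate_succ_apply', rotL, if_neg (by omega), if_neg (by omega), ih]

theorem run_rightPow (n k : ℕ) (t : ℕ → ℤ) :
    (rightPow n k).run t = {((rotL n)^[k] t, rotFlux n k t)} := by
  induction k with
  | zero => simp [rightPow, Word.run, rotFlux]
  | succ k ih =>
    simp only [rightPow, Word.run, ih, Multiset.singleton_bind, Event.back, Multiset.map_singleton,
      Function.iterate_succ_apply', rotL_iterate k (Nat.zero_le n), rotFlux, Finset.sum_range_succ,
      zero_add]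
    rw [add_comm]

theorem run_leftPow (n k : ℕ) (t : ℕ → ℤ) :
    (leftPow n k).run t = {((rotR n)^[k] t, -rotFlux n k ((rotR n)^[k] t))} := by
  induction k with
  | zero => simp [leftPow, Word.run, rotFlux]
  | succ k ih =>
    simp only [leftPow, Word.run, ih, Multiset.singleton_bind, Event.back, Multiset.map_singleton,
      Function.iterate_succ_apply']
    congr 2
    rw [rotFlux, rotFlux, Finset.sum_range_succ', Nat.zero_mod, rotR_zero, neg_add_rev]
    congr 2
    refine Finset.sum_congr rfl fun j _ => ?_
    conv_lhs => rw [← rotL_rotR n ((rotR n)^[k] t)]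
    rw [rotL_apply (Nat.le_of_lt_succ (Nat.mod_lt _ n.succ_pos)), Nat.mod_add_mod]

theorem rotR_iterate_eq {n k : ℕ} {s t : ℕ → ℤ} : (rotR n)^[k] t = s ↔ (rotL n)^[k] s = t := by
  have h1 := Function.LeftInverse.iterate (rotR_rotL n) k
  have h2 := Function.LeftInverse.iterate (rotL_rotR n) k
  constructor
  · rintro rfl; exact h2 t
  · rintro rfl; exact h1 s

theorem rotL_fullTwist (n k : ℕ) (t : ℕ → ℤ) : (rotL n)^[(n + 1) * k] t = t := by
  ext a
  rcases Nat.lt_or_ge n a with h | h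
  · exact rotL_iterate_of_lt _ h t
  · rw [rotL_iterate _ h, Nat.add_mul_mod_self_left, Nat.mod_eq_of_lt (by omega)]

theorem rotFlux_fullTwist (n k : ℕ) (t : ℕ → ℤ) :
    rotFlux n ((n + 1) * k) t = k * total (n + 1) t := by
  induction k with
  | zero => simp [rotFlux]
  | succ k ih =>
    rw [Nat.mul_succ, rotFlux, Finset.sum_range_add, ← rotFlux, ih]
    have : ∑ x ∈ Finset.range (n + 1), t (((n + 1) * k + x) % (n + 1)) = total (n + 1) t := by
      refine Finset.sum_congr rfl fun x hx => ?_
      rw [Nat.mul_add_mod_self_left, Nat.mod_eq_of_lt (Finset.mem_range.1 hx)]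
    rw [this]
    push_cast
    ring

/-- The `k`-fold full twist of `n + 1` strands. -/
def twist (n : ℕ) (k : ℤ) : Word (n + 1) (n + 1) :=
  if 0 ≤ k then rightPow n ((n + 1) * k.toNat) else leftPow n ((n + 1) * (-k).toNat)

theorem run_twist (n : ℕ) (k : ℤ) (t : ℕ → ℤ) :
    (twist n k).run t = {(t, k * total (n + 1) t)} := by
  unfold twist
  split_ifs with h
  · rw [run_rightPow, rotL_fullTwist, rotFlux_fullTwist, Int.toNat_of_nonneg h]
  · have h1 : (rotR n)^[(n + 1) * (-k).toNat] t = t := rotR_iterate_eq.2 (rotL_fullTwist _ _ _)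
    rw [run_leftPow, h1, rotFlux_fullTwist, Int.toNat_of_nonneg (by omega)]
    simp

/-! ### The state sums of straight configurations -/

/-- Extend labels of `g` points periodically to `N` points. -/
def periodic (g N : ℕ) : (ℕ → ℤ) →+ (ℕ → ℤ) where
  toFun u a := if a < N then u (a % g) else 0
  map_zero' := by ext; simp
  map_add' u v := by ext a; simp only [Pi.add_apply]; split_ifs <;> simp

theorem periodic_apply (g N : ℕ) (u : ℕ → ℤ) (a : ℕ) :
    periodic g N u a = if a < N then u (a % g) else 0 := rfl

theorem rotL_periodic {n k g : ℕ} (h1 : g ∣ n + 1) (h2 : g ∣ k) (u : ℕ → ℤ) :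
    (rotL n)^[k] (periodic g (n + 1) u) = periodic g (n + 1) u := by
  ext a
  rcases Nat.lt_or_ge n a with h | h
  · rw [rotL_iterate_of_lt _ h]
  · rw [rotL_iterate _ h, periodic_apply, periodic_apply, if_pos (Nat.mod_lt _ n.succ_pos),
      if_pos (by omega), Nat.mod_mod_of_dvd _ h1, Nat.add_mod, Nat.mod_eq_zero_of_dvd h2]
    simp

/-- A label that is invariant under a shift by `k` has period `gcd (n + 1, k)`. -/
theorem eq_periodic {n k : ℕ} {t : ℕ → ℤ} (ht : IsLabel (n + 1) t) (h : (rotL n)^[k] t = t) :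
    ∃ u, IsLabel ((n + 1).gcd k) u ∧ periodic ((n + 1).gcd k) (n + 1) u = t := by
  set g := (n + 1).gcd k with hg
  have hg0 : 0 < g := Nat.gcd_pos_of_pos_left _ n.succ_pos
  have hgN : g ∣ n + 1 := Nat.gcd_dvd_left _ _
  have h1 : ∀ j : ℕ, ∀ a ≤ n, t ((a + j * k) % (n + 1)) = t a := by
    intro j a ha
    induction j with
    | zero => simp [Nat.mod_eq_of_lt (Nat.lt_succ_of_le ha)]
    | succ j ih =>
      rw [← ih]
      conv_rhs => rw [← h]
      rw [rotL_iterate _ (Nat.le_of_lt_succ (Nat.mod_lt _ n.succ_pos)), Nat.mod_add_mod]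
      congr 2
      ring
  -- some multiple of `k` is congruent to `g` modulo `n + 1`
  obtain ⟨j, hj⟩ : ∃ j : ℕ, j * k ≡ g [MOD n + 1] := by
    have hb := Nat.gcd_eq_gcd_ab (n + 1) k
    refine ⟨((Nat.gcdB (n + 1) k) % ((n + 1 : ℕ) : ℤ)).toNat, ?_⟩
    rw [← Int.natCast_modEq_iff]
    push_cast
    rw [Int.toNat_of_nonneg (Int.emod_nonneg _ (by omega)), hg, hb]
    push_cast
    calc (Nat.gcdB (n + 1) k) % ((n : ℤ) + 1) * (k : ℤ)
        ≡ (Nat.gcdB (n + 1) k) * k [ZMOD (n : ℤ) + 1] := (Int.mod_modEq _ _).mul_right _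
      _ ≡ ((n : ℤ) + 1) * (Nat.gcdA (n + 1) k) + k * (Nat.gcdB (n + 1) k) [ZMOD (n : ℤ) + 1] := by
          rw [Int.modEq_iff_dvd]
          exact ⟨Nat.gcdA (n + 1) k, by ring⟩
  have h2 : ∀ a ≤ n, t ((a + g) % (n + 1)) = t a := by
    intro a ha
    rw [← h1 j a ha]
    congr 1
    exact (Nat.ModEq.add_left a hj).symm
  have h3 : ∀ a ≤ n, t (a % g) = t a := by
    intro a
    induction a using Nat.strong_induction_on with
    | _ a ih =>
      intro ha
      rcases Nat.lt_or_ge a g with h | h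
      · rw [Nat.mod_eq_of_lt h]
      · have := h2 (a - g) (by omega)
        rw [Nat.sub_add_cancel h, Nat.mod_eq_of_lt (by omega)] at this
        rw [this, ← ih (a - g) (by omega) (by omega)]
        rw [Nat.mod_eq_sub_mod h]
  have hle : g ≤ n + 1 := Nat.le_of_dvd n.succ_pos hgN
  refine ⟨fun a => if a < g then t a else 0, ⟨fun a ha => ?_, fun a ha => ?_⟩, ?_⟩
  · simp only [if_pos ha]; exact ht.1 a (by omega)
  · simp [Nat.not_lt.2 ha]
  · ext a
    rw [periodic_apply]
    split_ifs with h4 h5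
    · exact h3 a (by omega)
    · exact absurd (Nat.mod_lt a hg0) h5
    · exact (ht.2 a (by omega)).symm

theorem isLabel_periodic {g N : ℕ} (hg : 0 < g) {u : ℕ → ℤ} (hu : IsLabel g u) :
    IsLabel N (periodic g N u) := by
  refine ⟨fun a ha => ?_, fun a ha => ?_⟩
  · rw [periodic_apply, if_pos ha]; exact hu.1 _ (Nat.mod_lt _ hg)
  · rw [periodic_apply, if_neg (by omega)]

theorem filter_labels_rotL (n k : ℕ) : ((labels (n + 1)).filter fun t => (rotL n)^[k] t = t) =
    (labels ((n + 1).gcd k)).map (periodic ((n + 1).gcd k) (n + 1)) := by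
  set g := (n + 1).gcd k with hg
  have hg0 : 0 < g := Nat.gcd_pos_of_pos_left _ n.succ_pos
  have hgN : g ∣ n + 1 := Nat.gcd_dvd_left _ _
  have hle : g ≤ n + 1 := Nat.le_of_dvd n.succ_pos hgN
  refine ((nodup_labels _).filter _).ext ((nodup_labels _).map_on ?_) |>.2 fun t => ?_
  · intro u hu v hv h
    rw [mem_labels] at hu hv
    ext a
    rcases Nat.lt_or_ge a g with h1 | h1
    · have := congrFun h a
      rwa [periodic_apply, periodic_apply, if_pos (by omega), if_pos (by omega),
        Nat.mod_eq_of_lt h1] at this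
    · rw [hu.2 a h1, hv.2 a h1]
  · simp only [Multiset.mem_filter, Multiset.mem_map, mem_labels]
    constructor
    · rintro ⟨h1, h2⟩
      exact eq_periodic h1 h2
    · rintro ⟨u, hu, rfl⟩
      exact ⟨isLabel_periodic hg0 hu, rotL_periodic hgN (Nat.gcd_dvd_right _ _) u⟩

theorem total_periodic_single {g r : ℕ} (q : ℕ) (hr : r < g) :
    total (g * q) (periodic g (g * q) (Pi.single r 1)) = q := by
  have : total (g * q) (periodic g (g * q) (Pi.single r 1)) =
      total (g * q) (fun a => (Pi.single r 1 : ℕ → ℤ) (a % g)) :=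
    total_congr fun a ha => by rw [periodic_apply, if_pos ha]
  rw [this]
  clear this
  induction q with
  | zero => simp [total]
  | succ q ih =>
    rw [Nat.mul_succ, total, Finset.sum_range_add, ← total, ih, Finset.sum_eq_single r]
    · simp [Nat.mod_eq_of_lt hr]
    · intro b hb hne
      rw [Nat.mul_add_mod_self_left, Nat.mod_eq_of_lt (Finset.mem_range.1 hb)]
      simp [hne]
    · intro h; exact absurd (Finset.mem_range.2 hr) h

theorem rotFlux_of_fixed {n k : ℕ} {t : ℕ → ℤ} (h : (rotL n)^[k] t = t) :
    rotFlux n k t * (n + 1) = k * total (n + 1) t := by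
  have h1 : (rotL n)^[k] (fun _ => 1) = fun _ => (1 : ℤ) := by
    ext a
    rcases Nat.lt_or_ge n a with h | h
    · rw [rotL_iterate_of_lt _ h]
    · rw [rotL_iterate _ h]
  have := (rightPow n k).cross_run (t := t) (t' := fun _ => 1)
    (p := (t, rotFlux n k t)) (p' := (fun _ => 1, rotFlux n k fun _ => 1))
    (by rw [run_rightPow, h]; simp) (by rw [run_rightPow, h1]; simp)
  simp [rotFlux, total] at this
  simp only [rotFlux, total]
  linarith

/-- Winding numbers and flow through the cut, as an additive function of the labels. -/
def flow (n k : ℕ) : (ℕ → ℤ) →+ ℤ × ℤ where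
  toFun t := (total (n + 1) t, rotFlux n k t)
  map_zero' := by simp [total, rotFlux]
  map_add' u v := by simp [total, rotFlux, Finset.sum_add_distrib]

theorem flow_apply (n k : ℕ) (t : ℕ → ℤ) : flow n k t = (total (n + 1) t, rotFlux n k t) := rfl

/-- The winding numbers of one strand of `n + 1` straight strands that are shifted by `k`. -/
def slope (n k : ℕ) : ℤ × ℤ := (((n + 1) / (n + 1).gcd k : ℕ), (k / (n + 1).gcd k : ℕ))

theorem flow_periodic_single {n k r : ℕ} (hr : r < (n + 1).gcd k) :
    flow n k (periodic ((n + 1).gcd k) (n + 1) (Pi.single r 1)) =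
      slope n k := by
  set g := (n + 1).gcd k with hg
  have hg0 : 0 < g := Nat.gcd_pos_of_pos_left _ n.succ_pos
  obtain ⟨q, hq⟩ : g ∣ n + 1 := Nat.gcd_dvd_left _ _
  obtain ⟨c, hc⟩ : g ∣ k := Nat.gcd_dvd_right _ _
  have h1 : total (n + 1) (periodic g (n + 1) (Pi.single r 1)) = q := by
    rw [hq]; exact total_periodic_single q hr
  have h2 := rotFlux_of_fixed (n := n) (k := k)
    (rotL_periodic ⟨q, hq⟩ ⟨c, hc⟩ (Pi.single r 1))
  rw [h1] at h2
  have h3 : rotFlux n k (periodic g (n + 1) (Pi.single r 1)) = c := by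
    have h4 : ((n : ℤ) + 1) = g * q := by exact_mod_cast hq
    have h5 : (k : ℤ) = g * c := by exact_mod_cast hc
    have h6 : ((n : ℤ) + 1) ≠ 0 := by omega
    apply mul_right_cancel₀ h6
    rw [h2, h4, h5]
    ring
  show (_, _) = _
  rw [h1, h3]
  have e1 : (n + 1) / g = q := by rw [hq]; exact Nat.mul_div_cancel_left _ hg0
  have e2 : k / g = c := by rw [hc]; exact Nat.mul_div_cancel_left _ hg0
  rw [slope, e1, e2]

theorem map_flow_labels (n k : ℕ) :
    ((labels (n + 1)).filter fun t => (rotL n)^[k] t = t).map (flow n k) =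
      signSums (Multiset.replicate ((n + 1).gcd k)
        (slope n k)) := by
  rw [filter_labels_rotL, labels, ← signSums_map, ← signSums_map]
  congr 1
  rw [Multiset.map_map, Multiset.map_map]
  rw [Multiset.map_congr rfl (g := fun _ =>
    (slope n k))]
  · simp
  · intro r hr
    exact flow_periodic_single (Multiset.mem_range.1 hr)

theorem bind_ite_singleton {α β : Type*} (M : Multiset α) (P : α → Prop) (f : α → β) :
    (M.bind fun a => if P a then {f a} else 0) = (M.filter P).map f := by
  induction M using Multiset.induction_on with
  | empty => simp
  | cons a M ih =>
    rw [Multiset.cons_bind, ih, Multiset.filter_cons]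
    split_ifs <;> simp

/-- A shift by `k` of `n + 1` straight strands has `gcd (n + 1, k)` loops, all with the same winding
numbers. -/
theorem windings_rightPow (n k : ℕ) : (Config.mk (n + 1) (rightPow n k)).windings =
    signSums (Multiset.replicate ((n + 1).gcd k)
      (slope n k)) := by
  rw [← map_flow_labels, ← bind_ite_singleton]
  refine Multiset.bind_congr fun t _ => ?_
  rw [run_rightPow, Multiset.filter_singleton]
  split_ifs <;> simp [flow_apply]

theorem windings_leftPow (n k : ℕ) : (Config.mk (n + 1) (leftPow n k)).windings =
    signSums (Multiset.replicate ((n + 1).gcd k)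
      ((slope n k).1, -(slope n k).2)) := by
  have e : ((slope n k).1, -(slope n k).2) =
    (AddMonoidHom.prodMap (AddMonoidHom.id ℤ) (-AddMonoidHom.id ℤ))
      (slope n k) := rfl
  rw [e, ← Multiset.map_replicate, signSums_map, ← map_flow_labels, ← bind_ite_singleton,
    Multiset.map_bind]
  refine Multiset.bind_congr fun t _ => ?_
  rw [run_leftPow, Multiset.filter_singleton]
  simp only [rotR_iterate_eq]
  split_ifs with h
  · have : (rotR n)^[k] t = t := rotR_iterate_eq.2 h
    simp [flow_apply, this]
  · simp

/-- A single strand that winds once around the annulus. -/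
def hLoop : Word 0 0 := three (.birth 0 0 le_rfl) (.right 1) (.death 0 0 le_rfl)

/-- `k` parallel horizontal loops. -/
def hPow : ℕ → Word 0 0
  | 0 => .nil 0
  | k + 1 => hLoop.comp (hPow k)

theorem run_hLoop (t : ℕ → ℤ) : hLoop.run t = {(t, 1), (t, -1)} := by
  have e (x : ℤ) : del 0 (rotL 1 (ins 0 x t)) = t := by
    ext j
    simp only [ins, del, rotL]
    split_ifs <;> first | rfl | (exfalso; omega)
  have e1 (x : ℤ) : ins 0 x t 0 = x := ins_self _ _ _
  have e2 (x : ℤ) : rotL 1 (ins 0 x t) 0 = -x := by simp [rotL, ins]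
  have e3 (x : ℤ) : rotL 1 (ins 0 x t) 1 = x := by simp [rotL, ins]
  simp [hLoop, run_three, run_two, Event.back, e, e1, e2, e3]

theorem run_hPow (k : ℕ) (t : ℕ → ℤ) :
    (hPow k).run t = (signSums (Multiset.replicate k (1 : ℤ))).map fun φ => (t, φ) := by
  induction k with
  | zero => simp [hPow, Word.run]
  | succ k ih =>
    rw [hPow, Word.run_comp, ih, Multiset.replicate_succ, signSums_cons, Multiset.bind_map]
    simp only [run_hLoop, Multiset.insert_eq_cons, Multiset.map_cons, Multiset.map_singleton]
    rw [Multiset.map_add, Multiset.map_map, Multiset.map_map, ← Multiset.bind_singleton,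
      ← Multiset.bind_singleton, ← Multiset.bind_add]
    rfl

theorem windings_hPow (k : ℕ) :
    (Config.mk 0 (hPow k)).windings = signSums (Multiset.replicate k ((0, 1) : ℤ × ℤ)) := by
  have e : ((0, 1) : ℤ × ℤ) = AddMonoidHom.inr ℤ ℤ 1 := rfl
  rw [e, ← Multiset.map_replicate, signSums_map]
  simp [Config.windings, labels, run_hPow, Multiset.map_map, total, Multiset.filter_map]
  rfl

/-! ### Sign sums of parallel vectors -/

/-- `g` copies of `u` and `k` copies of `0`. -/
def straight (u : ℤ × ℤ) (g k : ℕ) : Multiset (ℤ × ℤ) :=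
  Multiset.replicate g u + Multiset.replicate k 0

/-- A primitive vector of the lattice. -/
def Primitive (u : ℤ × ℤ) : Prop := IsCoprime u.1 u.2

theorem Primitive.ne_zero {u : ℤ × ℤ} (h : Primitive u) : u ≠ 0 := by
  rintro rfl
  exact not_isCoprime_zero_zero h

theorem Primitive.smul_injective {u : ℤ × ℤ} (h : Primitive u) :
    Function.Injective fun j : ℤ => j • u := fun _ _ hij => smul_left_injective ℤ h.ne_zero hij

theorem le_sum_of_mem_signSums {Λ : Multiset ℤ} (h : ∀ a ∈ Λ, 0 ≤ a) {x : ℤ}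
    (hx : x ∈ signSums Λ) : x ≤ Λ.sum := by
  induction Λ using Multiset.induction_on generalizing x with
  | empty => simp at hx; simp [hx]
  | cons a Λ ih =>
    have ha := h a (Multiset.mem_cons_self _ _)
    rw [signSums_cons, Multiset.mem_add, Multiset.mem_map, Multiset.mem_map] at hx
    rw [Multiset.sum_cons]
    rcases hx with ⟨y, hy, rfl⟩ | ⟨y, hy, rfl⟩ <;>
    · have := ih (fun b hb => h b (Multiset.mem_cons_of_mem hb)) hy
      omega

/-- The largest of the sums with signs occurs once for each choice of signs of the zeros. -/
theorem count_sum_signSums {Λ : Multiset ℤ} (h : ∀ a ∈ Λ, 0 ≤ a) :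
    (signSums Λ).count Λ.sum = 2 ^ Λ.count 0 := by
  induction Λ using Multiset.induction_on with
  | empty => simp
  | cons a Λ ih =>
    have hΛ : ∀ b ∈ Λ, 0 ≤ b := fun b hb => h b (Multiset.mem_cons_of_mem hb)
    rw [signSums_cons, Multiset.count_add, Multiset.sum_cons,
      Multiset.count_map_eq_count' _ _ (add_right_injective a), ih hΛ]
    rcases (h a (Multiset.mem_cons_self _ _)).eq_or_lt with rfl | ha
    · rw [neg_zero, Multiset.count_map_eq_count' _ _ (add_right_injective 0), ih hΛ,
        Multiset.count_cons_self, pow_succ]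
      ring
    · rw [Multiset.count_cons_of_ne ha.ne,
        Multiset.count_eq_zero_of_notMem (a := a + Λ.sum), add_zero]
      intro hmem
      obtain ⟨y, hy, he⟩ := Multiset.mem_map.1 hmem
      have := le_sum_of_mem_signSums hΛ hy
      omega

theorem signSums_map_abs (Λ : Multiset ℤ) : signSums (Λ.map fun a => |a|) = signSums Λ := by
  induction Λ using Multiset.induction_on with
  | empty => simp
  | cons a Λ ih =>
    rw [Multiset.map_cons, signSums_cons_congr _ ih]
    rcases abs_choice a with h | h <;> rw [h]
    exact signSums_neg_cons _ _

/-- The sign sums determine a family of `0` and `±1` up to signs. The largest sum is the sum of the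
absolute values, and its multiplicity is `2` to the number of zeros; the remaining absolute values
are positive and have average `1`. -/
theorem abs_eq_of_signSums_eq {Λ : Multiset ℤ} {g k : ℕ}
    (h : signSums Λ = signSums (Multiset.replicate g 1 + Multiset.replicate k 0)) :
    Λ.map (fun a => |a|) = Multiset.replicate g 1 + Multiset.replicate k 0 := by
  set N := Λ.map fun a => |a| with hN
  set R : Multiset ℤ := Multiset.replicate g 1 + Multiset.replicate k 0 with hR
  have h1 : signSums N = signSums R := by rw [hN, signSums_map_abs, h]
  have hN0 : ∀ a ∈ N, 0 ≤ a := by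
    intro a ha
    obtain ⟨b, _, rfl⟩ := Multiset.mem_map.1 ha
    exact abs_nonneg b
  have hR0 : ∀ a ∈ R, 0 ≤ a := by
    intro a ha
    rcases Multiset.mem_add.1 ha with ha | ha <;> rw [Multiset.eq_of_mem_replicate ha]
    exact zero_le_one
  have hsum : N.sum = R.sum := by
    apply le_antisymm
    · exact le_sum_of_mem_signSums hR0 (h1 ▸ sum_mem_signSums N)
    · exact le_sum_of_mem_signSums hN0 (h1 ▸ sum_mem_signSums R)
  have hcount : N.count 0 = R.count 0 := by
    have := count_sum_signSums hN0
    rw [h1, hsum, count_sum_signSums hR0] at this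
    exact (Nat.pow_right_injective le_rfl this).symm
  have hcard : N.card = R.card := by
    have := congrArg Multiset.card h1
    rw [card_signSums, card_signSums] at this
    exact Nat.pow_right_injective le_rfl this
  have hRs : R.sum = g := by simp [hR]
  have hRk : R.count 0 = k := by simp [hR, Multiset.count_replicate]
  have hRc : R.card = g + k := by simp [hR]
  have hsplit : N = N.filter (0 ≠ ·) + Multiset.replicate k 0 := by
    conv_lhs => rw [← Multiset.filter_add_not (0 ≠ ·) N]
    congr 1
    simp only [ne_eq, not_not]
    rw [← hRk, ← hcount, Multiset.filter_eq]
  have hcard' : (N.filter (0 ≠ ·)).card = g := by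
    have := congrArg Multiset.card hsplit
    rw [Multiset.card_add, Multiset.card_replicate] at this
    omega
  have hsum' : (N.filter (0 ≠ ·)).sum = g := by
    have := congrArg Multiset.sum hsplit
    simp only [Multiset.sum_add, Multiset.sum_replicate, smul_zero, add_zero] at this
    rw [← this, hsum, hRs]
  have key : ∀ M : Multiset ℤ, (∀ a ∈ M, 1 ≤ a) → (M.card : ℤ) ≤ M.sum ∧
      (M.sum = M.card → ∀ a ∈ M, a = 1) := by
    intro M
    induction M using Multiset.induction_on with
    | empty => simp
    | cons a M ih =>
      intro hM
      have ha := hM a (Multiset.mem_cons_self _ _)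
      obtain ⟨i1, i2⟩ := ih fun b hb => hM b (Multiset.mem_cons_of_mem hb)
      rw [Multiset.sum_cons, Multiset.card_cons]
      push_cast
      refine ⟨by omega, fun he b hb => ?_⟩
      rcases Multiset.mem_cons.1 hb with rfl | hb
      · omega
      · exact i2 (by omega) b hb
  have hall : ∀ a ∈ N.filter (0 ≠ ·), a = 1 := by
    refine (key _ fun a ha => ?_).2 (by rw [hsum', hcard'])
    have h2 := hN0 a (Multiset.mem_of_mem_filter ha)
    have h3 := (Multiset.mem_filter.1 ha).2
    omega
  rw [hsplit, Multiset.eq_replicate.2 ⟨hcard', hall⟩]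

theorem mem_signSums_straight {u x : ℤ × ℤ} {g k : ℕ} (h : x ∈ signSums (straight u g k)) :
    ∃ j : ℤ, x = j • u := by
  obtain ⟨S, hS, rfl⟩ := Multiset.mem_map.1 h
  have hS := Multiset.mem_powerset.1 hS
  have key : ∀ M : Multiset (ℤ × ℤ), (∀ a ∈ M, a = u ∨ a = 0) → ∃ j : ℤ, M.sum = j • u := by
    intro M
    induction M using Multiset.induction_on with
    | empty => exact fun _ => ⟨0, by simp⟩
    | cons a M ih =>
      intro hM
      obtain ⟨j, hj⟩ := ih fun b hb => hM b (Multiset.mem_cons_of_mem hb)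
      rw [Multiset.sum_cons, hj]
      rcases hM a (Multiset.mem_cons_self _ _) with rfl | rfl
      · exact ⟨1 + j, by rw [add_smul, one_smul]⟩
      · exact ⟨j, by rw [zero_add]⟩
  have hL : ∀ a ∈ straight u g k, a = u ∨ a = 0 := by
    intro a ha
    rcases Multiset.mem_add.1 ha with ha | ha
    · exact Or.inl (Multiset.eq_of_mem_replicate ha)
    · exact Or.inr (Multiset.eq_of_mem_replicate ha)
  obtain ⟨i, hi⟩ := key S fun a ha => hL a (Multiset.mem_of_le hS ha)
  obtain ⟨j, hj⟩ := key _ hL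
  exact ⟨2 * i - j, by rw [hi, hj, sub_smul, mul_smul]; norm_cast⟩

theorem straight_eq_map (u : ℤ × ℤ) (g k : ℕ) : straight u g k =
    (Multiset.replicate g (1 : ℤ) + Multiset.replicate k 0).map fun j => j • u := by
  simp [straight, Multiset.map_replicate]

/-- The sign sums of a family of lattice vectors that agree with those of `g` copies of a primitive
vector and `k` zeros determine the family up to signs. -/
theorem exists_coeff_of_signSums_eq {L : Multiset (ℤ × ℤ)} {u : ℤ × ℤ} (hu : Primitive u) {g k : ℕ}
    (h : signSums L = signSums (straight u g k)) :
    ∃ Λ : Multiset ℤ, L = Λ.map (fun j => j • u) ∧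
      Λ.map (fun a => |a|) = Multiset.replicate g 1 + Multiset.replicate k 0 := by
  have h1 : ∀ w ∈ L, ∃ j : ℤ, j • u = w := by
    intro w hw
    obtain ⟨L', rfl⟩ := Multiset.exists_cons_of_mem hw
    obtain ⟨x, hx⟩ := exists_mem_signSums L'
    rw [signSums_cons] at h
    obtain ⟨i, hi⟩ := mem_signSums_straight
      (h ▸ Multiset.mem_add.2 (Or.inl (Multiset.mem_map_of_mem _ hx)))
    obtain ⟨j, hj⟩ := mem_signSums_straight
      (h ▸ Multiset.mem_add.2 (Or.inr (Multiset.mem_map_of_mem _ hx)))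
    have e1 : 2 * w.1 = (i - j) * u.1 := by
      have a1 := congrArg Prod.fst hi
      have a2 := congrArg Prod.fst hj
      simp at a1 a2
      linarith
    have e2 : 2 * w.2 = (i - j) * u.2 := by
      have a1 := congrArg Prod.snd hi
      have a2 := congrArg Prod.snd hj
      simp at a1 a2
      linarith
    obtain ⟨a, b, hab⟩ := hu
    have e3 : i - j = 2 * (a * w.1 + b * w.2) := by
      linear_combination (-(i - j)) * hab - a * e1 - b * e2
    refine ⟨a * w.1 + b * w.2, ?_⟩
    rw [e3] at e1 e2
    ext
    · simp only [Prod.smul_fst, smul_eq_mul]; linarith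
    · simp only [Prod.smul_snd, smul_eq_mul]; linarith
  choose! c hc using h1
  refine ⟨L.map c, ?_, ?_⟩
  · rw [Multiset.map_map]
    conv_lhs => rw [← Multiset.map_id L]
    exact Multiset.map_congr rfl fun w hw => (hc w hw).symm
  · apply abs_eq_of_signSums_eq
    apply Multiset.map_injective hu.smul_injective
    have e : (fun j : ℤ => j • u) = ((smulAddHom ℤ (ℤ × ℤ)).flip u : ℤ → ℤ × ℤ) := rfl
    simp only [e]
    rw [← signSums_map, ← signSums_map, ← e, ← straight_eq_map, ← h, Multiset.map_map]
    congr 1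
    conv_rhs => rw [← Multiset.map_id L]
    exact Multiset.map_congr rfl fun w hw => hc w hw

theorem mem_signSums_map {ι G : Type*} [AddCommGroup G] (s : Finset ι) (f : ι → G) {x : G} :
    x ∈ signSums (s.val.map f) ↔
      ∃ ε : ι → ℤ, (∀ i, ε i = 1 ∨ ε i = -1) ∧ x = ∑ i ∈ s, ε i • f i := by
  induction s using Finset.induction_on generalizing x with
  | empty =>
    simp only [Finset.empty_val, Multiset.map_zero, signSums_zero, Multiset.mem_singleton,
      Finset.sum_empty]
    exact ⟨fun h => ⟨fun _ => 1, fun _ => Or.inl rfl, h⟩, fun ⟨_, _, h⟩ => h⟩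
  | insert i s hi ih =>
    rw [Finset.insert_val_of_notMem hi, Multiset.map_cons, signSums_cons, Multiset.mem_add,
      Multiset.mem_map, Multiset.mem_map]
    have aux : ∀ (ε : ι → ℤ) (c : ℤ), ∑ j ∈ insert i s, Function.update ε i c j • f j =
        c • f i + ∑ j ∈ s, ε j • f j := by
      intro ε c
      rw [Finset.sum_insert hi, Function.update_self]
      congr 1
      refine Finset.sum_congr rfl fun j hj => ?_
      rw [Function.update_of_ne]
      rintro rfl
      exact hi hj
    constructor
    · rintro (⟨y, hy, rfl⟩ | ⟨y, hy, rfl⟩)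
      · obtain ⟨ε, h1, rfl⟩ := ih.1 hy
        refine ⟨Function.update ε i 1, fun j => ?_, by rw [aux, one_smul]⟩
        rcases eq_or_ne j i with rfl | hne
        · simp
        · simpa [hne] using h1 j
      · obtain ⟨ε, h1, rfl⟩ := ih.1 hy
        refine ⟨Function.update ε i (-1), fun j => ?_, by rw [aux, neg_smul, one_smul]⟩
        rcases eq_or_ne j i with rfl | hne
        · simp
        · simpa [hne] using h1 j
    · rintro ⟨ε, h1, rfl⟩
      rw [Finset.sum_insert hi]
      rcases h1 i with h | h
      · exact Or.inl ⟨_, ih.2 ⟨ε, h1, rfl⟩, by rw [h, one_smul]⟩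
      · exact Or.inr ⟨_, ih.2 ⟨ε, h1, rfl⟩, by rw [h, neg_smul, one_smul]⟩

theorem nodup_signSums_map {ι G : Type*} [AddCommGroup G] (s : Finset ι) (f : ι → G)
    (φ : ι → G →+ ℤ) (h : ∀ i ∈ s, φ i (f i) ≠ 0) (h' : ∀ i ∈ s, ∀ j ∈ s, i ≠ j → φ i (f j) = 0) :
    (signSums (s.val.map f)).Nodup := by
  induction s using Finset.induction_on with
  | empty => simp
  | insert i s hi ih =>
    have ih := ih (fun j hj => h j (Finset.mem_insert_of_mem hj))
      fun j hj l hl => h' j (Finset.mem_insert_of_mem hj) l (Finset.mem_insert_of_mem hl)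
    rw [Finset.insert_val_of_notMem hi, Multiset.map_cons, signSums_cons, Multiset.nodup_add]
    refine ⟨ih.map (add_right_injective _), ih.map (add_right_injective _), ?_⟩
    rw [Multiset.disjoint_left]
    intro u h1 h2
    obtain ⟨v, hv, rfl⟩ := Multiset.mem_map.1 h1
    obtain ⟨v', hv', he⟩ := Multiset.mem_map.1 h2
    have key : ∀ v ∈ signSums (s.val.map f), φ i v = 0 := by
      intro v hv
      obtain ⟨ε, _, rfl⟩ := (mem_signSums_map s f).1 hv
      rw [map_sum]
      refine Finset.sum_eq_zero fun j hj => ?_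
      rw [map_zsmul, h' i (Finset.mem_insert_self _ _) j (Finset.mem_insert_of_mem hj), smul_zero]
      rintro rfl
      exact hi hj
    have := congrArg (φ i) he
    simp only [map_add, map_neg, key v hv, key v' hv'] at this
    exact h i (Finset.mem_insert_self _ _) (by omega)

/-! ### Orientations of a configuration -/

/-- Put the labels `s` below all labels in `f`. -/
def consLabels (s : ℕ → ℤ) (f : ℕ → ℕ → ℤ) : ℕ → ℕ → ℤ
  | 0 => s
  | l + 1 => f l

/-- All orientations of a diagram with given labels at the top. -/
def Word.paths : {m n : ℕ} → Word m n → (ℕ → ℤ) → Multiset (ℕ → ℕ → ℤ)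
  | _, _, .nil _, t => {fun l => if l = 0 then t else 0}
  | _, _, .cons e w, t => (w.paths t).bind fun f =>
      (e.back (f 0)).map fun p => consLabels p.1 f

theorem Event.flux_back {m n : ℕ} (e : Event m n) {u : ℕ → ℤ} {p : (ℕ → ℤ) × ℤ}
    (hp : p ∈ e.back u) : p.2 = e.flux p.1 := by
  cases e with
  | birth n i h =>
    simp only [Event.back] at hp
    split_ifs at hp with h1
    · rw [Multiset.mem_singleton] at hp
      subst hp
      rfl
    · simp at hp
  | death n i h =>
    simp only [Event.back, Multiset.insert_eq_cons, Multiset.mem_cons,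
      Multiset.mem_singleton] at hp
    rcases hp with rfl | rfl <;> rfl
  | right n =>
    simp only [Event.back, Multiset.mem_singleton] at hp
    subst hp
    simp [Event.flux, rotL_last]
  | left n =>
    simp only [Event.back, Multiset.mem_singleton] at hp
    subst hp
    simp [Event.flux, rotR_zero]

/-- The state sum remembers only the bottom labels and the flow through the vertical cut of every
orientation. -/
theorem run_eq_map_paths {m n : ℕ} (w : Word m n) (t : ℕ → ℤ) :
    w.run t = (w.paths t).map fun f => (f 0, w.flux f) := by
  induction w with
  | nil n => simp [Word.run, Word.paths, Word.flux]
  | cons e w ih =>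
    simp only [Word.run, Word.paths, ih, Multiset.bind_map, Multiset.map_bind, Multiset.map_map]
    refine Multiset.bind_congr fun f _ => Multiset.map_congr rfl fun p hp => ?_
    simp only [Function.comp, Word.flux, consLabels, e.flux_back hp]

/-- The conditions on the labels below and above an event. -/
def Event.Compatible : {m n : ℕ} → Event m n → (ℕ → ℤ) → (ℕ → ℤ) → Prop
  | m, n, e, s, u => (∀ a b, a < m → b < n → e.Through a b → u b = s a) ∧
    match e with
    | .birth _ i _ => u (i + 1) = -u i
    | .death _ i _ => s (i + 1) = -s i
    | .right _ => True
    | .left _ => True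

theorem Event.mem_back {m n : ℕ} (e : Event m n) {s u : ℕ → ℤ} (hs : IsLabel m s)
    (hu : IsLabel n u) : (∃ c, (s, c) ∈ e.back u) ↔ e.Compatible s u := by
  cases e with
  | birth n i h =>
    simp only [Event.back, Event.Compatible, Event.Through]
    constructor
    · rintro ⟨c, hc⟩
      split_ifs at hc with h1
      · rw [Multiset.mem_singleton, Prod.mk.injEq] at hc
        obtain ⟨rfl, rfl⟩ := hc
        refine ⟨?_, by omega⟩
        rintro a b - - (⟨h2, rfl⟩ | ⟨h2, rfl⟩)
        · simp [del, h2]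
        · simp [del, Nat.not_lt.2 h2]
      · simp at hc
    · rintro ⟨h1, h2⟩
      rw [if_pos (by omega)]
      refine ⟨0, ?_⟩
      rw [Multiset.mem_singleton, Prod.mk.injEq]
      refine ⟨?_, rfl⟩
      ext a
      simp only [del]
      split_ifs with h3
      · exact (h1 a a (by omega) (by omega) (Or.inl ⟨h3, rfl⟩)).symm
      · rcases Nat.lt_or_ge a m with h4 | h4
        · exact (h1 a (a + 2) h4 (by omega) (Or.inr ⟨by omega, rfl⟩)).symm
        · rw [hs.2 a h4, hu.2 _ (by omega)]
  | death n i h =>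
    simp only [Event.back, Event.Compatible, Event.Through, Multiset.insert_eq_cons,
      Multiset.mem_cons, Multiset.mem_singleton, Prod.mk.injEq]
    constructor
    · rintro ⟨c, ⟨rfl, rfl⟩ | ⟨rfl, rfl⟩⟩
      all_goals
        refine ⟨?_, by rw [ins_succ, ins_self]⟩
        rintro a b - - (⟨h2, rfl⟩ | ⟨h2, rfl⟩)
        · rw [ins_lt h2]
        · rw [ins_ge h2]
    · rintro ⟨h1, h2⟩
      have key : s = ins i (s i) u := by
        ext a
        simp only [ins]
        split_ifs with h3 h4 h5
        · exact (h1 a a (by omega) (by omega) (Or.inl ⟨h3, rfl⟩)).symm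
        · rw [h4]
        · rw [h5, h2]
        · rcases Nat.lt_or_ge a (n + 2) with h6 | h6
          · exact (h1 a (a - 2) h6 (by omega) (Or.inr ⟨by omega, by omega⟩)).symm
          · rw [hs.2 a h6, hu.2 _ (by omega)]
      rcases hs.1 i (by omega) with h3 | h3
      · exact ⟨0, Or.inl ⟨by rw [← h3]; exact key, rfl⟩⟩
      · exact ⟨0, Or.inr ⟨by rw [← h3]; exact key, rfl⟩⟩
  | right n =>
    simp only [Event.back, Event.Compatible, Event.Through, Multiset.mem_singleton,
      Prod.mk.injEq, and_true]
    constructor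
    · rintro ⟨c, rfl, rfl⟩ a b ha hb (rfl | ⟨rfl, rfl⟩)
      · rw [rotL, if_pos (by omega)]
      · rw [rotL_last]
    · intro h
      refine ⟨u 0, ?_, rfl⟩
      ext a
      simp only [rotL]
      split_ifs with h1 h2
      · exact (h a (a + 1) (by omega) (by omega) (Or.inl rfl)).symm
      · exact (h a 0 (by omega) (by omega) (Or.inr ⟨h2, rfl⟩)).symm
      · rw [hs.2 a (by omega), hu.2 _ (by omega)]
  | left n =>
    simp only [Event.back, Event.Compatible, Event.Through, Multiset.mem_singleton,
      Prod.mk.injEq, and_true]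
    constructor
    · rintro ⟨c, rfl, rfl⟩ a b ha hb (rfl | ⟨rfl, rfl⟩)
      · rw [rotR_succ (by omega)]
      · rw [rotR_zero]
    · intro h
      refine ⟨_, ?_, rfl⟩
      ext a
      simp only [rotR]
      split_ifs with h1 h2
      · exact (h a n (by omega) (by omega) (Or.inr ⟨h1, rfl⟩)).symm
      · exact (h a (a - 1) (by omega) (by omega) (Or.inl (by omega))).symm
      · rw [hs.2 a (by omega), hu.2 _ (by omega)]

theorem Word.width_zero {m n : ℕ} (w : Word m n) : w.width 0 = m := by
  cases w <;> rfl

theorem Word.width_length {m n : ℕ} (w : Word m n) : w.width w.length = n := by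
  induction w with
  | nil n => rfl
  | cons e w ih => exact ih

theorem Word.Has.bounds {m n l a b : ℕ} {w : Word m n} {e : Event a b} (h : w.Has l e) :
    l < w.length ∧ w.width l = a ∧ w.width (l + 1) = b := by
  induction h with
  | head e w => exact ⟨Nat.succ_pos _, rfl, w.width_zero⟩
  | tail e w _ ih => exact ⟨Nat.succ_lt_succ ih.1, ih.2⟩

/-- `f` is an orientation of the diagram, extended by `0`. -/
def Word.Follows {m n : ℕ} (w : Word m n) (f : ℕ → ℕ → ℤ) : Prop :=
  (∀ l ≤ w.length, IsLabel (w.width l) (f l)) ∧ (∀ l, w.length < l → f l = 0) ∧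
    ∀ (l a b : ℕ) (e : Event a b), w.Has l e → e.Compatible (f l) (f (l + 1))

theorem Word.follows_cons {m k n : ℕ} (e : Event m k) (w : Word k n) (f : ℕ → ℕ → ℤ) :
    (Word.cons e w).Follows f ↔
      IsLabel m (f 0) ∧ e.Compatible (f 0) (f 1) ∧ w.Follows fun l => f (l + 1) := by
  constructor
  · rintro ⟨h1, h2, h3⟩
    refine ⟨h1 0 (Nat.zero_le _), h3 0 _ _ e (.head e w), fun l hl => ?_, fun l hl => ?_,
      fun l a b g hg => ?_⟩
    · exact h1 (l + 1) (Nat.succ_le_succ hl)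
    · exact h2 (l + 1) (Nat.succ_lt_succ hl)
    · exact h3 (l + 1) a b g (.tail e w hg)
  · rintro ⟨h1, h2, h3, h4, h5⟩
    refine ⟨fun l hl => ?_, fun l hl => ?_, fun l a b g hg => ?_⟩
    · cases l with
      | zero => exact h1
      | succ l => exact h3 l (Nat.le_of_succ_le_succ hl)
    · cases l with
      | zero => exact absurd hl (Nat.not_lt_zero _)
      | succ l => exact h4 l (Nat.lt_of_succ_lt_succ hl)
    · cases hg with
      | head => exact h2
      | tail _ _ hg => exact h5 _ a b g hg

theorem Word.mem_paths {m n : ℕ} (w : Word m n) {t : ℕ → ℤ} (ht : IsLabel n t)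
    {f : ℕ → ℕ → ℤ} : f ∈ w.paths t ↔ w.Follows f ∧ f w.length = t := by
  induction w generalizing f with
  | nil n =>
    simp only [Word.paths, Multiset.mem_singleton, Word.length]
    constructor
    · rintro rfl
      refine ⟨⟨fun l hl => ?_, fun l hl => ?_, fun l a b e h => by cases h⟩, by simp⟩
      · obtain rfl : l = 0 := Nat.le_zero.1 hl
        simpa [Word.width] using ht
      · simp [Nat.pos_iff_ne_zero.1 hl]
    · rintro ⟨⟨_, h2, _⟩, rfl⟩
      ext1 l
      split_ifs with h
      · rw [h]
      · exact h2 l (Nat.pos_of_ne_zero h)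
  | @cons m k n e w ih =>
    simp only [Word.paths, Multiset.mem_bind, Multiset.mem_map, Word.follows_cons, Word.length]
    constructor
    · rintro ⟨g, hg, p, hp, rfl⟩
      obtain ⟨h1, h2⟩ := (ih ht).1 hg
      have h3 : IsLabel k (g 0) := by simpa [Word.width_zero] using h1.1 0 (Nat.zero_le _)
      have h4 := e.isLabel_back h3 hp
      exact ⟨⟨h4, (e.mem_back h4 h3).1 ⟨p.2, hp⟩, h1⟩, h2⟩
    · rintro ⟨⟨h1, h2, h3⟩, h4⟩
      have h5 : IsLabel k (f 1) := by simpa [Word.width_zero] using h3.1 0 (Nat.zero_le _)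
      obtain ⟨c, hc⟩ := (e.mem_back h1 h5).2 h2
      refine ⟨fun l => f (l + 1), (ih ht).2 ⟨h3, h4⟩, _, hc, ?_⟩
      ext1 l
      cases l <;> rfl

theorem Event.nodup_map_fst_back {m n : ℕ} (e : Event m n) (u : ℕ → ℤ) :
    ((e.back u).map Prod.fst).Nodup := by
  cases e with
  | birth n i h =>
    simp only [Event.back]
    split_ifs <;> simp
  | death n i h =>
    simp only [Event.back, Multiset.insert_eq_cons, Multiset.map_cons, Multiset.map_singleton,
      Multiset.nodup_cons, Multiset.mem_singleton, Multiset.nodup_singleton, and_true]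
    intro h
    have := congrFun h i
    rw [ins_self, ins_self] at this
    omega
  | right n => simp [Event.back]
  | left n => simp [Event.back]

theorem Word.nodup_paths {m n : ℕ} (w : Word m n) (t : ℕ → ℤ) : (w.paths t).Nodup := by
  induction w with
  | nil n => simp [Word.paths]
  | cons e w ih =>
    rw [Word.paths, Multiset.nodup_bind]
    constructor
    · intro f _
      have h := (e.nodup_map_fst_back (f 0)).map (f := fun s => consLabels s f)
        fun s s' h => congrFun h 0
      rwa [Multiset.map_map] at h
    · refine ih.pairwise fun f _ g _ hne => ?_
      rw [Function.onFun, Multiset.disjoint_left]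
      intro x h1 h2
      obtain ⟨p, _, rfl⟩ := Multiset.mem_map.1 h1
      obtain ⟨q, _, h⟩ := Multiset.mem_map.1 h2
      exact hne (funext fun l => (congrFun h (l + 1)).symm)

/-- The loop through a point. -/
def Config.loopOf (C : Config) (p : C.Point) : C.Loop := Quot.mk _ p

theorem Config.exists_loopOf {C : Config} (c : C.Loop) : ∃ p, C.loopOf p = c := Quot.exists_rep c

/-- The labels given by arrows on the points of a configuration, restricted to the loops in `A`. -/
def Config.restrict (C : Config) (o : C.Point → ℤ) (A : Set C.Loop) : ℕ → ℕ → ℤ := fun l a =>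
  if h : l ≤ C.word.length ∧ a < C.word.width l then
    (if C.loopOf ⟨(l, a), h⟩ ∈ A then o ⟨(l, a), h⟩ else 0)
  else 0

theorem Config.restrict_apply {C : Config} (o : C.Point → ℤ) (A : Set C.Loop) (p : C.Point) :
    C.restrict o A p.1.1 p.1.2 = if C.loopOf p ∈ A then o p else 0 :=
  dif_pos p.2

theorem Config.winding_eq (C : Config) (o : C.Point → ℤ) (A : Set C.Loop) :
    C.winding o A = (total C.base (C.restrict o A 0), C.word.flux (C.restrict o A)) := rfl

/-- All orientations of a configuration. -/
def Config.orientations (C : Config) : Multiset (ℕ → ℕ → ℤ) :=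
  (labels C.base).bind fun t => (C.word.paths t).filter fun f => f 0 = t

theorem windings_eq_map (C : Config) : C.windings =
    C.orientations.map fun f => (total C.base (f 0), C.word.flux f) := by
  rw [Config.windings, Config.orientations, Multiset.map_bind]
  refine Multiset.bind_congr fun t _ => ?_
  rw [run_eq_map_paths, Multiset.filter_map, Multiset.map_map]
  refine Multiset.map_congr rfl fun f hf => ?_
  simp only [Function.comp, Multiset.mem_filter] at hf ⊢
  rw [hf.2]

theorem Config.mem_orientations {C : Config} {f : ℕ → ℕ → ℤ} :
    f ∈ C.orientations ↔ C.word.Follows f ∧ f 0 = f C.word.length := by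
  simp only [Config.orientations, Multiset.mem_bind, Multiset.mem_filter, mem_labels]
  constructor
  · rintro ⟨t, ht, h1, h2⟩
    rw [C.word.mem_paths ht] at h1
    exact ⟨h1.1, by rw [h2, h1.2]⟩
  · rintro ⟨h1, h2⟩
    have h3 : IsLabel C.base (f C.word.length) := by
      simpa [Word.width_length] using h1.1 _ le_rfl
    exact ⟨_, h3, (C.word.mem_paths h3).2 ⟨h1, rfl⟩, h2⟩

theorem Config.nodup_orientations (C : Config) : C.orientations.Nodup := by
  rw [Config.orientations, Multiset.nodup_bind]
  refine ⟨fun t _ => (C.word.nodup_paths t).filter _, (nodup_labels _).pairwise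
    fun t _ u _ hne => ?_⟩
  rw [Function.onFun, Multiset.disjoint_left]
  intro f h1 h2
  exact hne ((Multiset.mem_filter.1 h1).2.symm.trans (Multiset.mem_filter.1 h2).2)

theorem Config.restrict_univ_apply {C : Config} (o : C.Point → ℤ) (p : C.Point) :
    C.restrict o Set.univ p.1.1 p.1.2 = o p := by
  rw [Config.restrict_apply, if_pos (Set.mem_univ _)]

theorem Config.restrict_of_not {C : Config} (o : C.Point → ℤ) (A : Set C.Loop) {l a : ℕ}
    (h : ¬ (l ≤ C.word.length ∧ a < C.word.width l)) : C.restrict o A l a = 0 := by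
  rw [Config.restrict, dif_neg h]

theorem Config.IsOrientation.mem {C : Config} {o : C.Point → ℤ} (ho : C.IsOrientation o) :
    C.restrict o Set.univ ∈ C.orientations := by
  obtain ⟨h1, h2, h3⟩ := ho
  rw [Config.mem_orientations]
  refine ⟨⟨fun l hl => ⟨fun a ha => ?_, fun a ha => ?_⟩, fun l hl => ?_, fun l m n e he => ?_⟩, ?_⟩
  · have := Config.restrict_univ_apply o ⟨(l, a), hl, ha⟩
    simp only at this
    rw [this]
    exact h1 _
  · exact Config.restrict_of_not _ _ (by omega)
  · ext a
    exact Config.restrict_of_not _ _ (by omega)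
  · obtain ⟨b1, b2, b3⟩ := he.bounds
    constructor
    · intro a b ha hb hab
      have e1 := Config.restrict_univ_apply o ⟨(l, a), b1.le, by simp only; omega⟩
      have e2 := Config.restrict_univ_apply o ⟨(l + 1, b), b1, by simp only; omega⟩
      simp only at e1 e2
      rw [e1, e2]
      exact h2 _ _ (.event he ha hb hab)
    · cases e with
      | birth n i h =>
        have e1 := Config.restrict_univ_apply o ⟨(l + 1, i), b1, by simp only; omega⟩
        have e2 := Config.restrict_univ_apply o ⟨(l + 1, i + 1), b1, by simp only; omega⟩
        simp only at e1 e2 ⊢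
        rw [e1, e2]
        exact h3 _ _ (.birth he)
      | death n i h =>
        have e1 := Config.restrict_univ_apply o ⟨(l, i), b1.le, by simp only; omega⟩
        have e2 := Config.restrict_univ_apply o ⟨(l, i + 1), b1.le, by simp only; omega⟩
        simp only at e1 e2 ⊢
        rw [e1, e2]
        exact h3 _ _ (.death he)
      | right n => trivial
      | left n => trivial
  · ext a
    rcases Nat.lt_or_ge a C.base with h | h
    · have e1 := Config.restrict_univ_apply o
        ⟨(0, a), Nat.zero_le _, by simp only [Word.width_zero]; exact h⟩
      have e2 := Config.restrict_univ_apply o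
        ⟨(C.word.length, a), le_rfl, by simp only [Word.width_length]; exact h⟩
      simp only at e1 e2
      rw [e1, e2]
      exact h2 _ _ (.cut h)
    · rw [Config.restrict_of_not _ _ (by simp only [Word.width_zero]; omega),
        Config.restrict_of_not _ _ (by simp only [Word.width_length]; omega)]

theorem Config.exists_of_mem_orientations {C : Config} {f : ℕ → ℕ → ℤ} (hf : f ∈ C.orientations) :
    ∃ o, C.IsOrientation o ∧ C.restrict o Set.univ = f := by
  obtain ⟨⟨h1, h2, h3⟩, h4⟩ := Config.mem_orientations.1 hf
  have hs : ∀ x y : ℕ × ℕ, C.Strand x y → f y.1 y.2 = f x.1 x.2 := by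
    intro x y hxy
    cases hxy with
    | event he ha hb hab => exact (h3 _ _ _ _ he).1 _ _ ha hb hab
    | cut ha => exact congrFun h4 _
  have ht : ∀ x y : ℕ × ℕ, C.Turn x y → f y.1 y.2 = -f x.1 x.2 := by
    intro x y hxy
    cases hxy with
    | birth he => exact (h3 _ _ _ _ he).2
    | death he => exact (h3 _ _ _ _ he).2
  refine ⟨fun p => f p.1.1 p.1.2, ⟨fun p => (h1 _ p.2.1).1 _ p.2.2, fun p q hpq => hs _ _ hpq,
    fun p q hpq => ht _ _ hpq⟩, ?_⟩
  ext l a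
  by_cases h : l ≤ C.word.length ∧ a < C.word.width l
  · exact Config.restrict_univ_apply (C := C) (fun p => f p.1.1 p.1.2) ⟨(l, a), h⟩
  · rw [Config.restrict_of_not _ _ h]
    rcases Nat.lt_or_ge C.word.length l with h5 | h5
    · rw [h2 l h5]; rfl
    · exact ((h1 l h5).2 a (by omega)).symm

instance (C : Config) : Finite C.Point := by
  let B := (Finset.range (C.word.length + 1)).sup C.word.width
  have : Function.Injective fun p : C.Point =>
      ((⟨p.1.1, Nat.lt_succ_of_le p.2.1⟩, ⟨p.1.2, p.2.2.trans_le
        (Finset.le_sup (f := C.word.width)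
          (Finset.mem_range.2 (Nat.lt_succ_of_le p.2.1)))⟩) :
          Fin (C.word.length + 1) × Fin B) := by
    rintro ⟨⟨a, b⟩, h⟩ ⟨⟨a', b'⟩, h'⟩ he
    simp only [Prod.mk.injEq, Fin.mk.injEq] at he
    obtain ⟨rfl, rfl⟩ := he
    rfl
  exact Finite.of_injective _ this

instance (C : Config) : Finite C.Loop := Quot.finite _

instance (C : Config) : Fintype C.Loop := Fintype.ofFinite _

theorem Config.restrict_singleton_smul_sum {C : Config} (o : C.Point → ℤ) (ε : C.Loop → ℤ) :
    ∑ c : C.Loop, ε c • C.restrict o {c} =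
      C.restrict (fun p => ε (C.loopOf p) * o p) Set.univ := by
  ext l a
  simp only [Finset.sum_apply, Pi.smul_apply, smul_eq_mul]
  by_cases h : l ≤ C.word.length ∧ a < C.word.width l
  · have e := fun o A => Config.restrict_apply (C := C) o A ⟨(l, a), h⟩
    simp only [] at e
    simp only [e, Set.mem_singleton_iff, Set.mem_univ, if_true]
    rw [Finset.sum_eq_single (C.loopOf ⟨(l, a), h⟩)]
    · rw [if_pos rfl]
    · intro c _ hc
      rw [if_neg (Ne.symm hc), mul_zero]
    · intro h; exact absurd (Finset.mem_univ _) h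
  · simp [Config.restrict_of_not _ _ h]

/-- Arrows may be reversed on every loop separately. -/
theorem Config.IsOrientation.smul {C : Config} {o : C.Point → ℤ} (ho : C.IsOrientation o)
    {ε : C.Loop → ℤ} (hε : ∀ c, ε c = 1 ∨ ε c = -1) :
    C.IsOrientation fun p => ε (C.loopOf p) * o p := by
  obtain ⟨h1, h2, h3⟩ := ho
  refine ⟨fun p => ?_, fun p q h => ?_, fun p q h => ?_⟩
  · rcases hε (C.loopOf p) with h | h <;> rcases h1 p with h' | h' <;> simp [h, h']
  · have : (C.loopOf p) = C.loopOf q := Quot.sound (Or.inl h)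
    simp only [this, h2 p q h]
  · have : (C.loopOf p) = C.loopOf q := Quot.sound (Or.inr h)
    simp only [this, h3 p q h, mul_neg]

/-- Two orientations differ by one sign for each loop. -/
theorem Config.IsOrientation.exists_sign {C : Config} {o o' : C.Point → ℤ}
    (ho : C.IsOrientation o) (ho' : C.IsOrientation o') :
    ∃ ε : C.Loop → ℤ, (∀ c, ε c = 1 ∨ ε c = -1) ∧ o' = fun p => ε (C.loopOf p) * o p := by
  obtain ⟨h1, h2, h3⟩ := ho
  obtain ⟨h1', h2', h3'⟩ := ho'
  refine ⟨Quot.lift (fun p => o' p * o p) ?_, ?_, ?_⟩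
  · rintro p q (h | h)
    · simp only [h2 p q h, h2' p q h]
    · simp only [h3 p q h, h3' p q h, neg_mul_neg]
  · intro c
    induction c using Quot.ind with
    | mk p => rcases h1 p with h | h <;> rcases h1' p with h' | h' <;> simp [h, h']
  · ext p
    show o' p = o' p * o p * o p
    rcases h1 p with h | h <;> simp [h]

/-- All orientations arise from one of them by independent reversals of the loops. Both sides are
free of repetitions, since a loop contains a point where no other loop has an arrow. -/
theorem Config.orientations_eq {C : Config} {o : C.Point → ℤ} (ho : C.IsOrientation o) :
    C.orientations = signSums ((Finset.univ : Finset C.Loop).val.map fun c => C.restrict o {c}) := by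
  refine (C.nodup_orientations.ext ?_).2 fun f => ?_
  · let p : C.Loop → C.Point := fun c => (Config.exists_loopOf c).choose
    have hp : ∀ c, C.loopOf (p c) = c := fun c => (Config.exists_loopOf c).choose_spec
    have e : ∀ c c', C.restrict o {c'} (p c).1.1 (p c).1.2 = if c = c' then o (p c) else 0 := by
      intro c c'
      rw [Config.restrict_apply, hp, Set.mem_singleton_iff]
    refine nodup_signSums_map _ _ (fun c => (Pi.evalAddMonoidHom (fun _ : ℕ => ℤ) (p c).1.2).comp
      (Pi.evalAddMonoidHom (fun _ : ℕ => ℕ → ℤ) (p c).1.1)) ?_ ?_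
    · intro c _
      show C.restrict o {c} (p c).1.1 (p c).1.2 ≠ 0
      rw [e, if_pos rfl]
      rcases ho.1 (p c) with h | h <;> rw [h] <;> norm_num
    · intro c _ c' _ hne
      show C.restrict o {c'} (p c).1.1 (p c).1.2 = 0
      rw [e, if_neg hne]
  · rw [mem_signSums_map]
    constructor
    · intro hf
      obtain ⟨o', ho', rfl⟩ := Config.exists_of_mem_orientations hf
      obtain ⟨ε, hε, rfl⟩ := ho.exists_sign ho'
      exact ⟨ε, hε, (Config.restrict_singleton_smul_sum o ε).symm⟩
    · rintro ⟨ε, hε, rfl⟩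
      rw [Config.restrict_singleton_smul_sum]
      exact (ho.smul hε).mem

theorem Event.flux_add {m n : ℕ} (e : Event m n) (f g : ℕ → ℤ) :
    e.flux (f + g) = e.flux f + e.flux g := by
  cases e <;> simp [Event.flux]
  ring

theorem Word.flux_add {m n : ℕ} (w : Word m n) (f g : ℕ → ℕ → ℤ) :
    w.flux (f + g) = w.flux f + w.flux g := by
  induction w generalizing f g with
  | nil n => simp [Word.flux]
  | cons e w ih =>
    have := ih (fun l => f (l + 1)) (fun l => g (l + 1))
    simp only [Word.flux, Pi.add_apply, e.flux_add]
    rw [show (fun l => f (l + 1) + g (l + 1)) = (fun l => f (l + 1)) + fun l => g (l + 1) from rfl,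
      this]
    ring

/-- The winding numbers as an additive function of the labels. -/
def Config.windingHom (C : Config) : (ℕ → ℕ → ℤ) →+ ℤ × ℤ :=
  AddMonoidHom.mk' (fun f => (total C.base (f 0), C.word.flux f)) fun f g => by
    simp [total, Finset.sum_add_distrib, Word.flux_add]

theorem Config.windingHom_restrict (C : Config) (o : C.Point → ℤ) (A : Set C.Loop) :
    C.windingHom (C.restrict o A) = C.winding o A := rfl

/-- The state sum consists of the sign sums of the windings of the single loops. This links the
transfer of labels from height to height with the set of loops. -/
theorem Config.windings_eq {C : Config} {o : C.Point → ℤ} (ho : C.IsOrientation o) :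
    C.windings =
      signSums ((Finset.univ : Finset C.Loop).val.map fun c => C.winding o {c}) := by
  rw [windings_eq_map]
  show C.orientations.map C.windingHom = _
  rw [Config.orientations_eq ho, ← signSums_map, Multiset.map_map]
  rfl

theorem Config.winding_univ {C : Config} (o : C.Point → ℤ) :
    C.winding o Set.univ = ∑ c : C.Loop, C.winding o {c} := by
  have := Config.restrict_singleton_smul_sum o fun _ => 1
  simp only [one_smul, one_mul] at this
  simp only [← Config.windingHom_restrict]
  rw [← this, map_sum]

/-- The coefficients of the loops with respect to the common primitive winding vector. -/
theorem Config.exists_coeff {C : Config} {u : ℤ × ℤ} {g k : ℕ} (hu : Primitive u)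
    (h : C.windings = signSums (straight u g k)) {o : C.Point → ℤ} (ho : C.IsOrientation o) :
    ∃ lam : C.Loop → ℤ, (∀ c, C.winding o {c} = lam c • u) ∧ (∀ c, |lam c| ≤ 1) ∧
      (∑ c, |lam c|) = g ∧ C.loops = g + k := by
  rw [Config.windings_eq ho] at h
  obtain ⟨Λ, h1, h2⟩ := exists_coeff_of_signSums_eq hu h
  have h3 : ∀ c : C.Loop, ∃ j ∈ Λ, j • u = C.winding o {c} := by
    intro c
    have : C.winding o {c} ∈ Λ.map fun j => j • u := by
      rw [← h1]
      exact Multiset.mem_map_of_mem (fun c => C.winding o {c}) (Finset.mem_univ c)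
    exact Multiset.mem_map.1 this
  choose lam h4 h5 using h3
  have h6 : Finset.univ.val.map lam = Λ := by
    apply Multiset.map_injective hu.smul_injective
    rw [← h1, Multiset.map_map]
    exact Multiset.map_congr rfl fun c _ => h5 c
  refine ⟨lam, fun c => (h5 c).symm, fun c => ?_, ?_, ?_⟩
  · have : |lam c| ∈ Λ.map fun a => |a| := Multiset.mem_map_of_mem _ (h4 c)
    rw [h2] at this
    rcases Multiset.mem_add.1 this with h | h <;> rw [Multiset.eq_of_mem_replicate h]
    norm_num
  · have : ((Finset.univ.val.map lam).map fun a => |a|).sum = g := by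
      rw [h6, h2]; simp
    rw [Multiset.map_map] at this
    exact this
  · have := congrArg Multiset.card h2
    rw [← h6] at this
    simp only [Multiset.card_map, Multiset.card_add, Multiset.card_replicate] at this
    rw [Config.loops, Nat.card_eq_fintype_card]
    exact this

theorem exists_isOrientation {C : Config} {L : Multiset (ℤ × ℤ)} (h : C.windings = signSums L)
    {v : ℤ × ℤ} (hv : v ∈ signSums L) : ∃ o, C.IsOrientation o ∧ C.winding o Set.univ = v := by
  rw [← h, windings_eq_map] at hv
  obtain ⟨f, hf, rfl⟩ := Multiset.mem_map.1 hv
  obtain ⟨o, ho, rfl⟩ := Config.exists_of_mem_orientations hf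
  exact ⟨o, ho, rfl⟩

theorem loops_eq {C : Config} {u : ℤ × ℤ} {g k : ℕ} (hu : Primitive u)
    (h : C.windings = signSums (straight u g k)) : C.loops = g + k := by
  obtain ⟨x, hx⟩ := exists_mem_signSums (straight u g k)
  obtain ⟨o, ho, _⟩ := exists_isOrientation h hx
  obtain ⟨_, _, _, _, h⟩ := Config.exists_coeff hu h ho
  exact h

theorem sum_straight (u : ℤ × ℤ) (g k : ℕ) : (straight u g k).sum = (g : ℤ) • u := by
  simp [straight]

/-- The winding numbers with parallel arrows are read off from the state sum: they are `g • u` up to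
a common sign. -/
theorem hasWinding_iff {C : Config} {u : ℤ × ℤ} {g k : ℕ} (hu : Primitive u)
    (h : C.windings = signSums (straight u g k)) {v : ℤ × ℤ} :
    C.HasWinding v ↔ v = (g : ℤ) • u ∨ v = -((g : ℤ) • u) := by
  constructor
  · rintro ⟨o, ho, ⟨u', hu'⟩, rfl⟩
    obtain ⟨lam, h1, h2, h3, -⟩ := Config.exists_coeff hu h ho
    rw [Config.winding_univ]
    simp only [h1] at hu' ⊢
    by_cases h0 : ∀ c, lam c = 0
    · simp only [h0, abs_zero, Finset.sum_const_zero] at h3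
      simp [h0, ← h3]
    · push Not at h0
      obtain ⟨c, hc⟩ := h0
      have h4 : ∀ c', lam c' = |lam c'| * lam c := by
        intro c'
        have e1 := hu' c
        have e2 := hu' c'
        have e3 : lam c • u ≠ 0 := smul_ne_zero hc hu.ne_zero
        rcases e1 with e1 | e1
        · exact absurd e1 e3
        · rw [← e1] at e2
          have b1 := h2 c
          have b2 := h2 c'
          rw [abs_le] at b1 b2
          rcases e2 with e2 | e2
          · rw [smul_eq_zero] at e2
            rcases e2 with e2 | e2
            · rw [e2]; simp
            · exact absurd e2 hu.ne_zero
          · have e2 : lam c' = lam c := hu.smul_injective e2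
            rw [e2]
            have : lam c = 1 ∨ lam c = -1 := by omega
            rcases this with h | h <;> rw [h] <;> norm_num
      rw [← Finset.sum_smul]
      have h5 : ∑ c', lam c' = g * lam c := by
        rw [← h3, Finset.sum_mul]
        exact Finset.sum_congr rfl fun c' _ => h4 c'
      rw [h5]
      have b1 := h2 c
      rw [abs_le] at b1
      have : lam c = 1 ∨ lam c = -1 := by omega
      rcases this with h | h <;> rw [h]
      · left; rw [mul_one]
      · right; rw [mul_neg_one, neg_smul]
  · intro hv
    have hmem : v ∈ signSums (straight u g k) := by
      rcases hv with rfl | rfl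
      · rw [← sum_straight u g k]; exact sum_mem_signSums _
      · rw [← sum_straight u g k]
        exact Multiset.mem_map.2 ⟨0, by simp, by simp⟩
    obtain ⟨o, ho, hov⟩ := exists_isOrientation h hmem
    obtain ⟨lam, h1, h2, h3, -⟩ := Config.exists_coeff hu h ho
    refine ⟨o, ho, ?_, hov⟩
    rw [Config.winding_univ] at hov
    simp only [h1] at hov ⊢
    rw [← Finset.sum_smul] at hov
    have key : ∀ s : ℤ, (s = 1 ∨ s = -1) → v = s • ((g : ℤ) • u) → ∀ c, lam c = s * |lam c| := by
      intro s hs hv c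
      rw [hv, smul_smul] at hov
      have e1 : ∑ c, lam c = s * g := hu.smul_injective hov
      have e2 : ∑ c, (|lam c| - s * lam c) = 0 := by
        rw [Finset.sum_sub_distrib, ← Finset.mul_sum, e1, h3, ← mul_assoc]
        rcases hs with rfl | rfl <;> norm_num
      have e3 : ∀ c ∈ Finset.univ, 0 ≤ |lam c| - s * lam c := by
        intro c _
        rcases hs with rfl | rfl
        · have := le_abs_self (lam c); omega
        · have := neg_le_abs (lam c); omega
      have e4 := (Finset.sum_eq_zero_iff_of_nonneg e3).1 e2 c (Finset.mem_univ c)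
      rcases hs with rfl | rfl <;> omega
    have fin : ∀ s : ℤ, (∀ c, lam c = s * |lam c|) → ∀ c, lam c • u = 0 ∨ lam c • u = s • u := by
      intro s hs c
      have b := h2 c
      have b0 := abs_nonneg (lam c)
      rw [hs c]
      have : |lam c| = 0 ∨ |lam c| = 1 := by omega
      rcases this with h | h <;> rw [h]
      · left; simp
      · right; simp
    rcases hv with hv | hv
    · exact ⟨_, fin 1 (key 1 (Or.inl rfl) (by rw [one_smul]; exact hv))⟩
    · exact ⟨_, fin (-1) (key (-1) (Or.inr rfl) (by rw [neg_one_smul]; exact hv))⟩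

/-! ### Reduction to straight configurations -/

@[simp] theorem Word.nil_comp {m n : ℕ} (w : Word m n) : (Word.nil m).comp w = w := rfl

@[simp] theorem Word.cons_comp {m k n l : ℕ} (e : Event m k) (w : Word k n) (v : Word n l) :
    (Word.cons e w).comp v = .cons e (w.comp v) := rfl

@[simp] theorem Word.comp_nil {m n : ℕ} (w : Word m n) : w.comp (.nil n) = w := by
  induction w with
  | nil n => rfl
  | cons e w ih => rw [Word.cons_comp, ih]

theorem Word.comp_assoc {m n k l : ℕ} (a : Word m n) (b : Word n k) (c : Word k l) :
    (a.comp b).comp c = a.comp (b.comp c) := by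
  induction a with
  | nil n => rfl
  | cons e w ih => simp only [Word.cons_comp, ih]

/-- `Red w v`: isotopies and removals of small loops lead from `w` to `v`. -/
inductive Red : {m n : ℕ} → Word m n → Word m n → Prop
  | refl {m n : ℕ} (w : Word m n) : Red w w
  | trans {m n : ℕ} {u v w : Word m n} : Red u v → Red v w → Red u w
  | move {m a b n : ℕ} (A : Word m a) {P Q : Word a b} (B : Word b n) :
      Move P Q → Red (A.comp (P.comp B)) (A.comp (Q.comp B))
  | move_symm {m a b n : ℕ} (A : Word m a) {P Q : Word a b} (B : Word b n) :
      Move P Q → Red (A.comp (Q.comp B)) (A.comp (P.comp B))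
  | loop {m a n i : ℕ} (A : Word m a) (h : i ≤ a) (B : Word a n) :
      Red (A.comp ((two (.birth a i h) (.death a i h)).comp B)) (A.comp B)

theorem Red.comp {m a b n : ℕ} (A : Word m a) {u v : Word a b} (B : Word b n) (h : Red u v) :
    Red (A.comp (u.comp B)) (A.comp (v.comp B)) := by
  induction h with
  | refl w => exact .refl _
  | trans _ _ h1 h2 => exact (h1 _).trans (h2 _)
  | move A' B' hm =>
    have := Red.move (A.comp A') (B'.comp B) hm
    simpa only [Word.comp_assoc] using this
  | move_symm A' B' hm =>
    have := Red.move_symm (A.comp A') (B'.comp B) hm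
    simpa only [Word.comp_assoc] using this
  | loop A' hi B' =>
    have := Red.loop (A.comp A') hi (B'.comp B)
    simpa only [Word.comp_assoc] using this

theorem Red.cons {m k n : ℕ} (e : Event m k) {u v : Word k n} (h : Red u v) :
    Red (.cons e u) (.cons e v) := by
  simpa [one] using h.comp (one e) (.nil n)

theorem Red.comp_left {m a b : ℕ} (A : Word m a) {u v : Word a b} (h : Red u v) :
    Red (A.comp u) (A.comp v) := by
  simpa using h.comp A (.nil b)

theorem Red.comp_right {a b n : ℕ} {u v : Word a b} (h : Red u v) (B : Word b n) :
    Red (u.comp B) (v.comp B) := by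
  simpa using h.comp (.nil a) B

theorem Move.red {a b n : ℕ} {P Q : Word a b} (h : Move P Q) (B : Word b n) :
    Red (P.comp B) (Q.comp B) := Red.move (.nil a) B h

theorem Move.red_symm {a b n : ℕ} {P Q : Word a b} (h : Move P Q)
    (B : Word b n) : Red (Q.comp B) (P.comp B) := Red.move_symm (.nil a) B h

theorem red_birth_left {n i m : ℕ} (h : i ≤ n) (B : Word (n + 3) m) :
    Red (.cons (.birth (n + 1) (i + 1) (by omega)) (.cons (.left (n + 2)) B))
      (.cons (.left n) (.cons (.birth (n + 1) i (by omega)) B)) := by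
  refine ((Move.left_right n).red_symm _).trans (Red.cons _ ?_)
  refine ((Move.birth_right n i h).red_symm (.cons (.left (n + 2)) B)).trans (Red.cons _ ?_)
  exact (Move.right_left (n + 2)).red B

theorem red_left_death {n i m : ℕ} (h : i ≤ n) (B : Word (n + 1) m) :
    Red (.cons (.left (n + 2)) (.cons (.death (n + 1) i (by omega)) B))
      (.cons (.death (n + 1) (i + 1) (by omega)) (.cons (.left n) B)) := by
  refine Red.trans ?_ ((Move.left_right (n + 2)).red _)
  refine Red.cons _ ?_
  refine Red.trans ?_ ((Move.death_right n i h).red (.cons (.left n) B))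
  refine Red.cons _ ?_
  exact (Move.right_left n).red_symm B

/-- The width at a minimum or a maximum. -/
def Event.weight : {m n : ℕ} → Event m n → ℕ
  | _, _, .birth n _ _ => n + 1
  | _, _, .death n _ _ => n + 1
  | _, _, .right _ => 0
  | _, _, .left _ => 0

/-- The total width of the minima and maxima. -/
def Word.weight : {m n : ℕ} → Word m n → ℕ
  | _, _, .nil _ => 0
  | _, _, .cons e w => e.weight + w.weight

theorem Word.weight_comp {m n k : ℕ} (A : Word m n) (B : Word n k) :
    (A.comp B).weight = A.weight + B.weight := by
  induction A with
  | nil n => simp [Word.weight]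
  | cons e w ih => simp [Word.weight, ih]; ring

/-- A sequence of crossings of the vertical cut, towards the right for `true`. -/
def rotWord (n : ℕ) : List Bool → Word (n + 1) (n + 1)
  | [] => .nil _
  | true :: l => .cons (.right n) (rotWord n l)
  | false :: l => .cons (.left n) (rotWord n l)

theorem weight_rotWord (n : ℕ) (l : List Bool) : (rotWord n l).weight = 0 := by
  induction l with
  | nil => rfl
  | cons b l ih => cases b <;> simpa [rotWord, Word.weight, Event.weight] using ih

/-- A diagram without minima and maxima is a sequence of rotations. The heterogeneous equality
accounts for the width, which is an index of the type. -/
theorem exists_rotWord {p q : ℕ} (w : Word p q) (hw : w.weight = 0) :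
    p = q ∧ ∀ N, p = N + 1 → ∃ l, HEq w (rotWord N l) := by
  induction w with
  | nil n => exact ⟨rfl, fun N hN => ⟨[], by subst hN; rfl⟩⟩
  | cons e w ih =>
    cases e with
    | birth n i h => simp [Word.weight, Event.weight] at hw
    | death n i h => simp [Word.weight, Event.weight] at hw
    | right n =>
      obtain ⟨rfl, h⟩ := ih (by simpa [Word.weight, Event.weight] using hw)
      refine ⟨rfl, fun N hN => ?_⟩
      obtain rfl : n = N := by omega
      obtain ⟨l, hl⟩ := h n rfl
      obtain rfl := eq_of_heq hl
      exact ⟨true :: l, HEq.rfl⟩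
    | left n =>
      obtain ⟨rfl, h⟩ := ih (by simpa [Word.weight, Event.weight] using hw)
      refine ⟨rfl, fun N hN => ?_⟩
      obtain rfl : n = N := by omega
      obtain ⟨l, hl⟩ := h n rfl
      obtain rfl := eq_of_heq hl
      exact ⟨false :: l, HEq.rfl⟩

/-- A minimum followed by rotations: the rotations can be moved below the minimum, which then
may spread over the vertical cut. -/
theorem red_birth_rotWord (n i : ℕ) (h : i ≤ n) (l : List Bool) :
    ∃ V : Word n n, V.weight = 0 ∧
      ((∃ j, ∃ hj : j ≤ n, Red (.cons (.birth n i h) (rotWord (n + 1) l))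
        (V.comp (one (.birth n j hj)))) ∨
      Red (.cons (.birth n i h) (rotWord (n + 1) l))
        (V.comp (two (.birth n n le_rfl) (.right (n + 1))))) := by
  induction hl : l.length using Nat.strong_induction_on generalizing n i l with
  | _ N ih =>
    subst hl
    have step : ∀ (i' : ℕ) (h' : i' ≤ n) (l' : List Bool), l'.length < l.length →
        Red (.cons (.birth n i h) (rotWord (n + 1) l))
          (.cons (.birth n i' h') (rotWord (n + 1) l')) →
        ∃ V : Word n n, V.weight = 0 ∧
          ((∃ j, ∃ hj : j ≤ n, Red (.cons (.birth n i h) (rotWord (n + 1) l))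
            (V.comp (one (.birth n j hj)))) ∨
          Red (.cons (.birth n i h) (rotWord (n + 1) l))
            (V.comp (two (.birth n n le_rfl) (.right (n + 1))))) := by
      intro i' h' l' hlt hred
      obtain ⟨V, hV, h1⟩ := ih _ hlt n i' h' l' rfl
      refine ⟨V, hV, ?_⟩
      rcases h1 with ⟨j, hj, h1⟩ | h1
      · exact Or.inl ⟨j, hj, hred.trans h1⟩
      · exact Or.inr (hred.trans h1)
    match l, ih, step with
    | [], _, _ => exact ⟨.nil n, rfl, Or.inl ⟨i, h, .refl _⟩⟩
    | true :: l, ih, step =>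
      rcases Nat.lt_or_ge i n with hlt | hge
      · obtain ⟨n, rfl⟩ := Nat.exists_eq_succ_of_ne_zero (Nat.ne_zero_of_lt hlt)
        obtain ⟨V, hV, h1⟩ := ih _ (Nat.lt_succ_self _) (n + 1) (i + 1) hlt l rfl
        have h0 := (Move.birth_right n i (Nat.le_of_lt_succ hlt)).red (rotWord (n + 2) l)
        refine ⟨.cons (.right n) V, by simpa [Word.weight, Event.weight] using hV, ?_⟩
        rcases h1 with ⟨j, hj, h1⟩ | h1
        · exact Or.inl ⟨j, hj, h0.trans (h1.cons _)⟩
        · exact Or.inr (h0.trans (h1.cons _))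
      · obtain rfl : i = n := le_antisymm h hge
        match l, ih, step with
        | [], _, _ => exact ⟨.nil _, rfl, Or.inr (.refl _)⟩
        | true :: l, _, step =>
          refine step 0 (Nat.zero_le _) l (by simp) ?_
          exact (Move.birth_cut i).red (rotWord (i + 1) l)
        | false :: l, _, step =>
          refine step i le_rfl l (by simp) (Red.cons _ ?_)
          exact (Move.right_left (i + 1)).red (rotWord (i + 1) l)
    | false :: l, ih, step =>
      rcases Nat.eq_zero_or_pos i with rfl | hpos
      · match l, ih, step with
        | [], _, _ =>
          refine ⟨.nil _, rfl, Or.inr ?_⟩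
          refine ((Move.birth_cut n).red_symm (one (.left (n + 1)))).trans ?_
          exact ((Move.right_left (n + 1)).red (.nil _)).cons _ |>.cons _
        | true :: l, _, step =>
          refine step 0 (Nat.zero_le _) l (by simp) (Red.cons _ ?_)
          exact (Move.left_right (n + 1)).red (rotWord (n + 1) l)
        | false :: l, _, step =>
          refine step n le_rfl l (by simp) ?_
          refine ((Move.birth_cut n).red_symm (rotWord (n + 1) (false :: false :: l))).trans ?_
          refine Red.cons _ ?_
          refine Red.trans (Red.cons _
            ((Move.right_left (n + 1)).red (rotWord (n + 1) (false :: l)))) ?_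
          exact (Move.right_left (n + 1)).red (rotWord (n + 1) l)
      · obtain ⟨i, rfl⟩ := Nat.exists_eq_succ_of_ne_zero hpos.ne'
        obtain ⟨n, rfl⟩ := Nat.exists_eq_succ_of_ne_zero (Nat.ne_zero_of_lt h)
        have hi : i ≤ n := Nat.le_of_succ_le_succ h
        obtain ⟨V, hV, h1⟩ := ih _ (Nat.lt_succ_self _) (n + 1) i (by omega) l rfl
        have h0 := red_birth_left hi (rotWord (n + 2) l)
        refine ⟨.cons (.left n) V, by simpa [Word.weight, Event.weight] using hV, ?_⟩
        rcases h1 with ⟨j, hj, h1⟩ | h1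
        · exact Or.inl ⟨j, hj, h0.trans (h1.cons _)⟩
        · exact Or.inr (h0.trans (h1.cons _))

/-- A minimum directly below a maximum: the two are interchanged, or form a zigzag or a small loop.
-/
theorem red_birth_death {a i j : ℕ} (hi : i ≤ a) (hj : j ≤ a) :
    ∃ W : Word a a, W.weight < 2 * (a + 1) ∧ Red (two (.birth a i hi) (.death a j hj)) W := by
  rcases lt_trichotomy i j with h | rfl | h
  · rcases Nat.lt_or_ge (i + 1) j with h1 | h1
    · obtain ⟨k, rfl⟩ := Nat.exists_eq_add_of_le h1
      obtain ⟨n, rfl⟩ : ∃ n, a = n + 2 := ⟨a - 2, by omega⟩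
      have e : i + 1 + 1 + k = (i + k) + 2 := by ring
      have hm := (Move.birth_death n i (i + k) (by omega) (by omega)).red (.nil _)
      refine ⟨two (.death n (i + k) (by omega)) (.birth n i (by omega)), ?_, ?_⟩
      · simp only [two, one, Word.weight, Event.weight]; omega
      · simp only [Word.comp_nil] at hm
        convert hm using 3
    · obtain rfl : j = i + 1 := by omega
      obtain ⟨n, rfl⟩ : ∃ n, a = n + 1 := ⟨a - 1, by omega⟩
      refine ⟨.nil _, by simp [Word.weight], ?_⟩
      simpa using (Move.zigzag n i (by omega)).red (.nil _)
  · exact ⟨.nil _, by simp [Word.weight], by simpa using Red.loop (.nil a) hi (.nil a)⟩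
  · rcases Nat.lt_or_ge (j + 1) i with h1 | h1
    · obtain ⟨k, rfl⟩ := Nat.exists_eq_add_of_le h1
      obtain ⟨n, rfl⟩ : ∃ n, a = n + 2 := ⟨a - 2, by omega⟩
      have e : j + 1 + 1 + k = (j + k) + 2 := by ring
      have hm := (Move.birth_death' n j (j + k) (by omega) (by omega)).red (.nil _)
      refine ⟨two (.death n j (by omega)) (.birth n (j + k) (by omega)), ?_, ?_⟩
      · simp only [two, one, Word.weight, Event.weight]; omega
      · simp only [Word.comp_nil] at hm
        convert hm using 3
    · obtain rfl : i = j + 1 := by omega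
      obtain ⟨n, rfl⟩ : ∃ n, a = n + 1 := ⟨a - 1, by omega⟩
      refine ⟨.nil _, by simp [Word.weight], ?_⟩
      simpa using (Move.zigzag' n j (by omega)).red (.nil _)

/-- A minimum with its two ends on different sides of the vertical cut, directly below a maximum,
can be lowered unless the two form a horizontal loop. -/
theorem red_birth_right_death {a j : ℕ} (hj : j ≤ a) :
    (∃ W : Word a a, W.weight < 2 * (a + 1) ∧
      Red (three (.birth a a le_rfl) (.right (a + 1)) (.death a j hj)) W) ∨ a = 0 := by
  rcases Nat.eq_zero_or_pos a with rfl | ha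
  · exact Or.inr rfl
  left
  obtain ⟨n, rfl⟩ : ∃ n, a = n + 1 := ⟨a - 1, by omega⟩
  rcases Nat.eq_zero_or_pos j with rfl | hj0
  · obtain ⟨W, hW, hr⟩ := red_birth_death (a := n + 1) (Nat.zero_le _)
      (Nat.succ_le_succ (Nat.zero_le n))
    refine ⟨W.comp (one (.left n)), by simpa [Word.weight_comp, one, Word.weight, Event.weight] using hW, ?_⟩
    refine Red.trans ?_ (hr.comp_right (one (.left n)))
    have h1 : Red (three (.birth (n + 1) (n + 1) le_rfl) (.right (n + 2)) (.death (n + 1) 0 hj))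
        (.cons (.birth (n + 1) (n + 1) le_rfl) (.cons (.right (n + 2)) (.cons (.right (n + 2))
          (.cons (.left (n + 2)) (one (.death (n + 1) 0 hj)))))) :=
      (((Move.right_left (n + 2)).red_symm (one (.death (n + 1) 0 hj))).cons _).cons _
    refine h1.trans (Red.trans ((Move.birth_cut (n + 1)).red
      (.cons (.left (n + 2)) (one (.death (n + 1) 0 hj)))) ?_)
    exact (red_left_death (Nat.zero_le n) (.nil _)).cons _
  · obtain ⟨i, rfl⟩ : ∃ i, j = i + 1 := ⟨j - 1, by omega⟩
    obtain ⟨W, hW, hr⟩ := red_birth_death (a := n + 1) (i := n + 1) (j := i) le_rfl (by omega)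
    refine ⟨W.comp (one (.right n)), by simpa [Word.weight_comp, one, Word.weight, Event.weight] using hW, ?_⟩
    refine Red.trans ?_ (hr.comp_right (one (.right n)))
    have := ((Move.death_right n i (by omega)).red_symm (.nil _)).cons (.birth (n + 1) (n + 1) le_rfl)
    exact this

/-- A peak, that is a minimum directly followed by a maximum, can be lowered, unless it is a
horizontal loop. -/
theorem red_peak (a i : ℕ) (hi : i ≤ a) (l : List Bool) (j : ℕ) (hj : j ≤ a) :
    (∃ W : Word a a, W.weight < 2 * (a + 1) ∧
      Red (.cons (.birth a i hi) ((rotWord (a + 1) l).comp (one (.death a j hj)))) W) ∨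
    (a = 0 ∧ Red (.cons (.birth a i hi) ((rotWord (a + 1) l).comp (one (.death a j hj))))
      (three (.birth a a le_rfl) (.right (a + 1)) (.death a j hj))) := by
  obtain ⟨V, hV, ⟨i', hi', h⟩ | h⟩ := red_birth_rotWord a i hi l
  · left
    obtain ⟨W, hW, hr⟩ := red_birth_death hi' hj
    refine ⟨V.comp W, by rw [Word.weight_comp, hV]; omega, ?_⟩
    have h1 := h.comp_right (one (.death a j hj))
    rw [Word.comp_assoc] at h1
    exact h1.trans (hr.comp_left V)
  · have h1 := h.comp_right (one (.death a j hj))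
    rw [Word.comp_assoc] at h1
    rcases red_birth_right_death hj with ⟨W, hW, hr⟩ | rfl
    · left
      exact ⟨V.comp W, by rw [Word.weight_comp, hV]; omega, h1.trans (hr.comp_left V)⟩
    · right
      refine ⟨rfl, ?_⟩
      have : V = .nil 0 := by
        cases V with
        | nil => rfl
        | cons e w => cases e; simp [Word.weight, Event.weight] at hV
      subst this
      exact h1

/-- The event is not a minimum. -/
def Event.NoBirth : {m n : ℕ} → Event m n → Prop
  | _, _, .birth _ _ _ => False
  | _, _, .death _ _ _ => True
  | _, _, .right _ => True
  | _, _, .left _ => True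

/-- The event is not a maximum. -/
def Event.NoDeath : {m n : ℕ} → Event m n → Prop
  | _, _, .birth _ _ _ => True
  | _, _, .death _ _ _ => False
  | _, _, .right _ => True
  | _, _, .left _ => True

/-- There are no minima. -/
def Word.NoBirth : {m n : ℕ} → Word m n → Prop
  | _, _, .nil _ => True
  | _, _, .cons e w => e.NoBirth ∧ w.NoBirth

/-- There are no maxima. -/
def Word.NoDeath : {m n : ℕ} → Word m n → Prop
  | _, _, .nil _ => True
  | _, _, .cons e w => e.NoDeath ∧ w.NoDeath

theorem Word.NoBirth.weight {m n : ℕ} {w : Word m n} (h : w.NoBirth) :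
    n ≤ m ∧ (n = m → w.weight = 0) := by
  induction w with
  | nil n => exact ⟨le_rfl, fun _ => rfl⟩
  | cons e w ih =>
    cases e with
    | birth n i hi => exact h.1.elim
    | death n i hi => have := ih h.2; exact ⟨by omega, fun h => by omega⟩
    | right n => simpa [Word.weight, Event.weight] using ih h.2
    | left n => simpa [Word.weight, Event.weight] using ih h.2

theorem Word.NoDeath.weight {m n : ℕ} {w : Word m n} (h : w.NoDeath) :
    m ≤ n ∧ (n = m → w.weight = 0) := by
  induction w with
  | nil n => exact ⟨le_rfl, fun _ => rfl⟩
  | cons e w ih =>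
    cases e with
    | birth n i hi => have := ih h.2; exact ⟨by omega, fun h => by omega⟩
    | death n i hi => exact h.1.elim
    | right n => simpa [Word.weight, Event.weight] using ih h.2
    | left n => simpa [Word.weight, Event.weight] using ih h.2

/-- The word contains a minimum that is followed by rotations and then by a maximum. -/
def Word.HasPeak {m n : ℕ} (w : Word m n) : Prop :=
  ∃ (a b : ℕ) (A : Word m a) (i : ℕ) (hi : i ≤ a) (σ : Word (a + 2) (b + 2)) (j : ℕ) (hj : j ≤ b)
    (B : Word b n), σ.weight = 0 ∧
    w = A.comp (.cons (.birth a i hi) (σ.comp (.cons (.death b j hj) B)))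

theorem Word.NoBirth.cases {m n : ℕ} {w : Word m n} (h : w.NoBirth) : w.weight = 0 ∨
    ∃ (b : ℕ) (σ : Word m (b + 2)) (j : ℕ) (hj : j ≤ b) (B : Word b n), σ.weight = 0 ∧
      w = σ.comp (.cons (.death b j hj) B) := by
  induction w with
  | nil n => exact Or.inl rfl
  | cons e w ih =>
    cases e with
    | birth n i hi => exact h.1.elim
    | death n i hi => exact Or.inr ⟨_, .nil _, i, hi, w, rfl, rfl⟩
    | right n =>
      rcases ih h.2 with h1 | ⟨b, σ, j, hj, B, h1, rfl⟩
      · exact Or.inl (by simpa [Word.weight, Event.weight] using h1)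
      · exact Or.inr ⟨b, .cons (.right n) σ, j, hj, B, by simpa [Word.weight, Event.weight] using h1, rfl⟩
    | left n =>
      rcases ih h.2 with h1 | ⟨b, σ, j, hj, B, h1, rfl⟩
      · exact Or.inl (by simpa [Word.weight, Event.weight] using h1)
      · exact Or.inr ⟨b, .cons (.left n) σ, j, hj, B, by simpa [Word.weight, Event.weight] using h1, rfl⟩

theorem Word.NoDeath.cases {m n : ℕ} {w : Word m n} (h : w.NoDeath) : w.weight = 0 ∨
    ∃ (a : ℕ) (A : Word m a) (i : ℕ) (hi : i ≤ a) (σ : Word (a + 2) n), σ.weight = 0 ∧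
      w = A.comp (.cons (.birth a i hi) σ) := by
  induction w with
  | nil n => exact Or.inl rfl
  | cons e w ih =>
    cases e with
    | birth n i hi =>
      rcases ih h.2 with h1 | ⟨a, A, j, hj, B, h1, rfl⟩
      · exact Or.inr ⟨_, .nil _, i, hi, w, h1, rfl⟩
      · exact Or.inr ⟨a, .cons (.birth _ i hi) A, j, hj, B, h1, rfl⟩
    | death n i hi => exact h.1.elim
    | right n =>
      rcases ih h.2 with h1 | ⟨a, A, j, hj, B, h1, rfl⟩
      · exact Or.inl (by simpa [Word.weight, Event.weight] using h1)
      · exact Or.inr ⟨a, .cons (.right n) A, j, hj, B, h1, rfl⟩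
    | left n =>
      rcases ih h.2 with h1 | ⟨a, A, j, hj, B, h1, rfl⟩
      · exact Or.inl (by simpa [Word.weight, Event.weight] using h1)
      · exact Or.inr ⟨a, .cons (.left n) A, j, hj, B, h1, rfl⟩

theorem Word.noDeath_of_weight {m n : ℕ} {w : Word m n} (h : w.weight = 0) : w.NoDeath := by
  induction w with
  | nil n => trivial
  | cons e w ih =>
    cases e with
    | birth n i hi => simp [Word.weight, Event.weight] at h
    | death n i hi => simp [Word.weight, Event.weight] at h
    | right n => exact ⟨trivial, ih (by simpa [Word.weight, Event.weight] using h)⟩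
    | left n => exact ⟨trivial, ih (by simpa [Word.weight, Event.weight] using h)⟩

theorem Word.noDeath_comp {m n k : ℕ} {v : Word m n} {w : Word n k} (hv : v.NoDeath)
    (hw : w.NoDeath) : (v.comp w).NoDeath := by
  induction v with
  | nil n => exact hw
  | cons e v ih =>
    cases e with
    | birth n i hi => exact ⟨trivial, ih hv.2 hw⟩
    | death n i hi => exact hv.1.elim
    | right n => exact ⟨trivial, ih hv.2 hw⟩
    | left n => exact ⟨trivial, ih hv.2 hw⟩

theorem Word.noBirth_of_comp {m n k : ℕ} (v : Word m n) {w : Word n k}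
    (h : (v.comp w).NoBirth) : w.NoBirth := by
  induction v with
  | nil n => exact h
  | cons e v ih => exact ih h.2

/-- A diagram without a peak consists of maxima below and minima above, apart from rotations. -/
theorem Word.hasPeak_or {m n : ℕ} (w : Word m n) : w.HasPeak ∨
    ∃ (k : ℕ) (D : Word m k) (B : Word k n), D.NoBirth ∧ B.NoDeath ∧ w = D.comp B := by
  induction w with
  | nil n => exact Or.inr ⟨n, .nil n, .nil n, trivial, trivial, rfl⟩
  | cons e w ih =>
    rcases ih with ⟨a, b, A, i, hi, σ, j, hj, B, h1, rfl⟩ | ⟨k, D, B, h1, h2, rfl⟩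
    · exact Or.inl ⟨a, b, .cons e A, i, hi, σ, j, hj, B, h1, rfl⟩
    · cases e with
      | birth n i hi =>
        rcases h1.cases with h3 | ⟨b, σ, j, hj, B', h3, rfl⟩
        · refine Or.inr ⟨_, .nil _, .cons (.birth _ i hi) (D.comp B), trivial, ?_, rfl⟩
          exact ⟨trivial, Word.noDeath_comp (Word.noDeath_of_weight h3) h2⟩
        · refine Or.inl ⟨_, b, .nil _, i, hi, σ, j, hj, B'.comp B, h3, ?_⟩
          simp [Word.comp_assoc]
      | death n i hi => exact Or.inr ⟨k, .cons (.death _ i hi) D, B, ⟨trivial, h1⟩, h2, rfl⟩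
      | right n => exact Or.inr ⟨k, .cons (.right n) D, B, ⟨trivial, h1⟩, h2, rfl⟩
      | left n => exact Or.inr ⟨k, .cons (.left n) D, B, ⟨trivial, h1⟩, h2, rfl⟩

/-- A peak can be lowered in weight, or it is a horizontal loop, and then the diagram is cut into
two diagrams that are closed at its height. -/
theorem Word.HasPeak.reduce {m n : ℕ} {w : Word m n} (h : w.HasPeak) :
    (∃ v : Word m n, v.weight < w.weight ∧ Red w v) ∨
    ∃ (A : Word m 0) (B : Word 0 n), A.weight + B.weight < w.weight ∧
      Red w (A.comp (hLoop.comp B)) := by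
  obtain ⟨a, b, A, i, hi, σ, j, hj, B, h1, rfl⟩ := h
  obtain ⟨h2, h3⟩ := exists_rotWord σ h1
  obtain rfl : a = b := by omega
  obtain ⟨l, hl⟩ := h3 (a + 1) rfl
  obtain rfl := eq_of_heq hl
  have e : (Word.cons (.birth a i hi) ((rotWord (a + 1) l).comp (.cons (.death a j hj) B))) =
      (Word.cons (.birth a i hi) ((rotWord (a + 1) l).comp (one (.death a j hj)))).comp B := by
    simp [Word.comp_assoc, one]
  have hw : (A.comp (.cons (.birth a i hi)
      ((rotWord (a + 1) l).comp (.cons (.death a j hj) B)))).weight =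
      A.weight + B.weight + 2 * (a + 1) := by
    simp only [Word.weight_comp, Word.weight, Event.weight, weight_rotWord]; ring
  rw [hw, e]
  rcases red_peak a i hi l j hj with ⟨W, hW, hr⟩ | ⟨rfl, hr⟩
  · left
    exact ⟨A.comp (W.comp B), by simp only [Word.weight_comp]; omega, hr.comp A B⟩
  · right
    obtain rfl : j = 0 := by omega
    exact ⟨A, B, by omega, hr.comp A B⟩

theorem hPow_comp (i j : ℕ) : (hPow i).comp (hPow j) = hPow (i + j) := by
  induction i with
  | zero => simp [hPow]
  | succ i ih => rw [hPow, Word.comp_assoc, ih, Nat.succ_add]; rfl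

/-- A diagram without end points reduces to horizontal loops. -/
theorem red_hPow (w : Word 0 0) : ∃ k, Red w (hPow k) := by
  induction hN : w.weight using Nat.strong_induction_on generalizing w with
  | _ N ih =>
    subst hN
    rcases w.hasPeak_or with h | ⟨k, D, B, h1, h2, rfl⟩
    · rcases h.reduce with ⟨v, hv, hr⟩ | ⟨A, B, hAB, hr⟩
      · obtain ⟨k, hk⟩ := ih _ hv v rfl
        exact ⟨k, hr.trans hk⟩
      · obtain ⟨i, hi⟩ := ih _ (by omega) A rfl
        obtain ⟨j, hj⟩ := ih _ (by omega) B rfl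
        refine ⟨i + (j + 1), hr.trans ?_⟩
        rw [← hPow_comp]
        exact (hi.comp_right _).trans ((hj.comp_left hLoop).comp_left _)
    · have h3 := h1.weight
      have h4 := h2.weight
      obtain rfl : k = 0 := by omega
      have h5 : (D.comp B).weight = 0 := by rw [Word.weight_comp, h3.2 rfl, h4.2 rfl]
      refine ⟨0, ?_⟩
      generalize D.comp B = w at h5
      cases w with
      | nil => exact .refl _
      | cons e w => cases e; simp [Word.weight, Event.weight] at h5

theorem red_rotWord (n : ℕ) (l : List Bool) :
    ∃ k, Red (rotWord n l) (rightPow n k) ∨ Red (rotWord n l) (leftPow n k) := by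
  induction l with
  | nil => exact ⟨0, Or.inl (.refl _)⟩
  | cons b l ih =>
    obtain ⟨k, h | h⟩ := ih <;> cases b
    · cases k with
      | zero => exact ⟨1, Or.inr (h.cons _)⟩
      | succ k => exact ⟨k, Or.inl ((h.cons _).trans ((Move.left_right n).red (rightPow n k)))⟩
    · exact ⟨k + 1, Or.inl (h.cons _)⟩
    · exact ⟨k + 1, Or.inr (h.cons _)⟩
    · cases k with
      | zero => exact ⟨1, Or.inl (h.cons _)⟩
      | succ k => exact ⟨k, Or.inr ((h.cons _).trans ((Move.right_left n).red (leftPow n k)))⟩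

/-- Every configuration is obtained from straight parallel strands by isotopies and by adding small
loops. -/
theorem config_induction {p : Config → Prop}
    (move : ∀ {m n : ℕ} {P Q : Word m n} (X : Word n m), Move P Q → (p (close P X) ↔ p (close Q X)))
    (rotate : ∀ {m n : ℕ} (X : Word m n) (Y : Word n m), p (close X Y) → p (close Y X))
    (loop : ∀ (n i : ℕ) (h : i ≤ n) (X : Word n n), p (close (.nil n) X) →
      p (close (two (.birth n i h) (.death n i h)) X))
    (right : ∀ n k, p ⟨n + 1, rightPow n k⟩) (left : ∀ n k, p ⟨n + 1, leftPow n k⟩)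
    (horizontal : ∀ k, p ⟨0, hPow k⟩) (C : Config) : p C := by
  have red : ∀ {m n : ℕ} {u v : Word m n}, Red u v → ∀ X : Word n m,
      p (close v X) → p (close u X) := by
    intro m n u v h
    induction h with
    | refl w => exact fun _ h => h
    | trans _ _ h1 h2 => exact fun X h => h1 X (h2 X h)
    | @move a b n A P Q B hm =>
      intro X h
      have h1 := rotate A ((Q.comp B).comp X) (by simpa [close, Word.comp_assoc] using h)
      have h2 : p (close Q ((B.comp X).comp A)) := by simpa [close, Word.comp_assoc] using h1
      have h3 := (move _ hm).2 h2
      have h4 := rotate ((P.comp B).comp X) A (by simpa [close, Word.comp_assoc] using h3)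
      simpa [close, Word.comp_assoc] using h4
    | @move_symm a b n A P Q B hm =>
      intro X h
      have h1 := rotate A ((P.comp B).comp X) (by simpa [close, Word.comp_assoc] using h)
      have h2 : p (close P ((B.comp X).comp A)) := by simpa [close, Word.comp_assoc] using h1
      have h3 := (move _ hm).1 h2
      have h4 := rotate ((Q.comp B).comp X) A (by simpa [close, Word.comp_assoc] using h3)
      simpa [close, Word.comp_assoc] using h4
    | @loop a n i A hi B =>
      intro X h
      have h1 := rotate A (B.comp X) (by simpa [close, Word.comp_assoc] using h)
      have h2 : p (close (.nil a) ((B.comp X).comp A)) := by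
        simpa [close, Word.comp_assoc] using h1
      have h3 := loop a i hi _ h2
      have h4 := rotate (((two (.birth a i hi) (.death a i hi)).comp B).comp X) A
        (by simpa [close, Word.comp_assoc] using h3)
      simpa [close, Word.comp_assoc] using h4
  have red' : ∀ {m : ℕ} {u v : Word m m}, Red u v → p ⟨m, v⟩ → p ⟨m, u⟩ := by
    intro m u v h hv
    have := red h (.nil m) (by simpa [close] using hv)
    simpa [close] using this
  have base0 : ∀ w : Word 0 0, p ⟨0, w⟩ := fun w => by
    obtain ⟨k, hk⟩ := red_hPow w
    exact red' hk (horizontal k)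
  obtain ⟨m, w⟩ := C
  induction hN : w.weight using Nat.strong_induction_on generalizing m w with
  | _ N ih =>
    subst hN
    have peak : ∀ (m' : ℕ) (w' : Word m' m'), w'.weight = w.weight → w'.HasPeak → p ⟨m', w'⟩ := by
      intro m' w' hw' h
      rcases h.reduce with ⟨v, hv, hr⟩ | ⟨A, B, -, hr⟩
      · exact red' hr (ih _ (by omega) m' v rfl)
      · exact red' hr (rotate (hLoop.comp B) A (base0 _))
    rcases w.hasPeak_or with h | ⟨k, D, B, h1, h2, rfl⟩
    · exact peak m w rfl h
    · rcases h1.cases with h3 | ⟨b, σ, j, hj, D', h3, rfl⟩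
      · obtain ⟨rfl, -⟩ := exists_rotWord D h3
        have h5 : (D.comp B).weight = 0 := by rw [Word.weight_comp, h3, h2.weight.2 rfl]
        generalize D.comp B = w at h5
        cases m with
        | zero => exact base0 w
        | succ m =>
          obtain ⟨l, hl⟩ := (exists_rotWord w h5).2 m rfl
          obtain rfl := eq_of_heq hl
          obtain ⟨k, h | h⟩ := red_rotWord m l
          · exact red' h (right m k)
          · exact red' h (left m k)
      · obtain ⟨rfl, -⟩ := exists_rotWord σ h3
        have h4 : k ≤ b := by
          have : D'.NoBirth := (Word.noBirth_of_comp σ h1).2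
          exact this.weight.1
        rcases h2.cases with h5 | ⟨a, A, i, hi, σ', h5, rfl⟩
        · obtain ⟨rfl, -⟩ := exists_rotWord B h5
          omega
        -- The maxima are below the minima, so cutting the torus in between yields a peak.
        · refine rotate _ _ (peak k _ ?_ ?_)
          · simp only [Word.weight_comp]; ring
          · refine ⟨a, b, A, i, hi, σ'.comp σ, j, hj, D', ?_, ?_⟩
            · rw [Word.weight_comp, h5, h3]
            · simp [Word.comp_assoc]

/-! ### The state sum with turning numbers -/

/-- The total winding numbers and turning numbers, the latter in units of a sixth of a turn, of
all orientations of a configuration, with multiplicity. -/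
def Config.turnWindings (C : Config) : Multiset ((ℤ × ℤ) × ℤ) :=
  (labels C.base).bind fun t =>
    ((C.word.turnRun t).filter fun p => p.1 = t).map fun p => ((total C.base t, p.2.1), 3 * p.2.2)

theorem map_turnWindings (C : Config) : C.turnWindings.map Prod.fst = C.windings := by
  rw [Config.turnWindings, Config.windings, Multiset.map_bind]
  refine Multiset.bind_congr fun t _ => ?_
  rw [← C.word.map_turnRun, Multiset.filter_map, Multiset.map_map, Multiset.map_map]
  rfl

theorem turnWindings_congr {m n : ℕ} {P Q : Word m n} (X : Word n m)
    (h : ∀ t, IsLabel n t → P.turnRun t = Q.turnRun t) :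
    (close P X).turnWindings = (close Q X).turnWindings := by
  refine Multiset.bind_congr fun t ht => ?_
  have ht := mem_labels.1 ht
  have : (P.comp X).turnRun t = (Q.comp X).turnRun t := by
    rw [Word.turnRun_comp, Word.turnRun_comp]
    exact Multiset.bind_congr fun p hp => by
      rw [h _ (X.isLabel_run ht (Word.mem_run_of_mem_turnRun hp))]
  show Multiset.map _ (((P.comp X).turnRun t).filter _) = _
  rw [this]
  rfl

theorem turnWindings_move {m n : ℕ} {P Q : Word m n} (h : Move P Q) (X : Word n m) :
    (close P X).turnWindings = (close Q X).turnWindings :=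
  turnWindings_congr X fun _ ht => h.turnRun_eq ht

theorem turnWindings_close {m n : ℕ} (X : Word m n) (Y : Word n m) : (close X Y).turnWindings =
    (labels m).bind fun t => (labels n).bind fun u =>
      ((Y.turnRun t).filter fun p => p.1 = u).bind fun p =>
        ((X.turnRun u).filter fun q => q.1 = t).map fun q =>
          ((total m t, p.2.1 + q.2.1), 3 * (p.2.2 + q.2.2)) := by
  refine Multiset.bind_congr fun t ht => ?_
  have ht := mem_labels.1 ht
  show Multiset.map _ (((X.comp Y).turnRun t).filter _) = _
  rw [Word.turnRun_comp, Multiset.filter_bind, Multiset.map_bind,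
    bind_eq_bind_labels (Y.turnRun t) (fun p hp => Y.isLabel_run ht (Word.mem_run_of_mem_turnRun hp))]
  refine Multiset.bind_congr fun u _ => Multiset.bind_congr fun p hp => ?_
  rw [Multiset.mem_filter] at hp
  rw [hp.2, Multiset.filter_map, Multiset.map_map]
  refine Multiset.map_congr rfl fun q _ => ?_
  simp [close, add_comm]

theorem turnWindings_rotate {m n : ℕ} (X : Word m n) (Y : Word n m) :
    (close X Y).turnWindings = (close Y X).turnWindings := by
  rw [turnWindings_close, turnWindings_close, Multiset.bind_bind]
  refine Multiset.bind_congr fun u hu => Multiset.bind_congr fun t ht => ?_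
  simp only [← Multiset.bind_singleton]
  rw [Multiset.bind_bind]
  refine Multiset.bind_congr fun q hq => Multiset.bind_congr fun p hp => ?_
  rw [Multiset.mem_filter] at hp
  rw [← hp.2, Y.total_run (Word.mem_run_of_mem_turnRun hp.1), add_comm, add_comm p.2.2]

theorem turnWindings_smallLoop {n i : ℕ} (h : i ≤ n) (X : Word n n) :
    (close (two (.birth n i h) (.death n i h)) X).turnWindings =
      (close (.nil n) X).turnWindings.map ((0, 6) + ·) +
        (close (.nil n) X).turnWindings.map (-(0, 6) + ·) := by
  have e : ∀ t : ℕ → ℤ,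
      (two (.birth n i h) (.death n i h)).turnRun t = {(t, 0, 2)} + {(t, 0, -2)} := by
    intro t
    have e (x : ℤ) : del i (ins i x t) = t := by
      ext j
      simp only [ins, del]
      split_ifs <;> first | rfl | (exfalso; omega)
    have e1 (x : ℤ) : ins i x t i = x := ins_self _ _ _
    have e2 (x : ℤ) : ins i x t (i + 1) = -x := ins_succ _ _ _
    simp [turnRun_two, Event.turnBack, e, e1, e2]
    exact Multiset.cons_swap _ _ _
  simp only [Config.turnWindings, close, Word.turnRun_comp, e]
  simp only [Multiset.map_add, Multiset.bind_add, Multiset.filter_add, Word.turnRun,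
    Multiset.map_singleton, Multiset.bind_singleton, Multiset.map_bind, Multiset.map_map,
    Multiset.filter_map, Function.comp_def]
  congr 1 <;>
  · refine Multiset.bind_congr fun t _ => ?_
    refine Multiset.map_congr (by simp) fun p _ => ?_
    ext <;> simp
    ring

/-! ### Straight state sums -/

/-- The generators of the state sum of `g` parallel loops with winding numbers `u` and `k`
contractible loops; the turning number of a contractible loop is six sixths of a turn. -/
def straightTurned (u : ℤ × ℤ) (g k : ℕ) : Multiset ((ℤ × ℤ) × ℤ) :=
  Multiset.replicate g (u, 0) + Multiset.replicate k (0, 6)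

theorem map_straightTurned {α : Type*} (f : (ℤ × ℤ) × ℤ → α) (u : ℤ × ℤ) (g k : ℕ) :
    (straightTurned u g k).map f =
      Multiset.replicate g (f (u, 0)) + Multiset.replicate k (f (0, 6)) := by
  simp [straightTurned]

/-- A state sum of disjoint simple closed curves on the torus: the noncontractible ones are parallel,
with primitive winding numbers, and do not turn, the contractible ones turn once. -/
def IsStraight (W : Multiset ((ℤ × ℤ) × ℤ)) : Prop :=
  ∃ u g k, Primitive u ∧ W = signSums (straightTurned u g k)

/-- No orientation of a strand turns in total. -/
def Word.Flat {m n : ℕ} (w : Word m n) : Prop :=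
  ∀ t, w.turnRun t = (w.run t).map fun p => (p.1, p.2, 0)

theorem Word.Flat.comp {m n k : ℕ} {v : Word m n} {w : Word n k} (hv : v.Flat) (hw : w.Flat) :
    (v.comp w).Flat := by
  intro t
  simp only [Word.turnRun_comp, Word.run_comp, hw t, hv _, Multiset.bind_map, Multiset.map_map,
    Multiset.map_bind, Function.comp_def, Prod.mk_add_mk, add_zero]

theorem Word.flat_nil (n : ℕ) : (Word.nil n).Flat := fun t => by simp [turnRun, run]; rfl

theorem flat_right (n : ℕ) : (one (.right n)).Flat := fun t => by
  simp [turnRun_one, run_one, Event.turnBack, Event.back]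

theorem flat_left (n : ℕ) : (one (.left n)).Flat := fun t => by
  simp [turnRun_one, run_one, Event.turnBack, Event.back]

theorem flat_rightPow (n k : ℕ) : (rightPow n k).Flat := by
  induction k with
  | zero => exact Word.flat_nil _
  | succ k ih => exact (flat_right n).comp ih

theorem flat_leftPow (n k : ℕ) : (leftPow n k).Flat := by
  induction k with
  | zero => exact Word.flat_nil _
  | succ k ih => exact (flat_left n).comp ih

theorem flat_hLoop : hLoop.Flat := by
  intro t
  have e (x : ℤ) : del 0 (rotL 1 (ins 0 x t)) = t := by
    ext j
    simp only [ins, del, rotL]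
    split_ifs <;> first | rfl | (exfalso; omega)
  have e1 (x : ℤ) : ins 0 x t 0 = x := ins_self _ _ _
  have e2 (x : ℤ) : rotL 1 (ins 0 x t) 0 = -x := by simp [rotL, ins]
  have e3 (x : ℤ) : rotL 1 (ins 0 x t) 1 = x := by simp [rotL, ins]
  rw [run_hLoop]
  simp [hLoop, turnRun_three, turnRun_two, Event.turnBack, e, e1, e2, e3]

theorem flat_hPow (k : ℕ) : (hPow k).Flat := by
  induction k with
  | zero => exact Word.flat_nil _
  | succ k ih => exact flat_hLoop.comp ih

theorem Word.Flat.turnWindings {n : ℕ} {w : Word n n} (h : w.Flat) :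
    (Config.mk n w).turnWindings = (Config.mk n w).windings.map fun v => (v, 0) := by
  rw [Config.turnWindings, Config.windings, Multiset.map_bind]
  refine Multiset.bind_congr fun t _ => ?_
  simp only [h t, Multiset.filter_map, Multiset.map_map]
  rfl

theorem Word.Flat.isStraight {n g : ℕ} {w : Word n n} (h : w.Flat) {u : ℤ × ℤ} (hu : Primitive u)
    (hw : (Config.mk n w).windings = signSums (Multiset.replicate g u)) :
    IsStraight (Config.mk n w).turnWindings := by
  refine ⟨u, g, 0, hu, ?_⟩
  have e : (fun v : ℤ × ℤ => (v, (0 : ℤ))) = AddMonoidHom.inl (ℤ × ℤ) ℤ := rfl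
  rw [h.turnWindings, hw, e, ← signSums_map]
  simp [straightTurned]

theorem primitive_slope (n k : ℕ) : Primitive (slope n k) :=
  Nat.isCoprime_iff_coprime.2 (Nat.coprime_div_gcd_div_gcd (Nat.gcd_pos_of_pos_left _ n.succ_pos))

/-- The noncontractible loops of every configuration are parallel. -/
theorem Config.isStraight (C : Config) : IsStraight C.turnWindings := by
  refine config_induction (p := fun C => IsStraight C.turnWindings) ?_ ?_ ?_ ?_ ?_ ?_ C
  · intro m n P Q X h
    rw [turnWindings_move h]
  · intro m n X Y h
    rwa [turnWindings_rotate]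
  · rintro n i h X ⟨u, g, k, hu, he⟩
    refine ⟨u, g, k + 1, hu, ?_⟩
    rw [turnWindings_smallLoop, he, ← signSums_cons, straightTurned, straightTurned,
      Multiset.replicate_succ, Multiset.add_cons]
  · intro n k
    exact (flat_rightPow n k).isStraight (primitive_slope n k) (windings_rightPow n k)
  · intro n k
    exact (flat_leftPow n k).isStraight (u := ((slope n k).1, -(slope n k).2))
      (primitive_slope n k).neg_right (windings_leftPow n k)
  · intro k
    exact (flat_hPow k).isStraight (u := (0, 1)) isCoprime_one_right (windings_hPow k)

theorem IsStraight.windings {C : Config} {u : ℤ × ℤ} {g k : ℕ}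
    (h : C.turnWindings = signSums (straightTurned u g k)) :
    C.windings = signSums (straight u g k) := by
  have e : (Prod.fst : (ℤ × ℤ) × ℤ → ℤ × ℤ) = AddMonoidHom.fst (ℤ × ℤ) ℤ := rfl
  rw [← map_turnWindings, h, e, ← signSums_map, map_straightTurned]
  rfl

theorem exists_hasWinding (C : Config) :
    ∃ v : ℤ × ℤ, ∀ u : ℤ × ℤ, C.HasWinding u ↔ u = v ∨ u = -v := by
  obtain ⟨u, g, k, hu, h⟩ := C.isStraight
  exact ⟨(g : ℤ) • u, fun v => hasWinding_iff hu (IsStraight.windings h)⟩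

theorem gcd_smul_slope (n k : ℕ) : (((n + 1).gcd k : ℕ) : ℤ) • slope n k = (((n + 1 : ℕ) : ℤ), (k : ℤ)) := by
  ext
  · simp only [slope, Prod.smul_mk, smul_eq_mul]
    exact_mod_cast Nat.mul_div_cancel' (Nat.gcd_dvd_left (n + 1) k)
  · simp only [slope, Prod.smul_mk, smul_eq_mul]
    exact_mod_cast Nat.mul_div_cancel' (Nat.gcd_dvd_right (n + 1) k)

theorem hasWinding_rightPow (n k : ℕ) :
    (Config.mk (n + 1) (rightPow n k)).HasWinding (((n + 1 : ℕ) : ℤ), (k : ℤ)) := by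
  rw [hasWinding_iff (k := 0) (primitive_slope n k) (by simpa [straight] using windings_rightPow n k),
    gcd_smul_slope]
  exact Or.inl rfl

theorem hasWinding_leftPow (n k : ℕ) :
    (Config.mk (n + 1) (leftPow n k)).HasWinding (((n + 1 : ℕ) : ℤ), -(k : ℤ)) := by
  rw [hasWinding_iff (u := ((slope n k).1, -(slope n k).2)) (k := 0)
    (primitive_slope n k).neg_right (by simpa [straight] using windings_leftPow n k)]
  left
  have := gcd_smul_slope n k
  rw [Prod.ext_iff] at this ⊢
  refine ⟨this.1.symm, ?_⟩
  have h2 := this.2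
  simp only [Prod.smul_snd, smul_eq_mul] at h2 ⊢
  rw [mul_neg, h2]

theorem hasWinding_hPow (k : ℕ) : (Config.mk 0 (hPow k)).HasWinding (0, (k : ℤ)) := by
  rw [hasWinding_iff (u := (0, 1)) (g := k) (k := 0) isCoprime_one_right
    (by simpa [straight] using windings_hPow k)]
  left
  ext <;> simp

theorem HasWinding.neg {C : Config} {v : ℤ × ℤ} (h : C.HasWinding v) : C.HasWinding (-v) := by
  obtain ⟨w, hw⟩ := exists_hasWinding C
  rw [hw] at h ⊢
  rcases h with rfl | rfl <;> simp

/-- Straight strands realize all winding numbers. -/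
theorem exists_config (v : ℤ × ℤ) : ∃ C : Config, C.HasWinding v := by
  have pos : ∀ (n : ℕ) (y : ℤ), ∃ C : Config, C.HasWinding ((n : ℤ), y) := by
    intro n y
    obtain ⟨k, rfl | rfl⟩ := y.eq_nat_or_neg <;> cases n with
    | zero =>
      first
        | exact ⟨_, hasWinding_hPow k⟩
        | exact ⟨_, by simpa using HasWinding.neg (hasWinding_hPow k)⟩
    | succ n =>
      first
        | exact ⟨_, hasWinding_rightPow n k⟩
        | exact ⟨_, hasWinding_leftPow n k⟩
  obtain ⟨x, y⟩ := v
  obtain ⟨n, rfl | rfl⟩ := x.eq_nat_or_neg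
  · exact pos n y
  · obtain ⟨C, hC⟩ := pos n (-y)
    exact ⟨C, by simpa using HasWinding.neg hC⟩

/-! ### Values of state sums -/

theorem abs_eq_of_signSums_eq_replicate {Λ : Multiset ℤ} {N : ℕ} {c : ℤ}
    (h : signSums Λ = signSums (Multiset.replicate N c)) {a : ℤ} (ha : a ∈ Λ) : |a| = |c| := by
  have h1 : ∀ {M : ℕ} {x : ℤ}, x ∈ signSums (Multiset.replicate M c) → ∃ j : ℤ, x = c * (M + 2 * j) := by
    intro M
    induction M with
    | zero => intro x hx; exact ⟨0, by simpa using hx⟩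
    | succ M ih =>
      intro x hx
      rw [Multiset.replicate_succ, signSums_cons, Multiset.mem_add, Multiset.mem_map,
        Multiset.mem_map] at hx
      rcases hx with ⟨y, hy, rfl⟩ | ⟨y, hy, rfl⟩ <;> obtain ⟨j, rfl⟩ := ih hy
      · exact ⟨j, by push_cast; ring⟩
      · exact ⟨j - 1, by push_cast; ring⟩
  have h2 : ∀ a ∈ Λ, ∃ b, a = c * b := by
    intro a ha
    obtain ⟨Λ', rfl⟩ := Multiset.exists_cons_of_mem ha
    obtain ⟨x, hx⟩ := exists_mem_signSums Λ'
    have e : ∀ y, y ∈ signSums (a ::ₘ Λ') → ∃ j : ℤ, y = c * (N + 2 * j) := fun y hy =>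
      h1 (by rwa [h] at hy)
    rw [signSums_cons] at e
    obtain ⟨i, hi⟩ := e (a + x) (Multiset.mem_add.2 (Or.inl (Multiset.mem_map_of_mem _ hx)))
    obtain ⟨j, hj⟩ := e (-a + x) (Multiset.mem_add.2 (Or.inr (Multiset.mem_map_of_mem _ hx)))
    exact ⟨i - j, by linarith⟩
  rcases eq_or_ne c 0 with rfl | hc
  · obtain ⟨b, rfl⟩ := h2 a ha
    simp
  choose! q hq using h2
  have h3 : Λ = (Λ.map q).map (AddMonoidHom.mulLeft c) := by
    rw [Multiset.map_map]
    conv_lhs => rw [← Multiset.map_id Λ]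
    exact Multiset.map_congr rfl fun a ha => hq a ha
  have h4 : signSums (Λ.map q) = signSums (Multiset.replicate N 1 + Multiset.replicate 0 0) := by
    apply Multiset.map_injective (f := AddMonoidHom.mulLeft c)
    · intro x y hxy
      exact mul_left_cancel₀ hc hxy
    · rw [← signSums_map, ← h3, h, ← signSums_map]
      simp
  have h5 := abs_eq_of_signSums_eq h4
  have h6 : |q a| ∈ (Λ.map q).map fun a => |a| :=
    Multiset.mem_map_of_mem _ (Multiset.mem_map_of_mem _ ha)
  rw [h5] at h6
  rw [Multiset.replicate_zero, add_zero] at h6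
  have h7 : |q a| = 1 := Multiset.eq_of_mem_replicate h6
  rw [hq a ha, abs_mul, h7, mul_one]

/-- The winding and turning numbers `w` of a simple closed curve that is contractible, and then
turns once in either direction, or parallel to `u`, and then does not turn in total. -/
def Parallel (u : ℤ × ℤ) (w : (ℤ × ℤ) × ℤ) : Prop :=
  (w = (u, 0) ∨ w = -(u, 0)) ∨ (w.1 = 0 ∧ |w.2| = 6)

/-- The number of noncontractible loops. -/
def windingCount (L : Multiset ((ℤ × ℤ) × ℤ)) : ℕ := (L.filter fun w => w.1 ≠ 0).card

/-- The state sum of a straight configuration determines its loops: `g` of them are `±(u, 0)` and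
`k` of them turn once without winding. This is tested on integer-valued functionals `f` of winding
and turning, whose sign sums determine the values of `|f|`. -/
theorem parallel_of_signSums_eq {u : ℤ × ℤ} {g k : ℕ} (hu : Primitive u)
    {L : Multiset ((ℤ × ℤ) × ℤ)} (h : signSums L = signSums (straightTurned u g k)) :
    (∀ w ∈ L, Parallel u w) ∧ windingCount L = g ∧ L.card = g + k := by
  obtain ⟨a, b, hab⟩ := id hu
  let fst : (ℤ × ℤ) × ℤ →+ ℤ := (AddMonoidHom.fst ℤ ℤ).comp (AddMonoidHom.fst (ℤ × ℤ) ℤ)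
  let snd : (ℤ × ℤ) × ℤ →+ ℤ := (AddMonoidHom.snd ℤ ℤ).comp (AddMonoidHom.fst (ℤ × ℤ) ℤ)
  let trd : (ℤ × ℤ) × ℤ →+ ℤ := AddMonoidHom.snd (ℤ × ℤ) ℤ
  have key : ∀ f : (ℤ × ℤ) × ℤ →+ ℤ, signSums (L.map f) =
      signSums (Multiset.replicate g |f (u, 0)| + Multiset.replicate k |f (0, 6)|) := by
    intro f
    rw [signSums_map, h, ← signSums_map, ← signSums_map_abs, map_straightTurned, Multiset.map_add,
      Multiset.map_replicate, Multiset.map_replicate]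
  have hp : ∀ w ∈ L, Parallel u w := by
    intro w hw
    have h1 := key (u.2 • fst - u.1 • snd)
    have h2 := key (6 • (a • fst + b • snd) + trd)
    have h3 := key (6 • (a • fst + b • snd) - trd)
    simp only [AddMonoidHom.sub_apply, AddMonoidHom.add_apply, AddMonoidHom.smul_apply, fst, snd,
      trd, AddMonoidHom.comp_apply, AddMonoidHom.coe_fst, AddMonoidHom.coe_snd, smul_eq_mul,
      hab, Prod.fst_zero, Prod.snd_zero, nsmul_eq_mul] at h1 h2 h3
    have e1 : u.2 * u.1 - u.1 * u.2 = 0 := by ring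
    norm_num [e1] at h1
    norm_num at h2 h3
    rw [← Multiset.replicate_add] at h1 h2 h3
    have h1 := abs_eq_of_signSums_eq_replicate h1 (Multiset.mem_map_of_mem _ hw)
    have h2 := abs_eq_of_signSums_eq_replicate h2 (Multiset.mem_map_of_mem _ hw)
    have h3 := abs_eq_of_signSums_eq_replicate h3 (Multiset.mem_map_of_mem _ hw)
    obtain ⟨⟨x, y⟩, τ⟩ := w
    simp only [AddMonoidHom.sub_apply, AddMonoidHom.smul_apply, AddMonoidHom.comp_apply,
      AddMonoidHom.coe_fst, AddMonoidHom.coe_snd, smul_eq_mul,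
      abs_zero, abs_eq_zero] at h1 h2 h3
    have hx : x = (a * x + b * y) * u.1 := by linear_combination -x * hab + b * h1
    have hy : y = (a * x + b * y) * u.2 := by linear_combination -y * hab - a * h1
    rw [← mul_add] at h2 h3
    generalize a * x + b * y = f at hx hy h2 h3
    rw [abs_of_pos (by norm_num : (0 : ℤ) < 6)] at h2 h3
    have h2 := eq_or_eq_neg_of_abs_eq h2
    have h3 := eq_or_eq_neg_of_abs_eq h3
    have hf : (f = 1 ∧ τ = 0) ∨ (f = -1 ∧ τ = 0) ∨ (f = 0 ∧ τ = 6) ∨ (f = 0 ∧ τ = -6) := by omega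
    rcases hf with ⟨rfl, rfl⟩ | ⟨rfl, rfl⟩ | ⟨rfl, rfl⟩ | ⟨rfl, rfl⟩
    · left; left; ext <;> simp [hx, hy]
    · left; right; ext <;> simp [hx, hy]
    · right; exact ⟨by ext <;> simp [hx, hy], by norm_num⟩
    · right; exact ⟨by ext <;> simp [hx, hy], by norm_num⟩
  have hc : L.card = g + k := by
    have h1 := congrArg Multiset.card h
    rw [card_signSums, card_signSums] at h1
    rw [Nat.pow_right_injective le_rfl h1]
    simp [straightTurned]
  refine ⟨hp, ?_, hc⟩
  have h1 := key (a • fst + b • snd)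
  have e : (a • fst + b • snd) (u, 0) = 1 := by simpa [fst, snd] using hab
  have e' : (a • fst + b • snd) (0, 6) = 0 := by simp [fst, snd]
  rw [e, e', abs_one, abs_zero] at h1
  have h2 := abs_eq_of_signSums_eq h1
  have h3 := congrArg (Multiset.count 1) h2
  rw [Multiset.map_map, Multiset.count_map, Multiset.count_add, Multiset.count_replicate_self,
    Multiset.count_replicate, if_neg (by norm_num), add_zero] at h3
  rw [windingCount, ← h3]
  congr 1
  refine Multiset.filter_congr fun w hw => ?_
  have hn := hu.ne_zero
  rcases hp w hw with (rfl | rfl) | ⟨h4, -⟩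
  · simp [e, hn]
  · simp only [Function.comp, map_neg, e]
    simp [hn]
  · have : (a • fst + b • snd) w = 0 := by simp [fst, snd, h4]
    simp [h4, this]

theorem signSums_of_parallel {u : ℤ × ℤ} {L : Multiset ((ℤ × ℤ) × ℤ)} (hL : ∀ w ∈ L, Parallel u w) :
    ∃ g k, signSums L = signSums (straightTurned u g k) := by
  induction L using Multiset.induction_on with
  | empty => exact ⟨0, 0, by simp [straightTurned]⟩
  | cons w L ih =>
    obtain ⟨g, k, h⟩ := ih fun v hv => hL v (Multiset.mem_cons_of_mem hv)
    rw [signSums_cons_congr w h]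
    have h1 : signSums ((u, 0) ::ₘ straightTurned u g k) = signSums (straightTurned u (g + 1) k) := by
      rw [straightTurned, straightTurned, Multiset.replicate_succ, Multiset.cons_add]
    have h2 : signSums ((0, 6) ::ₘ straightTurned u g k) = signSums (straightTurned u g (k + 1)) := by
      rw [straightTurned, straightTurned, Multiset.replicate_succ, Multiset.add_cons]
    rcases hL w (Multiset.mem_cons_self _ _) with (rfl | rfl) | ⟨h4, h5⟩
    · exact ⟨_, _, h1⟩
    · rw [signSums_neg_cons]
      exact ⟨_, _, h1⟩
    · obtain ⟨v, τ⟩ := w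
      obtain rfl : v = 0 := h4
      refine ⟨g, k + 1, ?_⟩
      rcases eq_or_eq_neg_of_abs_eq h5 with h5 | h5
      · obtain rfl : τ = 6 := h5
        exact h2
      · obtain rfl : τ = -6 := h5
        rw [← h2, ← signSums_neg_cons]
        rfl

/-- The value `ψ(n_x, n_y) d ^ |C|` of a configuration with state sum `W`, and `0` if `W` is not
straight. For even `ψ` it does not depend on the choice of `u`, which is unique up to sign. -/
def value (ψ : ℤ × ℤ → ℂ) (d : ℂ) (W : Multiset ((ℤ × ℤ) × ℤ)) : ℂ :=
  if h : ∃ p : (ℤ × ℤ) × ℕ × ℕ, Primitive p.1 ∧ W = signSums (straightTurned p.1 p.2.1 p.2.2) then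
    ψ ((h.choose.2.1 : ℤ) • h.choose.1) * d ^ (h.choose.2.1 + h.choose.2.2)
  else 0

theorem value_signSums {ψ : ℤ × ℤ → ℂ} (hψ : ∀ v, ψ (-v) = ψ v) (d : ℂ) {u : ℤ × ℤ}
    (hu : Primitive u) {L : Multiset ((ℤ × ℤ) × ℤ)} (hL : ∀ w ∈ L, Parallel u w) :
    value ψ d (signSums L) = ψ ((windingCount L : ℤ) • u) * d ^ L.card := by
  have h : ∃ p : (ℤ × ℤ) × ℕ × ℕ, Primitive p.1 ∧
      signSums L = signSums (straightTurned p.1 p.2.1 p.2.2) := by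
    obtain ⟨g, k, h⟩ := signSums_of_parallel hL
    exact ⟨(u, g, k), hu, h⟩
  rw [value, dif_pos h]
  obtain ⟨hu', he⟩ := h.choose_spec
  generalize h.choose = p at hu' he
  obtain ⟨h1, h2, h3⟩ := parallel_of_signSums_eq hu' he
  rw [← h3, ← h2]
  congr 1
  rcases Nat.eq_zero_or_pos (windingCount L) with h0 | h0
  · simp [h0]
  · obtain ⟨w, hw⟩ := Multiset.card_pos_iff_exists_mem.1 h0
    rw [Multiset.mem_filter] at hw
    have e : ∀ v, Parallel v w → w.1 = v ∨ w.1 = -v := by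
      intro v hv
      rcases hv with (rfl | rfl) | ⟨h4, -⟩
      · exact Or.inl rfl
      · exact Or.inr rfl
      · exact absurd h4 hw.2
    have h5 : p.1 = u ∨ p.1 = -u := by
      rcases e _ (h1 w hw.1) with h | h <;> rcases e _ (hL w hw.1) with h' | h'
      · left; rw [← h, h']
      · right; rw [← h, h']
      · right; rw [← h', h, neg_neg]
      · left; rw [← neg_inj, ← h, h']
    rcases h5 with h5 | h5
    · rw [h5]
    · rw [h5, smul_neg, hψ]

/-- The wavefunction `ψ(n_x, n_y) d ^ |C|`. -/
def stateOf (d : ℂ) (ψ : ℤ × ℤ → ℂ) (C : Config) : ℂ := value ψ d C.turnWindings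

theorem parallel_straightTurned (u : ℤ × ℤ) (g k : ℕ) : ∀ w ∈ straightTurned u g k, Parallel u w := by
  intro w hw
  rcases Multiset.mem_add.1 hw with h | h
  · exact Or.inl (Or.inl (Multiset.eq_of_mem_replicate h))
  · rw [Multiset.eq_of_mem_replicate h]
    exact Or.inr ⟨rfl, by norm_num⟩

theorem stateOf_eq {d : ℂ} {ψ : ℤ × ℤ → ℂ} (hψ : ∀ v, ψ (-v) = ψ v) {C : Config} {v : ℤ × ℤ}
    (hv : C.HasWinding v) : stateOf d ψ C = ψ v * d ^ C.loops := by
  obtain ⟨u, g, k, hu, h⟩ := C.isStraight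
  obtain ⟨-, h1, h2⟩ := parallel_of_signSums_eq hu (L := straightTurned u g k) rfl
  rw [stateOf, h, value_signSums hψ d hu (parallel_straightTurned u g k), h1, h2,
    loops_eq hu (IsStraight.windings h)]
  rcases (hasWinding_iff hu (IsStraight.windings h)).1 hv with rfl | rfl
  · rfl
  · rw [hψ]

/-! ### Zero-energy states -/

theorem amplitude_apply (v : Config →₀ ℂ) (Ψ : Config → ℂ) :
    amplitude v Ψ = v.sum fun C z => star z * Ψ C := by
  simp [amplitude, Finsupp.sum]

theorem amplitude_add (v w : Config →₀ ℂ) (Ψ : Config → ℂ) :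
    amplitude (v + w) Ψ = amplitude v Ψ + amplitude w Ψ := by
  simp only [amplitude_apply]
  exact Finsupp.sum_add_index' (by simp) (by intros; simp [add_mul])

theorem amplitude_smul (c : ℂ) (v : Config →₀ ℂ) (Ψ : Config → ℂ) :
    amplitude (c • v) Ψ = star c * amplitude v Ψ := by
  simp only [amplitude_apply]
  rw [Finsupp.sum_smul_index' (by simp), Finsupp.mul_sum]
  exact Finsupp.sum_congr fun C _ => by rw [smul_eq_mul, star_mul']; ring

theorem amplitude_sub (v w : Config →₀ ℂ) (Ψ : Config → ℂ) :
    amplitude (v - w) Ψ = amplitude v Ψ - amplitude w Ψ := by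
  have := amplitude_add (v - w) w Ψ
  rw [sub_add_cancel] at this
  rw [this, add_sub_cancel_right]

theorem amplitude_ket (C : Config) (Ψ : Config → ℂ) : amplitude (ket C) Ψ = Ψ C := by
  rw [amplitude_apply, ket, Finsupp.sum_single_index] <;> simp

/-- A vector is orthogonal to itself only if it vanishes, so the normalized projectors are not
degenerate. -/
theorem amplitude_self {v : Config →₀ ℂ} (h : amplitude v v = 0) : v = 0 := by
  rw [amplitude_apply, Finsupp.sum] at h
  have h1 : ∀ C, star (v C) * v C = ((‖v C‖ ^ 2 : ℝ) : ℂ) := fun C => by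
    have := Complex.conj_mul' (v C)
    push_cast
    exact this
  simp only [h1] at h
  rw [← Complex.ofReal_sum, Complex.ofReal_eq_zero,
    Finset.sum_eq_zero_iff_of_nonneg fun C _ => by positivity] at h
  ext C
  by_cases hC : C ∈ v.support
  · simpa using h C hC
  · simpa using hC

theorem mem_zeroEnergy_iff {d : ℂ} {Ψ : Config → ℂ} :
    Ψ ∈ zeroEnergy d ↔ ∀ v, Penalized d v → amplitude v Ψ = 0 := by
  simp only [zeroEnergy, Submodule.mem_iInf, LinearMap.mem_ker, Subtype.forall]
  refine forall₂_congr fun v _ => ?_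
  rcases eq_or_ne v 0 with rfl | hv
  · simp [projector, amplitude]
  · have h1 : amplitude v v ≠ 0 := fun h => hv (amplitude_self h)
    have h2 : (v : Config → ℂ) ≠ 0 := fun h => hv (DFunLike.coe_injective h)
    simp [projector, h1, h2]

/-- The wavefunctions that are invariant under isotopies and multiplied by `d` when a small loop
is added. -/
structure IsSkein (d : ℂ) (Ψ : Config → ℂ) : Prop where
  move {m n : ℕ} {P Q : Word m n} (X : Word n m) : Move P Q → Ψ (close P X) = Ψ (close Q X)
  rotate {m n : ℕ} (X : Word m n) (Y : Word n m) : Ψ (close X Y) = Ψ (close Y X)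
  loop (n i : ℕ) (h : i ≤ n) (X : Word n n) :
    Ψ (close (two (.birth n i h) (.death n i h)) X) = d * Ψ (close (.nil n) X)

/-- On `n + 3` strands, a maximum at `a` and, above it, a minimum at `b`. -/
def hook {n : ℕ} (a b : ℕ) (ha : a ≤ n + 1) (hb : b ≤ n + 1) : Word (n + 3) (n + 3) :=
  two (.death (n + 1) a ha) (.birth (n + 1) b hb)

/-- The Jones-Wenzl combination of the values of a wavefunction. -/
def jwSum (d : ℂ) (Ψ : Config → ℂ) (n i : ℕ) (h : i ≤ n) (X : Word (n + 3) (n + 3)) : ℂ :=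
  Ψ (close (.nil (n + 3)) X) +
    Ψ (close (hook i (i + 1) (by omega) (by omega)) X) +
    Ψ (close (hook (i + 1) i (by omega) (by omega)) X) -
    d * (Ψ (close (hook i i (by omega) (by omega)) X) +
      Ψ (close (hook (i + 1) (i + 1) (by omega) (by omega)) X))

theorem amplitude_jonesWenzl (d : ℂ) (Ψ : Config → ℂ) (n i : ℕ) (h : i ≤ n)
    (X : Word (n + 3) (n + 3)) : amplitude (jonesWenzl d n i h X) Ψ = jwSum d Ψ n i h X := by
  simp only [jonesWenzl, amplitude_sub, amplitude_add, amplitude_smul, amplitude_ket, star_star]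
  rfl

/-- The zero-energy conditions as linear relations between values of the wavefunction. -/
theorem mem_zeroEnergy {d : ℂ} {Ψ : Config → ℂ} : Ψ ∈ zeroEnergy d ↔
    IsSkein d Ψ ∧ ∀ n i h X, jwSum d Ψ n i h X = 0 := by
  rw [mem_zeroEnergy_iff]
  constructor
  · intro H
    refine ⟨⟨fun X h => ?_, fun X Y => ?_, fun n i h X => ?_⟩, fun n i h X => ?_⟩
    · have := H _ (.isotopy X h)
      rwa [amplitude_sub, amplitude_ket, amplitude_ket, sub_eq_zero] at this
    · have := H _ (.rotate X Y)
      rwa [amplitude_sub, amplitude_ket, amplitude_ket, sub_eq_zero] at this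
    · have := H _ (.smallLoop n i h X)
      rw [amplitude_sub, amplitude_smul, amplitude_ket, amplitude_ket, sub_eq_zero, star_star] at this
      exact this.symm
    · rw [← amplitude_jonesWenzl]
      exact H _ (.jonesWenzl n i h X)
  · rintro ⟨h1, h2⟩ v hv
    cases hv with
    | isotopy X h => rw [amplitude_sub, amplitude_ket, amplitude_ket, h1.move X h, sub_self]
    | rotate X Y => rw [amplitude_sub, amplitude_ket, amplitude_ket, h1.rotate X Y, sub_self]
    | smallLoop n i h X =>
      rw [amplitude_sub, amplitude_smul, amplitude_ket, amplitude_ket, star_star,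
        h1.loop n i h X, sub_self]
    | jonesWenzl n i h X => rw [amplitude_jonesWenzl, h2]

theorem isSkein_stateOf (d : ℂ) {ψ : ℤ × ℤ → ℂ} (hψ : ∀ v, ψ (-v) = ψ v) :
    IsSkein d (stateOf d ψ) := by
  refine ⟨fun X h => ?_, fun X Y => ?_, fun n i h X => ?_⟩
  · rw [stateOf, stateOf, turnWindings_move h]
  · rw [stateOf, stateOf, turnWindings_rotate]
  · obtain ⟨u, g, k, hu, he⟩ := (close (.nil n) X).isStraight
    rw [stateOf, stateOf, turnWindings_smallLoop, he, ← signSums_cons,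
      value_signSums hψ d hu (parallel_straightTurned u g k), value_signSums hψ d hu]
    · rw [Multiset.card_cons, windingCount, Multiset.filter_cons_of_neg _ (by simp), windingCount]
      ring
    · intro w hw
      rcases Multiset.mem_cons.1 hw with rfl | hw
      · exact Or.inr ⟨rfl, by norm_num⟩
      · exact parallel_straightTurned u g k w hw

theorem hasWinding_congr {C C' : Config} (h : C.windings = C'.windings) {v : ℤ × ℤ}
    (hv : C.HasWinding v) : C'.HasWinding v := by
  obtain ⟨u, g, k, hu, he⟩ := C.isStraight
  have he := IsStraight.windings he
  rw [hasWinding_iff hu he] at hv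
  rwa [hasWinding_iff hu (h ▸ he)]

theorem loops_congr {C C' : Config} (h : C.windings = C'.windings) : C.loops = C'.loops := by
  obtain ⟨u, g, k, hu, he⟩ := C.isStraight
  have he := IsStraight.windings he
  rw [loops_eq hu he, loops_eq hu (h ▸ he)]

theorem windings_smallLoop_straight {n i : ℕ} (h : i ≤ n) {X : Word n n} {u : ℤ × ℤ} {g k : ℕ}
    (he : (close (.nil n) X).windings = signSums (straight u g k)) :
    (close (two (.birth n i h) (.death n i h)) X).windings = signSums (straight u g (k + 1)) := by
  rw [windings_smallLoop, he, straight, straight, Multiset.replicate_succ, Multiset.add_cons,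
    signSums_cons]
  simp

/-- The straight configuration with winding numbers `(n, y)`. -/
def normalForm (n : ℕ) (y : ℤ) : Config :=
  match n with
  | 0 => ⟨0, hPow y.natAbs⟩
  | n + 1 => ⟨n + 1, if 0 ≤ y then rightPow n y.natAbs else leftPow n y.natAbs⟩

theorem normalForm_unique {n n' : ℕ} {y y' : ℤ}
    (h : ((n : ℤ), y) = ((n' : ℤ), y') ∨ ((n : ℤ), y) = -((n' : ℤ), y')) :
    normalForm n y = normalForm n' y' := by
  rcases h with h | h
  · simp only [Prod.mk.injEq, Nat.cast_inj] at h
    rw [h.1, h.2]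
  · simp only [Prod.neg_mk, Prod.mk.injEq] at h
    obtain rfl : n = 0 := by omega
    obtain rfl : n' = 0 := by omega
    rw [h.2, normalForm, normalForm, Int.natAbs_neg]

/-- The value at a configuration is determined by the value at the straight configuration with the
same winding numbers. -/
theorem IsSkein.exists_normalForm {d : ℂ} {Ψ : Config → ℂ} (hΨ : IsSkein d Ψ) (C : Config) :
    ∃ (n : ℕ) (y : ℤ), C.HasWinding ((n : ℤ), y) ∧
      Ψ C * d ^ (normalForm n y).loops = Ψ (normalForm n y) * d ^ C.loops := by
  refine config_induction (p := fun C => ∃ (n : ℕ) (y : ℤ), C.HasWinding ((n : ℤ), y) ∧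
      Ψ C * d ^ (normalForm n y).loops = Ψ (normalForm n y) * d ^ C.loops) ?_ ?_ ?_ ?_ ?_ ?_ C
  · intro m n P Q X h
    have h1 := windings_move h X
    rw [hΨ.move X h, loops_congr h1]
    exact ⟨fun ⟨k, y, h2, h3⟩ => ⟨k, y, hasWinding_congr h1 h2, h3⟩,
      fun ⟨k, y, h2, h3⟩ => ⟨k, y, hasWinding_congr h1.symm h2, h3⟩⟩
  · rintro m n X Y ⟨k, y, h2, h3⟩
    have h1 := windings_rotate X Y
    exact ⟨k, y, hasWinding_congr h1 h2, by rw [← hΨ.rotate, ← loops_congr h1, h3]⟩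
  · rintro n i h X ⟨k, y, h2, h3⟩
    obtain ⟨u, g, l, hu, he⟩ := (close (.nil n) X).isStraight
    have he := IsStraight.windings he
    have he' := windings_smallLoop_straight h he
    refine ⟨k, y, ?_, ?_⟩
    · rw [hasWinding_iff hu he] at h2
      rwa [hasWinding_iff hu he']
    · rw [loops_eq hu he] at h3
      rw [hΨ.loop, loops_eq hu he', ← add_assoc, pow_succ]
      linear_combination d * h3
  · intro n k
    refine ⟨n + 1, k, hasWinding_rightPow n k, ?_⟩
    simp [normalForm]
  · intro n k
    refine ⟨n + 1, -k, hasWinding_leftPow n k, ?_⟩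
    rcases Nat.eq_zero_or_pos k with rfl | hk
    · simp [normalForm, leftPow, rightPow]
    · simp [normalForm, hk.ne']
  · intro k
    exact ⟨0, k, by simpa using hasWinding_hPow k, by simp [normalForm]⟩

/-- The amplitude of the configurations with winding numbers `v`. -/
def amplitudeOf (d : ℂ) (Ψ : Config → ℂ) (v : ℤ × ℤ) : ℂ :=
  Ψ (exists_config v).choose * (d ^ (exists_config v).choose.loops)⁻¹

theorem IsSkein.eq_amplitudeOf {d : ℂ} (hd : d ≠ 0) {Ψ : Config → ℂ} (hΨ : IsSkein d Ψ) {C : Config}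
    {v : ℤ × ℤ} (hv : C.HasWinding v) : Ψ C = amplitudeOf d Ψ v * d ^ C.loops := by
  have hv' := (exists_config v).choose_spec
  rw [amplitudeOf]
  generalize (exists_config v).choose = C' at hv'
  obtain ⟨n, y, h1, h2⟩ := hΨ.exists_normalForm C
  obtain ⟨n', y', h1', h2'⟩ := hΨ.exists_normalForm C'
  have e : normalForm n y = normalForm n' y' := by
    refine normalForm_unique ?_
    obtain ⟨w, hw⟩ := exists_hasWinding C
    obtain ⟨w', hw'⟩ := exists_hasWinding C'
    rw [hw] at h1 hv
    rw [hw'] at h1' hv'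
    have e : w = w' ∨ w = -w' := by
      rcases hv with hv | hv <;> rcases hv' with hv' | hv' <;> rw [hv] at hv'
      · exact Or.inl hv'
      · exact Or.inr hv'
      · exact Or.inr (neg_eq_iff_eq_neg.1 hv')
      · exact Or.inl (neg_injective hv')
    rcases h1 with h1 | h1 <;> rcases h1' with h1' | h1' <;> rcases e with rfl | rfl <;>
      simp [h1, h1']
  rw [e] at h2
  have p1 := pow_ne_zero C'.loops hd
  have p2 := pow_ne_zero (normalForm n' y').loops hd
  field_simp
  refine mul_right_cancel₀ p2 ?_
  linear_combination d ^ C'.loops * h2 - d ^ C.loops * h2'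

theorem IsSkein.amplitudeOf_neg {d : ℂ} (hd : d ≠ 0) {Ψ : Config → ℂ} (hΨ : IsSkein d Ψ)
    (v : ℤ × ℤ) : amplitudeOf d Ψ (-v) = amplitudeOf d Ψ v := by
  obtain ⟨C, hC⟩ := exists_config v
  have h1 := hΨ.eq_amplitudeOf hd hC
  have h2 := hΨ.eq_amplitudeOf hd (HasWinding.neg hC)
  exact mul_right_cancel₀ (pow_ne_zero C.loops hd) (h2.symm.trans h1)

/-- Isotopies and small loops alone force the form `ψ(n_x, n_y) d ^ |C|`; the constraints on `ψ`
come from the Jones-Wenzl state. -/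
theorem IsSkein.eq_stateOf {d : ℂ} (hd : d ≠ 0) {Ψ : Config → ℂ} (hΨ : IsSkein d Ψ) :
    Ψ = stateOf d (amplitudeOf d Ψ) := by
  ext C
  obtain ⟨v, hv⟩ := exists_hasWinding C
  have hv := (hv v).2 (Or.inl rfl)
  rw [hΨ.eq_amplitudeOf hd hv, stateOf_eq (hΨ.amplitudeOf_neg hd) hv]

/-! ### Tangles with six ends -/

/-- The flow out of a disc with six ends, numbered cyclically, with its winding and turning numbers. -/
abbrev Flow := (Fin 6 → ℤ) × ((ℤ × ℤ) × ℤ)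

/-- The flow that leaves at `p` and enters at `q`. -/
def arc (p q : Fin 6) : Fin 6 → ℤ := Pi.single p 1 - Pi.single q 1

/-- The turning, in sixths of a turn, of a chord of a regular hexagon from the corner `p` to the
corner `q`, if the strands meet the hexagon radially. -/
def turn (p q : Fin 6) : ℤ := ((q - p : Fin 6) : ℕ) - 3

/-- Join the six ends by chords. Of the orientations in `M`, those are kept that match along every
chord, and the turning of the chords is added. -/
def closeUp (P : List (Fin 6 × Fin 6)) (M : Multiset Flow) : Multiset ((ℤ × ℤ) × ℤ) :=
  (M.filter fun g => ∀ p ∈ P, g.1 p.1 + g.1 p.2 = 0).map fun g =>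
    g.2 + (0, (P.map fun p => g.1 p.1 * turn p.1 p.2).sum)

/-- The planar connection with one chord between opposite ends. -/
def side (r : Fin 6) : List (Fin 6 × Fin 6) := [(r, r + 3), (r + 1, r + 2), (r + 4, r + 5)]

/-- The planar connection of neighbouring ends. -/
def pairs (r : Fin 6) : List (Fin 6 × Fin 6) := [(r, r + 1), (r + 2, r + 3), (r + 4, r + 5)]

theorem closeUp_add (P : List (Fin 6 × Fin 6)) (M N : Multiset Flow) :
    closeUp P (M + N) = closeUp P M + closeUp P N := by
  simp [closeUp]

theorem closeUp_shift (P : List (Fin 6 × Fin 6)) {K : Multiset Flow} (hK : ∀ k ∈ K, k.1 = 0)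
    (g : Flow) : closeUp P ((signSums K).map (g + ·)) =
      if ∀ p ∈ P, g.1 p.1 + g.1 p.2 = 0 then
        (signSums (K.map Prod.snd)).map
          ((g.2 + (0, (P.map fun p => g.1 p.1 * turn p.1 p.2).sum)) + ·)
      else 0 := by
  have h0 : ∀ x ∈ signSums K, x.1 = 0 := by
    intro x hx
    have e : (Prod.fst : Flow → Fin 6 → ℤ) = AddMonoidHom.fst (Fin 6 → ℤ) ((ℤ × ℤ) × ℤ) := rfl
    have h1 : x.1 ∈ signSums (K.map Prod.fst) := by
      rw [e, signSums_map]
      exact Multiset.mem_map_of_mem _ hx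
    have h2 : ∀ L : Multiset (Fin 6 → ℤ), (∀ k ∈ L, k = 0) → ∀ x ∈ signSums L, x = 0 := by
      intro L
      induction L using Multiset.induction_on with
      | empty => intro _ x hx; simpa using hx
      | cons a L ih =>
        intro hL x hx
        obtain rfl := hL a (Multiset.mem_cons_self _ _)
        rw [signSums_cons, Multiset.mem_add, Multiset.mem_map, Multiset.mem_map] at hx
        have ih := ih fun k hk => hL k (Multiset.mem_cons_of_mem hk)
        rcases hx with ⟨y, hy, rfl⟩ | ⟨y, hy, rfl⟩ <;> simp [ih y hy]
    refine h2 _ ?_ _ h1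
    intro k hk
    obtain ⟨k', hk', rfl⟩ := Multiset.mem_map.1 hk
    exact hK k' hk'
  have e : (Prod.snd : Flow → (ℤ × ℤ) × ℤ) = AddMonoidHom.snd (Fin 6 → ℤ) ((ℤ × ℤ) × ℤ) := rfl
  rw [closeUp, Multiset.filter_map, Multiset.map_map]
  split_ifs with h
  · rw [e, signSums_map, Multiset.map_map, Multiset.filter_eq_self.2]
    · refine Multiset.map_congr rfl fun x hx => ?_
      simp only [Function.comp, Prod.fst_add, h0 x hx, add_zero, Prod.snd_add,
        AddMonoidHom.coe_snd]
      abel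
    · intro x hx
      simpa [h0 x hx] using h
  · rw [Multiset.filter_eq_nil.2, Multiset.map_zero]
    intro x hx
    simpa [h0 x hx] using h

theorem closeUp_cons_cons_cons (P : List (Fin 6 × Fin 6)) (K : Multiset Flow) (f g h : Flow) : closeUp P (signSums (f ::ₘ g ::ₘ h ::ₘ K)) =
      closeUp P ((signSums K).map ((f + (g + h)) + ·)) +
      closeUp P ((signSums K).map ((f + (g + -h)) + ·)) +
      closeUp P ((signSums K).map ((f + (-g + h)) + ·)) +
      closeUp P ((signSums K).map ((f + (-g + -h)) + ·)) +
      closeUp P ((signSums K).map ((-f + (g + h)) + ·)) +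
      closeUp P ((signSums K).map ((-f + (g + -h)) + ·)) +
      closeUp P ((signSums K).map ((-f + (-g + h)) + ·)) +
      closeUp P ((signSums K).map ((-f + (-g + -h)) + ·)) := by
  simp only [← closeUp_add, signSums_cons, Multiset.map_add, Multiset.map_map, Function.comp_def,
    add_assoc]


/-- The determinant of two vectors of the lattice. -/
def det (a b : ℤ × ℤ) : ℤ := a.1 * b.2 - a.2 * b.1

/-- The antisymmetric form on flows through a cyclic sequence of six ends that counts crossings. -/
def cyc (c c' : Fin 6 → ℤ) : ℤ :=
  ∑ i : Fin 6, ∑ j : Fin 6, if i < j then c i * c' j - c j * c' i else 0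

theorem exists_parallel {L : Multiset ((ℤ × ℤ) × ℤ)} (h : IsStraight (signSums L)) :
    ∃ u, Primitive u ∧ ∀ w ∈ L, Parallel u w := by
  obtain ⟨u, g, k, hu, h⟩ := h
  exact ⟨u, hu, (parallel_of_signSums_eq hu h).1⟩

theorem Primitive.isUnit_of_smul {u : ℤ × ℤ} {β : ℤ} (h : Primitive (β • u)) : β = 1 ∨ β = -1 := by
  obtain ⟨a, b, hab⟩ := h
  refine Int.isUnit_iff.1 (IsUnit.of_mul_eq_one (a * u.1 + b * u.2) ?_)
  simp only [Prod.smul_fst, Prod.smul_snd, smul_eq_mul] at hab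
  linear_combination hab

/-- If all loops are multiples of one primitive vector, then they are contractible or parallel to
it. -/
theorem parallel_of_smul {u : ℤ × ℤ} {L : Multiset ((ℤ × ℤ) × ℤ)}
    (hS : IsStraight (signSums L)) (hL : ∀ w ∈ L, ∃ β : ℤ, w.1 = β • u) :
    ∀ w ∈ L, Parallel u w := by
  obtain ⟨u', hu', h⟩ := exists_parallel hS
  intro w hw
  obtain ⟨β, hβ⟩ := hL w hw
  rcases h w hw with (h1 | h1) | h1
  · subst h1
    obtain rfl : u' = β • u := hβ
    rcases hu'.isUnit_of_smul with rfl | rfl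
    · left; left; simp
    · left; right; simp
  · subst h1
    obtain rfl : u' = (-β) • u := by
      rw [neg_smul, ← hβ]
      simp
    rcases hu'.isUnit_of_smul with h2 | h2
    · left; right; simp [h2]
    · left; left; simp [h2]
  · exact Or.inr h1

theorem windingCount_cons {u : ℤ × ℤ} (hu : Primitive u) {w : (ℤ × ℤ) × ℤ} {β : ℤ}
    (hw : w.1 = β • u) (hβ : β = 0 ∨ β = 1 ∨ β = -1) (L : Multiset ((ℤ × ℤ) × ℤ)) :
    windingCount (w ::ₘ L) = windingCount L + β.natAbs := by
  have := hu.ne_zero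
  rw [windingCount, Multiset.filter_cons, hw, windingCount]
  rcases hβ with rfl | rfl | rfl <;> simp [this, add_comm]

theorem Parallel.exists_coeff {u : ℤ × ℤ} {w : (ℤ × ℤ) × ℤ} (h : Parallel u w) :
    ∃ β : ℤ, (β = 0 ∨ β = 1 ∨ β = -1) ∧ w.1 = β • u := by
  rcases h with (rfl | rfl) | ⟨h, -⟩
  · exact ⟨1, by simp, by simp⟩
  · exact ⟨-1, by simp, by simp⟩
  · exact ⟨0, by simp, by simp [h]⟩

theorem windingCount_zero {L : Multiset ((ℤ × ℤ) × ℤ)} (h : ∀ w ∈ L, w.1 = 0) :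
    windingCount L = 0 := by
  rw [windingCount, Multiset.filter_eq_nil.2 (by simpa using h), Multiset.card_zero]

section Values

variable {ψ : ℤ × ℤ → ℂ} (d : ℂ)

theorem value_one (hψ : ∀ v, ψ (-v) = ψ v) {w : (ℤ × ℤ) × ℤ} {K : Multiset ((ℤ × ℤ) × ℤ)}
    (hK : ∀ k ∈ K, k.1 = 0) (hS : IsStraight (signSums (w ::ₘ K))) :
    value ψ d (signSums (w ::ₘ K)) = ψ w.1 * d ^ (K.card + 1) := by
  obtain ⟨u, hu, h⟩ := exists_parallel hS
  obtain ⟨β, hβ, h1⟩ := (h w (Multiset.mem_cons_self _ _)).exists_coeff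
  rw [value_signSums hψ d hu h, windingCount_cons hu h1 hβ, windingCount_zero hK, h1,
    Multiset.card_cons]
  rcases hβ with rfl | rfl | rfl <;> simp [hψ]

theorem value_two (hψ : ∀ v, ψ (-v) = ψ v) {w w' : (ℤ × ℤ) × ℤ} {K : Multiset ((ℤ × ℤ) × ℤ)}
    (hK : ∀ k ∈ K, k.1 = 0) (hw : w'.1 = w.1 ∨ w'.1 = -w.1)
    (hS : IsStraight (signSums (w ::ₘ w' ::ₘ K))) :
    value ψ d (signSums (w ::ₘ w' ::ₘ K)) = ψ (2 • w.1) * d ^ (K.card + 2) := by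
  obtain ⟨u, hu, h⟩ := exists_parallel hS
  obtain ⟨β, hβ, h1⟩ := (h w (Multiset.mem_cons_self _ _)).exists_coeff
  obtain ⟨γ, hγ, h2⟩ : ∃ γ, (γ = β ∨ γ = -β) ∧ w'.1 = γ • u := by
    rcases hw with hw | hw
    · exact ⟨β, by simp, hw.trans h1⟩
    · exact ⟨-β, by simp, by rw [hw, h1, neg_smul]⟩
  rw [value_signSums hψ d hu h, windingCount_cons hu h1 hβ, windingCount_cons hu h2 (by omega),
    windingCount_zero hK, h1, Multiset.card_cons, Multiset.card_cons]
  have e : γ.natAbs = β.natAbs := by omega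
  rw [e]
  rcases hβ with rfl | rfl | rfl
  · simp
  · simp
  · rw [← hψ]
    simp

end Values

/-- The sum over the five planar connections in the Jones-Wenzl state. -/
def jwValue (ψ : ℤ × ℤ → ℂ) (d : ℂ) (M : Multiset Flow) : ℂ :=
  value ψ d (closeUp (side 0) M) + value ψ d (closeUp (side 1) M) +
    value ψ d (closeUp (side 2) M) -
    d * (value ψ d (closeUp (pairs 0) M) + value ψ d (closeUp (pairs 1) M))

/-- The strands of a loop configuration on the torus outside a disc with six ends. The flow is
conserved; the intersection number of two strands, computed from the cyclic order of their ends and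
from their windings, vanishes, as the strands are disjoint outside the disc; and the five planar
connections inside the disc give disjoint simple closed curves. -/
structure IsTangle (L : Multiset Flow) : Prop where
  flow : ∀ g ∈ L, ∑ k, g.1 k = 0
  cross : ∀ g ∈ L, ∀ h ∈ L, cyc g.1 h.1 = -2 * det g.2.1 h.2.1
  side0 : IsStraight (closeUp (side 0) (signSums L))
  side1 : IsStraight (closeUp (side 1) (signSums L))
  side2 : IsStraight (closeUp (side 2) (signSums L))
  pairs0 : IsStraight (closeUp (pairs 0) (signSums L))
  pairs1 : IsStraight (closeUp (pairs 1) (signSums L))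

/-- The constraints on amplitudes, for all bases of the lattice. -/
structure IsAmplitude (d : ℂ) (ψ : ℤ × ℤ → ℂ) : Prop where
  even : ∀ v, ψ (-v) = ψ v
  three : ∀ a b, det a b = 1 ∨ det a b = -1 →
    ψ (2 • a + 2 • b) + ψ (2 • a) + ψ (2 • b) - 2 * ψ 0 = 0
  two : ∀ a b, det a b = 1 ∨ det a b = -1 → ψ (a + 2 • b) + ψ (a - 2 • b) - d * ψ a = 0
  one : ∀ (u : ℤ × ℤ), Primitive u → ∀ n : ℕ, ψ (((3 + n : ℕ) : ℤ) • u) = ψ (((1 + n : ℕ) : ℤ) • u)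

/-- The Jones-Wenzl sum vanishes if the strands outside the disc join the ends `p i` and `q i`. -/
def JWZero (d : ℂ) (ψ : ℤ × ℤ → ℂ) (p₁ q₁ p₂ q₂ p₃ q₃ : Fin 6) : Prop :=
  ∀ (w₁ w₂ w₃ : (ℤ × ℤ) × ℤ) (K : Multiset Flow), (∀ k ∈ K, k.1 = 0) →
    IsTangle ((arc p₁ q₁, w₁) ::ₘ (arc p₂ q₂, w₂) ::ₘ (arc p₃ q₃, w₃) ::ₘ K) →
    jwValue ψ d (signSums ((arc p₁ q₁, w₁) ::ₘ (arc p₂ q₂, w₂) ::ₘ (arc p₃ q₃, w₃) ::ₘ K)) = 0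

theorem coe_neg_five : (((-5 : Fin 6) : ℕ) : ℤ) = 1 := rfl

set_option maxHeartbeats 2000000 in
/-- The ends are joined to neighbouring ones. -/
theorem closeUp_pairs (a a' s b b' s' c c' s'' : ℤ) {K : Multiset Flow} (hK : ∀ k ∈ K, k.1 = 0)
    {L : Multiset Flow} (hL : L = (arc 0 1, ((a, a'), s)) ::ₘ
      (arc 2 3, ((b, b'), s')) ::ₘ (arc 4 5, ((c, c'), s'')) ::ₘ K) :
    closeUp (side 0) (signSums L) =
      signSums (((a + b, a' + b'), s + s' + 2) ::ₘ ((c, c'), s'' - 2) ::ₘ K.map Prod.snd) ∧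
    closeUp (side 1) (signSums L) =
      signSums (((a + c, a' + c'), s + s'' + 2) ::ₘ ((b, b'), s' - 2) ::ₘ K.map Prod.snd) ∧
    closeUp (side 2) (signSums L) =
      signSums (((b + c, b' + c'), s' + s'' + 2) ::ₘ ((a, a'), s - 2) ::ₘ K.map Prod.snd) ∧
    closeUp (pairs 0) (signSums L) =
      signSums (((a, a'), s - 2) ::ₘ ((b, b'), s' - 2) ::ₘ ((c, c'), s'' - 2) ::ₘ K.map Prod.snd) ∧
    closeUp (pairs 1) (signSums L) =
      signSums (((a + b + c, a' + b' + c'), s + s' + s'' + 6) ::ₘ K.map Prod.snd) := by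
  rw [hL]
  refine ⟨?_, ?_, ?_, ?_, ?_⟩
  all_goals
    rw [closeUp_cons_cons_cons]
    simp only [closeUp_shift _ hK, signSums_cons, Multiset.map_add, Multiset.map_map,
      Function.comp_def]
    simp [pairs, side, turn, arc, Pi.single_apply, ← add_assoc, coe_neg_five]
    ring_nf
    try abel

set_option maxHeartbeats 2000000 in
/-- One arc joins opposite ends, and the strands do not cross. -/
theorem closeUp_side (a a' s b b' s' c c' s'' : ℤ) {K : Multiset Flow} (hK : ∀ k ∈ K, k.1 = 0)
    {L : Multiset Flow} (hL : L = (arc 0 3, ((a, a'), s)) ::ₘ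
      (arc 1 2, ((b, b'), s')) ::ₘ (arc 4 5, ((c, c'), s'')) ::ₘ K) :
    closeUp (side 0) (signSums L) =
      signSums (((a, a'), s) ::ₘ ((b, b'), s' - 2) ::ₘ ((c, c'), s'' - 2) ::ₘ K.map Prod.snd) ∧
    closeUp (side 1) (signSums L) =
      signSums (((a - b + c, a' - b' + c'), s - s' + s'') ::ₘ K.map Prod.snd) ∧
    closeUp (side 2) (signSums L) =
      signSums (((a - b + c, a' - b' + c'), s - s' + s'') ::ₘ K.map Prod.snd) ∧
    closeUp (pairs 0) (signSums L) =
      signSums (((a - b, a' - b'), s - s' - 4) ::ₘ ((c, c'), s'' - 2) ::ₘ K.map Prod.snd) ∧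
    closeUp (pairs 1) (signSums L) =
      signSums (((a + c, a' + c'), s + s'' + 4) ::ₘ ((b, b'), s' - 2) ::ₘ K.map Prod.snd) := by
  rw [hL]
  refine ⟨?_, ?_, ?_, ?_, ?_⟩
  all_goals
    rw [closeUp_cons_cons_cons]
    simp only [closeUp_shift _ hK, signSums_cons, Multiset.map_add, Multiset.map_map,
      Function.comp_def]
    simp [pairs, side, turn, arc, Pi.single_apply, ← add_assoc, coe_neg_five]
    ring_nf
    try abel

set_option maxHeartbeats 2000000 in
/-- Two arcs cross. -/
theorem closeUp_one (a a' s b b' s' c c' s'' : ℤ) {K : Multiset Flow} (hK : ∀ k ∈ K, k.1 = 0)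
    {L : Multiset Flow} (hL : L = (arc 0 1, ((a, a'), s)) ::ₘ
      (arc 2 4, ((b, b'), s')) ::ₘ (arc 3 5, ((c, c'), s'')) ::ₘ K) :
    closeUp (side 0) (signSums L) =
      signSums (((a + b - c, a' + b' - c'), s + s' - s'' + 4) ::ₘ K.map Prod.snd) ∧
    closeUp (side 1) (signSums L) =
      signSums (((a - b + c, a' - b' + c'), s - s' + s'' + 4) ::ₘ K.map Prod.snd) ∧
    closeUp (side 2) (signSums L) =
      signSums (((b + c, b' + c'), s' + s'' - 2) ::ₘ ((a, a'), s - 2) ::ₘ K.map Prod.snd) ∧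
    closeUp (pairs 0) (signSums L) =
      signSums (((b - c, b' - c'), s' - s'') ::ₘ ((a, a'), s - 2) ::ₘ K.map Prod.snd) ∧
    closeUp (pairs 1) (signSums L) =
      signSums (((a + b + c, a' + b' + c'), s + s' + s'' + 2) ::ₘ K.map Prod.snd) := by
  rw [hL]
  refine ⟨?_, ?_, ?_, ?_, ?_⟩
  all_goals
    rw [closeUp_cons_cons_cons]
    simp only [closeUp_shift _ hK, signSums_cons, Multiset.map_add, Multiset.map_map,
      Function.comp_def]
    simp [pairs, side, turn, arc, Pi.single_apply, ← add_assoc, coe_neg_five]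
    ring_nf
    try abel

set_option maxHeartbeats 2000000 in
/-- One arc crosses the two others. -/
theorem closeUp_two (a a' s b b' s' c c' s'' : ℤ) {K : Multiset Flow} (hK : ∀ k ∈ K, k.1 = 0)
    {L : Multiset Flow} (hL : L = (arc 0 3, ((a, a'), s)) ::ₘ
      (arc 1 5, ((b, b'), s')) ::ₘ (arc 2 4, ((c, c'), s'')) ::ₘ K) :
    closeUp (side 0) (signSums L) =
      signSums (((b - c, b' - c'), s' - s'' - 4) ::ₘ ((a, a'), s) ::ₘ K.map Prod.snd) ∧
    closeUp (side 1) (signSums L) =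
      signSums (((a + b + c, a' + b' + c'), s + s' + s'') ::ₘ K.map Prod.snd) ∧
    closeUp (side 2) (signSums L) =
      signSums (((a - b - c, a' - b' - c'), s - s' - s'') ::ₘ K.map Prod.snd) ∧
    closeUp (pairs 0) (signSums L) =
      signSums (((a - b + c, a' - b' + c'), s - s' + s'' - 2) ::ₘ K.map Prod.snd) ∧
    closeUp (pairs 1) (signSums L) =
      signSums (((a + b - c, a' + b' - c'), s + s' - s'' + 2) ::ₘ K.map Prod.snd) := by
  rw [hL]
  refine ⟨?_, ?_, ?_, ?_, ?_⟩
  all_goals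
    rw [closeUp_cons_cons_cons]
    simp only [closeUp_shift _ hK, signSums_cons, Multiset.map_add, Multiset.map_map,
      Function.comp_def]
    simp [pairs, side, turn, arc, Pi.single_apply, ← add_assoc, coe_neg_five]
    ring_nf
    try abel

set_option maxHeartbeats 2000000 in
/-- Opposite ends are joined. -/
theorem closeUp_three (a a' s b b' s' c c' s'' : ℤ) {K : Multiset Flow} (hK : ∀ k ∈ K, k.1 = 0)
    {L : Multiset Flow} (hL : L = (arc 0 3, ((a, a'), s)) ::ₘ
      (arc 1 4, ((b, b'), s')) ::ₘ (arc 2 5, ((c, c'), s'')) ::ₘ K) :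
    closeUp (side 0) (signSums L) =
      signSums (((b - c, b' - c'), s' - s'') ::ₘ ((a, a'), s) ::ₘ K.map Prod.snd) ∧
    closeUp (side 1) (signSums L) =
      signSums (((a + c, a' + c'), s + s'') ::ₘ ((b, b'), s') ::ₘ K.map Prod.snd) ∧
    closeUp (side 2) (signSums L) =
      signSums (((a - b, a' - b'), s - s') ::ₘ ((c, c'), s'') ::ₘ K.map Prod.snd) ∧
    closeUp (pairs 0) (signSums L) =
      signSums (((a - b + c, a' - b' + c'), s - s' + s'' - 6) ::ₘ K.map Prod.snd) ∧
    closeUp (pairs 1) (signSums L) =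
      signSums (((a - b + c, a' - b' + c'), s - s' + s'' + 6) ::ₘ K.map Prod.snd) := by
  rw [hL]
  refine ⟨?_, ?_, ?_, ?_, ?_⟩
  all_goals
    rw [closeUp_cons_cons_cons]
    simp only [closeUp_shift _ hK, signSums_cons, Multiset.map_add, Multiset.map_map,
      Function.comp_def]
    simp [pairs, side, turn, arc, Pi.single_apply, ← add_assoc, coe_neg_five]
    ring_nf
    try abel

/-! ### The Jones-Wenzl sum of a tangle -/

theorem coeff_sub {u x y : ℤ × ℤ} {β γ : ℤ} (hx : x = β • u) (hy : y = γ • u) :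
    x - y = (β - γ) • u := by rw [hx, hy, sub_smul]

theorem coeff_add {u x y : ℤ × ℤ} {β γ : ℤ} (hx : x = β • u) (hy : y = γ • u) :
    x + y = (β + γ) • u := by rw [hx, hy, add_smul]

theorem Parallel.coeff {u : ℤ × ℤ} (hu : Primitive u) {w : (ℤ × ℤ) × ℤ} (h : Parallel u w) {β : ℤ}
    (hβ : w.1 = β • u) : β = 0 ∨ β = 1 ∨ β = -1 := by
  obtain ⟨γ, h1, h2⟩ := h.exists_coeff
  rwa [hu.smul_injective (hβ.symm.trans h2)]

/-- If all loops are multiples of a primitive vector, the value depends on the number of those that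
are noncontractible. -/
theorem value_of_smul {d : ℂ} {ψ : ℤ × ℤ → ℂ} (hψ : ∀ v, ψ (-v) = ψ v) {u : ℤ × ℤ}
    (hu : Primitive u) {L : Multiset ((ℤ × ℤ) × ℤ)} (hS : IsStraight (signSums L))
    (hL : ∀ w ∈ L, ∃ β : ℤ, w.1 = β • u) :
    value ψ d (signSums L) = ψ ((windingCount L : ℤ) • u) * d ^ L.card :=
  value_signSums hψ d hu (parallel_of_smul hS hL)

theorem value_cons {d : ℂ} {ψ : ℤ × ℤ → ℂ} (hψ : ∀ v, ψ (-v) = ψ v) {u : ℤ × ℤ}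
    (hu : Primitive u) {x : ℤ × ℤ} {t : ℤ} {K : Multiset ((ℤ × ℤ) × ℤ)}
    (hS : IsStraight (signSums ((x, t) ::ₘ K)))
    {β : ℤ} (hβ : x = β • u) (hK : ∀ w ∈ K, Parallel u w) :
    (β = 0 ∨ β = 1 ∨ β = -1) ∧ Parallel u (x, t) ∧ value ψ d (signSums ((x, t) ::ₘ K)) =
      ψ (((windingCount K + β.natAbs : ℕ) : ℤ) • u) * d ^ (K.card + 1) := by
  have hL : ∀ w ∈ (x, t) ::ₘ K, ∃ γ : ℤ, w.1 = γ • u := by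
    intro w hw
    rcases Multiset.mem_cons.1 hw with rfl | hw
    · exact ⟨β, hβ⟩
    · obtain ⟨γ, -, h⟩ := (hK w hw).exists_coeff
      exact ⟨γ, h⟩
  have hp := parallel_of_smul hS hL _ (Multiset.mem_cons_self _ _)
  have h1 := hp.coeff hu hβ
  refine ⟨h1, hp, ?_⟩
  rw [value_of_smul hψ hu hS hL, windingCount_cons hu hβ h1, Multiset.card_cons]

theorem value_cons_cons {d : ℂ} {ψ : ℤ × ℤ → ℂ} (hψ : ∀ v, ψ (-v) = ψ v) {u : ℤ × ℤ}
    (hu : Primitive u) {x y : ℤ × ℤ} {t s : ℤ} {K : Multiset ((ℤ × ℤ) × ℤ)}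
    (hS : IsStraight (signSums ((x, t) ::ₘ (y, s) ::ₘ K)))
    {β γ : ℤ} (hβ : x = β • u) (hγ : y = γ • u) (hK : ∀ w ∈ K, Parallel u w) :
    ((β = 0 ∨ β = 1 ∨ β = -1) ∧ (γ = 0 ∨ γ = 1 ∨ γ = -1)) ∧
      (Parallel u (x, t) ∧ Parallel u (y, s)) ∧
      value ψ d (signSums ((x, t) ::ₘ (y, s) ::ₘ K)) =
        ψ (((windingCount K + γ.natAbs + β.natAbs : ℕ) : ℤ) • u) * d ^ (K.card + 2) := by
  have hL : ∀ w ∈ (x, t) ::ₘ (y, s) ::ₘ K, ∃ γ : ℤ, w.1 = γ • u := by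
    intro w hw
    rcases Multiset.mem_cons.1 hw with rfl | hw
    · exact ⟨β, hβ⟩
    rcases Multiset.mem_cons.1 hw with rfl | hw
    · exact ⟨γ, hγ⟩
    · obtain ⟨γ, -, h⟩ := (hK w hw).exists_coeff
      exact ⟨γ, h⟩
  have hp := parallel_of_smul hS hL
  have hp1 := hp _ (Multiset.mem_cons_self _ _)
  have hp2 := hp _ (Multiset.mem_cons_of_mem (Multiset.mem_cons_self _ _))
  have h1 := hp1.coeff hu hβ
  have h2 := hp2.coeff hu hγ
  refine ⟨⟨h1, h2⟩, ⟨hp1, hp2⟩, ?_⟩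
  rw [value_of_smul hψ hu hS hL, windingCount_cons hu hβ h1, windingCount_cons hu hγ h2,
    Multiset.card_cons, Multiset.card_cons]

/-- Without crossings, and with every arc closed up by a chord, all strands are parallel. -/
theorem exists_coeffs {d : ℂ} {ψ : ℤ × ℤ → ℂ} (hψ : ∀ v, ψ (-v) = ψ v) {x y z : ℤ × ℤ}
    {r s t : ℤ} {K : Multiset ((ℤ × ℤ) × ℤ)}
    (hS : IsStraight (signSums ((x, r) ::ₘ (y, s) ::ₘ (z, t) ::ₘ K))) :
    ∃ (u : ℤ × ℤ) (α β γ : ℤ), Primitive u ∧ x = α • u ∧ y = β • u ∧ z = γ • u ∧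
      (α = 0 ∨ α = 1 ∨ α = -1) ∧ (β = 0 ∨ β = 1 ∨ β = -1) ∧ (γ = 0 ∨ γ = 1 ∨ γ = -1) ∧
      (∀ w ∈ K, Parallel u w) ∧
      (Parallel u (x, r) ∧ Parallel u (y, s) ∧ Parallel u (z, t)) ∧
      value ψ d (signSums ((x, r) ::ₘ (y, s) ::ₘ (z, t) ::ₘ K)) =
        ψ (((windingCount K + γ.natAbs + β.natAbs + α.natAbs : ℕ) : ℤ) • u) * d ^ (K.card + 3) := by
  obtain ⟨u, hu, h⟩ := exists_parallel hS
  have p1 := h _ (Multiset.mem_cons_self _ _)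
  have p2 := h _ (Multiset.mem_cons_of_mem (Multiset.mem_cons_self _ _))
  have p3 := h _ (Multiset.mem_cons_of_mem (Multiset.mem_cons_of_mem (Multiset.mem_cons_self _ _)))
  obtain ⟨α, h1, h1'⟩ := p1.exists_coeff
  obtain ⟨β, h2, h2'⟩ := p2.exists_coeff
  obtain ⟨γ, h3, h3'⟩ := p3.exists_coeff
  refine ⟨u, α, β, γ, hu, h1', h2', h3', h1, h2, h3, fun w hw => h w (Multiset.mem_cons_of_mem
    (Multiset.mem_cons_of_mem (Multiset.mem_cons_of_mem hw))), ⟨p1, p2, p3⟩, ?_⟩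
  rw [value_signSums hψ d hu h, windingCount_cons hu h1' h1, windingCount_cons hu h2' h2,
    windingCount_cons hu h3' h3, Multiset.card_cons, Multiset.card_cons, Multiset.card_cons]

/-- Without crossings, the coefficients of the Jones-Wenzl state combine with the weights of the
loops, since `d ^ 2 = 2`. -/
theorem jw_algebra_pairs {d : ℂ} (hd : d ^ 2 = 2) (k : ℕ) {a b c x y : ℂ}
    (h : a + b + c - 2 * x - y = 0) : a * d ^ (k + 2) + b * d ^ (k + 2) + c * d ^ (k + 2) -
      d * (x * d ^ (k + 3) + y * d ^ (k + 1)) = 0 := by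
  linear_combination 2 * d ^ k * h + d ^ k * (a + b + c - (d ^ 2 + 2) * x - y) * hd

theorem jw_algebra_side {d : ℂ} (hd : d ^ 2 = 2) (k : ℕ) {a b x y : ℂ}
    (h : a + b - x - y = 0) : a * d ^ (k + 3) + b * d ^ (k + 1) + b * d ^ (k + 1) -
      d * (x * d ^ (k + 2) + y * d ^ (k + 2)) = 0 := by
  linear_combination 2 * d ^ (k + 1) * h + d ^ (k + 1) * (a - x - y) * hd

/-- Neighbouring ends are joined. All loops are parallel, and the relation holds identically in `ψ`
for all admissible windings of the three arcs. -/
theorem jwZero_pairs {d : ℂ} (hd : d ^ 2 = 2) {ψ : ℤ × ℤ → ℂ} (hψ : IsAmplitude d ψ) :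
    JWZero d ψ 0 1 2 3 4 5 := by
  rintro ⟨⟨a, a'⟩, s⟩ ⟨⟨b, b'⟩, s'⟩ ⟨⟨c, c'⟩, s''⟩ K hK h
  obtain ⟨a0, a1, a2, b0, b1⟩ := closeUp_pairs a a' s b b' s' c c' s'' hK rfl
  have e0 := h.side0
  have e1 := h.side1
  have e2 := h.side2
  have f0 := h.pairs0
  have f1 := h.pairs1
  rw [jwValue, a0, a1, a2, b0, b1]
  rw [a0] at e0
  rw [a1] at e1
  rw [a2] at e2
  rw [b0] at f0
  rw [b1] at f1
  obtain ⟨u, α, β, γ, hu, hα, hβ, hγ, hα', hβ', hγ', hKu, -, V⟩ :=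
    exists_coeffs (d := d) hψ.even f0
  obtain ⟨⟨c0, -⟩, -, V0⟩ := value_cons_cons (d := d) hψ.even hu e0 (coeff_add hα hβ) hγ hKu
  obtain ⟨⟨c1, -⟩, -, V1⟩ := value_cons_cons (d := d) hψ.even hu e1 (coeff_add hα hγ) hβ hKu
  obtain ⟨⟨c2, -⟩, -, V2⟩ := value_cons_cons (d := d) hψ.even hu e2 (coeff_add hβ hγ) hα hKu
  obtain ⟨c3, -, V3⟩ := value_cons (d := d) hψ.even hu f1 (coeff_add (coeff_add hα hβ) hγ) hKu
  rw [V, V0, V1, V2, V3]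
  generalize windingCount (K.map Prod.snd) = N
  generalize (K.map Prod.snd).card = k
  have key : ∀ F : ℕ → ℂ, F (N + γ.natAbs + (α + β).natAbs) + F (N + β.natAbs + (α + γ).natAbs) +
      F (N + α.natAbs + (β + γ).natAbs) - 2 * F (N + γ.natAbs + β.natAbs + α.natAbs) -
      F (N + (α + β + γ).natAbs) = 0 := by
    clear * - hα' hβ' hγ' c0 c1 c2 c3
    intro F
    rcases hα' with rfl | rfl | rfl <;> rcases hβ' with rfl | rfl | rfl <;>
      rcases hγ' with rfl | rfl | rfl <;> first
      | (exfalso; omega)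
      | (norm_num [add_assoc]; try ring)
  have := key fun n => ψ ((n : ℤ) • u)
  exact jw_algebra_pairs hd k this

/-- No crossings, and one arc between opposite ends. If all three arcs wind, then the closure with
three loops has two more noncontractible loops than the other four closures, which is where `ψ((3 +
n) u) = ψ((1 + n) u)` enters. -/
theorem jwZero_side {d : ℂ} (hd : d ^ 2 = 2) {ψ : ℤ × ℤ → ℂ} (hψ : IsAmplitude d ψ) :
    JWZero d ψ 0 3 1 2 4 5 := by
  rintro ⟨⟨a, a'⟩, s⟩ ⟨⟨b, b'⟩, s'⟩ ⟨⟨c, c'⟩, s''⟩ K hK h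
  obtain ⟨a0, a1, a2, b0, b1⟩ := closeUp_side a a' s b b' s' c c' s'' hK rfl
  have e0 := h.side0
  have e1 := h.side1
  have e2 := h.side2
  have f0 := h.pairs0
  have f1 := h.pairs1
  rw [jwValue, a0, a1, a2, b0, b1]
  rw [a0] at e0
  rw [a1] at e1
  rw [a2] at e2
  rw [b0] at f0
  rw [b1] at f1
  obtain ⟨u, α, β, γ, hu, hα, hβ, hγ, hα', hβ', hγ', hKu, ⟨q1, q2, q3⟩, V⟩ :=
    exists_coeffs (d := d) hψ.even e0
  obtain ⟨⟨c0, -⟩, ⟨q4, -⟩, V0⟩ :=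
    value_cons_cons (d := d) hψ.even hu f0 (coeff_sub hα hβ) hγ hKu
  obtain ⟨⟨c1, -⟩, ⟨q5, -⟩, V1⟩ :=
    value_cons_cons (d := d) hψ.even hu f1 (coeff_add hα hγ) hβ hKu
  obtain ⟨c2, -, V2⟩ := value_cons (d := d) hψ.even hu e1 (coeff_add (coeff_sub hα hβ) hγ) hKu
  -- If the arc between opposite ends and its chord bound a disc, then one of the other two arcs
  -- lies in that disc and is closed up to a contractible loop by its own chord. The windings do not
  -- show this, but the turning numbers do.
  have hbad : ¬ (α = 0 ∧ β ≠ 0 ∧ γ ≠ 0) := by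
    rintro ⟨rfl, h2, h3⟩
    have z : ∀ {x : ℤ × ℤ} {δ : ℤ}, x = δ • u → δ ≠ 0 → ∀ t, Parallel u (x, t) → t = 0 := by
      rintro x δ rfl hδ t (h | ⟨h, -⟩)
      · rcases h with h | h
        · exact (Prod.ext_iff.1 h).2
        · simpa using (Prod.ext_iff.1 h).2
      · exact absurd (hu.smul_injective (h.trans (zero_smul ℤ u).symm)) hδ
    have z2 := z hβ h2 _ q2
    have z3 := z hγ h3 _ q3
    have z4 := z (coeff_sub hα hβ) (by simpa using h2) _ q4
    have z5 := z (coeff_add hα hγ) (by simpa using h3) _ q5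
    omega
  rw [V, V0, V1, V2]
  generalize windingCount (K.map Prod.snd) = N
  generalize (K.map Prod.snd).card = k
  have key : ∀ F : ℕ → ℂ, (∀ n, F (3 + n) = F (1 + n)) →
      F (N + γ.natAbs + β.natAbs + α.natAbs) + F (N + (α - β + γ).natAbs) -
      F (N + γ.natAbs + (α - β).natAbs) - F (N + β.natAbs + (α + γ).natAbs) = 0 := by
    clear * - hα' hβ' hγ' c0 c1 c2 hbad
    intro F hF
    have hF := hF N
    rw [add_comm, add_comm 1] at hF
    rcases hα' with rfl | rfl | rfl <;> rcases hβ' with rfl | rfl | rfl <;>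
      rcases hγ' with rfl | rfl | rfl <;> first
      | (exfalso; omega)
      | (norm_num [add_assoc, hF]; try ring)
  have := key (fun n => ψ ((n : ℤ) • u)) fun n => hψ.one u hu n
  exact jw_algebra_side hd k this

theorem cyc_arc (p q r s : Fin 6) : cyc (arc p q) (arc r s) = ∑ i : Fin 6, ∑ j : Fin 6,
    if i < j then ((if i = p then 1 else 0) - (if i = q then 1 else 0)) *
      ((if j = r then 1 else 0) - (if j = s then 1 else 0)) -
      ((if j = p then 1 else 0) - (if j = q then 1 else 0)) *
      ((if i = r then 1 else 0) - (if i = s then 1 else 0)) else 0 := by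
  simp only [cyc, arc, Pi.sub_apply, Pi.single_apply]

theorem cyc_zero (c : Fin 6 → ℤ) : cyc c 0 = 0 := by simp [cyc]

/-- A vector with vanishing determinant with a basis vanishes. -/
theorem eq_zero_of_det {a b x : ℤ × ℤ} (hab : det a b ≠ 0) (h1 : det a x = 0) (h2 : det b x = 0) :
    x = 0 := by
  simp only [det] at *
  ext
  · refine (mul_eq_zero.1 (?_ : (a.1 * b.2 - a.2 * b.1) * x.1 = 0)).resolve_left hab
    linear_combination b.1 * h1 - a.1 * h2
  · refine (mul_eq_zero.1 (?_ : (a.1 * b.2 - a.2 * b.1) * x.2 = 0)).resolve_left hab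
    linear_combination b.2 * h1 - a.2 * h2

/-- The windings of two strands that cross are linearly independent, so a strand that crosses
neither of them does not wind. -/
theorem isTangle_snd {L : Multiset Flow} (h : IsTangle L) {f g k : Flow} (hf : f ∈ L) (hg : g ∈ L)
    (hk : k ∈ L) (hfg : cyc f.1 g.1 ≠ 0) (h1 : cyc f.1 k.1 = 0) (h2 : cyc g.1 k.1 = 0) :
    k.2.1 = 0 := by
  have e0 := h.cross f hf g hg
  have e1 := h.cross f hf k hk
  have e2 := h.cross g hg k hk
  exact eq_zero_of_det (a := f.2.1) (b := g.2.1) (by intro h0; rw [h0] at e0; simp [e0] at hfg)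
    (by omega) (by omega)

set_option maxHeartbeats 1000000 in
/-- Two arcs cross once, and the third one crosses neither. The third arc and all closed loops are
contractible, and the five terms cancel by `d ^ 2 = 2` without a constraint on `ψ`. -/
theorem jwZero_one {d : ℂ} (hd : d ^ 2 = 2) {ψ : ℤ × ℤ → ℂ} (hψ : IsAmplitude d ψ) :
    JWZero d ψ 0 1 2 4 3 5 := by
  rintro ⟨⟨a, a'⟩, s⟩ ⟨⟨b, b'⟩, s'⟩ ⟨⟨c, c'⟩, s''⟩ K hK h
  obtain ⟨a0, a1, a2, b0, b1⟩ := closeUp_one a a' s b b' s' c c' s'' hK rfl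
  have e0 := h.side0
  have e1 := h.side1
  have e2 := h.side2
  have f0 := h.pairs0
  have f1 := h.pairs1
  rw [jwValue, a0, a1, a2, b0, b1]
  rw [a0] at e0
  rw [a1] at e1
  rw [a2] at e2
  rw [b0] at f0
  rw [b1] at f1
  have hK' : ∀ k ∈ K.map Prod.snd, k.1 = 0 := by
    intro k hk
    obtain ⟨k, hk', rfl⟩ := Multiset.mem_map.1 hk
    refine isTangle_snd h (f := (arc 2 4, ((b, b'), s'))) (g := (arc 3 5, ((c, c'), s''))) (k := k)
      (by simp) (by simp) (by simp [hk']) ?_ ?_ ?_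
    · rw [cyc_arc]; decide
    · rw [hK k hk', cyc_zero]
    · rw [hK k hk', cyc_zero]
  have hw : ((a, a') : ℤ × ℤ) = 0 := by
    refine isTangle_snd h (f := (arc 2 4, ((b, b'), s'))) (g := (arc 3 5, ((c, c'), s'')))
      (k := (arc 0 1, ((a, a'), s))) (by simp) (by simp) (by simp) ?_ ?_ ?_ <;>
      (rw [cyc_arc]; decide)
  obtain ⟨rfl, rfl⟩ : a = 0 ∧ a' = 0 := Prod.ext_iff.1 hw
  have hK1 : ∀ k ∈ ((0, 0), s - 2) ::ₘ K.map Prod.snd, k.1 = 0 := by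
    intro k hk
    rcases Multiset.mem_cons.1 hk with rfl | hk
    · rfl
    · exact hK' k hk
  rw [value_one d hψ.even hK' e0, value_one d hψ.even hK' e1, value_one d hψ.even hK1 e2,
    value_one d hψ.even hK1 f0, value_one d hψ.even hK' f1, Multiset.card_cons]
  have h1 : ψ (0 - b + c, 0 - b' + c') = ψ (b - c, b' - c') := by
    rw [← hψ.even]
    congr 1
    ext <;> simp
    all_goals ring
  simp only [zero_add] at h1 ⊢
  simp only [h1]
  generalize (K.map Prod.snd).card = k
  linear_combination (-d * d ^ k * ψ (b - c, b' - c')) * hd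

/-- One arc with winding `a` crosses two others, whose windings `b` agree. The closures have
windings `a`, `a + 2 • b` and `a - 2 • b`, which is the second constraint. -/
theorem jwZero_two {d : ℂ} {ψ : ℤ × ℤ → ℂ} (hψ : IsAmplitude d ψ) :
    JWZero d ψ 0 3 1 5 2 4 := by
  rintro ⟨⟨a, a'⟩, s⟩ ⟨⟨b, b'⟩, s'⟩ ⟨⟨c, c'⟩, s''⟩ K hK h
  obtain ⟨a0, a1, a2, b0, b1⟩ := closeUp_two a a' s b b' s' c c' s'' hK rfl
  have e0 := h.side0
  have e1 := h.side1
  have e2 := h.side2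
  have f0 := h.pairs0
  have f1 := h.pairs1
  rw [jwValue, a0, a1, a2, b0, b1]
  rw [a0] at e0
  rw [a1] at e1
  rw [a2] at e2
  rw [b0] at f0
  rw [b1] at f1
  have hK' : ∀ k ∈ K.map Prod.snd, k.1 = 0 := by
    intro k hk
    obtain ⟨k, hk', rfl⟩ := Multiset.mem_map.1 hk
    refine isTangle_snd h (f := (arc 0 3, ((a, a'), s))) (g := (arc 1 5, ((b, b'), s'))) (k := k)
      (by simp) (by simp) (by simp [hk']) ?_ ?_ ?_
    · rw [cyc_arc]; decide
    · rw [hK k hk', cyc_zero]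
    · rw [hK k hk', cyc_zero]
  have x12 := h.cross (arc 0 3, ((a, a'), s)) (by simp) (arc 1 5, ((b, b'), s')) (by simp)
  have x13 := h.cross (arc 0 3, ((a, a'), s)) (by simp) (arc 2 4, ((c, c'), s'')) (by simp)
  have x23 := h.cross (arc 1 5, ((b, b'), s')) (by simp) (arc 2 4, ((c, c'), s'')) (by simp)
  rw [show cyc (arc 0 3, ((a, a'), s)).1 (arc 1 5, ((b, b'), s')).1 = 2 by
    rw [cyc_arc]; decide] at x12
  rw [show cyc (arc 0 3, ((a, a'), s)).1 (arc 2 4, ((c, c'), s'')).1 = 2 by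
    rw [cyc_arc]; decide] at x13
  rw [show cyc (arc 1 5, ((b, b'), s')).1 (arc 2 4, ((c, c'), s'')).1 = 0 by
    rw [cyc_arc]; decide] at x23
  simp only [det] at x12 x13 x23
  have hbc : ((b - c, b' - c') : ℤ × ℤ) = 0 := by
    refine eq_zero_of_det (a := (a, a')) (b := (b, b')) ?_ ?_ ?_
    · simp only [det]; omega
    · simp only [det]; linarith
    · simp only [det]; linarith
  obtain ⟨h1, h2⟩ := Prod.ext_iff.1 hbc
  obtain rfl : c = b := by simp at h1; omega
  obtain rfl : c' = b' := by simp at h2; omega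
  have hK1 : ∀ k ∈ ((c - c, c' - c'), s' - s'' - 4) ::ₘ K.map Prod.snd, k.1 = 0 := by
    intro k hk
    rcases Multiset.mem_cons.1 hk with rfl | hk
    · simp
    · exact hK' k hk
  rw [Multiset.cons_swap] at e0 ⊢
  rw [value_one d hψ.even hK1 e0, value_one d hψ.even hK' e1, value_one d hψ.even hK' e2,
    value_one d hψ.even hK' f0, value_one d hψ.even hK' f1, Multiset.card_cons]
  generalize (K.map Prod.snd).card = k
  have := hψ.two (a, a') (c, c') (Or.inr (by simp only [det]; linarith))
  have y1 : ((a, a') : ℤ × ℤ) + 2 • (c, c') = (a + c + c, a' + c' + c') := by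
    ext <;> simp <;> ring
  have y2 : ((a, a') : ℤ × ℤ) - 2 • (c, c') = (a - c - c, a' - c' - c') := by
    ext <;> simp <;> ring
  rw [y1, y2] at this
  have y3 : ((a - c + c, a' - c' + c') : ℤ × ℤ) = (a, a') := by ext <;> simp
  have y4 : ((a + c - c, a' + c' - c') : ℤ × ℤ) = (a, a') := by ext <;> simp
  simp only [y3, y4]
  linear_combination d ^ (k + 1) * this

/-- Any two of the three arcs cross, so their windings are `a`, `a + c` and `c` for a basis `a`, `c`
of the lattice. The closures have windings `2 • a`, `2 • c`, `2 • (a + c)` and `0`, which is the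
first constraint. -/
theorem jwZero_three {d : ℂ} {ψ : ℤ × ℤ → ℂ} (hψ : IsAmplitude d ψ) :
    JWZero d ψ 0 3 1 4 2 5 := by
  rintro ⟨⟨a, a'⟩, s⟩ ⟨⟨b, b'⟩, s'⟩ ⟨⟨c, c'⟩, s''⟩ K hK h
  obtain ⟨a0, a1, a2, b0, b1⟩ := closeUp_three a a' s b b' s' c c' s'' hK rfl
  have e0 := h.side0
  have e1 := h.side1
  have e2 := h.side2
  have f0 := h.pairs0
  have f1 := h.pairs1
  rw [jwValue, a0, a1, a2, b0, b1]
  rw [a0] at e0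
  rw [a1] at e1
  rw [a2] at e2
  rw [b0] at f0
  rw [b1] at f1
  have hK' : ∀ k ∈ K.map Prod.snd, k.1 = 0 := by
    intro k hk
    obtain ⟨k, hk', rfl⟩ := Multiset.mem_map.1 hk
    refine isTangle_snd h (f := (arc 0 3, ((a, a'), s))) (g := (arc 1 4, ((b, b'), s'))) (k := k)
      (by simp) (by simp) (by simp [hk']) ?_ ?_ ?_
    · rw [cyc_arc]; decide
    · rw [hK k hk', cyc_zero]
    · rw [hK k hk', cyc_zero]
  have x12 := h.cross (arc 0 3, ((a, a'), s)) (by simp) (arc 1 4, ((b, b'), s')) (by simp)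
  have x13 := h.cross (arc 0 3, ((a, a'), s)) (by simp) (arc 2 5, ((c, c'), s'')) (by simp)
  have x23 := h.cross (arc 1 4, ((b, b'), s')) (by simp) (arc 2 5, ((c, c'), s'')) (by simp)
  rw [show cyc (arc 0 3, ((a, a'), s)).1 (arc 1 4, ((b, b'), s')).1 = 2 by
    rw [cyc_arc]; decide] at x12
  rw [show cyc (arc 0 3, ((a, a'), s)).1 (arc 2 5, ((c, c'), s'')).1 = 2 by
    rw [cyc_arc]; decide] at x13
  rw [show cyc (arc 1 4, ((b, b'), s')).1 (arc 2 5, ((c, c'), s'')).1 = 2 by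
    rw [cyc_arc]; decide] at x23
  simp only [det] at x12 x13 x23
  have hbc : ((a + c - b, a' + c' - b') : ℤ × ℤ) = 0 := by
    refine eq_zero_of_det (a := (a, a')) (b := (b, b')) ?_ ?_ ?_
    · simp only [det]; omega
    · simp only [det]; linarith
    · simp only [det]; linarith
  obtain ⟨h1, h2⟩ := Prod.ext_iff.1 hbc
  obtain rfl : b = a + c := by simp at h1; omega
  obtain rfl : b' = a' + c' := by simp at h2; omega
  rw [value_two d hψ.even hK' (Or.inl (by ext <;> simp)) e0,
    value_two d hψ.even hK' (Or.inl (by ext <;> simp)) e1,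
    value_two d hψ.even hK' (Or.inr (by ext <;> simp)) e2,
    value_one d hψ.even hK' f0, value_one d hψ.even hK' f1]
  generalize (K.map Prod.snd).card = k
  have := hψ.three (a, a') (c, c') (Or.inr (by simp only [det]; linarith))
  have y1 : 2 • ((a + c, a' + c') : ℤ × ℤ) = 2 • (a, a') + 2 • (c, c') := by
    ext <;> simp <;> ring
  have y2 : 2 • ((a + c - c, a' + c' - c') : ℤ × ℤ) = 2 • (a, a') := by
    ext <;> simp
  have y3 : (2 • (a - (a + c), a' - (a' + c')) : ℤ × ℤ) = -(2 • (c, c') : ℤ × ℤ) := by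
    ext <;> simp
  have y4 : ((a - (a + c) + c, a' - (a' + c') + c') : ℤ × ℤ) = 0 := by ext <;> simp
  simp only [y1, y2, y3, y4, hψ.even]
  linear_combination d ^ (k + 2) * this

/-! ### Symmetries of tangles -/

/-- Rotate the six ends by one step. -/
def rotate : Flow →+ Flow where
  toFun g := (fun k => g.1 (k + 1), g.2)
  map_zero' := rfl
  map_add' _ _ := rfl

theorem rotate_arc (p q : Fin 6) (w : (ℤ × ℤ) × ℤ) :
    rotate (arc (p + 1) (q + 1), w) = (arc p q, w) := by
  refine Prod.ext (funext fun k => ?_) rfl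
  simp [rotate, arc, Pi.single_apply]

/-- Only the pairs of joined ends matter, up to the order in which they are listed. -/
theorem closeUp_congr {P Q : List (Fin 6 × Fin 6)}
    (h1 : ∀ c : Fin 6 → ℤ, (∀ p ∈ P, c p.1 + c p.2 = 0) ↔ ∀ p ∈ Q, c p.1 + c p.2 = 0)
    (h2 : ∀ c : Fin 6 → ℤ, (∀ p ∈ Q, c p.1 + c p.2 = 0) →
      (P.map fun p => c p.1 * turn p.1 p.2).sum = (Q.map fun p => c p.1 * turn p.1 p.2).sum)
    (M : Multiset Flow) : closeUp P M = closeUp Q M := by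
  rw [closeUp, closeUp, Multiset.filter_congr fun g _ => h1 g.1]
  refine Multiset.map_congr rfl fun g hg => ?_
  rw [h2 g.1 (Multiset.mem_filter.1 hg).2]

theorem closeUp_rotate (P : List (Fin 6 × Fin 6)) (M : Multiset Flow) :
    closeUp P (M.map rotate) = closeUp (P.map fun p => (p.1 + 1, p.2 + 1)) M := by
  rw [closeUp, closeUp, Multiset.filter_map, Multiset.map_map]
  have e : ∀ g : Flow, (∀ p ∈ P, (rotate g).1 p.1 + (rotate g).1 p.2 = 0) ↔
      ∀ p ∈ P.map fun p => (p.1 + 1, p.2 + 1), g.1 p.1 + g.1 p.2 = 0 := by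
    intro g
    simp only [List.forall_mem_map]
    rfl
  have e' : M.filter ((fun g : Flow => ∀ p ∈ P, g.1 p.1 + g.1 p.2 = 0) ∘ rotate) =
      M.filter fun g => ∀ p ∈ P.map fun p => (p.1 + 1, p.2 + 1), g.1 p.1 + g.1 p.2 = 0 :=
    Multiset.filter_congr fun g _ => e g
  rw [e']
  refine Multiset.map_congr rfl fun g _ => ?_
  have e'' : ((fun p : Fin 6 × Fin 6 => g.1 p.1 * turn p.1 p.2) ∘ fun p : Fin 6 × Fin 6 =>
      (p.1 + 1, p.2 + 1)) = fun p : Fin 6 × Fin 6 => (rotate g).1 p.1 * turn p.1 p.2 := by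
    funext p
    simp only [Function.comp, turn, add_sub_add_right_eq_sub]
    rfl
  rw [List.map_map, e'']
  rfl

theorem closeUp_side_three (M : Multiset Flow) : closeUp (side 3) M = closeUp (side 0) M := by
  refine closeUp_congr (fun c => ?_) (fun c h => ?_) M
  · simp [side, and_comm, add_comm]
  · simp only [side, List.mem_cons, List.not_mem_nil, or_false, forall_eq_or_imp, forall_eq] at h
    simp only [side, List.map_cons, List.map_nil, List.sum_cons, List.sum_nil]
    have t1 : turn 3 (3 + 3) = 0 := by decide
    have t2 : turn (3 + 1) (3 + 2) = -2 := by decide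
    have t3 : turn (3 + 4) (3 + 5) = -2 := by decide
    have t4 : turn 0 (0 + 3) = 0 := by decide
    have t5 : turn (0 + 1) (0 + 2) = -2 := by decide
    have t6 : turn (0 + 4) (0 + 5) = -2 := by decide
    rw [t1, t2, t3, t4, t5, t6]
    show _ + (c 4 * _ + (c 1 * _ + _)) = _ + (c 1 * _ + (c 4 * _ + _))
    ring

theorem closeUp_pairs_two (M : Multiset Flow) : closeUp (pairs 2) M = closeUp (pairs 0) M := by
  refine closeUp_congr (fun c => ?_) (fun c h => ?_) M
  · simp only [pairs, List.mem_cons, List.not_mem_nil, or_false, forall_eq_or_imp, forall_eq]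
    show (c 2 + c 3 = 0 ∧ c 4 + c 5 = 0 ∧ c 0 + c 1 = 0) ↔
      (c 0 + c 1 = 0 ∧ c 2 + c 3 = 0 ∧ c 4 + c 5 = 0)
    tauto
  · simp only [pairs, List.map_cons, List.map_nil, List.sum_cons, List.sum_nil]
    have t1 : turn 2 (2 + 1) = -2 := by decide
    have t2 : turn (2 + 2) (2 + 3) = -2 := by decide
    have t3 : turn (2 + 4) (2 + 5) = -2 := by decide
    have t4 : turn 0 (0 + 1) = -2 := by decide
    have t5 : turn (0 + 2) (0 + 3) = -2 := by decide
    have t6 : turn (0 + 4) (0 + 5) = -2 := by decide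
    rw [t1, t2, t3, t4, t5, t6]
    show c 2 * _ + (c 4 * _ + (c 0 * _ + _)) = c 0 * _ + (c 2 * _ + (c 4 * _ + _))
    ring

theorem closeUp_rotate_all (M : Multiset Flow) :
    closeUp (side 0) (M.map rotate) = closeUp (side 1) M ∧
    closeUp (side 1) (M.map rotate) = closeUp (side 2) M ∧
    closeUp (side 2) (M.map rotate) = closeUp (side 0) M ∧
    closeUp (pairs 0) (M.map rotate) = closeUp (pairs 1) M ∧
    closeUp (pairs 1) (M.map rotate) = closeUp (pairs 0) M := by
  refine ⟨?_, ?_, ?_, ?_, ?_⟩ <;> rw [closeUp_rotate]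
  · rfl
  · rfl
  · exact closeUp_side_three M
  · rfl
  · exact closeUp_pairs_two M

theorem cyc_rotate {c c' : Fin 6 → ℤ} (hc : ∑ k, c k = 0) (hc' : ∑ k, c' k = 0) :
    cyc (fun k => c (k + 1)) (fun k => c' (k + 1)) = cyc c c' := by
  simp only [cyc, Fin.sum_univ_six] at *
  simp
  linear_combination (2 * c' 0) * hc - (2 * c 0) * hc'

theorem IsTangle.rotate {L : Multiset Flow} (h : IsTangle L) : IsTangle (L.map rotate) := by
  obtain ⟨e0, e1, e2, f0, f1⟩ := closeUp_rotate_all (signSums L)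
  refine ⟨?_, ?_, ?_, ?_, ?_, ?_, ?_⟩
  · intro g' hg'
    obtain ⟨g, hg, rfl⟩ := Multiset.mem_map.1 hg'
    rw [← h.flow g hg]
    exact Fintype.sum_equiv (Equiv.addRight 1) _ _ fun k => rfl
  · intro g' hg' k' hk'
    obtain ⟨g, hg, rfl⟩ := Multiset.mem_map.1 hg'
    obtain ⟨k, hk, rfl⟩ := Multiset.mem_map.1 hk'
    rw [← show cyc g.1 k.1 = -2 * det (TorusLoops.rotate g).2.1 (TorusLoops.rotate k).2.1 from
      h.cross g hg k hk]
    exact cyc_rotate (h.flow g hg) (h.flow k hk)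
  · rw [signSums_map, e0]; exact h.side1
  · rw [signSums_map, e1]; exact h.side2
  · rw [signSums_map, e2]; exact h.side0
  · rw [signSums_map, f0]; exact h.pairs1
  · rw [signSums_map, f1]; exact h.pairs0

theorem jwValue_rotate (ψ : ℤ × ℤ → ℂ) (d : ℂ) (M : Multiset Flow) :
    jwValue ψ d (M.map rotate) = jwValue ψ d M := by
  obtain ⟨e0, e1, e2, f0, f1⟩ := closeUp_rotate_all M
  rw [jwValue, jwValue, e0, e1, e2, f0, f1]
  ring

theorem cyc_neg_left (c c' : Fin 6 → ℤ) : cyc (-c) c' = -cyc c c' := by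
  simp only [cyc, ← Finset.sum_neg_distrib]
  refine Finset.sum_congr rfl fun i _ => Finset.sum_congr rfl fun j _ => ?_
  split_ifs <;> simp
  ring

theorem cyc_neg_right (c c' : Fin 6 → ℤ) : cyc c (-c') = -cyc c c' := by
  simp only [cyc, ← Finset.sum_neg_distrib]
  refine Finset.sum_congr rfl fun i _ => Finset.sum_congr rfl fun j _ => ?_
  split_ifs <;> simp
  ring

theorem cyc_self (c : Fin 6 → ℤ) : cyc c c = 0 := by
  refine Finset.sum_eq_zero fun i _ => Finset.sum_eq_zero fun j _ => ?_
  split_ifs <;> ring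

theorem IsTangle.neg_cons {g : Flow} {L : Multiset Flow} (h : IsTangle (g ::ₘ L)) :
    IsTangle (-g ::ₘ L) := by
  have hg := Multiset.mem_cons_self g L
  have hL : ∀ k ∈ L, k ∈ g ::ₘ L := fun k hk => Multiset.mem_cons_of_mem hk
  refine ⟨?_, ?_, ?_, ?_, ?_, ?_, ?_⟩
  · intro k hk
    rcases Multiset.mem_cons.1 hk with rfl | hk
    · simpa using h.flow g hg
    · exact h.flow k (hL k hk)
  · intro k hk l hl
    rcases Multiset.mem_cons.1 hk with rfl | hk <;> rcases Multiset.mem_cons.1 hl with rfl | hl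
    · rw [cyc_self]
      simp [det]
      ring
    · have := h.cross g hg l (hL l hl)
      rw [Prod.fst_neg, cyc_neg_left, this]
      simp [det]
      ring
    · have := h.cross k (hL k hk) g hg
      rw [Prod.fst_neg, cyc_neg_right, this]
      simp [det]
      ring
    · exact h.cross k (hL k hk) l (hL l hl)
  · rw [signSums_neg_cons]; exact h.side0
  · rw [signSums_neg_cons]; exact h.side1
  · rw [signSums_neg_cons]; exact h.side2
  · rw [signSums_neg_cons]; exact h.pairs0
  · rw [signSums_neg_cons]; exact h.pairs1

section Symmetry

variable {d : ℂ} {ψ : ℤ × ℤ → ℂ} {p₁ q₁ p₂ q₂ p₃ q₃ : Fin 6}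

theorem JWZero.flip (h : JWZero d ψ p₁ q₁ p₂ q₂ p₃ q₃) : JWZero d ψ q₁ p₁ p₂ q₂ p₃ q₃ := by
  intro w₁ w₂ w₃ K hK hL
  have e : ((arc q₁ p₁, w₁) : Flow) = -(arc p₁ q₁, -w₁) := by simp [arc]
  have := hL.neg_cons
  rw [e, neg_neg] at this
  rw [e, signSums_neg_cons]
  exact h _ _ _ K hK this

theorem JWZero.swap (h : JWZero d ψ p₁ q₁ p₂ q₂ p₃ q₃) : JWZero d ψ p₂ q₂ p₁ q₁ p₃ q₃ := by
  intro w₁ w₂ w₃ K hK hL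
  rw [Multiset.cons_swap] at hL ⊢
  exact h _ _ _ K hK hL

theorem JWZero.swap' (h : JWZero d ψ p₁ q₁ p₂ q₂ p₃ q₃) : JWZero d ψ p₁ q₁ p₃ q₃ p₂ q₂ := by
  intro w₁ w₂ w₃ K hK hL
  rw [Multiset.cons_swap (arc p₃ q₃, w₂)] at hL ⊢
  exact h _ _ _ K hK hL

theorem JWZero.rotate (h : JWZero d ψ p₁ q₁ p₂ q₂ p₃ q₃) :
    JWZero d ψ (p₁ + 1) (q₁ + 1) (p₂ + 1) (q₂ + 1) (p₃ + 1) (q₃ + 1) := by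
  intro w₁ w₂ w₃ K hK hL
  have := hL.rotate
  simp only [Multiset.map_cons, rotate_arc] at this
  rw [← jwValue_rotate, ← signSums_map]
  simp only [Multiset.map_cons, rotate_arc]
  refine h w₁ w₂ w₃ _ ?_ this
  intro k' hk'
  obtain ⟨k, hk, rfl⟩ := Multiset.mem_map.1 hk'
  funext i
  exact congrFun (hK k hk) (i + 1)

end Symmetry

/-- The Jones-Wenzl sum vanishes for each of the fifteen ways to join six ends. -/
theorem jwZero {d : ℂ} (hd : d ^ 2 = 2) {ψ : ℤ × ℤ → ℂ} (hψ : IsAmplitude d ψ) :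
    (JWZero d ψ 0 1 2 3 4 5 ∧ JWZero d ψ 0 1 2 4 3 5 ∧ JWZero d ψ 0 1 2 5 3 4) ∧
    (JWZero d ψ 0 2 1 3 4 5 ∧ JWZero d ψ 0 2 1 4 3 5 ∧ JWZero d ψ 0 2 1 5 3 4) ∧
    (JWZero d ψ 0 3 1 2 4 5 ∧ JWZero d ψ 0 3 1 4 2 5 ∧ JWZero d ψ 0 3 1 5 2 4) ∧
    (JWZero d ψ 0 4 1 2 3 5 ∧ JWZero d ψ 0 4 1 3 2 5 ∧ JWZero d ψ 0 4 1 5 2 3) ∧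
    (JWZero d ψ 0 5 1 2 3 4 ∧ JWZero d ψ 0 5 1 3 2 4 ∧ JWZero d ψ 0 5 1 4 2 3) := by
  have h1 := jwZero_pairs hd hψ
  have h2 := jwZero_side hd hψ
  have h3 := jwZero_one hd hψ
  have h4 := jwZero_two hψ
  have h5 := jwZero_three hψ
  exact ⟨⟨h1, h3, h2.swap'.swap.rotate.rotate⟩,
    ⟨h3.swap.swap'.rotate.rotate.rotate.rotate, h4.swap.flip.rotate,
      h3.swap.flip.swap'.swap.rotate.rotate.rotate⟩,
    ⟨h2, h5, h4⟩,
    ⟨h3.swap'.swap.flip.rotate, h4.swap.flip.swap'.swap.flip.rotate.rotate,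
      h3.swap.flip.swap'.swap.flip.swap.rotate.rotate⟩,
    ⟨h1.swap'.swap.flip.rotate, h3.flip.rotate.rotate.rotate.rotate.rotate,
      h2.swap'.swap.flip.rotate⟩⟩

/-! ### Strands that join ends in pairs -/

section Matched

variable {E E' G H : Type*} [AddCommGroup G] [AddCommGroup H]

/-- The family `L` consists of strands that join the ends in `S` in pairs and of closed loops, where
`χ e g` is the flow of `g` out of the end `e`. -/
structure Matched (S : Finset E) (χ : E → G →+ ℤ) (L : Multiset G) : Prop where
  ends : ∀ e ∈ S, (L.map fun g => |χ e g|).sum = 1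
  flow : ∀ g ∈ L, ∑ e ∈ S, χ e g = 0
  size : ∀ g ∈ L, ∑ e ∈ S, |χ e g| ≤ 2

theorem exists_of_sum_abs_eq_one {α : Type*} {L : Multiset α} {f : α → ℤ}
    (h : (L.map fun g => |f g|).sum = 1) :
    ∃ g M, L = g ::ₘ M ∧ |f g| = 1 ∧ ∀ k ∈ M, f k = 0 := by
  have hnn : ∀ M : Multiset α, 0 ≤ (M.map fun g => |f g|).sum := fun M =>
    Multiset.sum_nonneg fun x hx => by
      obtain ⟨k, -, rfl⟩ := Multiset.mem_map.1 hx
      exact abs_nonneg _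
  obtain ⟨g, hg, hg0⟩ : ∃ g ∈ L, f g ≠ 0 := by
    by_contra! H
    rw [Multiset.map_congr rfl fun g hg => by rw [H g hg, abs_zero]] at h
    simp at h
  obtain ⟨M, rfl⟩ := Multiset.exists_cons_of_mem hg
  have h1 : 1 ≤ |f g| := Int.one_le_abs hg0
  rw [Multiset.map_cons, Multiset.sum_cons] at h
  have h2 := hnn M
  refine ⟨g, M, rfl, by omega, fun k hk => ?_⟩
  obtain ⟨M', rfl⟩ := Multiset.exists_cons_of_mem hk
  have h3 := hnn M'
  rw [Multiset.map_cons, Multiset.sum_cons] at h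
  have := abs_nonneg (f k)
  exact abs_eq_zero.1 (by omega)

theorem Matched.neg_cons {S : Finset E} {χ : E → G →+ ℤ} {g : G} {L : Multiset G}
    (h : Matched S χ (g ::ₘ L)) : Matched S χ (-g ::ₘ L) := by
  refine ⟨fun e he => ?_, fun k hk => ?_, fun k hk => ?_⟩
  · simpa using h.ends e he
  · rcases Multiset.mem_cons.1 hk with rfl | hk
    · simpa using h.flow g (Multiset.mem_cons_self _ _)
    · exact h.flow k (Multiset.mem_cons_of_mem hk)
  · rcases Multiset.mem_cons.1 hk with rfl | hk
    · simpa using h.size g (Multiset.mem_cons_self _ _)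
    · exact h.size k (Multiset.mem_cons_of_mem hk)

/-- Rename the ends. -/
theorem Matched.map [DecidableEq E] {S : Finset E} {χ : E → G →+ ℤ} {L : Multiset G} (h : Matched S χ L)
    (f : G →+ H) {S' : Finset E'} {χ' : E' → H →+ ℤ} (σ : E' → E) (hσ : Set.InjOn σ S')
    (hS : S'.image σ = S) (hχ : ∀ e ∈ S', ∀ g, χ' e (f g) = χ (σ e) g) :
    Matched S' χ' (L.map f) := by
  subst hS
  refine ⟨fun e he => ?_, fun k hk => ?_, fun k hk => ?_⟩
  · rw [Multiset.map_map, ← h.ends (σ e) (Finset.mem_image_of_mem σ he)]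
    exact congrArg _ (Multiset.map_congr rfl fun g _ => by simp [hχ e he])
  · obtain ⟨g, hg, rfl⟩ := Multiset.mem_map.1 hk
    rw [← h.flow g hg, Finset.sum_image hσ]
    exact Finset.sum_congr rfl fun e he => hχ e he g
  · obtain ⟨g, hg, rfl⟩ := Multiset.mem_map.1 hk
    refine le_trans (le_of_eq ?_) (h.size g hg)
    rw [Finset.sum_image hσ]
    exact Finset.sum_congr rfl fun e he => by rw [hχ e he g]

/-- Add a strand that joins the new ends `a` and `b`. -/
theorem Matched.cons [DecidableEq E] {S : Finset E} {χ : E → G →+ ℤ} {L : Multiset G} (h : Matched S χ L)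
    {a b : E} (hab : a ≠ b) (ha : a ∉ S) (hb : b ∉ S) {g : G} (hga : χ a g = 1) (hgb : χ b g = -1)
    (hg : ∀ e ∈ S, χ e g = 0) (hL : ∀ k ∈ L, χ a k = 0 ∧ χ b k = 0) :
    Matched (insert a (insert b S)) χ (g ::ₘ L) := by
  have ha' : a ∉ insert b S := by simp [hab, ha]
  have hsum : ∀ f : G → ℤ, (∀ k ∈ L, f k = 0) → (L.map f).sum = 0 := by
    intro f hf
    exact Multiset.sum_eq_zero fun x hx => by
      obtain ⟨k, hk, rfl⟩ := Multiset.mem_map.1 hx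
      exact hf k hk
  refine ⟨fun e he => ?_, fun k hk => ?_, fun k hk => ?_⟩
  · rw [Multiset.map_cons, Multiset.sum_cons]
    rcases Finset.mem_insert.1 he with rfl | he
    · rw [hga, hsum _ fun k hk => by rw [(hL k hk).1, abs_zero]]
      rfl
    rcases Finset.mem_insert.1 he with rfl | he
    · rw [hgb, hsum _ fun k hk => by rw [(hL k hk).2, abs_zero]]
      rfl
    · rw [hg e he, h.ends e he]
      rfl
  · rw [Finset.sum_insert ha', Finset.sum_insert hb]
    rcases Multiset.mem_cons.1 hk with rfl | hk
    · rw [Finset.sum_eq_zero hg, hga, hgb]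
      rfl
    · rw [h.flow k hk, (hL k hk).1, (hL k hk).2]
      rfl
  · rw [Finset.sum_insert ha', Finset.sum_insert hb]
    rcases Multiset.mem_cons.1 hk with rfl | hk
    · rw [Finset.sum_eq_zero fun e he => by rw [hg e he, abs_zero], hga, hgb]
      rfl
    · rw [(hL k hk).1, (hL k hk).2]
      simpa using h.size k hk

theorem filter_shift {M : Multiset G} {f : G →+ ℤ} (hM : ∀ x ∈ M, f x = 0) (g : G) :
    (M.map (g + ·)).filter (fun x => f x = 0) = if f g = 0 then M.map (g + ·) else 0 := by
  split_ifs with h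
  · refine Multiset.filter_eq_self.2 fun x hx => ?_
    obtain ⟨y, hy, rfl⟩ := Multiset.mem_map.1 hx
    rw [map_add, h, hM y hy, add_zero]
  · refine Multiset.filter_eq_nil.2 fun x hx => ?_
    obtain ⟨y, hy, rfl⟩ := Multiset.mem_map.1 hx
    rwa [map_add, hM y hy, add_zero]

theorem map_eq_zero_of_mem_signSums {L : Multiset G} {f : G →+ ℤ} (h : ∀ k ∈ L, f k = 0) {x : G}
    (hx : x ∈ signSums L) : f x = 0 := by
  induction L using Multiset.induction_on generalizing x with
  | empty =>
    rw [signSums_zero, Multiset.mem_singleton] at hx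
    rw [hx, map_zero]
  | cons a L ih =>
    have ha := h a (Multiset.mem_cons_self _ _)
    rw [signSums_cons, Multiset.mem_add, Multiset.mem_map, Multiset.mem_map] at hx
    rcases hx with ⟨y, hy, rfl⟩ | ⟨y, hy, rfl⟩ <;>
      simp [ha, ih (fun k hk => h k (Multiset.mem_cons_of_mem hk)) hy]

/-- An additive map that vanishes on all sign sums vanishes on the family. -/
theorem map_eq_zero_of_signSums {L : Multiset G} {f : G →+ ℤ} (h : ∀ x ∈ signSums L, f x = 0) :
    ∀ g ∈ L, f g = 0 := by
  intro g hg
  obtain ⟨M, rfl⟩ := Multiset.exists_cons_of_mem hg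
  obtain ⟨y, hy⟩ := exists_mem_signSums M
  rw [signSums_cons] at h
  have h1 := h (g + y) (Multiset.mem_add.2 (Or.inl (Multiset.mem_map_of_mem _ hy)))
  have h2 := h (-g + y) (Multiset.mem_add.2 (Or.inr (Multiset.mem_map_of_mem _ hy)))
  simp only [map_add, map_neg] at h1 h2
  omega

/-- Joining the ends `a` and `b` either closes one strand or connects two of them. -/
theorem Matched.glue [DecidableEq E] {S : Finset E} {χ : E → G →+ ℤ} {L : Multiset G} (h : Matched S χ L)
    {a b : E} (hab : a ≠ b) (ha : a ∈ S) (hb : b ∈ S) :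
    ∃ L', (signSums L).filter (fun x => χ a x + χ b x = 0) = signSums L' ∧
      Matched ((S.erase a).erase b) χ L' := by
  have hb' : b ∈ S.erase a := Finset.mem_erase.2 ⟨hab.symm, hb⟩
  have split : ∀ f : E → ℤ, ∑ e ∈ S, f e = f a + (f b + ∑ e ∈ (S.erase a).erase b, f e) := by
    intro f
    rw [← Finset.add_sum_erase S f ha, ← Finset.add_sum_erase _ f hb']
  have hS : ∀ e ∈ (S.erase a).erase b, e ∈ S := fun e he =>
    Finset.mem_of_mem_erase (Finset.mem_of_mem_erase he)
  have hnn : ∀ g, 0 ≤ ∑ e ∈ (S.erase a).erase b, |χ e g| := fun g =>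
    Finset.sum_nonneg fun e _ => abs_nonneg _
  obtain ⟨g, M, hgM, hga, hMa⟩ := exists_of_sum_abs_eq_one (h.ends a ha)
  obtain ⟨g, h, hga, hsig⟩ : ∃ g, Matched S χ (g ::ₘ M) ∧ χ a g = 1 ∧
      signSums L = signSums (g ::ₘ M) := by
    subst hgM
    rcases (abs_eq zero_le_one).1 hga with h1 | h1
    · exact ⟨g, h, h1, rfl⟩
    · exact ⟨-g, h.neg_cons, by simp [h1], (signSums_neg_cons _ _).symm⟩
  rw [hsig]
  have hgg := Multiset.mem_cons_self g M
  have hfg := h.flow g hgg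
  have hsg := h.size g hgg
  rw [split] at hfg hsg
  by_cases hgb : χ b g = 0
  · -- The strands at `a` and at `b` are different.
    have e1 := h.ends b hb
    rw [Multiset.map_cons, Multiset.sum_cons, hgb, abs_zero, zero_add] at e1
    obtain ⟨k, N, hkN, hkb, hNb⟩ := exists_of_sum_abs_eq_one e1
    obtain ⟨k, h, hkb, hka, hsig'⟩ : ∃ k, Matched S χ (g ::ₘ k ::ₘ N) ∧ χ b k = -1 ∧ χ a k = 0 ∧
        signSums (g ::ₘ M) = signSums (g ::ₘ k ::ₘ N) := by
      subst hkN
      have hka := hMa k (Multiset.mem_cons_self _ _)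
      rcases (abs_eq zero_le_one).1 hkb with h1 | h1
      · refine ⟨-k, ?_, by simp [h1], by simp [hka],
          signSums_cons_congr _ (signSums_neg_cons _ _).symm⟩
        rw [Multiset.cons_swap] at h ⊢
        exact h.neg_cons
      · exact ⟨k, h, h1, hka, rfl⟩
    rw [hsig']
    have hNa : ∀ x ∈ N, χ a x = 0 := fun x hx => hMa x (hkN ▸ Multiset.mem_cons_of_mem hx)
    have hkk : k ∈ g ::ₘ k ::ₘ N := Multiset.mem_cons_of_mem (Multiset.mem_cons_self _ _)
    have hfk := h.flow k hkk
    have hsk := h.size k hkk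
    rw [split] at hfk hsk
    have hnull : ∀ x ∈ signSums N, (χ a + χ b) x = 0 := fun x hx =>
      map_eq_zero_of_mem_signSums (fun y hy => by simp [hNa y hy, hNb y hy]) hx
    refine ⟨(g + k) ::ₘ N, ?_, ?_, ?_, ?_⟩
    · simp only [signSums_cons, Multiset.map_add, Multiset.map_map, Function.comp_def,
        Multiset.filter_add, ← add_assoc]
      have := fun y => filter_shift hnull y
      simp only [AddMonoidHom.add_apply] at this
      rw [this, this, this, this]
      simp [hga, hgb, hkb, hka, add_comm (-g) (-k)]
    · intro e he
      have h1 := h.ends e (hS e he)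
      have hN : 0 ≤ (N.map fun x => |χ e x|).sum := Multiset.sum_nonneg fun x hx => by
        obtain ⟨y, -, rfl⟩ := Multiset.mem_map.1 hx
        exact abs_nonneg _
      simp only [Multiset.map_cons, Multiset.sum_cons, map_add] at h1 ⊢
      have : χ e g = 0 ∨ χ e k = 0 := by
        by_contra! H
        have := Int.one_le_abs H.1
        have := Int.one_le_abs H.2
        omega
      rcases this with h2 | h2 <;> simp only [h2, abs_zero, zero_add, add_zero] at h1 ⊢ <;> omega
    · intro x hx
      rcases Multiset.mem_cons.1 hx with rfl | hx
      · simp only [map_add, Finset.sum_add_distrib]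
        omega
      · have := h.flow x (by simp [hx])
        rw [split, hNa x hx, hNb x hx] at this
        omega
    · intro x hx
      rcases Multiset.mem_cons.1 hx with rfl | hx
      · refine (Finset.sum_le_sum fun e _ => ?_ : _ ≤ ∑ e ∈ (S.erase a).erase b,
          (|χ e g| + |χ e k|)).trans ?_
        · rw [map_add]; exact abs_add_le _ _
        · rw [Finset.sum_add_distrib]
          rw [hga, hgb] at hsg
          rw [hka, hkb] at hsk
          norm_num at hsg hsk
          omega
      · have := h.size x (by simp [hx])
        rw [split, hNa x hx, hNb x hx] at this
        simpa using this
  · -- One strand joins `a` and `b`.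
    have hrest : ∑ e ∈ (S.erase a).erase b, |χ e g| = 0 := by
      have h1 := Int.one_le_abs hgb
      have := hnn g
      rw [hga, abs_one] at hsg
      omega
    have hzero : ∀ e ∈ (S.erase a).erase b, χ e g = 0 := fun e he =>
      abs_eq_zero.1 ((Finset.sum_eq_zero_iff_of_nonneg fun e _ => abs_nonneg _).1 hrest e he)
    have hgb1 : χ b g = -1 := by
      rw [Finset.sum_eq_zero hzero] at hfg
      omega
    have hMb : ∀ x ∈ M, χ b x = 0 := by
      have e1 := h.ends b hb
      rw [Multiset.map_cons, Multiset.sum_cons, hgb1] at e1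
      have e2 : (M.map fun x => |χ b x|).sum = 0 := by
        norm_num at e1
        exact e1
      intro x hx
      by_contra H
      have := Int.one_le_abs H
      obtain ⟨N, rfl⟩ := Multiset.exists_cons_of_mem hx
      have hN : 0 ≤ (N.map fun x => |χ b x|).sum := Multiset.sum_nonneg fun x hx => by
        obtain ⟨y, -, rfl⟩ := Multiset.mem_map.1 hx
        exact abs_nonneg _
      rw [Multiset.map_cons, Multiset.sum_cons] at e2
      omega
    have hnull : ∀ k ∈ g ::ₘ M, (χ a + χ b) k = 0 := by
      intro k hk
      rcases Multiset.mem_cons.1 hk with rfl | hk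
      · simp [hga, hgb1]
      · simp [hMa k hk, hMb k hk]
    refine ⟨g ::ₘ M, ?_, fun e he => h.ends e (hS e he), fun k hk => ?_, fun k hk => ?_⟩
    · exact Multiset.filter_eq_self.2 fun x hx => map_eq_zero_of_mem_signSums hnull hx
    · have := h.flow k hk
      have h2 := hnull k hk
      rw [split] at this
      simp only [AddMonoidHom.add_apply] at h2
      omega
    · have := h.size k hk
      rw [split] at this
      have := abs_nonneg (χ a k)
      have := abs_nonneg (χ b k)
      omega

end Matched

/-! ### The strands of a diagram -/

/-- The labels at the top and at the bottom of an oriented diagram, the flow through the vertical cut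
and the turning. -/
abbrev Strand := (ℕ → ℤ) × (ℕ → ℤ) × ℤ × ℤ

/-- The outward flow at the top points `Sum.inl j` and at the bottom points `Sum.inr j`. -/
def outflow : ℕ ⊕ ℕ → Strand →+ ℤ
  | .inl j => (Pi.evalAddMonoidHom (fun _ : ℕ => ℤ) j).comp (AddMonoidHom.fst _ _)
  | .inr j => -((Pi.evalAddMonoidHom (fun _ : ℕ => ℤ) j).comp
      ((AddMonoidHom.fst _ _).comp (AddMonoidHom.snd _ _)))

@[simp] theorem outflow_inl (j : ℕ) (g : Strand) : outflow (.inl j) g = g.1 j := rfl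
@[simp] theorem outflow_inr (j : ℕ) (g : Strand) : outflow (.inr j) g = -g.2.1 j := rfl

/-- The top and bottom points of a diagram. -/
def endPoints (m n : ℕ) : Finset (ℕ ⊕ ℕ) := (Finset.range n).disjSum (Finset.range m)

@[simp] theorem inl_mem_endPoints {m n j : ℕ} : Sum.inl j ∈ endPoints m n ↔ j < n := by
  simp [endPoints]

@[simp] theorem inr_mem_endPoints {m n j : ℕ} : Sum.inr j ∈ endPoints m n ↔ j < m := by
  simp [endPoints]

/-- All orientations of a diagram. -/
def Word.graph {m n : ℕ} (X : Word m n) : Multiset Strand :=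
  (labels n).bind fun t => (X.turnRun t).map fun p => (t, p)

/-- Apply an additive map to the labels at the bottom. -/
def mapBottom (f : (ℕ → ℤ) →+ (ℕ → ℤ)) : Strand →+ Strand :=
  (AddMonoidHom.id _).prodMap (f.prodMap (AddMonoidHom.id _))

/-- `del i` as an additive map. -/
def delHom (i : ℕ) : (ℕ → ℤ) →+ (ℕ → ℤ) where
  toFun := del i
  map_zero' := by ext; simp [del]
  map_add' u v := by ext k; simp only [del, Pi.add_apply]; split_ifs <;> rfl

/-- `ins i 0` as an additive map. -/
def insHom (i : ℕ) : (ℕ → ℤ) →+ (ℕ → ℤ) where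
  toFun := ins i 0
  map_zero' := by ext; simp [ins]
  map_add' u v := by ext k; simp only [ins, Pi.add_apply]; split_ifs <;> simp

/-- The cup or cap with end points `i` and `i + 1`, oriented from the latter to the former. -/
theorem ins_eq (i : ℕ) (x : ℤ) (u : ℕ → ℤ) :
    ins i x u = x • (Pi.single i 1 - Pi.single (i + 1) 1 : ℕ → ℤ) + insHom i u := by
  ext k
  simp only [insHom, AddMonoidHom.coe_mk, ZeroHom.coe_mk, ins, Pi.add_apply, Pi.smul_apply,
    Pi.sub_apply, Pi.single_apply, smul_eq_mul]
  split_ifs <;> omega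

/-- `rotL n` as an additive map. -/
def rotLHom (n : ℕ) : (ℕ → ℤ) →+ (ℕ → ℤ) where
  toFun := rotL n
  map_zero' := by ext; simp [rotL]
  map_add' u v := by ext k; simp only [rotL, Pi.add_apply]; split_ifs <;> rfl

/-- `rotR n` as an additive map. -/
def rotRHom (n : ℕ) : (ℕ → ℤ) →+ (ℕ → ℤ) where
  toFun := rotR n
  map_zero' := by ext; simp [rotR]
  map_add' u v := by ext k; simp only [rotR, Pi.add_apply]; split_ifs <;> rfl

/-- The first point at the bottom crosses the vertical cut. -/
def rightHom (n : ℕ) : Strand →+ Strand where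
  toFun g := (g.1, rotL n g.2.1, g.2.1 0 + g.2.2.1, g.2.2.2)
  map_zero' := by
    have := (rotLHom n).map_zero
    ext <;> simp_all [rotLHom]
  map_add' a b := by
    have := (rotLHom n).map_add a.2.1 b.2.1
    simp only [rotLHom, AddMonoidHom.coe_mk, ZeroHom.coe_mk] at this
    simp only [Prod.fst_add, Prod.snd_add, this, Pi.add_apply]
    ext <;> simp
    ring

/-- The last point at the bottom crosses the vertical cut. -/
def leftHom (n : ℕ) : Strand →+ Strand where
  toFun g := (g.1, rotR n g.2.1, -g.2.1 n + g.2.2.1, g.2.2.2)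
  map_zero' := by
    have := (rotRHom n).map_zero
    ext <;> simp_all [rotRHom]
  map_add' a b := by
    have := (rotRHom n).map_add a.2.1 b.2.1
    simp only [rotRHom, AddMonoidHom.coe_mk, ZeroHom.coe_mk] at this
    simp only [Prod.fst_add, Prod.snd_add, this, Pi.add_apply]
    ext <;> simp
    ring

/-- Join the points `i`, `i + 1` at the bottom by a minimum. -/
def birthHom (i : ℕ) : Strand →+ Strand where
  toFun g := (g.1, del i g.2.1, g.2.2.1, -g.2.1 i + g.2.2.2)
  map_zero' := by
    have := (delHom i).map_zero
    ext <;> simp_all [delHom]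
  map_add' a b := by
    have := (delHom i).map_add a.2.1 b.2.1
    simp only [delHom, AddMonoidHom.coe_mk, ZeroHom.coe_mk] at this
    simp only [Prod.fst_add, Prod.snd_add, this, Pi.add_apply]
    ext <;> simp
    ring

theorem graph_cons {m k n : ℕ} (e : Event m k) (w : Word k n) : (Word.cons e w).graph =
    w.graph.bind fun g => (e.turnBack g.2.1).map fun q => (g.1, q.1, q.2 + g.2.2) := by
  simp only [Word.graph, Word.turnRun, Multiset.bind_assoc, Multiset.map_bind, Multiset.bind_map,
    Multiset.map_map, Function.comp_def]

/-- Renumber the points at the bottom. -/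
theorem Matched.mapBottom {A B B' : Finset ℕ} {L : Multiset Strand}
    (h : Matched (A.disjSum B) outflow L) (f : Strand →+ Strand) (σ : ℕ → ℕ)
    (hσ : Set.InjOn σ B') (hB : B'.image σ = B)
    (hf : ∀ g, (f g).1 = g.1 ∧ ∀ j ∈ B', (f g).2.1 j = g.2.1 (σ j)) :
    Matched (A.disjSum B') outflow (L.map f) := by
  refine h.map f (Sum.map id σ) ?_ ?_ ?_
  · rintro (a | a) ha (b | b) hb hab
    · simpa using hab
    · simp at hab
    · simp at hab
    · simp only [Sum.map_inr, Sum.inr.injEq] at hab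
      rw [hσ (by simpa using ha) (by simpa using hb) hab]
  · subst hB
    ext (k | k) <;> simp
  · rintro (j | j) hj g
    · simp [(hf g).1]
    · simp [(hf g).2 j (by simpa using hj)]

/-- The strands of a diagram: all orientations of the diagram are obtained by orienting them
independently. -/
theorem Word.exists_strands {m n : ℕ} (X : Word m n) :
    ∃ L, X.graph = signSums L ∧ Matched (endPoints m n) outflow L := by
  induction X with
  | nil n =>
    let f : (ℕ → ℤ) →+ Strand :=
      (AddMonoidHom.id _).prod ((AddMonoidHom.id _).prod 0)
    refine ⟨((Multiset.range n).map fun a => (Pi.single a 1 : ℕ → ℤ)).map f, ?_, ?_, ?_, ?_⟩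
    · rw [signSums_map, ← labels]
      simp only [Word.graph, Word.turnRun, Multiset.map_singleton, Multiset.bind_singleton]
      rfl
    · intro e he
      have key : ∀ j < n, ((Multiset.range n).map fun a =>
          |(Pi.single a 1 : ℕ → ℤ) j|).sum = 1 := by
        intro j hj
        show ∑ a ∈ Finset.range n, |(Pi.single a 1 : ℕ → ℤ) j| = 1
        rw [Finset.sum_eq_single j]
        · simp
        · intro b _ hb
          simp [hb.symm]
        · simp [hj]
      simp only [Multiset.map_map, Function.comp_def]
      rcases e with j | j
      · exact key j (inl_mem_endPoints.1 he)
      · refine Eq.trans ?_ (key j (inr_mem_endPoints.1 he))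
        simp [f]
    · intro g hg
      obtain ⟨s, -, rfl⟩ := Multiset.mem_map.1 hg
      rw [endPoints, Finset.sum_disjSum]
      simp [f]
    · intro g hg
      obtain ⟨s, hs, rfl⟩ := Multiset.mem_map.1 hg
      obtain ⟨a, ha, rfl⟩ := Multiset.mem_map.1 hs
      have ha : a < n := by simpa using ha
      have key : ∑ j ∈ Finset.range n, |(Pi.single a 1 : ℕ → ℤ) j| = 1 := by
        rw [Finset.sum_eq_single a]
        · simp
        · intro b _ hb
          simp [hb]
        · simp [ha]
      rw [endPoints, Finset.sum_disjSum]
      simp [f, key]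
  | cons e w ih =>
    obtain ⟨L, hL, hM⟩ := ih
    rw [graph_cons, hL]
    cases e with
    | birth _ i hi =>
      obtain ⟨L', hL', hM'⟩ := hM.glue (a := .inr i) (b := .inr (i + 1)) (by simp)
        (by rw [inr_mem_endPoints]; omega) (by rw [inr_mem_endPoints]; omega)
      refine ⟨L'.map (birthHom i), ?_, ?_⟩
      · rw [signSums_map, ← hL']
        refine (Multiset.bind_congr fun g _ => ?_).trans ((bind_ite_singleton (signSums L)
          (fun g => outflow (.inr i) g + outflow (.inr (i + 1)) g = 0) (birthHom i)).trans ?_)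
        · obtain ⟨t, s, φ, τ⟩ := g
          have e : outflow (.inr i) (t, s, φ, τ) + outflow (.inr (i + 1)) (t, s, φ, τ) = 0 ↔
              s i + s (i + 1) = 0 := by
            simp only [outflow_inr]
            omega
          simp only [Event.turnBack]
          by_cases h : s i + s (i + 1) = 0
          · rw [if_pos h, if_pos (e.2 h)]
            simp [birthHom]
          · rw [if_neg h, if_neg fun h' => h (e.1 h')]
            rfl
        · congr
      · have e (a b : ℕ) : ((endPoints (a + 2) b).erase (Sum.inr i)).erase (Sum.inr (i + 1)) =
            (Finset.range b).disjSum (((Finset.range (a + 2)).erase i).erase (i + 1)) := by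
          ext (k | k) <;> simp
        rw [e] at hM'
        refine hM'.mapBottom _ (fun j => if j < i then j else j + 2) ?_ ?_ fun g => ⟨rfl, ?_⟩
        · intro a _ b _ hab
          simp only at hab
          split_ifs at hab <;> omega
        · ext k
          simp only [Finset.mem_image, Finset.mem_range, Finset.mem_erase]
          constructor
          · rintro ⟨j, hj, rfl⟩
            split_ifs <;> omega
          · rintro ⟨h1, h2, h3⟩
            refine ⟨if k < i then k else k - 2, ?_, ?_⟩ <;> split_ifs <;> omega
        · intro j _
          simp only [birthHom, AddMonoidHom.coe_mk, ZeroHom.coe_mk, del]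
          split_ifs <;> rfl
    | death _ i hi =>
      rename_i k₀ n₀
      refine ⟨(0, Pi.single i 1 - Pi.single (i + 1) 1, 0, -1) ::ₘ
        L.map (mapBottom (insHom i)), ?_, ?_⟩
      · rw [signSums_cons, signSums_map, Multiset.map_map, Multiset.map_map,
          ← Multiset.bind_singleton, ← Multiset.bind_singleton, ← Multiset.bind_add]
        refine Multiset.bind_congr fun g _ => ?_
        obtain ⟨t, s, φ, τ⟩ := g
        simp [Event.turnBack, ins_eq, mapBottom]
      · have h1 := hM.mapBottom (B' := ((Finset.range (k₀ + 2)).erase i).erase (i + 1))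
          (mapBottom (insHom i)) (fun j => if j < i then j else j - 2) ?_ ?_ ?_
        · have h2 := h1.cons (a := Sum.inr (i + 1)) (b := Sum.inr i)
            (g := (0, Pi.single i 1 - Pi.single (i + 1) 1, 0, -1)) (by simp) (by simp) (by simp)
            (by simp) (by simp) ?_ ?_
          · convert h2 using 1
            ext (k | k)
            · simp
            · simp
              omega
          · rintro (e | e) he
            · simp
            · simp at he
              simp [he]
          · intro k hk
            obtain ⟨g, -, rfl⟩ := Multiset.mem_map.1 hk
            simp [mapBottom, insHom, ins]
        · intro a ha b hb hab
          simp at ha hb hab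
          split_ifs at hab <;> omega
        · ext k
          simp only [Finset.mem_image, Finset.mem_range, Finset.mem_erase]
          constructor
          · rintro ⟨j, hj, rfl⟩
            split_ifs <;> omega
          · intro h1
            refine ⟨if k < i then k else k + 2, ?_, ?_⟩ <;> split_ifs <;> omega
        · refine fun g => ⟨rfl, fun j hj => ?_⟩
          simp at hj
          show ins i 0 g.2.1 j = _
          simp only [ins]
          split_ifs <;> first | rfl | omega
    | right p =>
      refine ⟨L.map (rightHom p), ?_, ?_⟩
      · rw [signSums_map, ← Multiset.bind_singleton]
        refine Multiset.bind_congr fun g _ => ?_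
        obtain ⟨t, s, φ, τ⟩ := g
        simp [Event.turnBack, rightHom]
      · refine hM.mapBottom _ (fun j => if j < p then j + 1 else if j = p then 0 else j) ?_ ?_
          fun g => ⟨rfl, ?_⟩
        · intro a ha b hb hab
          simp at ha hb hab
          split_ifs at hab <;> omega
        · ext k
          simp only [Finset.mem_image, Finset.mem_range]
          constructor
          · rintro ⟨j, hj, rfl⟩
            split_ifs <;> omega
          · intro h1
            refine ⟨if k = 0 then p else k - 1, ?_, ?_⟩ <;> split_ifs <;> omega
        · intro j _
          simp only [rightHom, AddMonoidHom.coe_mk, ZeroHom.coe_mk, rotL]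
          split_ifs <;> rfl
    | left p =>
      refine ⟨L.map (leftHom p), ?_, ?_⟩
      · rw [signSums_map, ← Multiset.bind_singleton]
        refine Multiset.bind_congr fun g _ => ?_
        obtain ⟨t, s, φ, τ⟩ := g
        simp [Event.turnBack, leftHom]
      · refine hM.mapBottom _ (fun j => if j = 0 then p else if j ≤ p then j - 1 else j) ?_ ?_
          fun g => ⟨rfl, ?_⟩
        · intro a ha b hb hab
          simp at ha hb hab
          split_ifs at hab <;> omega
        · ext k
          simp only [Finset.mem_image, Finset.mem_range]
          constructor
          · rintro ⟨j, hj, rfl⟩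
            split_ifs <;> omega
          · intro h1
            by_cases hk : k = p
            · exact ⟨0, by omega, by simp [hk]⟩
            · exact ⟨k + 1, by omega, by simp; omega⟩
        · intro j _
          simp only [leftHom, AddMonoidHom.coe_mk, ZeroHom.coe_mk, rotR]
          split_ifs <;> rfl

/-! ### Closing all strands outside a disc -/

/-- The ends of the three strands `i`, `i + 1`, `i + 2` of the disc, in cyclic order. The turning is
counted up to the corners of a hexagon. -/
def toFlow (N i : ℕ) : Strand →+ Flow where
  toFun g := (![g.1 i, g.1 (i + 1), g.1 (i + 2), -g.2.1 (i + 2), -g.2.1 (i + 1), -g.2.1 i],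
    ((total N g.1, g.2.2.1),
      3 * g.2.2.2 + (g.1 (i + 2) - g.1 i + g.2.1 (i + 2) - g.2.1 i)))
  map_zero' := by
    refine Prod.ext (funext fun k => ?_) ?_
    · fin_cases k <;> rfl
    · simp [total]
  map_add' a b := by
    refine Prod.ext (funext fun k => ?_) ?_
    · fin_cases k <;> simp [add_comm]
    · simp [total, Finset.sum_add_distrib]
      ring

/-- The strands outside the disc are closed. -/
def ClosedOutside (N i : ℕ) (g : Strand) : Prop :=
  ∀ j < N, j < i ∨ i + 3 ≤ j → g.1 j = g.2.1 j

/-- Joining the top and the bottom of all strands outside the disc, one after the other, leaves a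
family of strands with the six ends of the disc. -/
theorem Matched.closeOutside {n i : ℕ} (h : i ≤ n) {L : Multiset Strand}
    (hL : Matched (endPoints (n + 3) (n + 3)) outflow L) :
    ∃ L', (signSums L).filter (ClosedOutside (n + 3) i) = signSums L' ∧
      Matched ((Finset.Ico i (i + 3)).disjSum (Finset.Ico i (i + 3))) outflow L' := by
  have key : ∀ k ≤ n + 3, ∃ L', (signSums L).filter (ClosedOutside k i) = signSums L' ∧
      Matched (((Finset.range (n + 3)).filter fun j => k ≤ j ∨ i ≤ j ∧ j < i + 3).disjSum
        ((Finset.range (n + 3)).filter fun j => k ≤ j ∨ i ≤ j ∧ j < i + 3)) outflow L' := by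
    intro k
    induction k with
    | zero =>
      intro _
      refine ⟨L, Multiset.filter_eq_self.2 fun x _ j hj => absurd hj (Nat.not_lt_zero j), ?_⟩
      simpa [endPoints] using hL
    | succ k ih =>
      intro hk
      obtain ⟨L', h1, h2⟩ := ih (by omega)
      by_cases hki : i ≤ k ∧ k < i + 3
      · refine ⟨L', ?_, ?_⟩
        · rw [← h1]
          refine Multiset.filter_congr fun g _ => ⟨fun H j hj h' => H j (by omega) h',
            fun H j hj h' => H j (by omega) h'⟩
        · convert h2 using 2 <;>
          · ext j
            simp
            omega
      · obtain ⟨L'', h3, h4⟩ := h2.glue (a := Sum.inl k) (b := Sum.inr k) (by simp)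
          (by simp; omega) (by simp; omega)
        refine ⟨L'', ?_, ?_⟩
        · rw [← h3, ← h1, Multiset.filter_filter]
          refine Multiset.filter_congr fun g _ => ⟨fun H => ⟨?_, fun j hj h' =>
            H j (by omega) h'⟩, fun H j hj h' => ?_⟩
          · have := H k (by omega) (by omega)
            simp [this]
          · rcases Nat.lt_succ_iff_lt_or_eq.1 hj with hj | rfl
            · exact H.2 j hj h'
            · have := H.1
              simp only [outflow_inl, outflow_inr] at this
              omega
        · convert h4 using 1
          ext (j | j) <;> simp <;> omega
  obtain ⟨L', h1, h2⟩ := key (n + 3) le_rfl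
  refine ⟨L', h1, ?_⟩
  convert h2 using 2 <;>
  · ext j
    simp
    omega

/-- The flow out of the six ends. -/
def endFlow (k : Fin 6) : Flow →+ ℤ :=
  (Pi.evalAddMonoidHom (fun _ : Fin 6 => ℤ) k).comp (AddMonoidHom.fst _ _)

@[simp] theorem endFlow_apply (k : Fin 6) (g : Flow) : endFlow k g = g.1 k := rfl

theorem Matched.toFlow {n i : ℕ} {L : Multiset Strand}
    (h : Matched ((Finset.Ico i (i + 3)).disjSum (Finset.Ico i (i + 3))) outflow L) :
    Matched Finset.univ endFlow (L.map (toFlow n i)) := by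
  refine h.map _ ![.inl i, .inl (i + 1), .inl (i + 2), .inr (i + 2), .inr (i + 1), .inr i] ?_ ?_ ?_
  · intro a _ b _ hab
    fin_cases a <;> fin_cases b <;> simp at hab <;> rfl
  · ext (j | j)
    · simp [Fin.exists_fin_succ]
      omega
    · simp [Fin.exists_fin_succ]
      omega
  · intro k _ g
    fin_cases k <;> rfl

/-- The flow of the strands outside a disc with three strands `i`, `i + 1`, `i + 2`. -/
def outside {n : ℕ} (i : ℕ) (X : Word (n + 3) (n + 3)) : Multiset Flow :=
  (X.graph.filter (ClosedOutside (n + 3) i)).map (toFlow (n + 3) i)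

theorem Word.mem_graph {m n : ℕ} {X : Word m n} {g : Strand} (hg : g ∈ X.graph) :
    IsLabel n g.1 ∧ (g.2.1, g.2.2.1) ∈ X.run g.1 := by
  rw [Word.graph, Multiset.mem_bind] at hg
  obtain ⟨t, ht, hg⟩ := hg
  obtain ⟨p, hp, rfl⟩ := Multiset.mem_map.1 hg
  exact ⟨mem_labels.1 ht, Word.mem_run_of_mem_turnRun hp⟩

/-- The state sum of a configuration with a diagram inserted into the annulus of three more strands.
-/
theorem turnWindings_close_eq {n : ℕ} (P X : Word (n + 3) (n + 3)) :
    (close P X).turnWindings = X.graph.bind fun g =>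
      ((P.turnRun g.2.1).filter fun q => q.1 = g.1).map fun q =>
        ((total (n + 3) g.1, q.2.1 + g.2.2.1), 3 * (q.2.2 + g.2.2.2)) := by
  rw [Word.graph, Multiset.bind_assoc]
  refine Multiset.bind_congr fun t _ => ?_
  show Multiset.map _ (((P.comp X).turnRun t).filter _) = _
  rw [Word.turnRun_comp, Multiset.filter_bind, Multiset.map_bind, Multiset.bind_map]
  refine Multiset.bind_congr fun p _ => ?_
  rw [Multiset.filter_map, Multiset.map_map]
  rfl

theorem turnWindings_close_hook {n a b : ℕ} (ha : a ≤ n + 1) (hb : b ≤ n + 1)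
    (X : Word (n + 3) (n + 3)) : (close (hook a b ha hb) X).turnWindings =
      (X.graph.filter fun g => g.1 a + g.1 (a + 1) = 0 ∧ g.2.1 b + g.2.1 (b + 1) = 0 ∧
        del a g.1 = del b g.2.1).map fun g =>
          ((total (n + 3) g.1, g.2.2.1), 3 * (g.2.2.2 - g.2.1 b - g.1 a)) := by
  rw [turnWindings_close_eq]
  refine Eq.trans ?_ ((bind_ite_singleton X.graph (fun g => g.1 a + g.1 (a + 1) = 0 ∧
    g.2.1 b + g.2.1 (b + 1) = 0 ∧ del a g.1 = del b g.2.1) fun g =>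
      ((total (n + 3) g.1, g.2.2.1), 3 * (g.2.2.2 - g.2.1 b - g.1 a))).trans (by congr))
  refine Multiset.bind_congr fun g hg => ?_
  obtain ⟨t, s, φ, τ⟩ := g
  have ht : IsLabel (n + 3) t := (Word.mem_graph hg).1
  have hins : ∀ x, ins a x (del b s) = t ↔ t a = x ∧ t a + t (a + 1) = 0 ∧ del a t = del b s := by
    intro x
    constructor
    · rintro rfl
      refine ⟨ins_self _ _ _, by rw [ins_self, ins_succ]; ring, ?_⟩
      ext j
      simp only [ins, del]
      split_ifs <;> first | rfl | (exfalso; omega)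
    · rintro ⟨rfl, h1, h2⟩
      rw [← h2, ins_del h1]
  rw [hook, turnRun_two]
  simp only [Event.turnBack]
  by_cases hs : s b + s (b + 1) = 0
  · rw [if_pos hs]
    simp only [Multiset.singleton_bind, Multiset.insert_eq_cons, Multiset.map_cons,
      Multiset.map_singleton, Multiset.filter_cons, Multiset.filter_singleton, hins, hs, true_and]
    by_cases h : t a + t (a + 1) = 0 ∧ del a t = del b s
    · rcases ht.1 a (by omega) with h1 | h1
      · have h2 : t (a + 1) = -1 := by omega
        simp [h.2, h1, h2]
        ring
      · have h2 : t (a + 1) = 1 := by omega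
        simp [h.2, h1, h2]
        ring
    · simp [h]
  · simp [hs]

theorem closeUp_outside {n : ℕ} (i : ℕ) (X : Word (n + 3) (n + 3)) (P : List (Fin 6 × Fin 6)) :
    closeUp P (outside i X) = (X.graph.filter fun g => ClosedOutside (n + 3) i g ∧
      ∀ p ∈ P, (toFlow (n + 3) i g).1 p.1 + (toFlow (n + 3) i g).1 p.2 = 0).map fun g =>
        (toFlow (n + 3) i g).2 +
          (0, (P.map fun p => (toFlow (n + 3) i g).1 p.1 * turn p.1 p.2).sum) := by
  rw [closeUp, outside, Multiset.filter_map, Multiset.filter_filter, Multiset.map_map]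
  refine Multiset.map_congr (Multiset.filter_congr fun g _ => and_comm) fun g _ => rfl

theorem turnWindings_close_nil {n i : ℕ} (h : i ≤ n) (X : Word (n + 3) (n + 3)) :
    (close (.nil (n + 3)) X).turnWindings = closeUp (side 1) (outside i X) := by
  rw [turnWindings_close_eq, closeUp_outside]
  refine Eq.trans ?_ ((bind_ite_singleton X.graph (fun g => g.2.1 = g.1) fun g =>
    ((total (n + 3) g.1, g.2.2.1), 3 * g.2.2.2)).trans ?_)
  · refine Multiset.bind_congr fun g _ => ?_
    simp only [Word.turnRun, Multiset.filter_singleton]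
    split_ifs <;> simp
  have e : ∀ g ∈ X.graph, (g.2.1 = g.1 ↔ ClosedOutside (n + 3) i g ∧
      ∀ p ∈ side 1, (toFlow (n + 3) i g).1 p.1 + (toFlow (n + 3) i g).1 p.2 = 0) := by
    intro g hg
    have ht := (Word.mem_graph hg).1
    have hs := X.isLabel_run ht (Word.mem_graph hg).2
    obtain ⟨t, s, φ, τ⟩ := g
    simp only [side, List.mem_cons, List.not_mem_nil, or_false, forall_eq_or_imp, forall_eq]
    show s = t ↔ ClosedOutside (n + 3) i (t, s, φ, τ) ∧ t (i + 1) + -s (i + 1) = 0 ∧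
      t (i + 2) + -s (i + 2) = 0 ∧ -s i + t i = 0
    constructor
    · rintro rfl
      exact ⟨fun _ _ _ => rfl, by ring, by ring, by ring⟩
    · rintro ⟨h0, h1, h2, h3⟩
      ext j
      by_cases hj : j < n + 3
      · by_cases hj' : j < i ∨ i + 3 ≤ j
        · exact (h0 j hj hj').symm
        · obtain rfl | rfl | rfl : j = i ∨ j = i + 1 ∨ j = i + 2 := by omega
          all_goals omega
      · exact (hs.2 j (by omega)).trans (ht.2 j (by omega)).symm
  rw [Multiset.filter_congr e]
  refine Multiset.map_congr (by congr) fun g hg => ?_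
  obtain ⟨-, h1⟩ := (Multiset.mem_filter.1 hg).2
  obtain ⟨t, s, φ, τ⟩ := g
  simp only [side, List.mem_cons, List.not_mem_nil, or_false, forall_eq_or_imp, forall_eq] at h1
  obtain ⟨h1, h2, h3⟩ : t (i + 1) + -s (i + 1) = 0 ∧ t (i + 2) + -s (i + 2) = 0 ∧
    -s i + t i = 0 := h1
  refine Prod.ext (by simp [toFlow]) ?_
  show 3 * τ = 3 * τ + (t (i + 2) - t i + s (i + 2) - s i) +
    (t (i + 1) * 0 + (t (i + 2) * (-2) + (-s i * (-2) + 0)))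
  linarith

/-- The middle point that is left when two of the points `i`, `i + 1`, `i + 2` are joined. -/
theorem del_eq {i a a' : ℕ} (h : a = i ∧ a' = i + 2 ∨ a = i + 1 ∧ a' = i) (t : ℕ → ℤ) :
    del a t = fun k => if k < i then t k else if k = i then t a' else t (k + 2) := by
  ext k
  rcases h with ⟨rfl, rfl⟩ | ⟨rfl, rfl⟩ <;> simp only [del] <;> split_ifs <;>
    first | rfl | (exfalso; omega) | (congr 1 <;> omega)

theorem turnWindings_close_hook_eq {n i a a' b b' : ℕ} (h : i ≤ n)
    (ha : a = i ∧ a' = i + 2 ∨ a = i + 1 ∧ a' = i) (hb : b = i ∧ b' = i + 2 ∨ b = i + 1 ∧ b' = i)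
    (ha' : a ≤ n + 1) (hb' : b ≤ n + 1) (X : Word (n + 3) (n + 3)) (P : List (Fin 6 × Fin 6))
    (hP : ∀ g, (∀ p ∈ P, (toFlow (n + 3) i g).1 p.1 + (toFlow (n + 3) i g).1 p.2 = 0) ↔
      g.1 a + g.1 (a + 1) = 0 ∧ g.2.1 b + g.2.1 (b + 1) = 0 ∧ g.1 a' = g.2.1 b')
    (hP' : ∀ g, g.1 a + g.1 (a + 1) = 0 → g.2.1 b + g.2.1 (b + 1) = 0 → g.1 a' = g.2.1 b' →
      g.1 (i + 2) - g.1 i + g.2.1 (i + 2) - g.2.1 i +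
        (P.map fun p => (toFlow (n + 3) i g).1 p.1 * turn p.1 p.2).sum =
      -3 * g.2.1 b - 3 * g.1 a) :
    (close (hook a b ha' hb') X).turnWindings = closeUp P (outside i X) := by
  rw [turnWindings_close_hook, closeUp_outside]
  have e : ∀ g ∈ X.graph, (g.1 a + g.1 (a + 1) = 0 ∧ g.2.1 b + g.2.1 (b + 1) = 0 ∧
      del a g.1 = del b g.2.1) ↔ ClosedOutside (n + 3) i g ∧
      ∀ p ∈ P, (toFlow (n + 3) i g).1 p.1 + (toFlow (n + 3) i g).1 p.2 = 0 := by
    intro g hg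
    have ht := (Word.mem_graph hg).1
    have hs := X.isLabel_run ht (Word.mem_graph hg).2
    rw [hP, del_eq ha, del_eq hb]
    constructor
    · rintro ⟨h1, h2, h3⟩
      refine ⟨?_, h1, h2, by simpa using congrFun h3 i⟩
      rintro j hj (hj' | hj')
      · simpa [hj'] using congrFun h3 j
      · have := congrFun h3 (j - 2)
        rwa [if_neg (by omega), if_neg (by omega), if_neg (by omega), if_neg (by omega),
          show j - 2 + 2 = j by omega] at this
    · rintro ⟨h0, h1, h2, h3⟩
      refine ⟨h1, h2, funext fun j => ?_⟩
      split_ifs with h4 h5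
      · exact h0 j (by omega) (Or.inl h4)
      · exact h3
      · by_cases hj : j + 2 < n + 3
        · exact h0 _ hj (Or.inr (by omega))
        · rw [ht.2 _ (by omega), hs.2 _ (by omega)]
  rw [Multiset.filter_congr e]
  refine Multiset.map_congr (by congr) fun g hg => ?_
  obtain ⟨-, h1⟩ := (Multiset.mem_filter.1 hg).2
  rw [hP] at h1
  have := hP' g h1.1 h1.2.1 h1.2.2
  refine Prod.ext (by simp [toFlow]) ?_
  show 3 * (g.2.2.2 - g.2.1 b - g.1 a) =
    3 * g.2.2.2 + (g.1 (i + 2) - g.1 i + g.2.1 (i + 2) - g.2.1 i) + _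
  linarith

theorem turnWindings_close_hook_pairs_zero {n i : ℕ} (h : i ≤ n) (X : Word (n + 3) (n + 3)) :
    (close (hook i i (by omega) (by omega)) X).turnWindings =
      closeUp (pairs 0) (outside i X) := by
  refine turnWindings_close_hook_eq h (a' := i + 2) (b' := i + 2) (by simp) (by simp) _ _ X _
    (fun g => ?_) fun g h1 h2 h3 => ?_
  · simp only [pairs, List.mem_cons, List.not_mem_nil, or_false, forall_eq_or_imp, forall_eq]
    show (g.1 i + g.1 (i + 1) = 0 ∧ g.1 (i + 2) + -g.2.1 (i + 2) = 0 ∧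
      -g.2.1 (i + 1) + -g.2.1 i = 0) ↔ _
    omega
  · show _ + (g.1 i * (-2) + (g.1 (i + 2) * (-2) + (-g.2.1 (i + 1) * (-2) + 0))) = _
    omega

theorem turnWindings_close_hook_pairs_one {n i : ℕ} (h : i ≤ n) (X : Word (n + 3) (n + 3)) :
    (close (hook (i + 1) (i + 1) (by omega) (by omega)) X).turnWindings =
      closeUp (pairs 1) (outside i X) := by
  refine turnWindings_close_hook_eq h (a' := i) (b' := i) (by simp) (by simp) _ _ X _
    (fun g => ?_) fun g h1 h2 h3 => ?_
  · simp only [pairs, List.mem_cons, List.not_mem_nil, or_false, forall_eq_or_imp, forall_eq]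
    show (g.1 (i + 1) + g.1 (i + 2) = 0 ∧ -g.2.1 (i + 2) + -g.2.1 (i + 1) = 0 ∧
      -g.2.1 i + g.1 i = 0) ↔ g.1 (i + 1) + g.1 (i + 2) = 0 ∧ g.2.1 (i + 1) + g.2.1 (i + 2) = 0 ∧ _
    omega
  · have h1 : g.1 (i + 1) + g.1 (i + 2) = 0 := h1
    have h2 : g.2.1 (i + 1) + g.2.1 (i + 2) = 0 := h2
    show _ + (g.1 (i + 1) * (-2) + (-g.2.1 (i + 2) * (-2) + (-g.2.1 i * (-2) + 0))) = _
    omega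

theorem turnWindings_close_hook_side_two {n i : ℕ} (h : i ≤ n) (X : Word (n + 3) (n + 3)) :
    (close (hook i (i + 1) (by omega) (by omega)) X).turnWindings =
      closeUp (side 2) (outside i X) := by
  refine turnWindings_close_hook_eq h (a' := i + 2) (b' := i) (by simp) (by simp) _ _ X _
    (fun g => ?_) fun g h1 h2 h3 => ?_
  · simp only [side, List.mem_cons, List.not_mem_nil, or_false, forall_eq_or_imp, forall_eq]
    show (g.1 (i + 2) + -g.2.1 i = 0 ∧ -g.2.1 (i + 2) + -g.2.1 (i + 1) = 0 ∧
      g.1 i + g.1 (i + 1) = 0) ↔ _ ∧ g.2.1 (i + 1) + g.2.1 (i + 2) = 0 ∧ _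
    omega
  · have h2 : g.2.1 (i + 1) + g.2.1 (i + 2) = 0 := h2
    show _ + (g.1 (i + 2) * 0 + (-g.2.1 (i + 2) * (-2) + (g.1 i * (-2) + 0))) = _
    omega

theorem turnWindings_close_hook_side_zero {n i : ℕ} (h : i ≤ n) (X : Word (n + 3) (n + 3)) :
    (close (hook (i + 1) i (by omega) (by omega)) X).turnWindings =
      closeUp (side 0) (outside i X) := by
  refine turnWindings_close_hook_eq h (a' := i) (b' := i + 2) (by simp) (by simp) _ _ X _
    (fun g => ?_) fun g h1 h2 h3 => ?_
  · simp only [side, List.mem_cons, List.not_mem_nil, or_false, forall_eq_or_imp, forall_eq]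
    show (g.1 i + -g.2.1 (i + 2) = 0 ∧ g.1 (i + 1) + g.1 (i + 2) = 0 ∧
      -g.2.1 (i + 1) + -g.2.1 i = 0) ↔ g.1 (i + 1) + g.1 (i + 2) = 0 ∧ _ ∧ _
    omega
  · have h1 : g.1 (i + 1) + g.1 (i + 2) = 0 := h1
    show _ + (g.1 i * 0 + (g.1 (i + 1) * (-2) + (-g.2.1 (i + 1) * (-2) + 0))) = _
    omega

/-- The Jones-Wenzl sum of a wavefunction `ψ(n_x, n_y) d ^ |C|` depends only on the strands outside
the disc. -/
theorem jwSum_stateOf {n i : ℕ} (h : i ≤ n) (d : ℂ) (ψ : ℤ × ℤ → ℂ) (X : Word (n + 3) (n + 3)) :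
    jwSum d (stateOf d ψ) n i h X = jwValue ψ d (outside i X) := by
  simp only [jwSum, stateOf, jwValue, turnWindings_close_nil h, turnWindings_close_hook_side_two h,
    turnWindings_close_hook_side_zero h, turnWindings_close_hook_pairs_zero h,
    turnWindings_close_hook_pairs_one h]
  ring

/-! ### Amplitudes give zero-energy states -/

/-- The strands that close up outside the disc drop out of the form that counts crossings, and the
cyclic form on the six ends remains. -/
theorem cross_closedOutside {N i : ℕ} (h : i + 3 ≤ N) {g g' : Strand}
    (hg : ClosedOutside N i g) (hg' : ClosedOutside N i g')
    (ht : total N g.1 = total N g.2.1) (ht' : total N g'.1 = total N g'.2.1) :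
    cyc (toFlow N i g).1 (toFlow N i g').1 = cross N g.1 g'.1 - cross N g.2.1 g'.2.1 := by
  obtain ⟨t, s, w⟩ := g
  obtain ⟨t', s', w'⟩ := g'
  have hc : cyc (toFlow N i (t, s, w)).1 (toFlow N i (t', s', w')).1 =
      cyc ![t i, t (i + 1), t (i + 2), -s (i + 2), -s (i + 1), -s i]
        ![t' i, t' (i + 1), t' (i + 2), -s' (i + 2), -s' (i + 1), -s' i] := rfl
  rw [hc]
  clear hc
  simp only [ClosedOutside] at hg hg' ht ht' ⊢
  induction N, h using Nat.le_induction with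
  | base =>
    have e1 : total i t = total i s := total_congr fun a ha => hg a (by omega) (Or.inl ha)
    have e2 : total i t' = total i s' := total_congr fun a ha => hg' a (by omega) (Or.inl ha)
    have e3 : cross i t t' = cross i s s' :=
      cross_congr (fun a ha => hg a (by omega) (Or.inl ha))
        fun a ha => hg' a (by omega) (Or.inl ha)
    simp only [show i + 3 = i + 1 + 1 + 1 from rfl, total_succ, cross_succ] at ht ht' ⊢
    rw [e1] at ht
    rw [e2] at ht'
    rw [e1, e2, e3]
    have f1 : t i = s i + s (i + 1) + s (i + 2) - t (i + 1) - t (i + 2) := by linarith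
    have f2 : t' i = s' i + s' (i + 1) + s' (i + 2) - t' (i + 1) - t' (i + 2) := by linarith
    simp [cyc, Fin.sum_univ_succ]
    rw [show i + 1 + 1 = i + 2 from rfl, f1, f2]
    ring
  | succ k hk ih =>
    have e1 := hg k (by omega) (Or.inr hk)
    have e2 := hg' k (by omega) (Or.inr hk)
    rw [total_succ, total_succ, e1] at ht
    rw [total_succ, total_succ, e2] at ht'
    have f1 := add_right_cancel ht
    have f2 := add_right_cancel ht'
    rw [ih (fun j hj => hg j (by omega)) f1 (fun j hj => hg' j (by omega)) f2, cross_succ,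
      cross_succ, e1, e2, f1, f2]
    ring

/-- The form that vanishes on the flows of strands on a torus. -/
def pairing (y : Flow) : Flow →+ ℤ where
  toFun x := cyc x.1 y.1 + 2 * det x.2.1 y.2.1
  map_zero' := by simp [cyc, det]
  map_add' a b := by
    simp only [cyc, det, Fin.sum_univ_succ, Prod.fst_add, Prod.snd_add, Pi.add_apply]
    simp
    ring

theorem pairing_apply (x y : Flow) : pairing y x = cyc x.1 y.1 + 2 * det x.2.1 y.2.1 := rfl

theorem pairing_swap (x y : Flow) : pairing y x = -pairing x y := by
  simp only [pairing_apply, cyc, det, Fin.sum_univ_succ]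
  simp
  ring

/-- The strands of a configuration outside a disc. -/
theorem exists_isTangle {n i : ℕ} (h : i ≤ n) (X : Word (n + 3) (n + 3)) :
    ∃ L, outside i X = signSums L ∧ IsTangle L ∧ Matched Finset.univ endFlow L := by
  obtain ⟨L₀, h1, h2⟩ := X.exists_strands
  obtain ⟨L₁, h3, h4⟩ := h2.closeOutside h
  have h5 : outside i X = signSums (L₁.map (toFlow (n + 3) i)) := by
    rw [signSums_map, ← h3, ← h1, outside]
  have h6 := h4.toFlow (n := n + 3)
  refine ⟨_, h5, ⟨fun g hg => h6.flow g hg, ?_, ?_, ?_, ?_, ?_, ?_⟩, h6⟩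
  · have key : ∀ x ∈ outside i X, ∀ y ∈ outside i X, pairing y x = 0 := by
      intro x hx y hy
      obtain ⟨g, hg, rfl⟩ := Multiset.mem_map.1 hx
      obtain ⟨g', hg', rfl⟩ := Multiset.mem_map.1 hy
      rw [Multiset.mem_filter] at hg hg'
      have r := (Word.mem_graph hg.1).2
      have r' := (Word.mem_graph hg'.1).2
      have t := X.total_run r
      have t' := X.total_run r'
      rw [pairing_apply, cross_closedOutside (by omega) hg.2 hg'.2 t.symm t'.symm, X.cross_run r r']
      simp only [toFlow, AddMonoidHom.coe_mk, ZeroHom.coe_mk, det]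
      ring
    rw [h5] at key
    intro g hg k hk
    have h7 : pairing k g = 0 := by
      refine map_eq_zero_of_signSums (fun x hx => ?_) g hg
      rw [pairing_swap, map_eq_zero_of_signSums (fun y hy => key y hy x hx) k hk, neg_zero]
    rw [pairing_apply] at h7
    linarith
  all_goals rw [← h5]
  · rw [← turnWindings_close_hook_side_zero h]; exact Config.isStraight _
  · rw [← turnWindings_close_nil h]; exact Config.isStraight _
  · rw [← turnWindings_close_hook_side_two h]; exact Config.isStraight _
  · rw [← turnWindings_close_hook_pairs_zero h]; exact Config.isStraight _
  · rw [← turnWindings_close_hook_pairs_one h]; exact Config.isStraight _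

/-- Remove the strand that leaves at the end `p`. -/
theorem Matched.exists_arc {S : Finset (Fin 6)} {L : Multiset Flow} (h : Matched S endFlow L)
    (hL : ∀ g ∈ L, ∀ e ∉ S, g.1 e = 0) {p : Fin 6} (hp : p ∈ S) :
    ∃ q ∈ S.erase p, ∃ g K, L = g ::ₘ K ∧ (g.1 = arc p q ∨ g.1 = arc q p) ∧
      Matched ((S.erase p).erase q) endFlow K ∧ ∀ g ∈ K, ∀ e ∉ (S.erase p).erase q, g.1 e = 0 := by
  obtain ⟨g, K, rfl, hgp, hKp⟩ := exists_of_sum_abs_eq_one (h.ends p hp)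
  have hg := Multiset.mem_cons_self g K
  have hflow := h.flow g hg
  have hsize := h.size g hg
  simp only [endFlow_apply] at hgp hKp hflow hsize
  rw [← Finset.add_sum_erase S _ hp] at hflow hsize
  obtain ⟨q, hq, hgq⟩ : ∃ q ∈ S.erase p, g.1 q ≠ 0 := by
    by_contra! H
    rw [Finset.sum_eq_zero H] at hflow
    rw [add_zero] at hflow
    rw [hflow] at hgp
    simp at hgp
  rw [← Finset.add_sum_erase _ _ hq] at hflow hsize
  have hrest : 0 ≤ ∑ e ∈ (S.erase p).erase q, |g.1 e| := Finset.sum_nonneg fun _ _ => abs_nonneg _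
  have hgq1 := Int.one_le_abs hgq
  have hzero : ∀ e ∈ (S.erase p).erase q, g.1 e = 0 := fun e he =>
    abs_eq_zero.1 ((Finset.sum_eq_zero_iff_of_nonneg fun e _ => abs_nonneg _).1
      (le_antisymm (by omega) hrest) e he)
  rw [Finset.sum_eq_zero hzero] at hflow
  have hqp : q ≠ p := Finset.ne_of_mem_erase hq
  have hqS : q ∈ S := Finset.mem_of_mem_erase hq
  have hoff : ∀ e, e ≠ p → e ≠ q → g.1 e = 0 := by
    intro e h1 h2
    by_cases h3 : e ∈ S
    · exact hzero e (Finset.mem_erase.2 ⟨h2, Finset.mem_erase.2 ⟨h1, h3⟩⟩)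
    · exact hL g hg e h3
  have hKnn : ∀ e, ∀ k ∈ K, 0 ≤ (K.map fun k => |endFlow e k|).sum ∧
      |k.1 e| ≤ (K.map fun k => |endFlow e k|).sum := by
    intro e k hk
    obtain ⟨K', rfl⟩ := Multiset.exists_cons_of_mem hk
    have : 0 ≤ (K'.map fun k => |endFlow e k|).sum := Multiset.sum_nonneg fun x hx => by
      obtain ⟨y, -, rfl⟩ := Multiset.mem_map.1 hx
      exact abs_nonneg _
    have := abs_nonneg (k.1 e)
    rw [Multiset.map_cons, Multiset.sum_cons, endFlow_apply]
    omega
  have hKq : ∀ k ∈ K, k.1 q = 0 := by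
    intro k hk
    have h1 := h.ends q hqS
    rw [Multiset.map_cons, Multiset.sum_cons, endFlow_apply] at h1
    have := hKnn q k hk
    have := abs_nonneg (k.1 q)
    exact abs_eq_zero.1 (by omega)
  refine ⟨q, hq, g, K, rfl, ?_, ⟨fun e he => ?_, fun k hk => ?_, fun k hk => ?_⟩, ?_⟩
  · rcases (abs_eq zero_le_one).1 hgp with h1 | h1
    · left
      ext e
      by_cases hep : e = p
      · subst hep
        simp [arc, h1, hqp.symm]
      by_cases heq : e = q
      · subst heq
        simp [arc, hep]
        omega
      · simp [arc, hep, heq, hoff e hep heq]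
    · right
      ext e
      by_cases hep : e = p
      · subst hep
        simp [arc, h1, hqp.symm]
      by_cases heq : e = q
      · subst heq
        simp [arc, hep]
        omega
      · simp [arc, hep, heq, hoff e hep heq]
  · have := h.ends e (Finset.mem_of_mem_erase (Finset.mem_of_mem_erase he))
    rwa [Multiset.map_cons, Multiset.sum_cons, endFlow_apply, hzero e he, abs_zero,
      zero_add] at this
  · have := h.flow k (Multiset.mem_cons_of_mem hk)
    rwa [← Finset.add_sum_erase S _ hp, ← Finset.add_sum_erase _ _ hq, endFlow_apply,
      endFlow_apply, hKp k hk, hKq k hk, zero_add, zero_add] at this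
  · have := h.size k (Multiset.mem_cons_of_mem hk)
    rwa [← Finset.add_sum_erase S _ hp, ← Finset.add_sum_erase _ _ hq, endFlow_apply,
      endFlow_apply, hKp k hk, hKq k hk, abs_zero, zero_add, zero_add] at this
  · intro k hk e he
    by_cases hep : e = p
    · rw [hep, hKp k hk]
    by_cases heq : e = q
    · rw [heq, hKq k hk]
    · exact hL k (Multiset.mem_cons_of_mem hk) e fun h => he
        (Finset.mem_erase.2 ⟨heq, Finset.mem_erase.2 ⟨hep, h⟩⟩)

/-- The orientations of the three arcs do not matter. -/
theorem JWZero.eq_zero {d : ℂ} {ψ : ℤ × ℤ → ℂ} {p₁ q₁ p₂ q₂ p₃ q₃ : Fin 6}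
    (h : JWZero d ψ p₁ q₁ p₂ q₂ p₃ q₃) {g₁ g₂ g₃ : Flow} {K : Multiset Flow}
    (h₁ : g₁.1 = arc p₁ q₁ ∨ g₁.1 = arc q₁ p₁) (h₂ : g₂.1 = arc p₂ q₂ ∨ g₂.1 = arc q₂ p₂)
    (h₃ : g₃.1 = arc p₃ q₃ ∨ g₃.1 = arc q₃ p₃) (hK : ∀ k ∈ K, k.1 = 0)
    (hT : IsTangle (g₁ ::ₘ g₂ ::ₘ g₃ ::ₘ K)) :
    jwValue ψ d (signSums (g₁ ::ₘ g₂ ::ₘ g₃ ::ₘ K)) = 0 := by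
  obtain ⟨c₁, w₁⟩ := g₁
  obtain ⟨c₂, w₂⟩ := g₂
  obtain ⟨c₃, w₃⟩ := g₃
  rcases h₁ with h₁ | h₁ <;> rcases h₂ with h₂ | h₂ <;> rcases h₃ with h₃ | h₃ <;>
    simp only at h₁ h₂ h₃ <;> subst h₁ h₂ h₃
  · exact h _ _ _ K hK hT
  · exact h.swap'.swap.flip.swap.swap' _ _ _ K hK hT
  · exact h.swap.flip.swap _ _ _ K hK hT
  · exact h.swap'.swap.flip.swap.swap'.swap.flip.swap _ _ _ K hK hT
  · exact h.flip _ _ _ K hK hT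
  · exact h.flip.swap'.swap.flip.swap.swap' _ _ _ K hK hT
  · exact h.flip.swap.flip.swap _ _ _ K hK hT
  · exact h.flip.swap'.swap.flip.swap.swap'.swap.flip.swap _ _ _ K hK hT

/-- When the partner of one end is known, it remains to go through the partners of a second end. -/
theorem jwValue_eq_zero_of_arc {d : ℂ} {ψ : ℤ × ℤ → ℂ} {p₁ q₁ p₂ : Fin 6} {S : Finset (Fin 6)}
    {g₁ : Flow} {K₁ : Multiset Flow} (h₁ : g₁.1 = arc p₁ q₁ ∨ g₁.1 = arc q₁ p₁)
    (hM : Matched S endFlow K₁) (hK₁ : ∀ g ∈ K₁, ∀ e ∉ S, g.1 e = 0) (hp₂ : p₂ ∈ S)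
    (H : ∀ q₂ ∈ S.erase p₂, ∃ p₃ q₃, ((S.erase p₂).erase q₂) = {p₃, q₃} ∧
      JWZero d ψ p₁ q₁ p₂ q₂ p₃ q₃) (hT : IsTangle (g₁ ::ₘ K₁)) :
    jwValue ψ d (signSums (g₁ ::ₘ K₁)) = 0 := by
  obtain ⟨q₂, hq₂, g₂, K₂, rfl, h₂, hM₂, hK₂⟩ := hM.exists_arc hK₁ hp₂
  obtain ⟨p₃, q₃, hS, hJ⟩ := H q₂ hq₂
  rw [hS] at hM₂ hK₂
  obtain ⟨q, hq, g₃, K₃, rfl, h₃, -, hK₃⟩ := hM₂.exists_arc hK₂ (p := p₃) (by simp)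
  obtain rfl : q = q₃ := by
    simp only [Finset.mem_erase, Finset.mem_insert, Finset.mem_singleton] at hq
    tauto
  refine hJ.eq_zero h₁ h₂ h₃ (fun k hk => funext fun e => hK₃ k hk e ?_) hT
  simp
  tauto

/-- The fifteen ways to join six ends, by the partners of the end `0` and of the next free end. -/
theorem jwValue_eq_zero {d : ℂ} (hd : d ^ 2 = 2) {ψ : ℤ × ℤ → ℂ} (hψ : IsAmplitude d ψ)
    {L : Multiset Flow} (hL : IsTangle L) (hM : Matched Finset.univ endFlow L) :
    jwValue ψ d (signSums L) = 0 := by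
  obtain ⟨⟨a1, a2, a3⟩, ⟨b1, b2, b3⟩, ⟨c1, c2, c3⟩, ⟨d1, d2, d3⟩, ⟨e1, e2, e3⟩⟩ := jwZero hd hψ
  obtain ⟨q₁, hq₁, g₁, K₁, rfl, h₁, hM₁, hK₁⟩ := hM.exists_arc (by simp) (p := 0) (by simp)
  have h : ∀ q ∈ (Finset.univ : Finset (Fin 6)).erase 0,
      q = 1 ∨ q = 2 ∨ q = 3 ∨ q = 4 ∨ q = 5 := by decide
  rcases h q₁ hq₁ with rfl | rfl | rfl | rfl | rfl
  · refine jwValue_eq_zero_of_arc h₁ hM₁ hK₁ (p₂ := 2) (by decide) (fun q₂ hq₂ => ?_) hL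
    have h : ∀ q ∈ (((Finset.univ : Finset (Fin 6)).erase 0).erase 1).erase 2,
        q = 3 ∨ q = 4 ∨ q = 5 := by decide
    rcases h q₂ hq₂ with rfl | rfl | rfl
    exacts [⟨_, _, by decide, a1⟩, ⟨_, _, by decide, a2⟩, ⟨_, _, by decide, a3⟩]
  · refine jwValue_eq_zero_of_arc h₁ hM₁ hK₁ (p₂ := 1) (by decide) (fun q₂ hq₂ => ?_) hL
    have h : ∀ q ∈ (((Finset.univ : Finset (Fin 6)).erase 0).erase 2).erase 1,
        q = 3 ∨ q = 4 ∨ q = 5 := by decide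
    rcases h q₂ hq₂ with rfl | rfl | rfl
    exacts [⟨_, _, by decide, b1⟩, ⟨_, _, by decide, b2⟩, ⟨_, _, by decide, b3⟩]
  · refine jwValue_eq_zero_of_arc h₁ hM₁ hK₁ (p₂ := 1) (by decide) (fun q₂ hq₂ => ?_) hL
    have h : ∀ q ∈ (((Finset.univ : Finset (Fin 6)).erase 0).erase 3).erase 1,
        q = 2 ∨ q = 4 ∨ q = 5 := by decide
    rcases h q₂ hq₂ with rfl | rfl | rfl
    exacts [⟨_, _, by decide, c1⟩, ⟨_, _, by decide, c2⟩, ⟨_, _, by decide, c3⟩]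
  · refine jwValue_eq_zero_of_arc h₁ hM₁ hK₁ (p₂ := 1) (by decide) (fun q₂ hq₂ => ?_) hL
    have h : ∀ q ∈ (((Finset.univ : Finset (Fin 6)).erase 0).erase 4).erase 1,
        q = 2 ∨ q = 3 ∨ q = 5 := by decide
    rcases h q₂ hq₂ with rfl | rfl | rfl
    exacts [⟨_, _, by decide, d1⟩, ⟨_, _, by decide, d2⟩, ⟨_, _, by decide, d3⟩]
  · refine jwValue_eq_zero_of_arc h₁ hM₁ hK₁ (p₂ := 1) (by decide) (fun q₂ hq₂ => ?_) hL
    have h : ∀ q ∈ (((Finset.univ : Finset (Fin 6)).erase 0).erase 5).erase 1,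
        q = 2 ∨ q = 3 ∨ q = 4 := by decide
    rcases h q₂ hq₂ with rfl | rfl | rfl
    exacts [⟨_, _, by decide, e1⟩, ⟨_, _, by decide, e2⟩, ⟨_, _, by decide, e3⟩]

/-- Amplitudes that satisfy the constraints give zero-energy states. -/
theorem stateOf_mem_zeroEnergy {d : ℂ} (hd : d ^ 2 = 2) {ψ : ℤ × ℤ → ℂ} (hψ : IsAmplitude d ψ) :
    stateOf d ψ ∈ zeroEnergy d := by
  refine mem_zeroEnergy.2 ⟨isSkein_stateOf d hψ.even, fun n i h X => ?_⟩
  obtain ⟨L, h1, h2, h3⟩ := exists_isTangle h X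
  rw [jwSum_stateOf h, h1, jwValue_eq_zero hd hψ h2 h3]

/-! ### Constraints on amplitudes in all bases -/

/-- Some product of the generators substitutes `v.1 • a + v.2 • b` for `v`. -/
def IsModular (a b : ℤ × ℤ) : Prop :=
  ∃ g ∈ Submonoid.closure {modS, modT, reflX}, ∀ ψ v, g ψ v = ψ (v.1 • a + v.2 • b)

theorem isModular_one : IsModular (1, 0) (0, 1) :=
  ⟨1, one_mem _, fun ψ v => by simp⟩

theorem IsModular.rot {a b : ℤ × ℤ} (h : IsModular a b) : IsModular (-b) a := by
  obtain ⟨g, hg, h⟩ := h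
  refine ⟨modS * g, mul_mem (Submonoid.subset_closure (by simp)) hg, fun ψ v => ?_⟩
  show g ψ (v.2, -v.1) = _
  rw [h]
  congr 1
  simp [add_comm]

theorem IsModular.shear {a b : ℤ × ℤ} (h : IsModular a b) : IsModular (a + b) b := by
  obtain ⟨g, hg, h⟩ := h
  refine ⟨modT * g, mul_mem (Submonoid.subset_closure (by simp)) hg, fun ψ v => ?_⟩
  show g ψ (v.1, v.1 + v.2) = _
  rw [h]
  congr 1
  simp only [add_smul, smul_add]
  abel

theorem IsModular.neg {a b : ℤ × ℤ} (h : IsModular a b) : IsModular (-a) b := by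
  obtain ⟨g, hg, h⟩ := h
  refine ⟨reflX * g, mul_mem (Submonoid.subset_closure (by simp)) hg, fun ψ v => ?_⟩
  show g ψ (-v.1, v.2) = _
  rw [h]
  congr 1
  simp

theorem IsModular.swap {a b : ℤ × ℤ} (h : IsModular a b) : IsModular b a := by
  simpa using h.rot.neg

theorem IsModular.add_smul {a b : ℤ × ℤ} (h : IsModular a b) (k : ℤ) :
    IsModular (a + k • b) b := by
  induction k using Int.induction_on with
  | zero => simpa using h
  | succ k ih =>
    have := ih.shear
    rwa [add_assoc, ← add_one_zsmul] at this
  | pred k ih =>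
    have := ih.neg.shear.neg
    rw [neg_add, neg_neg] at this
    rwa [sub_smul, one_smul, ← add_sub_assoc, sub_eq_add_neg]

/-- Every basis of the lattice is reached from the standard one by the generators, by the Euclidean
algorithm on the first components. -/
theorem isModular_of_det {a b : ℤ × ℤ} (h : det a b = 1 ∨ det a b = -1) : IsModular a b := by
  have key : ∀ (N : ℕ) (a b : ℤ × ℤ), b.1.natAbs = N → (det a b = 1 ∨ det a b = -1) →
      IsModular a b := by
    intro N
    induction N using Nat.strong_induction_on with
    | _ N ih =>
      intro a b hN h
      by_cases hb : b.1 = 0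
      · obtain ⟨a1, a2⟩ := a
        obtain ⟨b1, b2⟩ := b
        simp only [det] at h hb
        subst hb
        have hu : IsUnit (a1 * b2) := by
          rw [Int.isUnit_iff]
          simpa using h
        have h1 := Int.isUnit_iff.1 (isUnit_of_mul_isUnit_left hu)
        have h2 := Int.isUnit_iff.1 (isUnit_of_mul_isUnit_right hu)
        have e1 : IsModular (a1, 0) (0, 1) := by
          rcases h1 with rfl | rfl
          · exact isModular_one
          · exact isModular_one.neg
        have e2 : IsModular (a1, 0) (0, b2) := by
          rcases h2 with rfl | rfl
          · exact e1
          · exact e1.swap.neg.swap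
        have := e2.add_smul (a2 * b2)
        rcases h2 with rfl | rfl <;> simpa using this
      · have := ih (a.1 % b.1).natAbs (by
            have := Int.emod_nonneg a.1 hb
            have := Int.emod_lt_abs a.1 hb
            rw [Int.abs_eq_natAbs] at this
            omega) b (a - (a.1 / b.1) • b) (by
            congr 1
            simp only [Prod.fst_sub, Prod.smul_fst, smul_eq_mul]
            have := Int.emod_def a.1 b.1
            linarith [mul_comm b.1 (a.1 / b.1)]) (by
            simp only [det, Prod.fst_sub, Prod.snd_sub, Prod.smul_fst, Prod.smul_snd,
              smul_eq_mul] at h ⊢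
            rcases h with h | h
            · right; linear_combination -h
            · left; linear_combination -h)
        simpa using this.swap.add_smul (a.1 / b.1)
  exact key _ a b rfl h

theorem Primitive.exists_det {u : ℤ × ℤ} (h : Primitive u) : ∃ a, det a u = 1 := by
  obtain ⟨x, y, h⟩ := h
  exact ⟨(y, -x), by simp only [det]; linarith⟩

theorem primitive_of_det {a u : ℤ × ℤ} (h : det a u = 1 ∨ det a u = -1) : Primitive u := by
  simp only [det] at h
  rcases h with h | h
  · exact ⟨-a.2, a.1, by linarith⟩
  · exact ⟨a.2, -a.1, by linarith⟩

theorem IsAmplitude.comp {d : ℂ} {ψ : ℤ × ℤ → ℂ} (h : IsAmplitude d ψ) (A : ℤ × ℤ →+ ℤ × ℤ)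
    (hA : ∀ a b, det (A a) (A b) = det a b ∨ det (A a) (A b) = -det a b) :
    IsAmplitude d fun v => ψ (A v) := by
  have hA' : ∀ a b, det a b = 1 ∨ det a b = -1 → det (A a) (A b) = 1 ∨ det (A a) (A b) = -1 := by
    intro a b
    have := hA a b
    omega
  refine ⟨fun v => ?_, fun a b hab => ?_, fun a b hab => ?_, fun u hu n => ?_⟩
  · rw [map_neg, h.even]
  · simpa only [map_add, map_nsmul, map_zero] using h.three _ _ (hA' a b hab)
  · simpa only [map_add, map_sub, map_nsmul] using h.two _ _ (hA' a b hab)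
  · obtain ⟨a, ha⟩ := hu.exists_det
    have := h.one _ (primitive_of_det (hA' a u (Or.inl ha))) n
    rwa [← map_zsmul, ← map_zsmul] at this

theorem isAmplitude_of_mem {d : ℂ} {ψ : ℤ × ℤ → ℂ} (h : ψ ∈ amplitudes d) : IsAmplitude d ψ := by
  have key : ∀ a b, det a b = 1 ∨ det a b = -1 →
      BasicConstraints d fun v => ψ (v.1 • a + v.2 • b) := by
    intro a b hab
    obtain ⟨g, hg, hg'⟩ := isModular_of_det hab
    have := h.2 g hg
    rwa [show g ψ = fun v => ψ (v.1 • a + v.2 • b) from funext fun v => hg' ψ v] at this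
  refine ⟨h.1, fun a b hab => ?_, fun a b hab => ?_, fun u hu n => ?_⟩
  · simpa using (key a b hab).1
  · have := (key a b hab).2.1
    simpa [sub_eq_add_neg] using this
  · obtain ⟨a, ha⟩ := hu.exists_det
    simpa using (key a u (Or.inl ha)).2.2 n

/-- The images of the basic constraints under the group are the constraints for all bases of the
lattice. -/
theorem mem_amplitudes {d : ℂ} {ψ : ℤ × ℤ → ℂ} : ψ ∈ amplitudes d ↔ IsAmplitude d ψ := by
  refine ⟨isAmplitude_of_mem, fun h => ⟨h.even, fun g hg => ?_⟩⟩
  have key : ∀ ψ, IsAmplitude d ψ → IsAmplitude d (g ψ) := by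
    refine Submonoid.closure_induction (motive := fun g _ => ∀ ψ, IsAmplitude d ψ → IsAmplitude d (g ψ))
      ?_ (fun ψ h => h) (fun f g _ _ hf hg ψ h => hf _ (hg _ h)) hg
    rintro g (rfl | rfl | rfl) ψ h
    · exact h.comp ((AddMonoidHom.snd ℤ ℤ).prod (-AddMonoidHom.fst ℤ ℤ)) fun a b => by
        left; simp [det]; ring
    · exact h.comp ((AddMonoidHom.fst ℤ ℤ).prod (AddMonoidHom.fst ℤ ℤ + AddMonoidHom.snd ℤ ℤ))
        fun a b => by left; simp [det]; ring
    · exact h.comp ((-AddMonoidHom.fst ℤ ℤ).prod (AddMonoidHom.snd ℤ ℤ))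
        fun a b => by right; simp [det]; ring
  have h := key ψ h
  refine ⟨?_, ?_, fun n => ?_⟩
  · have := h.three (1, 0) (0, 1) (by simp [det])
    simp at this
    exact this
  · simpa using h.two (1, 0) (0, 1) (by simp [det])
  · have := h.one (0, 1) ⟨0, 1, by simp⟩ n
    simpa using this

/-! ### Amplitudes of zero-energy states are determined by nine values -/

theorem exists_le_of_mem_signSums_straight {u x : ℤ × ℤ} {g k : ℕ}
    (h : x ∈ signSums (straight u g k)) : ∃ j : ℤ, |j| ≤ g ∧ x = j • u := by
  have h0 : ∀ k : ℕ, ∀ x ∈ signSums (Multiset.replicate k (0 : ℤ × ℤ)), x = 0 := by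
    intro k
    induction k with
    | zero => simp
    | succ k ih =>
      intro x hx
      rw [Multiset.replicate_succ, signSums_cons] at hx
      simp only [neg_zero, zero_add, Multiset.map_id', Multiset.mem_add, or_self] at hx
      exact ih x hx
  induction g generalizing x with
  | zero => exact ⟨0, by simp, by simpa using h0 k x (by simpa [straight] using h)⟩
  | succ g ih =>
    rw [straight, Multiset.replicate_succ, Multiset.cons_add, signSums_cons, Multiset.mem_add,
      Multiset.mem_map, Multiset.mem_map] at h
    rcases h with ⟨y, hy, rfl⟩ | ⟨y, hy, rfl⟩ <;> obtain ⟨j, hj, rfl⟩ := ih hy <;>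
      rw [abs_le] at hj
    · exact ⟨1 + j, by rw [abs_le]; push_cast; constructor <;> linarith, by rw [add_smul, one_smul]⟩
    · exact ⟨-1 + j, by rw [abs_le]; push_cast; constructor <;> linarith,
        by rw [add_smul, neg_smul, one_smul]⟩

theorem HasWinding.mem_windings {C : Config} {v : ℤ × ℤ} (h : C.HasWinding v) :
    v ∈ C.windings := by
  obtain ⟨u, g, k, hu, h1⟩ := C.isStraight
  have h1 := IsStraight.windings h1
  have e : (straight u g k).sum = (g : ℤ) • u := by simp [straight]
  rw [h1]
  rcases (hasWinding_iff hu h1).1 h with rfl | rfl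
  · rw [← e]
    exact sum_mem_signSums _
  · refine Multiset.mem_map.2 ⟨0, by simp, ?_⟩
    rw [e]
    simp

/-- All windings of a configuration are collinear with the winding for parallel arrows and at most
of its size. -/
theorem HasWinding.bound {C : Config} {v w : ℤ × ℤ} (h : C.HasWinding v) (hw : w ∈ C.windings) :
    w.1 * v.2 = w.2 * v.1 ∧ |w.1| ≤ |v.1| ∧ |w.2| ≤ |v.2| := by
  obtain ⟨u, g, k, hu, h1⟩ := C.isStraight
  have h1 := IsStraight.windings h1
  rw [h1] at hw
  obtain ⟨j, hj, rfl⟩ := exists_le_of_mem_signSums_straight hw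
  rcases (hasWinding_iff hu h1).1 h with rfl | rfl <;>
    simp only [Prod.smul_fst, Prod.smul_snd, Prod.fst_neg, Prod.snd_neg, smul_eq_mul, abs_neg,
      abs_mul, Nat.abs_cast]
  · exact ⟨by ring, by gcongr, by gcongr⟩
  · exact ⟨by ring, by gcongr, by gcongr⟩

theorem mem_windings_nil {n : ℕ} {X : Word n n} {v : ℤ × ℤ} :
    v ∈ (close (.nil n) X).windings ↔
      ∃ t, IsLabel n t ∧ ∃ φ, (t, φ) ∈ X.run t ∧ v = (total n t, φ) := windings_mem

theorem mem_windings_hook {n a b : ℕ} {ha : a ≤ n + 1} {hb : b ≤ n + 1}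
    {X : Word (n + 3) (n + 3)} {v : ℤ × ℤ} : v ∈ (close (hook a b ha hb) X).windings ↔
      ∃ t, IsLabel (n + 3) t ∧ ∃ s φ, (s, φ) ∈ X.run t ∧ t a + t (a + 1) = 0 ∧
        s b + s (b + 1) = 0 ∧ del a t = del b s ∧ v = (total (n + 3) t, φ) := by
  rw [← map_turnWindings, turnWindings_close_hook, Multiset.map_map, Multiset.mem_map]
  constructor
  · rintro ⟨g, hg, rfl⟩
    rw [Multiset.mem_filter] at hg
    obtain ⟨h1, h2⟩ := Word.mem_graph hg.1
    exact ⟨g.1, h1, g.2.1, g.2.2.1, h2, hg.2.1, hg.2.2.1, hg.2.2.2, rfl⟩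
  · rintro ⟨t, ht, s, φ, hs, h1, h2, h3, rfl⟩
    rw [← X.map_turnRun, Multiset.mem_map] at hs
    obtain ⟨⟨s', φ', τ⟩, hp, he⟩ := hs
    obtain ⟨rfl, rfl⟩ := Prod.mk.inj he
    refine ⟨(t, s', φ', τ), Multiset.mem_filter.2 ⟨?_, h1, h2, h3⟩, rfl⟩
    exact Multiset.mem_bind.2 ⟨t, mem_labels.2 ht, Multiset.mem_map_of_mem _ hp⟩

theorem abs_total_le {n : ℕ} {u : ℕ → ℤ} (h : IsLabel n u) : |total n u| ≤ n := by
  refine (Finset.abs_sum_le_sum_abs _ _).trans (le_of_eq ?_)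
  rw [Finset.sum_congr rfl (g := fun _ => (1 : ℤ)) fun a ha => ?_]
  · simp
  · rcases h.1 a (Finset.mem_range.1 ha) with h | h <;> simp [h]

/-- `ψ` is the amplitude of a zero-energy state. -/
structure IsGround (d : ℂ) (ψ : ℤ × ℤ → ℂ) : Prop where
  even : ∀ v, ψ (-v) = ψ v
  mem : stateOf d ψ ∈ zeroEnergy d

section Ground

variable {d : ℂ} {ψ : ℤ × ℤ → ℂ}

/-- It suffices that `ψ` vanishes on the windings of all orientations, among which are the parallel
ones. -/
theorem stateOf_eq_zero (hψ : ∀ v, ψ (-v) = ψ v) {C : Config} (h : ∀ v ∈ C.windings, ψ v = 0) :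
    stateOf d ψ C = 0 := by
  obtain ⟨v, hv⟩ := exists_hasWinding C
  have hv := (hv v).2 (Or.inl rfl)
  rw [stateOf_eq hψ hv, h v (HasWinding.mem_windings hv), zero_mul]

theorem eq_zero_of_stateOf (hd : d ≠ 0) (hψ : ∀ v, ψ (-v) = ψ v) {C : Config} {v : ℤ × ℤ}
    (hv : ∀ w, C.HasWinding w → w = v ∨ w = -v) (h : stateOf d ψ C = 0) : ψ v = 0 := by
  obtain ⟨w, hw⟩ := exists_hasWinding C
  have hw := (hw w).2 (Or.inl rfl)
  rw [stateOf_eq hψ hw] at h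
  have h := (mul_eq_zero.1 h).resolve_right (pow_ne_zero _ hd)
  rcases hv w hw with rfl | rfl
  · exact h
  · rwa [hψ] at h

theorem abs_fst_le_of_hook {n a b : ℕ} {ha : a ≤ n + 1} {hb : b ≤ n + 1}
    {X : Word (n + 3) (n + 3)} {v : ℤ × ℤ} (hv : v ∈ (close (hook a b ha hb) X).windings) :
    |v.1| ≤ n + 1 := by
  obtain ⟨t, ht, s, φ, -, h1, -, -, rfl⟩ := mem_windings_hook.1 hv
  rw [← ins_del h1]
  show |total (n + 1 + 2) _| ≤ _
  rw [total_ins ha]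
  exact_mod_cast abs_total_le (isLabel_del ha ht)

/-- The values for `|x| ≤ 2` determine all others. On `n + 3` straight strands, every term of the
Jones-Wenzl relation but the first has two strands joined by a maximum, hence `|x|` at most `n + 1`.
-/
theorem IsGround.eq_zero_of_wide (hd : d ≠ 0) (h : IsGround d ψ)
    (h2 : ∀ x y : ℤ, |x| ≤ 2 → ψ (x, y) = 0) : ψ = 0 := by
  have key : ∀ (n : ℕ), ∀ x y : ℤ, |x| ≤ n + 2 → ψ (x, y) = 0 := by
    intro n
    induction n with
    | zero => simpa using h2
    | succ n ih =>
      have hook0 : ∀ a b (ha : a ≤ n + 1) (hb : b ≤ n + 1) (X : Word (n + 3) (n + 3)),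
          stateOf d ψ (close (hook a b ha hb) X) = 0 := by
        intro a b ha hb X
        refine stateOf_eq_zero h.even fun v hv => ih _ _ ?_
        have := abs_fst_le_of_hook hv
        linarith
      have wide : ∀ y : ℤ, ψ (((n + 3 : ℕ) : ℤ), y) = 0 := by
        have aux : ∀ (X : Word (n + 3) (n + 3)) (v : ℤ × ℤ), (Config.mk (n + 3) X).HasWinding v →
            ψ v = 0 := by
          intro X v hv
          have := (mem_zeroEnergy.1 h.mem).2 n 0 (by omega) X
          simp only [jwSum, hook0, add_zero, mul_zero, sub_zero] at this
          obtain ⟨w, hw⟩ := exists_hasWinding (Config.mk (n + 3) X)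
          refine eq_zero_of_stateOf hd h.even (fun u hu => ?_) this
          have h1 := (hw u).1 hu
          rcases (hw v).1 hv with rfl | rfl
          · exact h1
          · rw [neg_neg]; exact h1.symm
        intro y
        obtain ⟨k, rfl | rfl⟩ := y.eq_nat_or_neg
        · exact aux _ _ (hasWinding_rightPow (n + 2) k)
        · exact aux _ _ (hasWinding_leftPow (n + 2) k)
      intro x y hx
      by_cases hx' : |x| ≤ n + 2
      · exact ih x y hx'
      · rcases abs_cases x with ⟨h1, -⟩ | ⟨h1, -⟩
        · obtain rfl : x = ((n + 3 : ℕ) : ℤ) := by push_cast at hx ⊢; omega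
          exact wide y
        · obtain rfl : x = -((n + 3 : ℕ) : ℤ) := by push_cast at hx ⊢; omega
          rw [← h.even]
          simpa using wide (-y)
  ext ⟨x, y⟩
  exact key x.natAbs x y (by rw [Int.abs_eq_natAbs]; omega)

/-- Two strands of three turn back at the vertical cut, and the third one winds `k` times. -/
def turnThree (k : ℤ) : Word 3 3 :=
  (two (.right 2) (.death 1 0 (by omega))).comp
    ((twist 0 k).comp (two (.birth 1 0 (by omega)) (.left 2)))

/-- The two strands that turn back at the vertical cut carry opposite labels, and the third one is
continued. -/
theorem run_turnThree {k : ℤ} {t s : ℕ → ℤ} {φ : ℤ} (h : (s, φ) ∈ (turnThree k).run t) :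
    t 2 + t 0 = 0 ∧ s 2 + s 0 = 0 ∧ s 1 = t 1 ∧ φ = s 2 - t 2 + k * t 1 := by
  simp [turnThree, Word.run_comp, run_two, Event.back, run_twist] at h
  rcases h with ⟨a, b, hab, rfl, rfl⟩ | ⟨a, b, hab, rfl, rfl⟩ <;> split_ifs at hab with h1 <;>
    simp at hab
  all_goals
    obtain ⟨rfl, rfl⟩ := hab
    simp [rotR] at h1
    simp [rotL, ins, del, rotR, total]
    refine ⟨h1, ?_⟩
    ring

/-- Two strands of four turn back at the vertical cut, and the others wind. -/
def turnFour (W : Word 2 2) (m : ℤ) : Word 4 4 :=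
  (two (.right 3) (.death 2 0 (by omega))).comp
    ((twist 1 m).comp (W.comp (one (.birth 2 2 (by omega)))))

theorem run_turnFour_nil {m : ℤ} {t s : ℕ → ℤ} {φ : ℤ}
    (h : (s, φ) ∈ (turnFour (.nil 2) m).run t) :
    t 2 + t 3 = 0 ∧ s 3 + s 0 = 0 ∧ s 1 = t 0 ∧ s 2 = t 1 ∧ φ = s 3 + m * (t 0 + t 1) := by
  simp [turnFour, Word.run_comp, run_two, run_one, Event.back, run_twist] at h
  rcases h with ⟨a, b, hab, rfl, rfl⟩ | ⟨a, b, hab, rfl, rfl⟩ <;> split_ifs at hab with h1 <;>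
    simp at hab
  all_goals
    obtain ⟨rfl, rfl⟩ := hab
    simp [rotL, ins, del, total, Finset.sum_range_succ]
    exact h1

theorem run_turnFour_right {m : ℤ} {t s : ℕ → ℤ} {φ : ℤ}
    (h : (s, φ) ∈ (turnFour (one (.right 1)) m).run t) :
    t 2 + t 3 = 0 ∧ s 3 + s 0 = 0 ∧ s 1 = t 1 ∧ s 2 = t 0 ∧
      φ = s 3 + m * (t 0 + t 1) + t 0 := by
  simp [turnFour, Word.run_comp, run_two, run_one, Event.back, run_twist] at h
  rcases h with ⟨a, b, hab, rfl, rfl⟩ | ⟨a, b, hab, rfl, rfl⟩ <;> split_ifs at hab with h1 <;>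
    simp at hab
  all_goals
    obtain ⟨rfl, rfl⟩ := hab
    simp [rotL, ins, del, total, Finset.sum_range_succ]
    refine ⟨h1, ?_⟩
    ring

theorem mem_run_turnFour_right (m : ℤ) {t : ℕ → ℤ} (h : t 2 + t 3 = 0) :
    (rotL 3 (ins 0 (-1) (rotL 1 (del 2 t))), -1 + (m * (t 0 + t 1) + t 0)) ∈
      (turnFour (one (.right 1)) m).run t := by
  simp [turnFour, Word.run_comp, run_two, run_one, Event.back, run_twist, h]
  right
  simp [rotL, ins, del, total, Finset.sum_range_succ]
  left
  ring

theorem IsGround.jwSum_eq_zero (h : IsGround d ψ) {n i : ℕ} (hi : i ≤ n)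
    (X : Word (n + 3) (n + 3)) : jwSum d (stateOf d ψ) n i hi X = 0 :=
  (mem_zeroEnergy.1 h.mem).2 n i hi X

theorem total_three (t : ℕ → ℤ) : total 3 t = t 0 + t 1 + t 2 := by
  simp [total, Finset.sum_range_succ]

theorem total_four (t : ℕ → ℤ) : total 4 t = t 0 + t 1 + t 2 + t 3 := by
  simp [total, Finset.sum_range_succ]

/-- If all windings are equal to `v` up to sign, then so is the winding with parallel arrows. -/
theorem hasWinding_of_forall {C : Config} {v : ℤ × ℤ} (h : ∀ w ∈ C.windings, w = v ∨ w = -v) :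
    ∀ w, C.HasWinding w → w = v ∨ w = -v := fun w hw => h w (HasWinding.mem_windings hw)

theorem windings_turnThree_nil {k : ℤ} {v : ℤ × ℤ}
    (hv : v ∈ (close (.nil 3) (turnThree k)).windings) : v = (1, k) ∨ v = -(1, k) := by
  obtain ⟨t, ht, φ, hs, rfl⟩ := mem_windings_nil.1 hv
  obtain ⟨h1, h2, h3, rfl⟩ := run_turnThree hs
  rw [total_three]
  rcases ht.1 1 (by omega) with h | h <;> rw [h]
  · left; ext <;> simp; omega
  · right; ext <;> simp; omega

theorem windings_turnThree_hook {k : ℤ} {a b : ℕ} {ha : a ≤ 1} {hb : b ≤ 1} {v : ℤ × ℤ}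
    (hv : v ∈ (close (n := 3) (hook (n := 0) a b ha hb) (turnThree k)).windings) :
    v = (1, k + 2 * a - 2 * b) ∨ v = -(1, k + 2 * a - 2 * b) := by
  obtain ⟨t, ht, s, φ, hs, e1, e2, e3, rfl⟩ := mem_windings_hook.1 hv
  obtain ⟨h1, h2, h3, rfl⟩ := run_turnThree hs
  have e3 := congrFun e3 0
  show (total 3 t, _) = _ ∨ (total 3 t, _) = _
  rw [total_three]
  obtain rfl | rfl : a = 0 ∨ a = 1 := by omega
  all_goals obtain rfl | rfl : b = 0 ∨ b = 1 := by omega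
  all_goals
    simp [del] at e1 e2 e3
    rcases ht.1 1 (by omega) with h | h
    · left; ext <;> simp [h] <;> omega
    · right; ext <;> simp [h] <;> omega

theorem eq_zero_of_pm {v w : ℤ × ℤ} (hψ : ∀ v, ψ (-v) = ψ v) (h : ψ v = 0)
    (hw : w = v ∨ w = -v) : ψ w = 0 := by
  rcases hw with rfl | rfl
  · exact h
  · rwa [hψ]

/-- In the column `x = 1`, the Jones-Wenzl relation on `turnThree k` relates `y = k - 2`, `y = k`
and `y = k + 2`, so four values determine all others. -/
theorem IsGround.eq_zero_of_one (hd : d ≠ 0) (h : IsGround d ψ) (h0 : ψ (1, 0) = 0)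
    (h1 : ψ (1, 1) = 0) (h2 : ψ (1, 2) = 0) (h3 : ψ (1, 3) = 0) (y : ℤ) : ψ (1, y) = 0 := by
  have nil0 : ∀ k, ψ (1, k) = 0 → stateOf d ψ (close (.nil 3) (turnThree k)) = 0 := fun k hk =>
    stateOf_eq_zero h.even fun v hv => eq_zero_of_pm h.even hk (windings_turnThree_nil hv)
  have hook0 : ∀ (k : ℤ) (a b : ℕ) (ha : a ≤ 1) (hb : b ≤ 1), ψ (1, k + 2 * a - 2 * b) = 0 →
      stateOf d ψ (close (n := 3) (hook (n := 0) a b ha hb) (turnThree k)) = 0 :=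
    fun k a b ha hb hk => stateOf_eq_zero h.even fun v hv =>
      eq_zero_of_pm h.even hk (windings_turnThree_hook hv)
  have up : ∀ k, ψ (1, k) = 0 → ψ (1, k - 2) = 0 → ψ (1, k + 2) = 0 := by
    intro k e1 e2
    have := h.jwSum_eq_zero le_rfl (turnThree k)
    simp only [jwSum] at this
    rw [nil0 k e1, hook0 k 0 0 _ _ (by simpa using e1), hook0 k 1 1 _ _ (by simpa using e1),
      hook0 k 0 1 _ _ (by simpa using e2)] at this
    refine eq_zero_of_stateOf hd h.even (C := close (hook (0 + 1) 0 _ _) (turnThree k))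
      (hasWinding_of_forall fun w hw => ?_) (by linear_combination this)
    simpa using windings_turnThree_hook hw
  have down : ∀ k, ψ (1, k) = 0 → ψ (1, k + 2) = 0 → ψ (1, k - 2) = 0 := by
    intro k e1 e2
    have := h.jwSum_eq_zero le_rfl (turnThree k)
    simp only [jwSum] at this
    rw [nil0 k e1, hook0 k 0 0 _ _ (by simpa using e1), hook0 k 1 1 _ _ (by simpa using e1),
      hook0 k 1 0 _ _ (by simpa using e2)] at this
    refine eq_zero_of_stateOf hd h.even (C := close (hook 0 (0 + 1) _ _) (turnThree k))
      (hasWinding_of_forall fun w hw => ?_) (by linear_combination this)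
    simpa using windings_turnThree_hook hw
  have key : ∀ k : ℤ, ψ (1, k) = 0 ∧ ψ (1, k + 1) = 0 ∧ ψ (1, k + 2) = 0 ∧ ψ (1, k + 3) = 0 := by
    intro k
    induction k using Int.induction_on with
    | zero => exact ⟨h0, h1, h2, h3⟩
    | succ k ih =>
      obtain ⟨i0, i1, i2, i3⟩ := ih
      refine ⟨i1, by rwa [add_assoc], by rwa [add_assoc], ?_⟩
      have := up (k + 2) i2 (by simpa using i0)
      rw [add_assoc] at this ⊢
      exact this
    | pred k ih =>
      obtain ⟨i0, i1, i2, i3⟩ := ih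
      refine ⟨?_, by simpa using i0, ?_, ?_⟩
      · have := down (-k + 1) i1 (by rw [add_assoc]; exact i3)
        rwa [show (-k + 1 - 2 : ℤ) = -k - 1 by ring] at this
      · rwa [show (-k - 1 + 2 : ℤ) = -k + 1 by ring]
      · rwa [show (-k - 1 + 3 : ℤ) = -k + 2 by ring]
  exact (key y).1

theorem windings_turnFour_fst {W : Word 2 2} {m : ℤ}
    (hW : ∀ t s φ, (s, φ) ∈ (turnFour W m).run t → t 2 + t 3 = 0 ∧ s 3 + s 0 = 0 ∧
      s 1 + s 2 = t 0 + t 1) {a b : ℕ} (hab : a = 0 ∨ b = 1) (ha : a ≤ 2) (hb : b ≤ 2)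
    {v : ℤ × ℤ} (hv : v ∈ (close (n := 4) (hook (n := 1) a b ha hb) (turnFour W m)).windings) :
    v.1 = 0 := by
  obtain ⟨t, ht, s, φ, hs, e1, e2, e3, rfl⟩ := mem_windings_hook.1 hv
  obtain ⟨h1, h2, h3⟩ := hW t s φ hs
  show total 4 t = 0
  rw [total_four]
  rcases hab with rfl | rfl <;> simp at e1 e2 <;> omega

/-- A step in the column `x = 2`: three of the five terms of the Jones-Wenzl relation have `x = 0`
and vanish, and the remaining two have windings `v` and `w`. -/
theorem IsGround.two_step (hd : d ≠ 0) (h : IsGround d ψ) (h0 : ∀ y, ψ (0, y) = 0) {W : Word 2 2}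
    {m : ℤ} (hW : ∀ t s φ, (s, φ) ∈ (turnFour W m).run t → t 2 + t 3 = 0 ∧ s 3 + s 0 = 0 ∧
      s 1 + s 2 = t 0 + t 1) {v w : ℤ × ℤ}
    (hv : (close (.nil 4) (turnFour W m)).HasWinding v)
    (hw : (close (n := 4) (hook (n := 1) 1 0 (by omega) (by omega)) (turnFour W m)).HasWinding w) :
    ψ v = 0 ↔ ψ w = 0 := by
  have hook0 : ∀ (a b : ℕ) (ha : a ≤ 2) (hb : b ≤ 2), a = 0 ∨ b = 1 →
      stateOf d ψ (close (n := 4) (hook (n := 1) a b ha hb) (turnFour W m)) = 0 :=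
    fun a b ha hb hab => stateOf_eq_zero h.even fun v hv => by
      obtain ⟨x, y⟩ := v
      obtain rfl : x = 0 := windings_turnFour_fst hW hab ha hb hv
      exact h0 y
  have := h.jwSum_eq_zero (i := 0) (by omega) (turnFour W m)
  simp only [jwSum] at this
  rw [hook0 0 0 _ _ (by simp), hook0 (0 + 1) (0 + 1) _ _ (by simp), hook0 0 (0 + 1) _ _ (by simp),
    add_zero, add_zero, mul_zero, sub_zero, stateOf_eq h.even hv] at this
  have e : stateOf d ψ (close (n := 4) (hook (n := 1) (0 + 1) 0 (by omega) (by omega))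
    (turnFour W m)) = _ := stateOf_eq h.even hw
  rw [e] at this
  constructor
  · intro h
    rw [h, zero_mul, zero_add] at this
    exact (mul_eq_zero.1 this).resolve_right (pow_ne_zero _ hd)
  · intro h
    rw [h, zero_mul, add_zero] at this
    exact (mul_eq_zero.1 this).resolve_right (pow_ne_zero _ hd)

/-- A winding whose first component is nonzero and of maximal size among all orientations is
attained with parallel arrows. -/
theorem hasWinding_of_mem {C : Config} {w : ℤ × ℤ} (hw : w ∈ C.windings) (h1 : w.1 ≠ 0)
    (h2 : ∀ v ∈ C.windings, |v.1| ≤ |w.1|) : C.HasWinding w := by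
  obtain ⟨v, hv⟩ := exists_hasWinding C
  have hv' := (hv v).2 (Or.inl rfl)
  rw [hv]
  obtain ⟨e1, e2, -⟩ := HasWinding.bound hv' hw
  have e3 := le_antisymm e2 (h2 v (HasWinding.mem_windings hv'))
  obtain ⟨w1, w2⟩ := w
  obtain ⟨v1, v2⟩ := v
  simp only at *
  rcases abs_eq_abs.1 e3 with rfl | rfl
  · left
    rw [mul_comm w2] at e1
    rw [mul_left_cancel₀ h1 e1]
  · right
    have : v2 = -w2 := mul_left_cancel₀ h1 (by linear_combination e1)
    subst this
    simp

/-- One step between odd values of `y` in the column `x = 2`. -/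
theorem hasWinding_turnFour_nil (m : ℤ) :
    (close (.nil 4) (turnFour (.nil 2) m)).HasWinding (2, 2 * m - 1) ∧
    (close (n := 4) (hook (n := 1) 1 0 (by omega) (by omega)) (turnFour (.nil 2) m)).HasWinding
      (2, 2 * m + 1) := by
  have key : ∀ {C : Config} {w : ℤ × ℤ}, (∀ v ∈ C.windings, v = w ∨ v = -w) → C.HasWinding w := by
    intro C w h
    obtain ⟨v, hv⟩ := exists_hasWinding C
    have hv' := (hv v).2 (Or.inl rfl)
    rw [hv]
    rcases h v (HasWinding.mem_windings hv') with rfl | rfl <;> simp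
  constructor
  · refine key fun v hv => ?_
    obtain ⟨t, ht, φ, hs, rfl⟩ := mem_windings_nil.1 hv
    obtain ⟨h1, h2, h3, h4, rfl⟩ := run_turnFour_nil hs
    rw [total_four]
    rcases ht.1 0 (by omega) with h | h
    · have h5 : t 1 = 1 := by omega
      left; ext <;> simp [h, h5] <;> omega
    · have h5 : t 1 = -1 := by omega
      right; ext <;> simp [h, h5] <;> omega
  · refine key fun v hv => ?_
    obtain ⟨t, ht, s, φ, hs, e1, e2, e3, rfl⟩ := mem_windings_hook.1 hv
    obtain ⟨h1, h2, h3, h4, rfl⟩ := run_turnFour_nil hs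
    have e4 := congrFun e3 0
    have e5 := congrFun e3 1
    simp [del] at e1 e2 e4 e5
    show (total 4 t, _) = _ ∨ (total 4 t, _) = _
    rw [total_four]
    rcases ht.1 0 (by omega) with h | h
    · have h5 : t 1 = 1 := by omega
      left; ext <;> simp [h, h5] <;> omega
    · have h5 : t 1 = -1 := by omega
      right; ext <;> simp [h, h5] <;> omega

theorem abs_add_le_two {t : ℕ → ℤ} (ht : IsLabel 4 t) : |t 0 + t 1| ≤ 2 := by
  rcases ht.1 0 (by omega) with h | h <;> rcases ht.1 1 (by omega) with h' | h' <;>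
    rw [h, h'] <;> norm_num

/-- One step between even values of `y` in the column `x = 2`. -/
theorem hasWinding_turnFour_right (m : ℤ) :
    (close (.nil 4) (turnFour (one (.right 1)) m)).HasWinding (2, 2 * m) ∧
    (close (n := 4) (hook (n := 1) 1 0 (by omega) (by omega))
      (turnFour (one (.right 1)) m)).HasWinding (2, 2 * m + 2) := by
  constructor
  · refine hasWinding_of_mem ?_ (by norm_num) fun v hv => ?_
    · let t : ℕ → ℤ := fun k => if k < 3 then 1 else if k = 3 then -1 else 0
      have ht : IsLabel 4 t := by
        constructor <;> intro a ha <;> simp only [t] <;> split_ifs <;> omega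
      have e : rotL 3 (ins 0 (-1) (rotL 1 (del 2 t))) = t := by
        ext j
        rcases j with _ | _ | _ | _ | j <;> simp [rotL, ins, del, t]
      have := mem_run_turnFour_right m (t := t) (by simp [t])
      rw [e] at this
      refine mem_windings_nil.2 ⟨t, ht, _, this, ?_⟩
      rw [total_four]
      ext <;> simp [t]
      ring
    · obtain ⟨t, ht, φ, hs, rfl⟩ := mem_windings_nil.1 hv
      obtain ⟨h1, -⟩ := run_turnFour_right hs
      show |total 4 t| ≤ 2
      rw [total_four, add_assoc, h1, add_zero]
      exact abs_add_le_two ht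
  · have : (close (n := 4) (hook (n := 1) 1 0 (by omega) (by omega))
        (turnFour (one (.right 1)) m)).HasWinding (-(2, 2 * m + 2)) := by
      refine hasWinding_of_mem ?_ (by norm_num) fun v hv => ?_
      · let t : ℕ → ℤ := fun k => if k < 4 then (if k = 2 then 1 else -1) else 0
        have ht : IsLabel 4 t := by
          constructor <;> intro a ha <;> simp only [t] <;> split_ifs <;> omega
        have := mem_run_turnFour_right m (t := t) (by simp [t])
        refine mem_windings_hook.2 ⟨t, ht, _, _, this, by simp [t], ?_, ?_, ?_⟩
        · simp [rotL, ins, del, t]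
        · ext j
          rcases j with _ | _ | j <;> simp [rotL, ins, del, t]
        · show _ = (total 4 t, _)
          rw [total_four]
          ext <;> simp [t]
          ring
      · obtain ⟨t, ht, s, φ, hs, -, -, -, rfl⟩ := mem_windings_hook.1 hv
        obtain ⟨h1, -⟩ := run_turnFour_right hs
        show |total 4 t| ≤ 2
        rw [total_four, add_assoc, h1, add_zero]
        exact abs_add_le_two ht
    simpa using HasWinding.neg this

/-- The column `x = 2`, in steps of `2` from `y = 0` and `y = 1`. -/
theorem IsGround.eq_zero_of_two (hd : d ≠ 0) (h : IsGround d ψ) (h0 : ∀ y, ψ (0, y) = 0)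
    (h1 : ψ (2, 0) = 0) (h2 : ψ (2, 1) = 0) (y : ℤ) : ψ (2, y) = 0 := by
  have odd : ∀ m : ℤ, ψ (2, 2 * m - 1) = 0 ↔ ψ (2, 2 * m + 1) = 0 := fun m =>
    h.two_step hd h0 (fun t s φ hs => by
      obtain ⟨e1, e2, e3, e4, -⟩ := run_turnFour_nil hs
      exact ⟨e1, e2, by omega⟩) (hasWinding_turnFour_nil m).1 (hasWinding_turnFour_nil m).2
  have even : ∀ m : ℤ, ψ (2, 2 * m) = 0 ↔ ψ (2, 2 * m + 2) = 0 := fun m =>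
    h.two_step hd h0 (fun t s φ hs => by
      obtain ⟨e1, e2, e3, e4, -⟩ := run_turnFour_right hs
      exact ⟨e1, e2, by omega⟩) (hasWinding_turnFour_right m).1 (hasWinding_turnFour_right m).2
  have key : ∀ m : ℤ, ψ (2, 2 * m) = 0 ∧ ψ (2, 2 * m + 1) = 0 := by
    intro m
    induction m using Int.induction_on with
    | zero => exact ⟨h1, h2⟩
    | succ k ih =>
      refine ⟨?_, ?_⟩
      · rw [mul_add, mul_one, ← even]
        exact ih.1
      · rw [← odd, show (2 * ((k : ℤ) + 1) - 1) = 2 * k + 1 by ring]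
        exact ih.2
    | pred k ih =>
      refine ⟨?_, ?_⟩
      · rw [even, show (2 * (-(k : ℤ) - 1) + 2) = 2 * -k by ring]
        exact ih.1
      · rw [show (2 * (-(k : ℤ) - 1) + 1) = 2 * -k - 1 by ring, odd]
        exact ih.2
  obtain ⟨m, rfl | rfl⟩ := Int.even_or_odd' y
  · exact (key m).1
  · exact (key m).2

end Ground

section Ground

variable {d : ℂ} {ψ : ℤ × ℤ → ℂ}

/-- Six strands cross the vertical cut in three nested arcs, which separate them from `n` parallel
horizontal loops. -/
def nested (n : ℕ) : Word 6 6 :=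
  (two (.right 5) (.death 4 0 (by omega))).comp
    ((two (.right 3) (.death 2 0 (by omega))).comp
      ((two (.right 1) (.death 0 0 le_rfl)).comp
        ((hPow n).comp (three (.birth 0 0 le_rfl) (.birth 2 1 (by omega))
          (.birth 4 2 (by omega))))))

theorem abs_le_of_mem_signSums_one {n : ℕ} {x : ℤ}
    (h : x ∈ signSums (Multiset.replicate n (1 : ℤ))) : |x| ≤ n := by
  induction n generalizing x with
  | zero => simp at h; simp [h]
  | succ n ih =>
    rw [Multiset.replicate_succ, signSums_cons, Multiset.mem_add, Multiset.mem_map,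
      Multiset.mem_map] at h
    rcases h with ⟨y, hy, rfl⟩ | ⟨y, hy, rfl⟩ <;> have := abs_le.1 (ih hy) <;> rw [abs_le] <;>
      push_cast <;> constructor <;> linarith

theorem run_right_death {n : ℕ} {t s : ℕ → ℤ} {φ : ℤ} :
    (s, φ) ∈ (two (.right (n + 1)) (.death n 0 n.zero_le)).run t ↔
      ∃ x, (x = 1 ∨ x = -1) ∧ s = rotL (n + 1) (ins 0 x t) ∧ φ = x := by
  simp only [run_two, Event.back, Multiset.insert_eq_cons, Multiset.mem_bind, Multiset.mem_cons,
    Multiset.mem_singleton, Multiset.mem_map, Prod.exists, Prod.mk.injEq]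
  constructor
  · rintro ⟨a, b, ⟨rfl, rfl⟩ | ⟨rfl, rfl⟩, a', b', ⟨rfl, rfl⟩, rfl, rfl⟩
    · exact ⟨1, by simp, rfl, by simp [ins_self]⟩
    · exact ⟨-1, by simp, rfl, by simp [ins_self]⟩
  · rintro ⟨x, rfl | rfl, rfl, rfl⟩
    · exact ⟨_, 0, Or.inl ⟨rfl, rfl⟩, _, _, ⟨rfl, rfl⟩, rfl, by simp [ins_self]⟩
    · exact ⟨_, 0, Or.inr ⟨rfl, rfl⟩, _, _, ⟨rfl, rfl⟩, rfl, by simp [ins_self]⟩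

theorem run_three_births {t s : ℕ → ℤ} {φ : ℤ} :
    (s, φ) ∈ (three (.birth 0 0 le_rfl) (.birth 2 1 (by omega)) (.birth 4 2 (by omega))).run t ↔
      (t 2 + t 3 = 0 ∧ t 1 + t 4 = 0 ∧ t 0 + t 5 = 0) ∧ s = del 0 (del 1 (del 2 t)) ∧ φ = 0 := by
  have e1 : del 2 t 1 = t 1 := rfl
  have e2 : del 2 t (1 + 1) = t 4 := rfl
  have e3 : del 1 (del 2 t) 0 = t 0 := rfl
  have e4 : del 1 (del 2 t) (0 + 1) = t 5 := rfl
  rw [run_three, run_two]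
  simp only [Event.back]
  by_cases h1 : t 2 + t (2 + 1) = 0
  · rw [if_pos h1]
    simp only [Multiset.singleton_bind, e1, e2]
    by_cases h2 : t 1 + t 4 = 0
    · rw [if_pos h2]
      simp only [Multiset.map_singleton, Multiset.singleton_bind, e3, e4]
      by_cases h3 : t 0 + t 5 = 0
      · rw [if_pos h3]
        simp [h1, h2, h3]
      · simp [h3]
    · simp [h2]
  · simp [h1]

theorem mem_run_comp {m n k : ℕ} {X : Word m n} {Y : Word n k} {t s : ℕ → ℤ} {φ : ℤ} :
    (s, φ) ∈ (X.comp Y).run t ↔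
      ∃ u φ₁ φ₂, (u, φ₁) ∈ Y.run t ∧ (s, φ₂) ∈ X.run u ∧ φ = φ₂ + φ₁ := by
  rw [Word.run_comp, Multiset.mem_bind]
  constructor
  · rintro ⟨p, hp, h⟩
    obtain ⟨q, hq, h⟩ := Multiset.mem_map.1 h
    obtain ⟨rfl, rfl⟩ := Prod.mk.inj h
    exact ⟨p.1, p.2, q.2, hp, hq, rfl⟩
  · rintro ⟨u, φ₁, φ₂, h1, h2, rfl⟩
    exact ⟨(u, φ₁), h1, Multiset.mem_map.2 ⟨(s, φ₂), h2, rfl⟩⟩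

theorem run_nested_iff {n : ℕ} {t s : ℕ → ℤ} {φ : ℤ} : (s, φ) ∈ (nested n).run t ↔
    (t 2 + t 3 = 0 ∧ t 1 + t 4 = 0 ∧ t 0 + t 5 = 0) ∧
      ∃ x y z : ℤ, ∃ h ∈ signSums (Multiset.replicate n (1 : ℤ)), (x = 1 ∨ x = -1) ∧
      (y = 1 ∨ y = -1) ∧ (z = 1 ∨ z = -1) ∧ φ = x + (y + (z + h)) ∧
      s = rotL 5 (ins 0 x (rotL 3 (ins 0 y (rotL 1 (ins 0 z (del 0 (del 1 (del 2 t)))))))) := by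
  simp only [nested, mem_run_comp, run_three_births, run_right_death, run_hPow, Multiset.mem_map,
    Prod.mk.injEq]
  constructor
  · rintro ⟨_, _, _, ⟨_, _, _, ⟨_, _, _, ⟨_, _, _, ⟨ht, rfl, rfl⟩, ⟨h, hh, rfl, rfl⟩, rfl⟩,
      ⟨z, hz, rfl, rfl⟩, rfl⟩, ⟨y, hy, rfl, rfl⟩, rfl⟩, ⟨x, hx, rfl, rfl⟩, rfl⟩
    exact ⟨ht, _, _, _, h, hh, hx, hy, hz, by simp, rfl⟩
  · rintro ⟨ht, x, y, z, h, hh, hx, hy, hz, rfl, rfl⟩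
    exact ⟨_, _, _, ⟨_, _, _, ⟨_, _, _, ⟨_, _, _, ⟨ht, rfl, rfl⟩, ⟨h, hh, rfl, rfl⟩, rfl⟩,
      ⟨z, hz, rfl, rfl⟩, rfl⟩, ⟨y, hy, rfl, rfl⟩, rfl⟩, ⟨x, hx, rfl, rfl⟩, by simp⟩

/-- The labels below and above the nested arcs. -/
theorem run_nested {n : ℕ} {t s : ℕ → ℤ} {φ : ℤ} (h : (s, φ) ∈ (nested n).run t) :
    (t 2 + t 3 = 0 ∧ t 1 + t 4 = 0 ∧ t 0 + t 5 = 0) ∧ |s 0| = 1 ∧ |s 1| = 1 ∧ |s 2| = 1 ∧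
      |φ + (s 0 + s 1 + s 2)| ≤ n := by
  obtain ⟨ht, x, y, z, φ', hh, hx, hy, hz, rfl, rfl⟩ := run_nested_iff.1 h
  have := abs_le_of_mem_signSums_one hh
  refine ⟨ht, ?_⟩
  simp [rotL, ins]
  refine ⟨(abs_eq zero_le_one).2 hx, (abs_eq zero_le_one).2 hy, (abs_eq zero_le_one).2 hz, ?_⟩
  rwa [show x + (y + (z + φ')) + (-x + -y + -z) = φ' by ring]

theorem total_six (t : ℕ → ℤ) : total 6 t = t 0 + t 1 + t 2 + t 3 + t 4 + t 5 := by
  simp [total, Finset.sum_range_succ]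

/-- Without a hook, the three arcs close up to horizontal loops. -/
theorem hasWinding_nested (n : ℕ) : (close (.nil 6) (nested n)).HasWinding (0, n + 3) := by
  have hmem : ((0, n + 3) : ℤ × ℤ) ∈ (close (.nil 6) (nested n)).windings := by
    let t : ℕ → ℤ := fun k => if k < 6 then (if k < 3 then -1 else 1) else 0
    have ht : IsLabel 6 t := by
      constructor <;> intro a ha <;> simp only [t] <;> split_ifs <;> omega
    refine mem_windings_nil.2 ⟨t, ht, n + 3, run_nested_iff.2 ⟨by simp [t], 1, 1, 1, n, ?_, by simp,
      by simp, by simp, by ring, ?_⟩, ?_⟩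
    · simpa using sum_mem_signSums (Multiset.replicate n (1 : ℤ))
    · ext j
      rcases j with _ | _ | _ | _ | _ | _ | j <;> simp [rotL, ins, del, t]
      split_ifs <;> omega
    · rw [total_six]
      simp [t]
  obtain ⟨v, hv⟩ := exists_hasWinding (close (.nil 6) (nested n))
  have hv' := (hv v).2 (Or.inl rfl)
  rw [hv]
  obtain ⟨-, -, e2⟩ := HasWinding.bound hv' hmem
  obtain ⟨t, ht, φ, hs, rfl⟩ := mem_windings_nil.1 (HasWinding.mem_windings hv')
  obtain ⟨⟨h1, h2, h3⟩, a0, a1, a2, h4⟩ := run_nested hs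
  have e0 : total 6 t = 0 := by rw [total_six]; omega
  have e3 : |φ| = n + 3 := by
    have e4 : |φ| ≤ |φ + (t 0 + t 1 + t 2)| + |t 0 + t 1 + t 2| := by
      have := abs_add_le (φ + (t 0 + t 1 + t 2)) (-(t 0 + t 1 + t 2))
      rwa [abs_neg, add_neg_cancel_right] at this
    have e5 := abs_add_three (t 0) (t 1) (t 2)
    have e6 : |((n : ℤ) + 3)| = n + 3 := abs_of_nonneg (by positivity)
    simp only at e2
    omega
  rw [e0]
  rcases (abs_eq (by positivity)).1 e3 with rfl | rfl
  · exact Or.inl rfl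
  · right
    simp

/-- A hook joins two of the horizontal loops that come from the arcs, which reduces the winding. -/
theorem windings_nested_hook {n a b : ℕ} {ha : a ≤ 4} {hb : b ≤ 1} {v : ℤ × ℤ}
    (hv : v ∈ (close (n := 6) (hook (n := 3) a b ha (by omega)) (nested n)).windings) :
    v.1 = 0 ∧ |v.2| ≤ n + 1 := by
  obtain ⟨t, ht, s, φ, hs, -, e2, -, rfl⟩ := mem_windings_hook.1 hv
  obtain ⟨⟨h1, h2, h3⟩, a0, a1, a2, h4⟩ := run_nested hs
  refine ⟨?_, ?_⟩
  · show total 6 t = 0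
    rw [total_six]
    omega
  · show |φ| ≤ n + 1
    have e5 : |s 0 + s 1 + s 2| = 1 := by
      obtain rfl | rfl : b = 0 ∨ b = 1 := by omega
      · rw [show s 0 + s 1 + s 2 = s 2 by simpa using e2]
        exact a2
      · have e2 : s 1 + s 2 = 0 := e2
        rwa [add_assoc, e2, add_zero]
    have e4 : |φ| ≤ |φ + (s 0 + s 1 + s 2)| + |s 0 + s 1 + s 2| := by
      have := abs_add_le (φ + (s 0 + s 1 + s 2)) (-(s 0 + s 1 + s 2))
      rwa [abs_neg, add_neg_cancel_right] at this
    omega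

/-- In the column `x = 0`, the Jones-Wenzl relation on `nested n` expresses the value at `y = n + 3`
by values at smaller `|y|`. -/
theorem IsGround.eq_zero_of_zero (hd : d ≠ 0) (h : IsGround d ψ) (h0 : ψ (0, 0) = 0)
    (h1 : ψ (0, 1) = 0) (h2 : ψ (0, 2) = 0) (y : ℤ) : ψ (0, y) = 0 := by
  have key : ∀ n : ℕ, ∀ m ≤ n, ψ (0, (m : ℤ)) = 0 := by
    intro n
    induction n with
    | zero =>
      intro m hm
      obtain rfl : m = 0 := by omega
      exact h0
    | succ n ih =>
      intro m hm
      obtain hm | rfl : m ≤ n ∨ m = n + 1 := by omega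
      · exact ih m hm
      obtain rfl | rfl | ⟨k, rfl⟩ : n = 0 ∨ n = 1 ∨ ∃ k, n = k + 2 := by
        rcases n with _ | _ | k
        · exact Or.inl rfl
        · exact Or.inr (Or.inl rfl)
        · exact Or.inr (Or.inr ⟨k, rfl⟩)
      · exact h1
      · exact h2
      have hook0 : ∀ (a b : ℕ) (ha : a ≤ 4) (hb : b ≤ 1),
          stateOf d ψ (close (n := 6) (hook (n := 3) a b ha (by omega)) (nested k)) = 0 :=
        fun a b ha hb => stateOf_eq_zero h.even fun v hv => by
          obtain ⟨e1, e2⟩ := windings_nested_hook (hb := hb) hv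
          obtain ⟨v1, v2⟩ := v
          simp only at e1 e2
          subst e1
          obtain ⟨m, rfl | rfl⟩ := v2.eq_nat_or_neg
          · rw [Nat.abs_cast] at e2
            exact ih m (by omega)
          · rw [abs_neg, Nat.abs_cast] at e2
            rw [← h.even]
            simpa using ih m (by omega)
      have := h.jwSum_eq_zero (i := 0) (by omega) (nested k)
      simp only [jwSum] at this
      rw [hook0 0 0 _ (by omega), hook0 (0 + 1) (0 + 1) _ (by omega), hook0 0 (0 + 1) _ (by omega),
        hook0 (0 + 1) 0 _ (by omega)] at this
      have e := stateOf_eq (d := d) h.even (hasWinding_nested k)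
      have e' : stateOf d ψ (close (.nil 6) (nested k)) = 0 := by linear_combination this
      rw [e'] at e
      have := (mul_eq_zero.1 e.symm).resolve_right (pow_ne_zero _ hd)
      push_cast
      rwa [show ((k : ℤ) + 2 + 1) = k + 3 by ring]
  obtain ⟨m, rfl | rfl⟩ := y.eq_nat_or_neg
  · exact key m m le_rfl
  · rw [← h.even]
    simpa using key m m le_rfl

/-- Nine values determine the amplitudes of a zero-energy state. -/
theorem IsGround.eq_zero (hd : d ≠ 0) (h : IsGround d ψ) (h00 : ψ (0, 0) = 0) (h01 : ψ (0, 1) = 0)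
    (h02 : ψ (0, 2) = 0) (h10 : ψ (1, 0) = 0) (h11 : ψ (1, 1) = 0) (h12 : ψ (1, 2) = 0)
    (h13 : ψ (1, 3) = 0) (h20 : ψ (2, 0) = 0) (h21 : ψ (2, 1) = 0) : ψ = 0 := by
  have z0 := h.eq_zero_of_zero hd h00 h01 h02
  have z1 := h.eq_zero_of_one hd h10 h11 h12 h13
  have z2 := h.eq_zero_of_two hd z0 h20 h21
  refine h.eq_zero_of_wide hd fun x y hx => ?_
  rw [abs_le] at hx
  obtain rfl | rfl | rfl | rfl | rfl : x = -2 ∨ x = -1 ∨ x = 0 ∨ x = 1 ∨ x = 2 := by omega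
  · rw [← h.even]
    exact z2 (-y)
  · rw [← h.even]
    exact z1 (-y)
  · exact z0 y
  · exact z1 y
  · exact z2 y

end Ground

end TorusLoops

namespace TorusLoops

/-! ### Explicit solutions of the constraints -/

/-- The primitive vector in the direction of `v`. -/
def direction (v : ℤ × ℤ) : ℤ × ℤ := (v.1 / (v.1.gcd v.2 : ℤ), v.2 / (v.1.gcd v.2 : ℤ))

theorem direction_smul {u : ℤ × ℤ} (hu : Primitive u) (n : ℕ) :
    direction (((n + 1 : ℕ) : ℤ) • u) = u := by
  have h1 : (u.1.gcd u.2 : ℕ) = 1 := Int.isCoprime_iff_gcd_eq_one.1 hu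
  have hn : ((n + 1 : ℕ) : ℤ) ≠ 0 := by positivity
  simp only [direction, Prod.smul_fst, Prod.smul_snd, smul_eq_mul, Int.gcd_mul_left, h1, mul_one,
    Int.natAbs_natCast]
  rw [Int.mul_ediv_cancel_left _ hn, Int.mul_ediv_cancel_left _ hn]

theorem direction_self {u : ℤ × ℤ} (hu : Primitive u) : direction u = u := by
  simpa using direction_smul hu 0

theorem direction_neg (v : ℤ × ℤ) : direction (-v) = -direction v := by
  simp only [direction, Prod.fst_neg, Prod.snd_neg, Int.gcd_neg, Int.neg_gcd]
  ext
  · exact Int.neg_ediv_of_dvd (Int.gcd_dvd_left _ _)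
  · exact Int.neg_ediv_of_dvd (Int.gcd_dvd_right _ _)

theorem parity_add (v w : ℤ × ℤ) : parity (v + w) = parity v + parity w := by
  simp [parity]

theorem parity_neg (v : ℤ × ℤ) : parity (-v) = parity v := by
  simp [parity]

theorem parity_two_nsmul (v : ℤ × ℤ) : parity (2 • v) = 0 := by
  rw [two_smul, parity_add]
  exact CharTwo.add_self_eq_zero (R := ZMod 2 × ZMod 2) _

theorem parity_add_two_nsmul (v w : ℤ × ℤ) : parity (v + 2 • w) = parity v := by
  rw [parity_add, parity_two_nsmul, add_zero]

theorem parity_sub_two_nsmul (v w : ℤ × ℤ) : parity (v - 2 • w) = parity v := by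
  rw [sub_eq_add_neg, parity_add, parity_neg, parity_two_nsmul, add_zero]

theorem parity_add_two_smul (n : ℕ) (u : ℤ × ℤ) :
    parity (((3 + n : ℕ) : ℤ) • u) = parity (((1 + n : ℕ) : ℤ) • u) := by
  rw [show ((3 + n : ℕ) : ℤ) • u = ((1 + n : ℕ) : ℤ) • u + 2 • u by
    rw [← natCast_zsmul, ← add_smul]; congr 1; push_cast; ring, parity_add_two_nsmul]

variable {d : ℂ} {ψ : ℤ × ℤ → ℂ}

/-- The constraints do not mix the parity sectors. -/
theorem IsAmplitude.glue {φ : ZMod 2 × ZMod 2 → ℤ × ℤ → ℂ} (h : ∀ ε, IsAmplitude d (φ ε)) :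
    IsAmplitude d fun v => φ (parity v) v := by
  refine ⟨fun v => ?_, fun a b hab => ?_, fun a b hab => ?_, fun u hu n => ?_⟩
  · rw [parity_neg, (h _).even]
  · have e : parity (2 • a + 2 • b) = 0 := by rw [parity_add_two_nsmul, parity_two_nsmul]
    have e' : parity 0 = 0 := rfl
    simp only [e, e', parity_two_nsmul]
    exact (h 0).three a b hab
  · simp only [parity_add_two_nsmul, parity_sub_two_nsmul]
    exact (h _).two a b hab
  · simp only [parity_add_two_smul]
    exact (h _).one u hu n

theorem isAmplitude_zero : IsAmplitude d 0 := mem_amplitudes.1 (zero_mem _)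

/-- An amplitude in the sector with even winding numbers: `1` if the primitive direction has class
`c` modulo `2`, and half of that without winding. -/
def evenSolution (c : ZMod 2 × ZMod 2) (v : ℤ × ℤ) : ℂ :=
  if v = 0 then 1 / 2 else if parity v = 0 ∧ parity (direction v) = c then 1 else 0

theorem parity_ne_zero {u : ℤ × ℤ} (hu : Primitive u) : parity u ≠ 0 := by
  obtain ⟨x, y, h⟩ := hu
  intro h0
  have h1 : ((u.1 : ℤ) : ZMod 2) = 0 := congrArg Prod.fst h0
  have h2 : ((u.2 : ℤ) : ZMod 2) = 0 := congrArg Prod.snd h0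
  have := congrArg (Int.cast : ℤ → ZMod 2) h
  push_cast at this
  rw [h1, h2] at this
  simp at this

theorem det_swap (a b : ℤ × ℤ) : det b a = -det a b := by
  simp only [det]
  ring

theorem primitive_of_det' {a b : ℤ × ℤ} (h : det a b = 1 ∨ det a b = -1) : Primitive a :=
  primitive_of_det (a := b) (by rw [det_swap]; omega)

set_option synthInstance.maxSize 1000 in
set_option synthInstance.maxHeartbeats 200000 in
/-- The three nonzero classes modulo `2` are permuted when `x`, `y` is completed by `x + y`. -/
theorem class_cases : ∀ c x y : ZMod 2 × ZMod 2, c ≠ 0 → x ≠ 0 → y ≠ 0 → x + y ≠ 0 →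
    (x + y = c ∧ x ≠ c ∧ y ≠ c) ∨ (x + y ≠ c ∧ x = c ∧ y ≠ c) ∨
    (x + y ≠ c ∧ x ≠ c ∧ y = c) := by decide

/-- Among the directions `a`, `b`, `a + b` of a basis and its sum, exactly one has class `c` modulo
`2`, which gives the first constraint; the others do not involve even windings of different
directions. -/
theorem isAmplitude_evenSolution {c : ZMod 2 × ZMod 2} (hc : c ≠ 0) :
    IsAmplitude d (evenSolution c) := by
  have two : ∀ u, Primitive u → evenSolution c (2 • u) = if parity u = c then 1 else 0 := by
    intro u hu
    have e : direction (2 • u) = u := by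
      have := direction_smul hu 1
      rwa [natCast_zsmul] at this
    rw [evenSolution, if_neg (smul_ne_zero two_ne_zero hu.ne_zero), e, parity_two_nsmul]
    simp only [true_and]
  have odd : ∀ u, parity u ≠ 0 → evenSolution c u = 0 := by
    intro u hu
    have : u ≠ 0 := by rintro rfl; exact hu rfl
    simp [evenSolution, hu, this]
  refine ⟨fun v => ?_, fun a b hab => ?_, fun a b hab => ?_, fun u hu n => ?_⟩
  · simp only [evenSolution, direction_neg, parity_neg, neg_eq_zero]
  · have ha : Primitive a := primitive_of_det' hab
    have hb : Primitive b := primitive_of_det hab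
    have hab' : Primitive (a + b) := primitive_of_det (a := a) (by
      simp only [det, Prod.fst_add, Prod.snd_add] at hab ⊢
      ring_nf at hab ⊢
      omega)
    rw [← smul_add, two _ ha, two _ hb, two _ hab', parity_add]
    have h3 := parity_ne_zero hab'
    rw [parity_add] at h3
    have e0 : evenSolution c 0 = 1 / 2 := by simp [evenSolution]
    rw [e0]
    rcases class_cases c _ _ hc (parity_ne_zero ha) (parity_ne_zero hb) h3 with
      ⟨k1, k2, k3⟩ | ⟨k1, k2, k3⟩ | ⟨k1, k2, k3⟩
    · rw [if_pos k1, if_neg k2, if_neg k3]; norm_num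
    · rw [if_neg k1, if_pos k2, if_neg k3]; norm_num
    · rw [if_neg k1, if_neg k2, if_pos k3]; norm_num
  · have h1 := parity_ne_zero (primitive_of_det' hab)
    rw [odd _ h1, odd _ (by rwa [parity_add_two_nsmul]), odd _ (by rwa [parity_sub_two_nsmul])]
    simp
  · have e1 := direction_smul hu (n + 2)
    have e2 := direction_smul hu n
    have e3 : ((3 + n : ℕ) : ℤ) • u ≠ 0 := smul_ne_zero (by omega) hu.ne_zero
    have e4 : ((1 + n : ℕ) : ℤ) • u ≠ 0 := smul_ne_zero (by omega) hu.ne_zero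
    rw [show n + 2 + 1 = 3 + n by ring] at e1
    rw [show n + 1 = 1 + n by ring] at e2
    simp only [evenSolution, if_neg e3, if_neg e4, e1, e2, parity_add_two_smul]

/-- An amplitude in the sector with odd winding numbers, for a primitive eighth root of unity `ζ`. -/
def oddSolution (ζ : ℂ) (v : ℤ × ℤ) : ℂ :=
  if parity v = (1, 1) then ζ ^ (((direction v).1 * (direction v).2 - 1) / 2) else 0

theorem parity_eq_one {v : ℤ × ℤ} : parity v = (1, 1) ↔ v.1 % 2 = 1 ∧ v.2 % 2 = 1 := by
  have key : ∀ n : ℤ, (n : ZMod 2) = 1 ↔ n % 2 = 1 := fun n => by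
    rw [← Int.cast_one, ZMod.intCast_eq_intCast_iff]
    rfl
  rw [parity, Prod.mk.injEq, key, key]

/-- The sum of `ζ ^ m` and its inverse for odd `m`, where `m ^ 2 = 1 + 8 * t` modulo `16`. -/
theorem eighth_root_sum {ζ : ℂ} (h4 : ζ ^ 4 = -1) (hd : ζ + ζ⁻¹ = d) {m t k : ℤ}
    (hm : m * m = 1 + 8 * t + 16 * k) : ζ ^ (4 * t) * (ζ ^ m + ζ ^ (-m)) = d := by
  have h0 : ζ ≠ 0 := by rintro rfl; norm_num at h4
  have z4 : ζ ^ (4 : ℤ) = -1 := by exact_mod_cast h4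
  have e8 : ∀ j k : ℤ, ζ ^ (8 * k + j) = ζ ^ j := fun j k => by
    rw [zpow_add₀ h0, zpow_mul, show (8 : ℤ) = 4 * 2 from rfl, zpow_mul, z4]
    norm_num
  have e4 : ∀ j k : ℤ, ζ ^ (8 * k + 4 + j) = -ζ ^ j := fun j k => by
    rw [add_assoc, e8, zpow_add₀ h0, z4, neg_one_mul]
  have h1 : ζ ^ (1 : ℤ) + ζ ^ (-1 : ℤ) = d := by rw [zpow_one, zpow_neg_one, hd]
  obtain ⟨n, i, hn, rfl⟩ : ∃ n i : ℤ, (i = 1 ∨ i = -1 ∨ i = 3 ∨ i = -3) ∧ m = 8 * n + i := by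
    have : m % 2 = 1 := by
      rcases Int.emod_two_eq_zero_or_one m with h | h
      · obtain ⟨l, rfl⟩ := Int.dvd_of_emod_eq_zero h
        have : 2 * l * (2 * l) = 4 * (l * l) := by ring
        omega
      · exact h
    have : m % 8 = 1 ∨ m % 8 = 7 ∨ m % 8 = 3 ∨ m % 8 = 5 := by omega
    rcases this with h | h | h | h
    · exact ⟨m / 8, 1, by simp, by omega⟩
    · exact ⟨m / 8 + 1, -1, by simp, by omega⟩
    · exact ⟨m / 8, 3, by simp, by omega⟩
    · exact ⟨m / 8 + 1, -3, by simp, by omega⟩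
  have hsq : (8 * n + i) * (8 * n + i) = 64 * (n * n) + 16 * (n * i) + i * i := by ring
  have hi : ζ ^ (8 * n + i) + ζ ^ (-(8 * n + i)) = ζ ^ i + ζ ^ (-i) := by
    rw [e8, neg_add, ← mul_neg, e8]
  rw [hi]
  have h3 : ζ ^ (3 : ℤ) + ζ ^ (-3 : ℤ) = -d := by
    rw [show (3 : ℤ) = 8 * 0 + 4 + -1 from rfl, e4,
      show (-(8 * 0 + 4 + -1) : ℤ) = 8 * (-1) + 4 + 1 from rfl, e4, ← h1]
    ring
  have even : t % 2 = 0 → ζ ^ (4 * t) = 1 := fun h => by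
    have := e8 0 (t / 2)
    rwa [show 8 * (t / 2) + 0 = 4 * t by omega, zpow_zero] at this
  have odd : t % 2 = 1 → ζ ^ (4 * t) = -1 := fun h => by
    have := e4 0 (t / 2)
    rwa [show 8 * (t / 2) + 4 + 0 = 4 * t by omega, zpow_zero] at this
  rcases hn with rfl | rfl | rfl | rfl
  · rw [even (by omega), h1, one_mul]
  · rw [even (by omega), neg_neg, add_comm, h1, one_mul]
  · rw [odd (by omega), h3, neg_mul_neg, one_mul]
  · rw [odd (by omega), neg_neg, add_comm, h3, neg_mul_neg, one_mul]

/-- For a basis `a`, `b` with odd `a`, put `a = (p, q)` and `b = (r, s)`. Half the change of the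
product of the components from `a` to `a ± 2 • b` is `2 * r * s ± m` with `m = p * s + q * r`, and
the second constraint becomes a sum of powers of `ζ`. -/
theorem isAmplitude_oddSolution {ζ : ℂ} (h4 : ζ ^ 4 = -1) (hd : ζ + ζ⁻¹ = d) :
    IsAmplitude d (oddSolution ζ) := by
  have h0 : ζ ≠ 0 := by rintro rfl; norm_num at h4
  have even : ∀ v, parity v = 0 → oddSolution ζ v = 0 := fun v hv => by
    rw [oddSolution, hv]
    exact if_neg (by decide)
  refine ⟨fun v => ?_, fun a b hab => ?_, fun a b hab => ?_, fun u hu n => ?_⟩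
  · simp only [oddSolution, direction_neg, parity_neg, Prod.fst_neg, Prod.snd_neg, neg_mul_neg]
  · rw [even _ (by rw [parity_add_two_nsmul, parity_two_nsmul]), even _ (parity_two_nsmul _),
      even _ (parity_two_nsmul _), even 0 rfl]
    simp
  · simp only [oddSolution, parity_add_two_nsmul, parity_sub_two_nsmul]
    split_ifs with hp
    · have e1 : direction (a + 2 • b) = a + 2 • b := direction_self (primitive_of_det' (b := b) (by
        simp only [det, Prod.fst_add, Prod.snd_add, two_nsmul] at hab ⊢
        ring_nf at hab ⊢
        omega))
      have e2 : direction (a - 2 • b) = a - 2 • b := direction_self (primitive_of_det' (b := b) (by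
        simp only [det, Prod.fst_sub, Prod.snd_sub, Prod.fst_add, Prod.snd_add, two_nsmul] at hab ⊢
        ring_nf at hab ⊢
        omega))
      rw [e1, e2, direction_self (primitive_of_det' hab)]
      obtain ⟨p, q⟩ := a
      obtain ⟨r, s⟩ := b
      rw [parity_eq_one] at hp
      simp only [det, Prod.fst_add, Prod.snd_add, Prod.fst_sub, Prod.snd_sub,
        two_nsmul] at hab hp ⊢
      obtain ⟨p, rfl⟩ : ∃ p', p = 2 * p' + 1 := ⟨p / 2, by omega⟩
      obtain ⟨q, rfl⟩ : ∃ q', q = 2 * q' + 1 := ⟨q / 2, by omega⟩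
      -- since `p`, `q` and the determinant are odd, one of `r`, `s` is even
      obtain ⟨t, ht⟩ : ∃ t, r * s = 2 * t := by
        have hrs : (r + s) % 2 = 1 := by
          have : (2 * p + 1) * s - (2 * q + 1) * r = 2 * (p * s - q * r) + (s - r) := by ring
          omega
        rcases Int.emod_two_eq_zero_or_one r with h | h
        · exact ⟨r / 2 * s, by rw [← mul_assoc, Int.mul_ediv_cancel' (Int.dvd_of_emod_eq_zero h)]⟩
        · have h : s % 2 = 0 := by omega
          exact ⟨r * (s / 2), by
            rw [mul_left_comm, Int.mul_ediv_cancel' (Int.dvd_of_emod_eq_zero h)]⟩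
      set κ := 2 * (p * q) + p + q with hκ
      set m := (2 * p + 1) * s + (2 * q + 1) * r with hm
      have h1 : ((2 * p + 1 + (r + r)) * (2 * q + 1 + (s + s)) - 1) / 2 = κ + (4 * t + m) := by
        have : (2 * p + 1 + (r + r)) * (2 * q + 1 + (s + s)) - 1 = 2 * (κ + (4 * t + m)) := by
          linear_combination 4 * ht
        omega
      have h2 : ((2 * p + 1 - (r + r)) * (2 * q + 1 - (s + s)) - 1) / 2 = κ + (4 * t + -m) := by
        have : (2 * p + 1 - (r + r)) * (2 * q + 1 - (s + s)) - 1 = 2 * (κ + (4 * t + -m)) := by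
          linear_combination 4 * ht
        omega
      have h3 : ((2 * p + 1) * (2 * q + 1) - 1) / 2 = κ := by
        have : (2 * p + 1) * (2 * q + 1) - 1 = 2 * κ := by rw [hκ]; ring
        omega
      have hmm : m * m = 1 + 8 * t + 16 * (κ * t) := by
        have e : m * m = ((2 * p + 1) * s - (2 * q + 1) * r) * ((2 * p + 1) * s - (2 * q + 1) * r)
            + 4 * (2 * κ + 1) * (r * s) := by rw [hm, hκ]; ring
        rw [e, ht]
        rcases hab with h | h <;> rw [h] <;> ring
      clear_value κ m
      rw [h1, h2, h3, zpow_add₀ h0 κ, zpow_add₀ h0 κ, zpow_add₀ h0 (4 * t),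
        zpow_add₀ h0 (4 * t),
        ← eighth_root_sum h4 hd hmm]
      ring
    · simp
  · have e1 := direction_smul hu (n + 2)
    have e2 := direction_smul hu n
    rw [show n + 2 + 1 = 3 + n by ring] at e1
    rw [show n + 1 = 1 + n by ring] at e2
    simp only [oddSolution, e1, e2, parity_add_two_smul]

theorem IsAmplitude.add {φ : ℤ × ℤ → ℂ} (h : IsAmplitude d ψ) (h' : IsAmplitude d φ) :
    IsAmplitude d (ψ + φ) :=
  mem_amplitudes.1 (add_mem (mem_amplitudes.2 h) (mem_amplitudes.2 h'))

theorem IsAmplitude.smul (c : ℂ) (h : IsAmplitude d ψ) : IsAmplitude d (c • ψ) :=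
  mem_amplitudes.1 (Submodule.smul_mem _ c (mem_amplitudes.2 h))

/-- The two primitive eighth roots of unity with `ζ + ζ⁻¹ = d` give two independent solutions in the
sector with odd winding numbers. -/
theorem exists_odd (hd : d ^ 2 = 2) (x y : ℂ) :
    ∃ ψ, IsAmplitude d ψ ∧ ψ (1, 1) = x ∧ ψ (1, 3) = y ∧ ψ (3, 1) = y := by
  have hI := Complex.I_sq
  have hd0 : d ≠ 0 := by rintro rfl; norm_num at hd
  set ζ := d / 2 * (1 + Complex.I) with hζ
  set ξ := d / 2 * (1 - Complex.I) with hξ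
  have h1 : ζ * ξ = 1 := by
    rw [hζ, hξ]
    linear_combination (1 - Complex.I ^ 2) / 4 * hd - 1 / 2 * hI
  have hζ2 : ζ ^ 2 = Complex.I := by
    rw [hζ]
    linear_combination (1 + Complex.I) ^ 2 / 4 * hd + 1 / 2 * hI
  have hξ2 : ξ ^ 2 = -Complex.I := by
    rw [hξ]
    linear_combination (1 - Complex.I) ^ 2 / 4 * hd + 1 / 2 * hI
  have a := isAmplitude_oddSolution (d := d) (ζ := ζ)
    (by rw [show 4 = 2 * 2 from rfl, pow_mul, hζ2, hI])
    (by rw [inv_eq_of_mul_eq_one_right h1, hζ, hξ]; ring)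
  have b := isAmplitude_oddSolution (d := d) (ζ := ξ)
    (by rw [show 4 = 2 * 2 from rfl, pow_mul, hξ2, neg_sq, hI])
    (by rw [inv_eq_of_mul_eq_one_left h1, hζ, hξ]; ring)
  have hne : ζ - ξ ≠ 0 := by
    rw [show ζ - ξ = d * Complex.I by rw [hζ, hξ]; ring]
    exact mul_ne_zero hd0 Complex.I_ne_zero
  have e11 : ∀ z, oddSolution z (1, 1) = 1 := fun z => by
    exact (if_pos rfl).trans (by simp [direction])
  have e13 : ∀ z, oddSolution z (1, 3) = z := fun z => by
    exact (if_pos rfl).trans (by simp [direction])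
  have e31 : ∀ z, oddSolution z (3, 1) = z := fun z => by
    exact (if_pos rfl).trans (by simp [direction])
  refine ⟨_, (a.smul ((y - x * ξ) / (ζ - ξ))).add (b.smul ((x * ζ - y) / (ζ - ξ))), ?_, ?_, ?_⟩ <;>
    simp only [Pi.add_apply, Pi.smul_apply, smul_eq_mul, e11, e13, e31] <;> field_simp <;> ring

/-- Nine pairs of winding numbers, three even ones and two in each of the other parity sectors, whose
amplitudes may be prescribed and determine the state. -/
def points : Fin 9 → ℤ × ℤ :=
  ![(0, 0), (0, 2), (2, 0), (1, 1), (1, 3), (1, 0), (1, 2), (0, 1), (2, 1)]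

/-- The nine values may be prescribed. The solutions in the mixed sectors are images of those in the
odd sector under shears. -/
theorem exists_isAmplitude (hd : d ^ 2 = 2) (c : Fin 9 → ℂ) :
    ∃ ψ, IsAmplitude d ψ ∧ ∀ i, ψ (points i) = c i := by
  obtain ⟨o, ho, o1, o2, -⟩ := exists_odd hd (c 3) (c 4)
  obtain ⟨p, hp, p1, p2, -⟩ := exists_odd hd (c 5) (c 6)
  obtain ⟨q, hq, q1, -, q2⟩ := exists_odd hd (c 7) (c 8)
  have hp := hp.comp ((AddMonoidHom.fst ℤ ℤ).prod (AddMonoidHom.fst ℤ ℤ + AddMonoidHom.snd ℤ ℤ))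
    fun a b => Or.inl (by simp [det]; ring)
  have hq := hq.comp ((AddMonoidHom.fst ℤ ℤ + AddMonoidHom.snd ℤ ℤ).prod (AddMonoidHom.snd ℤ ℤ))
    fun a b => Or.inl (by simp [det]; ring)
  have e := ((isAmplitude_evenSolution (d := d) (c := (0, 1)) (by decide)).smul (c 1)).add
    (((isAmplitude_evenSolution (d := d) (c := (1, 0)) (by decide)).smul (c 2)).add
    ((isAmplitude_evenSolution (d := d) (c := (1, 1)) (by decide)).smul (2 * c 0 - c 1 - c 2)))
  have h := IsAmplitude.glue (φ := fun ε => if ε = 0 then _ else if ε = (1, 1) then _ else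
    if ε = (1, 0) then _ else _) fun ε => by
    split_ifs
    exacts [e, ho, hp, hq]
  refine ⟨_, h, fun i => ?_⟩
  have h3 : (3 : ZMod 2) = 1 := rfl
  have h2 : (2 : ZMod 2) = 0 := rfl
  fin_cases i
  all_goals simp [points, parity, direction, evenSolution, h2, h3]
  exacts [by ring, o1, o2, p1, p2, q1, q2]

/-! ### Dimensions -/

variable {d : ℂ} {ψ : ℤ × ℤ → ℂ}

theorem IsAmplitude.isGround (hd : d ^ 2 = 2) (h : IsAmplitude d ψ) : IsGround d ψ :=
  ⟨h.even, stateOf_mem_zeroEnergy hd h⟩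

theorem IsGround.sub {φ : ℤ × ℤ → ℂ} (h : IsGround d ψ) (h' : IsGround d φ) :
    IsGround d (ψ - φ) := by
  have e : ∀ v, (ψ - φ) (-v) = (ψ - φ) v := fun v => by
    rw [Pi.sub_apply, Pi.sub_apply, h.even, h'.even]
  refine ⟨e, ?_⟩
  convert sub_mem h.mem h'.mem using 1
  ext C
  obtain ⟨v, hv⟩ := exists_hasWinding C
  have hv := (hv v).2 (Or.inl rfl)
  rw [Pi.sub_apply, stateOf_eq e hv, stateOf_eq h.even hv, stateOf_eq h'.even hv, Pi.sub_apply,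
    sub_mul]

theorem IsGround.eq_zero_of_points (hd : d ≠ 0) (h : IsGround d ψ) (h0 : ∀ i, ψ (points i) = 0) :
    ψ = 0 :=
  h.eq_zero hd (h0 0) (h0 7) (h0 1) (h0 5) (h0 3) (h0 6) (h0 4) (h0 2) (h0 8)

/-- Zero-energy states come from amplitudes: an amplitude with the same values at the nine points
gives the same state. -/
theorem IsGround.isAmplitude (hd : d ^ 2 = 2) (h : IsGround d ψ) : IsAmplitude d ψ := by
  have hd0 : d ≠ 0 := by rintro rfl; norm_num at hd
  obtain ⟨φ, hφ, e⟩ := exists_isAmplitude hd fun i => ψ (points i)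
  have := (h.sub (hφ.isGround hd)).eq_zero_of_points hd0 fun i => by
    rw [Pi.sub_apply, e, sub_self]
  rwa [sub_eq_zero.1 this]

theorem isGround_amplitudeOf (hd : d ≠ 0) {Ψ : Config → ℂ} (h : Ψ ∈ zeroEnergy d) :
    IsGround d (amplitudeOf d Ψ) :=
  ⟨(mem_zeroEnergy.1 h).1.amplitudeOf_neg hd, (mem_zeroEnergy.1 h).1.eq_stateOf hd ▸ h⟩

theorem mem_zeroEnergy_iff_exists_amplitude (hd : d ^ 2 = 2) {Ψ : Config → ℂ} :
    Ψ ∈ zeroEnergy d ↔ ∃ ψ ∈ amplitudes d, ∀ (C : Config) (v : ℤ × ℤ),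
      C.HasWinding v → Ψ C = ψ v * d ^ C.loops := by
  have hd0 : d ≠ 0 := by rintro rfl; norm_num at hd
  constructor
  · intro h
    exact ⟨amplitudeOf d Ψ, mem_amplitudes.2 ((isGround_amplitudeOf hd0 h).isAmplitude hd),
      fun C v hv => (mem_zeroEnergy.1 h).1.eq_amplitudeOf hd0 hv⟩
  · rintro ⟨ψ, hψ, h⟩
    have hψ := mem_amplitudes.1 hψ
    convert stateOf_mem_zeroEnergy hd hψ
    ext C
    obtain ⟨v, hv⟩ := exists_hasWinding C
    have hv := (hv v).2 (Or.inl rfl)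
    rw [h C v hv, stateOf_eq hψ.even hv]

/-- A space of functions that may be prescribed at certain points, and are determined there. -/
theorem finrank_eq_card_of_points {X ι : Type*} [Fintype ι] (W : Submodule ℂ (X → ℂ)) (p : ι → X)
    (surj : ∀ c : ι → ℂ, ∃ ψ ∈ W, ∀ i, ψ (p i) = c i)
    (inj : ∀ ψ ∈ W, (∀ i, ψ (p i) = 0) → ψ = 0) : Module.finrank ℂ W = Fintype.card ι := by
  have h : Function.Bijective ((LinearMap.funLeft ℂ ℂ p).comp W.subtype) := by
    constructor
    · rw [injective_iff_map_eq_zero]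
      intro ψ h
      exact Subtype.ext (inj ψ.1 ψ.2 fun i => congrFun h i)
    · intro c
      obtain ⟨ψ, hψ, h⟩ := surj c
      exact ⟨⟨ψ, hψ⟩, funext h⟩
  rw [(LinearEquiv.ofBijective _ h).finrank_eq, Module.finrank_fintype_fun_eq_card]

/-- The values of an amplitude may be prescribed in any set of parity sectors. -/
theorem exists_isAmplitude_sectors (hd : d ^ 2 = 2) (q : ZMod 2 × ZMod 2 → Prop) [DecidablePred q]
    (c : {i // q (parity (points i))} → ℂ) : ∃ ψ, IsAmplitude d ψ ∧
      (∀ v, ¬ q (parity v) → ψ v = 0) ∧ ∀ i, ψ (points i.1) = c i := by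
  obtain ⟨ψ, hψ, e⟩ := exists_isAmplitude hd fun i => if h : _ then c ⟨i, h⟩ else 0
  refine ⟨_, IsAmplitude.glue (φ := fun ε => if q ε then ψ else 0) fun ε => ?_, fun v hv => ?_,
    fun i => ?_⟩
  · split_ifs
    exacts [hψ, isAmplitude_zero]
  · simp only [if_neg hv, Pi.zero_apply]
  · simp only [if_pos i.2, e, dif_pos i.2]

theorem finrank_amplitudes_sectors (hd : d ^ 2 = 2) (q : ZMod 2 × ZMod 2 → Prop) [DecidablePred q]
    (W : Submodule ℂ (ℤ × ℤ → ℂ))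
    (hW : ∀ ψ, ψ ∈ W ↔ IsAmplitude d ψ ∧ ∀ v, ¬ q (parity v) → ψ v = 0) :
    Module.finrank ℂ W = Fintype.card {i // q (parity (points i))} := by
  have hd0 : d ≠ 0 := by rintro rfl; norm_num at hd
  refine finrank_eq_card_of_points W (fun i => points i.1) (fun c => ?_) fun ψ hψ h => ?_
  · obtain ⟨ψ, h1, h2, h3⟩ := exists_isAmplitude_sectors hd q c
    exact ⟨ψ, (hW ψ).2 ⟨h1, h2⟩, h3⟩
  · obtain ⟨h1, h2⟩ := (hW ψ).1 hψ
    refine (h1.isGround hd).eq_zero_of_points hd0 fun i => ?_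
    by_cases hi : q (parity (points i))
    exacts [h ⟨i, hi⟩, h2 _ hi]

theorem finrank_zeroEnergy_sectors (hd : d ^ 2 = 2) (q : ZMod 2 × ZMod 2 → Prop) [DecidablePred q]
    (W : Submodule ℂ (Config → ℂ))
    (hW : ∀ Ψ, Ψ ∈ W ↔ Ψ ∈ zeroEnergy d ∧
      ∀ C v, Config.HasWinding C v → ¬ q (parity v) → Ψ C = 0) :
    Module.finrank ℂ W = Fintype.card {i // q (parity (points i))} := by
  have hd0 : d ≠ 0 := by rintro rfl; norm_num at hd
  choose C hC using fun i => exists_config (points i)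
  refine finrank_eq_card_of_points W (fun i => C i.1) (fun c => ?_) fun Ψ hΨ h => ?_
  · obtain ⟨ψ, h1, h2, h3⟩ := exists_isAmplitude_sectors hd q fun i => c i * (d ^ (C i).loops)⁻¹
    refine ⟨stateOf d ψ, (hW _).2 ⟨stateOf_mem_zeroEnergy hd h1, fun C v hv hq => ?_⟩, fun i => ?_⟩
    · rw [stateOf_eq h1.even hv, h2 v hq, zero_mul]
    · rw [stateOf_eq h1.even (hC i), h3, inv_mul_cancel_right₀ (pow_ne_zero _ hd0)]
  · obtain ⟨h1, h2⟩ := (hW Ψ).1 hΨ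
    have hs := (mem_zeroEnergy.1 h1).1
    have : amplitudeOf d Ψ = 0 := by
      refine (isGround_amplitudeOf hd0 h1).eq_zero_of_points hd0 fun i => ?_
      have hi : Ψ (C i) = 0 := by
        by_cases hi : q (parity (points i))
        exacts [h ⟨i, hi⟩, h2 _ _ (hC i) hi]
      rw [hs.eq_amplitudeOf hd0 (hC i)] at hi
      exact (mul_eq_zero.1 hi).resolve_right (pow_ne_zero _ hd0)
    ext C
    obtain ⟨v, hv⟩ := exists_hasWinding C
    rw [hs.eq_amplitudeOf hd0 ((hv v).2 (Or.inl rfl)), this, Pi.zero_apply, zero_mul, Pi.zero_apply]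

theorem card_points (ε : ZMod 2 × ZMod 2) :
    Fintype.card {i // parity (points i) = ε} = if ε = 0 then 3 else 2 := by
  revert ε
  decide

theorem finrank_amplitudes (hd : d ^ 2 = 2) : Module.finrank ℂ (amplitudes d) = 9 := by
  rw [finrank_amplitudes_sectors hd (fun _ => True) _ fun ψ => by simp [mem_amplitudes]]
  rfl

theorem finrank_amplitudes_sector (hd : d ^ 2 = 2) (ε : ZMod 2 × ZMod 2) :
    Module.finrank ℂ ↥(amplitudes d ⊓ sectorAmplitudes ε) = if ε = 0 then 3 else 2 := by
  rw [finrank_amplitudes_sectors hd (fun ε' => ε' = ε) _ fun ψ => by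
    rw [Submodule.mem_inf, mem_amplitudes]; rfl, card_points]

theorem finrank_zeroEnergy (hd : d ^ 2 = 2) : Module.finrank ℂ (zeroEnergy d) = 9 := by
  rw [finrank_zeroEnergy_sectors hd (fun _ => True) _ fun ψ => by simp]
  rfl

theorem finrank_zeroEnergy_sector (hd : d ^ 2 = 2) (ε : ZMod 2 × ZMod 2) :
    Module.finrank ℂ ↥(zeroEnergy d ⊓ sectorStates ε) = if ε = 0 then 3 else 2 := by
  rw [finrank_zeroEnergy_sectors hd (fun ε' => ε' = ε) _ fun ψ => by
    rw [Submodule.mem_inf]; rfl, card_points]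

/-! ### Domain walls -/

/-- The number of strands that cross the vertical cut at an event. -/
def Event.crossings : {m n : ℕ} → Event m n → ℕ
  | _, _, .birth _ _ _ => 0
  | _, _, .death _ _ _ => 0
  | _, _, .right _ => 1
  | _, _, .left _ => 1

/-- The number of crossings of the vertical cut below the height `l`. -/
def Word.crossings : {m n : ℕ} → Word m n → ℕ → ℕ
  | _, _, _, 0 => 0
  | _, _, .nil _, _ + 1 => 0
  | _, _, .cons e w, l + 1 => e.crossings + w.crossings l

theorem Word.crossings_zero {m n : ℕ} (w : Word m n) : w.crossings 0 = 0 := by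
  cases w <;> rfl

theorem Word.Has.crossings_succ {m n l a b : ℕ} {w : Word m n} {e : Event a b} (h : w.Has l e) :
    w.crossings (l + 1) = w.crossings l + e.crossings := by
  induction h with
  | head e w => exact (congrArg _ w.crossings_zero).trans (zero_add _).symm
  | tail e w _ ih => exact (congrArg _ ih).trans (add_assoc _ _ _).symm

theorem Word.exists_has {m n l : ℕ} {w : Word m n} (h : l < w.length) :
    ∃ (a b : ℕ) (e : Event a b), w.Has l e := by
  induction w generalizing l with
  | nil n => exact absurd h (Nat.not_lt_zero _)
  | cons e w ih =>
    cases l with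
    | zero => exact ⟨_, _, e, .head e w⟩
    | succ l =>
      obtain ⟨a, b, f, hf⟩ := ih (Nat.lt_of_succ_lt_succ h)
      exact ⟨a, b, f, .tail e w hf⟩

theorem Event.even_iff {m n : ℕ} (e : Event m n) : Even m ↔ Even n := by
  cases e <;> simp [Nat.even_add]

theorem Word.even_width {m n : ℕ} (w : Word m n) (l : ℕ) (hm : Even m) : Even (w.width l) := by
  induction w generalizing l with
  | nil n => cases l <;> exact hm
  | cons e w ih =>
    cases l with
    | zero => exact hm
    | succ l => exact ih l (e.even_iff.1 hm)

/-- The parity of the number of walls between a region and the one to the right of the vertical cut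
is preserved along regions, up to the crossings of the cut. -/
theorem Event.Gap.bodd {m n a b : ℕ} {e : Event m n} (h : e.Gap a b) :
    (e.crossings + b).bodd = a.bodd := by
  cases e <;> simp only [Event.Gap] at h <;> simp only [Event.crossings]
  · rcases h with ⟨-, rfl⟩ | ⟨-, rfl⟩ <;> simp
  · rcases h with ⟨-, rfl⟩ | ⟨-, rfl⟩ <;> simp
  · subst h; simp
  · subst h; simp

/-- A two-valued spin exists if and only if the horizontal and the vertical circle are crossed an
even number of times. -/
theorem Config.isDomainWall_iff (C : Config) :
    C.IsDomainWall ↔ Even C.base ∧ Even (C.word.crossings C.word.length) := by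
  have even_iff : ∀ n : ℕ, Even n ↔ n.bodd = false := fun n => by
    rw [Nat.even_iff, Nat.mod_two_of_bodd]
    cases n.bodd <;> simp
  constructor
  · rintro ⟨s, h1, h2, h3⟩
    -- the spin changes by the parity of the number of walls in between
    have hs : ∀ l ≤ C.word.length, ∀ k ≤ C.word.width l, s l k = (s l 0 ^^ k.bodd) := by
      intro l hl k
      induction k with
      | zero => simp
      | succ k ih =>
        intro hk
        rw [(h1 l hl).2 k hk, ih (by omega), Nat.bodd_succ]
        simp
    have hc : ∀ l ≤ C.word.length, s l 0 = (s 0 0 ^^ (C.word.crossings l).bodd) := by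
      intro l
      induction l with
      | zero => simp [Word.crossings_zero]
      | succ l ih =>
        intro hl
        obtain ⟨a, b, e, he⟩ := Word.exists_has (w := C.word) (l := l) (by omega)
        obtain ⟨-, hw1, hw2⟩ := he.bounds
        obtain ⟨x, y, hx, hy, hg⟩ : ∃ x y, x ≤ a ∧ y ≤ b ∧ e.Gap x y := by
          cases e with
          | birth n i h => exact ⟨0, 0, by omega, by omega, Or.inl ⟨by omega, rfl⟩⟩
          | death n i h => exact ⟨0, 0, by omega, by omega, Or.inl ⟨by omega, rfl⟩⟩
          | right n => exact ⟨0, 1, by omega, by omega, rfl⟩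
          | left n => exact ⟨1, 0, by omega, by omega, rfl⟩
        have e1 := h2 l a b x y e he hx hy hg
        rw [hs l (by omega) x (by omega), hs (l + 1) hl y (by omega), ih (by omega)] at e1
        have e2 := hg.bodd
        rw [he.crossings_succ, Nat.bodd_add]
        rw [Nat.bodd_add] at e2
        revert e1 e2
        generalize s (l + 1) 0 = p1
        generalize s 0 0 = p2
        generalize x.bodd = p3
        generalize y.bodd = p4
        generalize e.crossings.bodd = p5
        generalize (C.word.crossings l).bodd = p6
        revert p1 p2 p3 p4 p5 p6
        decide
    constructor
    · have e1 := (h1 0 (Nat.zero_le _)).1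
      rw [hs 0 (Nat.zero_le _) _ le_rfl, Word.width_zero] at e1
      rw [even_iff]
      revert e1
      generalize s 0 0 = p1
      cases p1 <;> simp
    · have e1 := h3 0 (Nat.zero_le _)
      rw [hc _ le_rfl] at e1
      rw [even_iff]
      revert e1
      generalize s 0 0 = p1
      cases p1 <;> simp
  · rintro ⟨h1, h2⟩
    refine ⟨fun l k => (C.word.crossings l + k).bodd, fun l hl => ⟨?_, fun k hk => ?_⟩,
      fun l m n a b e he ha hb hg => ?_, fun k hk => ?_⟩
    · have := (even_iff _).1 (C.word.even_width l h1)
      simp [Nat.bodd_add, this]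
    · exact Nat.bodd_succ _
    · show (C.word.crossings l + a).bodd = (C.word.crossings (l + 1) + b).bodd
      rw [he.crossings_succ, add_assoc, Nat.bodd_add, Nat.bodd_add, hg.bodd]
    · have := (even_iff _).1 h2
      simp [Nat.bodd_add, this, Word.crossings_zero]

theorem Word.flux_mod_two {m n : ℕ} (w : Word m n) (f : ℕ → ℕ → ℤ)
    (hf : ∀ l ≤ w.length, ∀ a < w.width l, f l a = 1 ∨ f l a = -1) :
    (w.flux f : ZMod 2) = w.crossings w.length := by
  induction w generalizing f with
  | nil n => exact Int.cast_zero
  | cons e w ih =>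
    have h0 := hf 0 (Nat.zero_le _)
    have h1 := ih (fun l => f (l + 1)) fun l hl => hf (l + 1) (Nat.succ_le_succ hl)
    have he : (e.flux (f 0) : ZMod 2) = e.crossings := by
      cases e with
      | birth n i h => simp [Event.flux, Event.crossings]
      | death n i h => simp [Event.flux, Event.crossings]
      | right n =>
        rcases h0 n (Nat.lt_succ_self n) with h | h <;> simp [Event.flux, Event.crossings, h]
      | left n =>
        rcases h0 0 (Nat.succ_pos n) with h | h <;> simp [Event.flux, Event.crossings, h]
    show ((e.flux (f 0) + w.flux fun l => f (l + 1) : ℤ) : ZMod 2)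
      = ((e.crossings + w.crossings w.length : ℕ) : ZMod 2)
    rw [Int.cast_add, h1, he, Nat.cast_add]

theorem Config.HasWinding.parity_eq {C : Config} {v : ℤ × ℤ} (h : C.HasWinding v) :
    parity v = ((C.base : ZMod 2), (C.word.crossings C.word.length : ZMod 2)) := by
  obtain ⟨o, ho, -, rfl⟩ := h
  have h1 : ∀ l ≤ C.word.length, ∀ a < C.word.width l,
      C.restrict o Set.univ l a = 1 ∨ C.restrict o Set.univ l a = -1 := by
    intro l hl a ha
    rw [Config.restrict, dif_pos ⟨hl, ha⟩, if_pos (Set.mem_univ _)]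
    exact ho.1 _
  rw [Config.winding_eq, total, parity, Word.flux_mod_two _ _ h1, Int.cast_sum,
    Finset.sum_congr rfl (g := fun _ => (1 : ZMod 2))]
  · simp
  · intro a ha
    rcases h1 0 (Nat.zero_le _) a (by rw [Word.width_zero]; exact Finset.mem_range.1 ha) with h | h
      <;> simp [h]

/-- Domain walls are the configurations with even winding numbers. -/
theorem Config.HasWinding.isDomainWall_iff {C : Config} {v : ℤ × ℤ} (h : C.HasWinding v) :
    C.IsDomainWall ↔ parity v = 0 := by
  rw [Config.isDomainWall_iff, h.parity_eq, Prod.mk_eq_zero, ZMod.natCast_eq_zero_iff_even,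
    ZMod.natCast_eq_zero_iff_even]

theorem domainWallStates_eq : domainWallStates = sectorStates 0 := by
  ext Ψ
  constructor
  · intro h C v hv hp
    exact h C (mt hv.isDomainWall_iff.1 hp)
  · intro h C hC
    obtain ⟨v, hv⟩ := exists_hasWinding C
    have hv := (hv v).2 (Or.inl rfl)
    exact h C v hv (mt hv.isDomainWall_iff.2 hC)

end TorusLoops

end

theorem mainTheorem7 (d : ℝ) (hd : d = √2 ∨ d = -√2) :
    -- the winding numbers of a configuration are well defined up to a common sign
    (∀ C : TorusLoops.Config, ∃ v : ℤ × ℤ, ∀ u : ℤ × ℤ, C.HasWinding u ↔ u = v ∨ u = -v) ∧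
    -- the zero-energy states, in terms of amplitudes of winding sectors
    (∀ Ψ : TorusLoops.Config → ℂ, Ψ ∈ TorusLoops.zeroEnergy d ↔
      ∃ ψ ∈ TorusLoops.amplitudes d, ∀ (C : TorusLoops.Config) (v : ℤ × ℤ),
        C.HasWinding v → Ψ C = ψ v * (d : ℂ) ^ C.loops) ∧
    -- the amplitudes are determined by the state
    (∀ v : ℤ × ℤ, ∃ C : TorusLoops.Config, C.HasWinding v) ∧
    -- the solution space of the constraints, and its part in each parity sector
    Module.finrank ℂ (TorusLoops.amplitudes d) = 9 ∧
    (∀ ε : ZMod 2 × ZMod 2,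
      Module.finrank ℂ ↥(TorusLoops.amplitudes d ⊓ TorusLoops.sectorAmplitudes ε)
        = if ε = 0 then 3 else 2) ∧
    -- the ground state degeneracy, and its part in each parity sector
    Module.finrank ℂ (TorusLoops.zeroEnergy d) = 9 ∧
    (∀ ε : ZMod 2 × ZMod 2,
      Module.finrank ℂ ↥(TorusLoops.zeroEnergy d ⊓ TorusLoops.sectorStates ε)
        = if ε = 0 then 3 else 2) ∧
    -- the ground state degeneracy in the domain-wall interpretation
    Module.finrank ℂ ↥(TorusLoops.zeroEnergy d ⊓ TorusLoops.domainWallStates) = 3 := by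
  have h2 : (d : ℂ) ^ 2 = 2 := by
    have : d ^ 2 = 2 := by
      rcases hd with rfl | rfl
      · exact Real.sq_sqrt (by norm_num)
      · rw [neg_sq]
        exact Real.sq_sqrt (by norm_num)
    exact_mod_cast this
  refine ⟨TorusLoops.exists_hasWinding,
    fun Ψ => TorusLoops.mem_zeroEnergy_iff_exists_amplitude h2,
    TorusLoops.exists_config, TorusLoops.finrank_amplitudes h2,
    TorusLoops.finrank_amplitudes_sector h2, TorusLoops.finrank_zeroEnergy h2,
    TorusLoops.finrank_zeroEnergy_sector h2, ?_⟩
  rw [TorusLoops.domainWallStates_eq, TorusLoops.finrank_zeroEnergy_sector h2, if_pos rfl]
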